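/- Work over $\mathbb C$. Let $\mathbb P^5=\mathbb P(\mathrm{Sym}^2\mathbb C^3)$ be the space of symmetric $3\times 3$ matrices up to scalars, let $V\subset\mathbb P^5$ be the Veronese surface of matrices of rank one, and let $f\colon\mathbb P^5\dashrightarrow\mathbb P^5$, $A\mapsto \mathrm{adj}(A)$, be the Cremona involution given by the linear system $|\mathcal I_V(2)|$ of quadrics through $V$. Let $X\subset\mathbb P^5$ be a cubic fourfold containing $V$, and let $X'$ be the image of $X$ under $f$, i.e. the closure of $f(X\setminus V)$. Assume that $X'$ is again a cubic fourfold, that $X$ and $X'$ are smooth, and that neither $X$ nor $X'$ contains a plane. Let $F$ and $F'$ be the Fano varieties of lines on $X$ and $X'$, regarded as projective varieties through the Plücker embedding. Let $\Gamma\subset\mathbb P^5\times\mathbb P^5$ be the closure of the graph of $f|_X$, with projections $p_1,p_2$. For a line $\ell\subset X$ let its total transform $C_\ell\subset X'$ be the scheme-theoretic image under $p_2$ of the scheme $p_1^{-1}(\ell)\subset\Gamma$. A line $\ell'\subset X'$ is called residual to $C_\ell$ if $C_\ell$ is a (possibly reducible or non-reduced) conic in a plane, spanning the plane $\langle C_\ell\rangle$,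 and $\langle C_\ell\rangle\cap X'=C_\ell+\ell'$ as divisors in this plane. Lines on $X$ residual to total transforms of lines on $X'$ (under $f|_{X'}\colon X'\dashrightarrow X$) are defined in the same way. (1) For every line $\ell\subset X$ there is exactly one line $\ell'\subset X'$ residual to $C_\ell$, and likewise with $X$ and $X'$ interchanged; and the resulting maps $\pi\colon F\to F'$, $[\ell]\mapsto[\ell']$, and $\pi'\colon F'\to F$, defined analogously, are morphisms of varieties with $\pi'\circ\pi=\mathrm{id}_F$ and $\pi\circ\pi'=\mathrm{id}_{F'}$. That is, $\pi$ and $\pi'$ are mutually inverse isomorphisms. (2) The assumptions on $X$ and $X'$ hold for a very general cubic fourfold $X$ containing $V$: for every cubic form in $H^0(\mathbb P^5,\mathcal I_V(3))$ outside the union of countably many proper Zariski-closed subsets of this vector space, its zero locus $X$ satisfies them. -/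

import Mathlib

open MvPolynomial

noncomputable section

namespace VeroneseFano

/-- Affine coordinates on `ℙ⁵ = ℙ(Sym² ℂ³)`: a vector of `ℂ⁶` is a symmetric `3 × 3` matrix. -/
def symMat (a : Fin 6 → ℂ) : Matrix (Fin 3) (Fin 3) ℂ :=
  !![a 0, a 1, a 2; a 1, a 3, a 4; a 2, a 4, a 5]

/-- The affine cone over the Veronese surface `V ⊂ ℙ⁵`, the image of `ℙ²` under all
quadratic monomials. -/
def veroneseCone : Set (Fin 6 → ℂ) :=
  Set.range fun t : Fin 3 → ℂ =>
    ![t 0 * t 0, t 0 * t 1, t 0 * t 2, t 1 * t 1, t 1 * t 2, t 2 * t 2]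

/-- The Cremona involution given by the quadrics through `V`: a symmetric matrix is sent to its
adjugate, whose entries are (up to sign) the `2 × 2` minors and span the quadrics through `V`. -/
def cremona (a : Fin 6 → ℂ) : Fin 6 → ℂ :=
  ![(symMat a).adjugate 0 0, (symMat a).adjugate 0 1, (symMat a).adjugate 0 2,
    (symMat a).adjugate 1 1, (symMat a).adjugate 1 2, (symMat a).adjugate 2 2]

/-- In matrix terms, `cremona` is the adjugate. -/
theorem symMat_cremona (a : Fin 6 → ℂ) : symMat (cremona a) = (symMat a).adjugate := by
  ext i j
  fin_cases i <;> fin_cases j <;>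
    simp [symMat, cremona, Matrix.adjugate_fin_three] <;> ring

/-- As a rational map of `ℙ⁵`, `cremona` is an involution. -/
theorem cremona_cremona (a : Fin 6 → ℂ) : cremona (cremona a) = (symMat a).det • a := by
  ext i
  fin_cases i <;>
    simp [symMat, cremona, Matrix.adjugate_fin_three, Matrix.det_fin_three] <;> ring

/-- Polynomials in the six homogeneous coordinates of `ℙ⁵`. -/
abbrev Poly : Type := MvPolynomial (Fin 6) ℂ

/-- The space `H⁰(ℙ⁵, I_V(3))` of cubic forms vanishing on the Veronese surface. -/
def cubicsThroughVeronese : Submodule ℂ Poly where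
  carrier := {F | F.IsHomogeneous 3 ∧ ∀ a ∈ veroneseCone, eval a F = 0}
  zero_mem' := ⟨isHomogeneous_zero _ _ _, fun _ _ => map_zero _⟩
  add_mem' := fun hF hG => ⟨hF.1.add hG.1, fun a ha => by
    rw [map_add, hF.2 a ha, hG.2 a ha, add_zero]⟩
  smul_mem' := fun c F hF => ⟨by
      rw [smul_eq_C_mul]
      simpa using (isHomogeneous_C (Fin 6) c).mul hF.1,
    fun a ha => by rw [smul_eval, hF.2 a ha, mul_zero]⟩

/-- The projective hypersurface `F = 0` is smooth (Jacobian criterion at every point). -/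
def IsSmoothHypersurface (F : Poly) : Prop :=
  ∀ a : Fin 6 → ℂ, a ≠ 0 → eval a F = 0 → ∃ i, eval a (pderiv i F) ≠ 0

/-- The linear subspace `ℙ(L)` is contained in the hypersurface `F = 0`. -/
def LiesOn (L : Submodule ℂ (Fin 6 → ℂ)) (F : Poly) : Prop :=
  ∀ a ∈ L, eval a F = 0

/-- The hypersurface `F = 0` contains no projective plane. -/
def ContainsNoPlane (F : Poly) : Prop :=
  ∀ P : Submodule ℂ (Fin 6 → ℂ), Module.finrank ℂ P = 3 → ¬ LiesOn P F

/-- `F'` is an equation of the image `f(X)` (the closure of the image of the rational map `f|_X`) of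
`X = {F = 0}` under the Cremona involution: the homogeneous ideal of `f(X)` is `(F')`. -/
def IsCremonaImage (F F' : Poly) : Prop :=
  vanishingIdeal ℂ (cremona '' {a | eval a F = 0}) = Ideal.span {F'}

/-- The standing assumptions on the pair of cubic fourfolds `X = {F = 0}`, `X' = {F' = 0}`. -/
structure IsCubicPair (F F' : Poly) : Prop where
  mem : F ∈ cubicsThroughVeronese
  smooth : IsSmoothHypersurface F
  noPlane : ContainsNoPlane F
  homogeneous' : F'.IsHomogeneous 3
  image : IsCremonaImage F F'
  smooth' : IsSmoothHypersurface F'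
  noPlane' : ContainsNoPlane F'

/-- The points of the Fano variety of lines on the hypersurface `F = 0`. -/
def FanoLines (F : Poly) : Type :=
  {L : Submodule ℂ (Fin 6 → ℂ) // Module.finrank ℂ L = 2 ∧ LiesOn L F}

/-- `p` is a vector of Plücker coordinates `u ∧ v` of the line `ℙ(L)`, `L = ⟨u, v⟩`. -/
def IsPluckerVector (L : Submodule ℂ (Fin 6 → ℂ)) (p : Fin 6 × Fin 6 → ℂ) : Prop :=
  ∃ u v : Fin 6 → ℂ, L = Submodule.span ℂ {u, v} ∧
    p = fun k => u k.1 * v k.2 - u k.2 * v k.1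

/-- A map between Fano varieties of lines, viewed as projective varieties through the Plücker
embedding, is a morphism: around each point it is given in homogeneous coordinates by homogeneous
polynomials of a common degree without common zero. -/
def IsMorphism {F F' : Poly} (φ : FanoLines F → FanoLines F') : Prop :=
  ∀ L₀ : FanoLines F, ∃ (d : ℕ) (g : Fin 6 × Fin 6 → MvPolynomial (Fin 6 × Fin 6) ℂ),
    (∀ k, (g k).IsHomogeneous d) ∧
    (∀ p, IsPluckerVector L₀.1 p → ∃ k, eval p (g k) ≠ 0) ∧
    ∀ (L : FanoLines F) (p : Fin 6 × Fin 6 → ℂ), IsPluckerVector L.1 p →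
      (∃ k, eval p (g k) ≠ 0) → IsPluckerVector (φ L).1 fun k => eval p (g k)

/-- The homogeneous ideal of the linear subspace `ℙ(L)` of `ℙ⁵`. -/
def linearIdeal (L : Submodule ℂ (Fin 6 → ℂ)) : Ideal Poly :=
  vanishingIdeal ℂ (L : Set (Fin 6 → ℂ))

/-- The bihomogeneous ideal of the closure `Γ ⊂ ℙ⁵ × ℙ⁵` of the graph of the Cremona involution
restricted to `X = {F = 0}`: the polynomials that vanish at all `(a, t • f(a))` with `a` in the cone
over `X` and `t` a scalar. The variables `inl i`, `inr j` are the coordinates on the two factors. -/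
def graphIdeal (F : Poly) : Ideal (MvPolynomial (Fin 6 ⊕ Fin 6) ℂ) :=
  vanishingIdeal ℂ
    {p | ∃ (a : Fin 6 → ℂ) (t : ℂ), eval a F = 0 ∧ p = Sum.elim a (t • cremona a)}

/-- An ideal of the subscheme `p₁⁻¹(ℓ)` of `Γ ⊂ ℙ⁵ × ℙ⁵`, where `ℓ = ℙ(L)`. -/
def preimageIdeal (F : Poly) (L : Submodule ℂ (Fin 6 → ℂ)) :
    Ideal (MvPolynomial (Fin 6 ⊕ Fin 6) ℂ) :=
  graphIdeal F ⊔ (linearIdeal L).map (rename (Sum.inl : Fin 6 → Fin 6 ⊕ Fin 6))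

/-- The homogeneous ideal of the total transform of the line `ℓ = ℙ(L) ⊂ X`, that is, of the
scheme-theoretic image `p₂(p₁⁻¹(ℓ))`: a form `G` belongs to it when its pullback vanishes on
`p₁⁻¹(ℓ)`, which is tested on the standard affine charts `x_i y_j ≠ 0` of `ℙ⁵ × ℙ⁵`. -/
def totalTransformIdeal (F : Poly) (L : Submodule ℂ (Fin 6 → ℂ)) : Ideal Poly where
  carrier := {G | ∀ i j : Fin 6, ∃ N : ℕ,
    (X (Sum.inl i) * X (Sum.inr j)) ^ N * rename Sum.inr G ∈ preimageIdeal F L}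
  zero_mem' := fun i j => ⟨0, by simp⟩
  add_mem' := by
    intro G H hG hH i j
    obtain ⟨N, hN⟩ := hG i j
    obtain ⟨M, hM⟩ := hH i j
    refine ⟨N + M, ?_⟩
    have h := Ideal.add_mem _
      (Ideal.mul_mem_left _ ((X (Sum.inl i) * X (Sum.inr j)) ^ M) hN)
      (Ideal.mul_mem_left _ ((X (Sum.inl i) * X (Sum.inr j)) ^ N) hM)
    rw [map_add, pow_add]
    convert h using 1
    ring
  smul_mem' := by
    intro c G hG i j
    obtain ⟨N, hN⟩ := hG i j
    refine ⟨N, ?_⟩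
    have h := Ideal.mul_mem_left _ (rename Sum.inr c) hN
    rw [smul_eq_mul, map_mul]
    convert h using 1
    ring

/-- `J` is the homogeneous ideal of the (possibly degenerate) conic `q = 0` in the plane `ℙ(P)`,
which is then the plane spanned by that conic. -/
def IsPlaneConic (J : Ideal Poly) (P : Submodule ℂ (Fin 6 → ℂ)) (q : Poly) : Prop :=
  Module.finrank ℂ P = 3 ∧ q.IsHomogeneous 2 ∧ q ∉ linearIdeal P ∧
    J = linearIdeal P ⊔ Ideal.span {q}

/-- The total transform `C_ℓ` in `X' = {F' = 0}` of the line `ℓ = ℙ(L)` on `X = {F = 0}` is a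
conic, and `ℓ' = ℙ(L')` is the line residual to it: the plane cubic `⟨C_ℓ⟩ ∩ X'` is the divisor
`C_ℓ + ℓ'` of the plane `⟨C_ℓ⟩`. -/
def IsResidualLine (F F' : Poly) (L L' : Submodule ℂ (Fin 6 → ℂ)) : Prop :=
  ∃ (P : Submodule ℂ (Fin 6 → ℂ)) (q m : Poly),
    IsPlaneConic (totalTransformIdeal F L) P q ∧
    m.IsHomogeneous 1 ∧ linearIdeal L' = linearIdeal P ⊔ Ideal.span {m} ∧
    F' - q * m ∈ linearIdeal P

/-- A property holds for a very general cubic form through the Veronese surface: it holds outside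
countably many proper Zariski-closed subsets `{D = 0}` of the vector space of these forms, `D` being
a polynomial in the coefficients of the form. -/
def VeryGeneralCubic (p : Poly → Prop) : Prop :=
  ∃ 𝒟 : Set (MvPolynomial (Fin 6 →₀ ℕ) ℂ), 𝒟.Countable ∧
    (∀ D ∈ 𝒟, ∃ F ∈ cubicsThroughVeronese, eval (fun s => coeff s F) D ≠ 0) ∧
    ∀ F ∈ cubicsThroughVeronese, (∀ D ∈ 𝒟, eval (fun s => coeff s F) D ≠ 0) → p F

end VeroneseFano

end

/-! ### Symmetric matrices, the action of 3 × 3 matrices, and frames of lines. -/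

open MvPolynomial
noncomputable section
namespace VeroneseFano

open Matrix

/-! Write f for the adjugate. Modulo the cubics b(a, f(a)), b a bilinear form on ℂ⁶, a cubic
monomial depends only on its restriction to V, so every cubic through V is of the form F(a) = b(a,
f(a)) (`exists_cubicOf`). Since f(f(a)) = det(a) a, the cubic b(f(y), y) vanishes on f(X), hence it
is F' up to a constant (`IsCubicPair.exists_dualCubics`). The roles of X and X' are thus exchanged
by transposing b, and the closed graph Γ satisfies bilinear equations: the matrix product a y is
scalar, and b(a, y) = 0.

Let L be a line of X. Up to the group action a pencil of ternary quadratic forms has one of seven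
normal forms, according to its position relative to V (`hasFrame_of_goodLine`). Each admits a frame:
a basis x₀, x₁, x₂ of a plane containing L = ⟨x₀, x₁⟩ and a basis y₀, y₁, y₂ of a plane P, such that
f carries each plane into the other. Modulo scalar matrices the products x_i y_j are governed by two
3 × 3 matrices s₁, s₂, and f sends ξ to a multiple of (ξ s₁) × (ξ s₂) and η to a multiple of (s₁ η)
× (s₂ η). On L × P the form b equals k₁ s₁ + k₂ s₂. For a point s x₀ + t x₁ the equations of Γ
impose two linear conditions on y in P; eliminating s and t gives a conic, the third coordinate of
(s₁ η) × (s₂ η).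

This conic in P is the total transform, as a scheme (`AdaptedFrame.totalTransformIdeal_eq`). A
linear form κ vanishing on P is killed because s²κ, stκ, t²κ are combinations of the bilinear
equations; dually, every `PencilTriple` lies in P. Conversely each point of the conic lifts to Γ
over L. Over V this uses that X is smooth there: the fibre of Γ over e eᵀ is then cut out by y e = 0
and b(e eᵀ, y) = 0. When the conic is a double line, which happens for tangent lines of V, points
over the dual numbers detect the multiplicity.

On P one has b(f(y), y) = c q(y) μ(y), where q is the conic and μ is the defect of b(x₂, ·) from k₁
s₁ + k₂ s₂, because the cross product is orthogonal to s₁ η and s₂ η. The residual line is therefore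
μ = 0 in P; neither factor vanishes identically since X' contains no plane. The transposed frame
serves L': b is a combination of s₁ and s₂ on ⟨x₀, x₁, x₂⟩ times L', which forces the plane of L' to
be ⟨x₀, x₁, x₂⟩, and F restricted to it is ξ₂ times the conic of L'. So the line residual to L' is
ξ₂ = 0, that is L (`DualCubics.isResidualLine_symm`).

The map is a morphism because the triples along a line form a space of constant dimension five
(`AdaptedFrame.finrank_solutions`). Cramer's rule then yields polynomial families of points of P,
and evaluating F' and the conic at three of them gives Plücker coordinates of the residual line
(`DualCubics.isMorphism`).

For the very general statement the excluded subsets are all those with rational equations. Outside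
them every first-order deformation of F within the cubics through V is induced by a derivation D of
ℂ (`isGeneric_of_forall_ne_zero`). A singular point or a plane of X has coordinates in ℂ, so
applying D to the equations expressing it shows that it survives every deformation to first order.
Dimension counts exclude this. For a general plane the count uses the apolarity of a base-point-free
net of conics: the net of partial derivatives of F along P has a one-dimensional apolar space of
cubics and no linear syzygies (`IsGeneric.containsNoPlane`). -/

/-- The coordinate vector of the symmetric part of a `3 × 3` matrix. -/
def ofSym {R : Type*} (M : Matrix (Fin 3) (Fin 3) R) : Fin 6 → R :=
  ![M 0 0, M 0 1, M 0 2, M 1 1, M 1 2, M 2 2]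

/-- The point `e eᵀ` of the Veronese cone. -/
def ver {R : Type*} [CommRing R] (e : Fin 3 → R) : Fin 6 → R :=
  ![e 0 * e 0, e 0 * e 1, e 0 * e 2, e 1 * e 1, e 1 * e 2, e 2 * e 2]

/-- The symmetric matrix `e e'ᵀ + e' eᵀ`. -/
def symProd {R : Type*} [CommRing R] (e e' : Fin 3 → R) : Fin 6 → R :=
  ![2 * (e 0 * e' 0), e 0 * e' 1 + e 1 * e' 0, e 0 * e' 2 + e 2 * e' 0,
    2 * (e 1 * e' 1), e 1 * e' 2 + e 2 * e' 1, 2 * (e 2 * e' 2)]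

/-- The Cremona map over an arbitrary ring. -/
def crem {R : Type*} [CommRing R] (a : Fin 6 → R) : Fin 6 → R :=
  ![a 3 * a 5 - a 4 * a 4, a 2 * a 4 - a 1 * a 5, a 1 * a 4 - a 2 * a 3,
    a 0 * a 5 - a 2 * a 2, a 1 * a 2 - a 0 * a 4, a 0 * a 3 - a 1 * a 1]

/-- The polarisation of the Cremona map. -/
def pol {R : Type*} [CommRing R] (a c : Fin 6 → R) : Fin 6 → R :=
  ![a 3 * c 5 + c 3 * a 5 - 2 * (a 4 * c 4), a 2 * c 4 + c 2 * a 4 - a 1 * c 5 - c 1 * a 5,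
    a 1 * c 4 + c 1 * a 4 - a 2 * c 3 - c 2 * a 3, a 0 * c 5 + c 0 * a 5 - 2 * (a 2 * c 2),
    a 1 * c 2 + c 1 * a 2 - a 0 * c 4 - c 0 * a 4, a 0 * c 3 + c 0 * a 3 - 2 * (a 1 * c 1)]

theorem cremona_eq (a : Fin 6 → ℂ) : cremona a = crem a := by
  ext i
  fin_cases i <;> simp [cremona, crem, symMat, Matrix.adjugate_fin_three] <;> ring

theorem mem_veroneseCone {a : Fin 6 → ℂ} : a ∈ veroneseCone ↔ ∃ e, ver e = a := Iff.rfl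

theorem symMat_add (a c : Fin 6 → ℂ) : symMat (a + c) = symMat a + symMat c := by
  ext i j; fin_cases i <;> fin_cases j <;> simp [symMat]

theorem symMat_smul (t : ℂ) (a : Fin 6 → ℂ) : symMat (t • a) = t • symMat a := by
  ext i j; fin_cases i <;> fin_cases j <;> simp [symMat]

/-- `symMat` as a linear map. -/
def symMatL : (Fin 6 → ℂ) →ₗ[ℂ] Matrix (Fin 3) (Fin 3) ℂ where
  toFun := symMat
  map_add' := symMat_add
  map_smul' := symMat_smul

theorem symMatL_apply (a : Fin 6 → ℂ) : symMatL a = symMat a := rfl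

theorem ofSym_symMat (a : Fin 6 → ℂ) : ofSym (symMat a) = a := by
  ext i; fin_cases i <;> simp [ofSym, symMat]

theorem symMat_ofSym {M : Matrix (Fin 3) (Fin 3) ℂ} (h : Mᵀ = M) : symMat (ofSym M) = M := by
  have h' : ∀ i j, M i j = M j i := fun i j => by
    conv_lhs => rw [← h]
    rfl
  ext i j
  fin_cases i <;> fin_cases j <;> simp [ofSym, symMat] <;> exact h' _ _

theorem symMat_transpose (a : Fin 6 → ℂ) : (symMat a)ᵀ = symMat a := by
  ext i j; fin_cases i <;> fin_cases j <;> simp [symMat]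

theorem symMat_injective : Function.Injective symMat := fun a c h => by
  rw [← ofSym_symMat a, h, ofSym_symMat]

/-- The action of a `3 × 3` matrix on symmetric matrices, `a ↦ g a gᵀ`. -/
def act (g : Matrix (Fin 3) (Fin 3) ℂ) : (Fin 6 → ℂ) →ₗ[ℂ] (Fin 6 → ℂ) where
  toFun a := ofSym (g * symMat a * gᵀ)
  map_add' a c := by
    rw [symMat_add, mul_add, add_mul]
    ext i; fin_cases i <;> simp [ofSym]
  map_smul' t a := by
    rw [symMat_smul, mul_smul_comm, smul_mul_assoc]
    ext i; fin_cases i <;> simp [ofSym]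

theorem symMat_act (g : Matrix (Fin 3) (Fin 3) ℂ) (a : Fin 6 → ℂ) :
    symMat (act g a) = g * symMat a * gᵀ := by
  apply symMat_ofSym
  simp [Matrix.transpose_mul, symMat_transpose, Matrix.mul_assoc]

theorem act_mul (g h : Matrix (Fin 3) (Fin 3) ℂ) (a : Fin 6 → ℂ) :
    act (g * h) a = act g (act h a) := by
  apply symMat_injective
  simp only [symMat_act, Matrix.transpose_mul, Matrix.mul_assoc]

theorem act_one (a : Fin 6 → ℂ) : act 1 a = a := by
  apply symMat_injective
  simp [symMat_act]

theorem act_injective {g h : Matrix (Fin 3) (Fin 3) ℂ} (hg : h * g = 1) :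
    Function.Injective (act g) := fun a c e => by
  rw [← act_one a, ← hg, act_mul, e, ← act_mul, hg, act_one]

theorem act_ver (g : Matrix (Fin 3) (Fin 3) ℂ) (e : Fin 3 → ℂ) :
    act g (ver e) = ver (g *ᵥ e) := by
  ext i
  fin_cases i <;>
    simp [act, ofSym, ver, symMat, Matrix.mulVec, dotProduct, Matrix.mul_apply,
      Fin.sum_univ_three] <;> ring

theorem act_symProd (g : Matrix (Fin 3) (Fin 3) ℂ) (e e' : Fin 3 → ℂ) :
    act g (symProd e e') = symProd (g *ᵥ e) (g *ᵥ e') := by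
  ext i
  fin_cases i <;>
    simp [act, ofSym, symProd, symMat, Matrix.mulVec, dotProduct, Matrix.mul_apply,
      Fin.sum_univ_three] <;> ring

/-- The adjugate reverses products, adj(g a gᵀ) = adj(g)ᵀ adj(a) adj(g), and adj(g) = det(g) h. So f
is equivariant when g acts on the source and its contragredient hᵀ on the target. -/
theorem crem_act {g h : Matrix (Fin 3) (Fin 3) ℂ} (hg : h * g = 1) (a : Fin 6 → ℂ) :
    crem (act g a) = (g.det ^ 2) • act hᵀ (crem a) := by
  have hadj : g.adjugate = g.det • h := by
    have := congrArg (h * ·) (Matrix.mul_adjugate g)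
    simp only [← Matrix.mul_assoc, hg, Matrix.one_mul] at this
    rw [this]; simp
  apply symMat_injective
  rw [← cremona_eq, symMat_cremona, symMat_act, symMat_smul, symMat_act, ← cremona_eq,
    symMat_cremona, Matrix.adjugate_mul_distrib, Matrix.adjugate_mul_distrib,
    ← Matrix.adjugate_transpose, hadj]
  simp only [Matrix.transpose_smul, Matrix.transpose_transpose, smul_mul_assoc, mul_smul_comm,
    smul_smul, Matrix.mul_assoc, pow_two]

theorem crem_add {R : Type*} [CommRing R] (a c : Fin 6 → R) :
    crem (a + c) = crem a + pol a c + crem c := by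
  ext i; fin_cases i <;> simp [crem, pol] <;> ring

theorem crem_smul {R : Type*} [CommRing R] (t : R) (a : Fin 6 → R) :
    crem (t • a) = (t ^ 2) • crem a := by
  ext i; fin_cases i <;> simp [crem] <;> ring

theorem pol_smul_smul {R : Type*} [CommRing R] (s t : R) (a c : Fin 6 → R) :
    pol (s • a) (t • c) = (s * t) • pol a c := by
  ext i; fin_cases i <;> simp [pol] <;> ring

theorem pol_eq_sub {R : Type*} [CommRing R] (a c : Fin 6 → R) :
    pol a c = crem (a + c) - crem a - crem c := by
  rw [crem_add]; abel

theorem pol_act {g h : Matrix (Fin 3) (Fin 3) ℂ} (hg : h * g = 1) (a c : Fin 6 → ℂ) :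
    pol (act g a) (act g c) = (g.det ^ 2) • act hᵀ (pol a c) := by
  rw [pol_eq_sub, pol_eq_sub, ← map_add, crem_act hg, crem_act hg, crem_act hg, map_sub, map_sub,
    smul_sub, smul_sub]

theorem crem_ver {R : Type*} [CommRing R] (e : Fin 3 → R) : crem (ver e) = 0 := by
  ext i; fin_cases i <;> simp [crem, ver] <;> ring

theorem crem_comb {R : Type*} [CommRing R] (s t : R) (u v : Fin 6 → R) :
    crem (s • u + t • v) = (s ^ 2) • crem u + (s * t) • pol u v + (t ^ 2) • crem v := by
  rw [crem_add, crem_smul, crem_smul, pol_smul_smul]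

/-- Bilinear forms on `ℂ⁶`. -/
abbrev Bil : Type := (Fin 6 → ℂ) →ₗ[ℂ] (Fin 6 → ℂ) →ₗ[ℂ] ℂ

/-- The pairs `(Y 0, Y 1)` annihilated by the bilinear equations of the graph along the pencil
spanned by `u` and `v`. -/
def PencilPair (b : Bil) (u v Y₀ Y₁ : Fin 6 → ℂ) : Prop :=
  (∃ l : ℂ, symMat u * symMat Y₀ + symMat v * symMat Y₁ = l • 1) ∧ b u Y₀ + b v Y₁ = 0

/-- Triples of vectors, both of whose consecutive pairs are annihilated. -/
def PencilTriple (b : Bil) (u v : Fin 6 → ℂ) (Y : Fin 3 → Fin 6 → ℂ) : Prop :=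
  PencilPair b u v (Y 0) (Y 1) ∧ PencilPair b u v (Y 1) (Y 2)

/-- Two planes, spanned by `x` and by `y`, interchanged by the Cremona map, on which the equations
`x y ∈ ℂ • 1` reduce to the two bilinear forms `s₁`, `s₂`. -/
structure ConicFrame (x y : Fin 3 → Fin 6 → ℂ) (s₁ s₂ : Matrix (Fin 3) (Fin 3) ℂ) : Prop where
  indep_x : LinearIndependent ℂ x
  indep_y : LinearIndependent ℂ y
  mul : ∃ (A B : Matrix (Fin 3) (Fin 3) ℂ) (τ : Matrix (Fin 3) (Fin 3) ℂ),
    (∀ r s t : ℂ, r • A + s • B + t • (1 : Matrix (Fin 3) (Fin 3) ℂ) = 0 → r = 0 ∧ s = 0) ∧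
    ∀ i j, symMat (x i) * symMat (y j) = s₁ i j • A + s₂ i j • B + τ i j • 1
  crem_x : ∃ c : ℂ, ∀ ξ : Fin 3 → ℂ, crem (∑ i, ξ i • x i) =
    c • ∑ j, ((ξ ᵥ* s₁) ⨯₃ (ξ ᵥ* s₂)) j • y j
  crem_y : ∃ c : ℂ, ∀ η : Fin 3 → ℂ, crem (∑ j, η j • y j) =
    c • ∑ i, ((s₁ *ᵥ η) ⨯₃ (s₂ *ᵥ η)) i • x i

/-- The quadratic form of the total transform of the line spanned by `x 0` and `x 1`. -/
def conicForm (s₁ s₂ : Matrix (Fin 3) (Fin 3) ℂ) (η : Fin 3 → ℂ) : ℂ :=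
  ((s₁ *ᵥ η) ⨯₃ (s₂ *ᵥ η)) 2

/-- The total transform has at least two independent tangent directions. -/
def ConicReduced (s₁ s₂ : Matrix (Fin 3) (Fin 3) ℂ) : Prop :=
  ∃ η η', 4 * conicForm s₁ s₂ η * conicForm s₁ s₂ η' -
    (conicForm s₁ s₂ (η + η') - conicForm s₁ s₂ η - conicForm s₁ s₂ η') ^ 2 ≠ 0

/-- The line spanned by `x 0` and `x 1` is tangent to the Veronese surface, and its total transform
is the double line `η₂² = 0`. -/
def ConicDouble (b : Bil) (x y : Fin 3 → Fin 6 → ℂ) (s₁ s₂ : Matrix (Fin 3) (Fin 3) ℂ) : Prop :=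
  (∃ k : ℂ, k ≠ 0 ∧ ∀ η, conicForm s₁ s₂ η = k * η 2 ^ 2) ∧
  (∃ e e' : Fin 3 → ℂ, x 0 = ver e ∧ x 1 = symProd e e') ∧
  (symMat (x 0) * symMat (y 0) = 0 ∧ symMat (x 1) * symMat (y 0) = 0 ∧
    symMat (x 0) * symMat (y 1) = 0 ∧
    symMat (x 0) * symMat (y 2) + symMat (x 1) * symMat (y 1) = 0) ∧
  (b (x 0) (y 0) = 0 ∧ b (x 1) (y 0) = 0 ∧ b (x 0) (y 1) = 0 ∧ b (x 0) (y 2) + b (x 1) (y 1) = 0)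

/-- A frame adapted to the line spanned by `x 0` and `x 1`. -/
structure AdaptedFrame (b : Bil) (x y : Fin 3 → Fin 6 → ℂ)
    (s₁ s₂ : Matrix (Fin 3) (Fin 3) ℂ) : Prop extends ConicFrame x y s₁ s₂ where
  bil : ∃ k₁ k₂ : ℂ, ∀ j, b (x 0) (y j) = k₁ * s₁ 0 j + k₂ * s₂ 0 j ∧
    b (x 1) (y j) = k₁ * s₁ 1 j + k₂ * s₂ 1 j
  triple : ∀ Y, PencilTriple b (x 0) (x 1) Y → ∀ k, Y k ∈ Submodule.span ℂ (Set.range y)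
  conic : ConicReduced s₁ s₂ ∨ ConicDouble b x y s₁ s₂

/-- The line spanned by `u` and `v` has an adapted frame. -/
def HasFrame (b : Bil) (L : Submodule ℂ (Fin 6 → ℂ)) : Prop :=
  ∃ x y s₁ s₂, AdaptedFrame b x y s₁ s₂ ∧ L = Submodule.span ℂ {x 0, x 1}

/-- The cubic `b(a, f(a))` contains the line `L`, and it is smooth along the Veronese surface at
the points of `L`. -/
def GoodLine (b : Bil) (L : Submodule ℂ (Fin 6 → ℂ)) : Prop :=
  (∀ a ∈ L, b a (crem a) = 0) ∧
  ∀ e : Fin 3 → ℂ, e ≠ 0 → ver e ∈ L → ∃ n, b (ver e) (pol (ver e) n) ≠ 0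

/-- The transform of a bilinear form under a change of coordinates. -/
def Bil.pull (b : Bil) (g h : Matrix (Fin 3) (Fin 3) ℂ) : Bil :=
  b.compl₁₂ (act g) (act hᵀ)

theorem Bil.pull_apply (b : Bil) (g h : Matrix (Fin 3) (Fin 3) ℂ) (a y : Fin 6 → ℂ) :
    b.pull g h a y = b (act g a) (act hᵀ y) := rfl

theorem act_mul_act {g h : Matrix (Fin 3) (Fin 3) ℂ} (hg : h * g = 1) (a y : Fin 6 → ℂ) :
    symMat (act g a) * symMat (act hᵀ y) = g * (symMat a * symMat y) * h := by
  have h1 : gᵀ * hᵀ = 1 := by rw [← Matrix.transpose_mul, hg, Matrix.transpose_one]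
  rw [symMat_act, symMat_act, Matrix.transpose_transpose]
  calc g * symMat a * gᵀ * (hᵀ * symMat y * h)
      = g * symMat a * (gᵀ * hᵀ) * symMat y * h := by simp only [Matrix.mul_assoc]
    _ = _ := by rw [h1]; simp only [Matrix.mul_assoc, Matrix.one_mul]

theorem PencilPair.pull {b : Bil} {g h : Matrix (Fin 3) (Fin 3) ℂ} (hg : h * g = 1)
    {u v Y₀ Y₁ : Fin 6 → ℂ} (H : PencilPair b (act g u) (act g v) Y₀ Y₁) :
    PencilPair (b.pull g h) u v (act gᵀ Y₀) (act gᵀ Y₁) := by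
  have hg' : g * h = 1 := mul_eq_one_comm.mp hg
  have h1 : hᵀ * gᵀ = 1 := by rw [← Matrix.transpose_mul, hg', Matrix.transpose_one]
  have e : ∀ Y, act hᵀ (act gᵀ Y) = Y := fun Y => by rw [← act_mul, h1, act_one]
  obtain ⟨⟨l, hl⟩, hb⟩ := H
  refine ⟨⟨l, ?_⟩, ?_⟩
  · rw [← e Y₀, ← e Y₁, act_mul_act hg, act_mul_act hg] at hl
    have := congrArg (fun M => h * M * g) hl
    simp only [mul_add, add_mul] at this
    have k : ∀ M : Matrix (Fin 3) (Fin 3) ℂ, h * (g * M * h) * g = M := fun M => by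
      calc h * (g * M * h) * g = (h * g) * M * (h * g) := by simp only [Matrix.mul_assoc]
        _ = M := by simp [hg]
    rw [k, k] at this
    rw [this]; simp [hg]
  · simp only [Bil.pull_apply, e]; exact hb

/-- All clauses are built from matrix products x y, conjugated by g when x moves by g and y by hᵀ,
and from the equivariant map f. This reduces the construction of frames to pencils in normal form.
-/
theorem AdaptedFrame.act {b : Bil} {g h : Matrix (Fin 3) (Fin 3) ℂ} (hg : h * g = 1)
    {x y : Fin 3 → Fin 6 → ℂ} {s₁ s₂ : Matrix (Fin 3) (Fin 3) ℂ}
    (H : AdaptedFrame (b.pull g h) x y s₁ s₂) :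
    AdaptedFrame b (fun i => act g (x i)) (fun j => act hᵀ (y j)) s₁ s₂ := by
  have hg' : g * h = 1 := mul_eq_one_comm.mp hg
  have h1 : hᵀ * gᵀ = 1 := by rw [← Matrix.transpose_mul, hg', Matrix.transpose_one]
  have h2 : gᵀ * hᵀ = 1 := by rw [← Matrix.transpose_mul, hg, Matrix.transpose_one]
  have conj0 : ∀ M : Matrix (Fin 3) (Fin 3) ℂ, M = 0 → g * M * h = 0 := fun M hM => by simp [hM]
  constructor
  · constructor
    · exact H.indep_x.map' (VeroneseFano.act g) (LinearMap.ker_eq_bot.mpr (act_injective hg))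
    · exact H.indep_y.map' (VeroneseFano.act hᵀ) (LinearMap.ker_eq_bot.mpr (act_injective h2))
    · obtain ⟨A, B, τ, hAB, hmul⟩ := H.mul
      refine ⟨g * A * h, g * B * h, τ, ?_, fun i j => ?_⟩
      · intro r s t h0
        apply hAB r s t
        have e' := congrArg (fun M => h * M * g) h0
        have k : ∀ M : Matrix (Fin 3) (Fin 3) ℂ, h * (g * M * h) * g = M := fun M => by
          calc h * (g * M * h) * g = (h * g) * M * (h * g) := by simp only [Matrix.mul_assoc]
            _ = M := by simp [hg]
        simpa [mul_add, add_mul, k, hg] using e'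
      · rw [act_mul_act hg, hmul]
        simp [mul_add, add_mul, hg']
    · obtain ⟨c, hc⟩ := H.crem_x
      refine ⟨g.det ^ 2 * c, fun ξ => ?_⟩
      simp only [← map_smul, ← map_sum]
      rw [crem_act hg, hc, ← map_smul, smul_smul]
    · obtain ⟨c, hc⟩ := H.crem_y
      refine ⟨(hᵀ).det ^ 2 * c, fun ξ => ?_⟩
      simp only [← map_smul, ← map_sum]
      rw [crem_act h2, hc, ← map_smul, smul_smul, Matrix.transpose_transpose]
  · exact H.bil
  · intro Y hY k
    have := H.triple (fun k => VeroneseFano.act gᵀ (Y k)) ⟨hY.1.pull hg, hY.2.pull hg⟩ k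
    have h3 := Submodule.mem_map_of_mem (f := VeroneseFano.act hᵀ) this
    rw [Submodule.map_span, ← Set.range_comp, ← act_mul, h1, act_one] at h3
    exact h3
  · rcases H.conic with h3 | ⟨hq, ⟨e, e', he, he'⟩, ⟨m1, m2, m3, m4⟩, hb⟩
    · exact Or.inl h3
    · refine Or.inr ⟨hq, ⟨g *ᵥ e, g *ᵥ e', by simp only [he, act_ver], by simp only [he', act_symProd]⟩,
        ⟨?_, ?_, ?_, ?_⟩, hb⟩
      · rw [act_mul_act hg]; exact conj0 _ m1
      · rw [act_mul_act hg]; exact conj0 _ m2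
      · rw [act_mul_act hg]; exact conj0 _ m3
      · rw [act_mul_act hg, act_mul_act hg, ← add_mul, ← mul_add]; exact conj0 _ m4

theorem HasFrame.act {b : Bil} {g h : Matrix (Fin 3) (Fin 3) ℂ} (hg : h * g = 1)
    {L : Submodule ℂ (Fin 6 → ℂ)} (H : HasFrame (b.pull g h) L) :
    HasFrame b (L.map (act g)) := by
  obtain ⟨x, y, s₁, s₂, hf, rfl⟩ := H
  refine ⟨_, _, _, _, hf.act hg, ?_⟩
  rw [Submodule.map_span, Set.image_pair]

theorem GoodLine.pull {b : Bil} {g h : Matrix (Fin 3) (Fin 3) ℂ} (hg : h * g = 1)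
    {L : Submodule ℂ (Fin 6 → ℂ)} (H : GoodLine b (L.map (act g))) :
    GoodLine (b.pull g h) L := by
  have hg' : g * h = 1 := mul_eq_one_comm.mp hg
  have hdet : g.det ≠ 0 := by
    intro h0
    have := congrArg Matrix.det hg
    simp [h0] at this
  constructor
  · intro a ha
    have := H.1 _ (Submodule.mem_map_of_mem ha)
    rw [crem_act hg, map_smul, smul_eq_mul] at this
    exact (mul_eq_zero.mp this).resolve_left (pow_ne_zero 2 hdet)
  · intro e he heL
    have he' : g *ᵥ e ≠ 0 := fun h0 => he (by
      have := congrArg (h *ᵥ ·) h0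
      simpa [Matrix.mulVec_mulVec, hg] using this)
    obtain ⟨n, hn⟩ := H.2 _ he' (by
      rw [← act_ver]; exact Submodule.mem_map_of_mem heL)
    refine ⟨VeroneseFano.act h n, ?_⟩
    rw [← act_ver, show n = VeroneseFano.act g (VeroneseFano.act h n) by
      rw [← act_mul, hg', act_one], pol_act hg, map_smul, smul_eq_mul] at hn
    exact right_ne_zero_of_mul hn

end VeroneseFano
end

/-! ### Frames of pencils in normal form, I. -/

open MvPolynomial
noncomputable section
namespace VeroneseFano

open Matrix

theorem indep_three {V : Type*} [AddCommGroup V] [Module ℂ V] {x₀ x₁ x₂ : V}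
    (h : ∀ r s t : ℂ, r • x₀ + s • x₁ + t • x₂ = 0 → r = 0 ∧ s = 0 ∧ t = 0) :
    LinearIndependent ℂ ![x₀, x₁, x₂] := by
  rw [Fintype.linearIndependent_iff]
  intro g hg
  rw [Fin.sum_univ_three] at hg
  obtain ⟨h0, h1, h2⟩ := h _ _ _ hg
  intro i
  fin_cases i
  exacts [h0, h1, h2]

theorem mem_span_three {V : Type*} [AddCommGroup V] [Module ℂ V] {x₀ x₁ x₂ z : V} (r s t : ℂ)
    (h : z = r • x₀ + s • x₁ + t • x₂) : z ∈ Submodule.span ℂ (Set.range ![x₀, x₁, x₂]) := by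
  rw [h]
  refine Submodule.add_mem _ (Submodule.add_mem _ ?_ ?_) ?_ <;>
    refine Submodule.smul_mem _ _ (Submodule.subset_span ?_)
  exacts [⟨0, rfl⟩, ⟨1, rfl⟩, ⟨2, rfl⟩]

theorem cubic_coeffs_zero {p₀ p₁ p₂ p₃ : ℂ}
    (h : ∀ s t : ℂ, p₀ * s ^ 3 + p₁ * (s ^ 2 * t) + p₂ * (s * t ^ 2) + p₃ * t ^ 3 = 0) :
    p₀ = 0 ∧ p₁ = 0 ∧ p₂ = 0 ∧ p₃ = 0 := by
  have h0 := h 1 0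
  have h1 := h 0 1
  have h2 := h 1 1
  have h3 := h 1 (-1)
  have h4 := h 1 2
  refine ⟨by linear_combination h0, ?_, ?_, by linear_combination h1⟩
  · linear_combination -h0/2 + h2 - h3/3 - h4/6
  · linear_combination -h0 + h2/2 + h3/2

/-- The relations expressing that the cubic contains the line spanned by `u` and `v`. -/
def LineRel (b : Bil) (u v : Fin 6 → ℂ) : Prop :=
  b u (crem u) = 0 ∧ b u (pol u v) + b v (crem u) = 0 ∧ b u (crem v) + b v (pol u v) = 0 ∧
    b v (crem v) = 0

theorem lineRel_of_forall {b : Bil} {u v : Fin 6 → ℂ}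
    (h : ∀ a ∈ Submodule.span ℂ {u, v}, b a (crem a) = 0) : LineRel b u v := by
  apply cubic_coeffs_zero
  intro s t
  have := h (s • u + t • v) (Submodule.mem_span_pair.mpr ⟨s, t, rfl⟩)
  rw [crem_comb] at this
  simp only [map_add, map_smul, LinearMap.add_apply, LinearMap.smul_apply, smul_eq_mul] at this
  linear_combination this

theorem bil_expand (b : Bil) (u Y : Fin 6 → ℂ) :
    b u Y = Y 0 * b u (Pi.single 0 1) + Y 1 * b u (Pi.single 1 1) + Y 2 * b u (Pi.single 2 1) +
      Y 3 * b u (Pi.single 3 1) + Y 4 * b u (Pi.single 4 1) + Y 5 * b u (Pi.single 5 1) := by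
  conv_lhs => rw [pi_eq_sum_univ' Y]
  simp only [map_add, map_smul, smul_eq_mul, Fin.sum_univ_six]

theorem matrix_eq_entries {M N : Matrix (Fin 3) (Fin 3) ℂ} (h : M = N) :
    (M 0 0 = N 0 0 ∧ M 0 1 = N 0 1 ∧ M 0 2 = N 0 2) ∧ (M 1 0 = N 1 0 ∧ M 1 1 = N 1 1 ∧
    M 1 2 = N 1 2) ∧ M 2 0 = N 2 0 ∧ M 2 1 = N 2 1 ∧ M 2 2 = N 2 2 := by
  subst h; simp

theorem matrix_ext_entries {M N : Matrix (Fin 3) (Fin 3) ℂ}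
    (h : (M 0 0 = N 0 0 ∧ M 0 1 = N 0 1 ∧ M 0 2 = N 0 2) ∧ (M 1 0 = N 1 0 ∧ M 1 1 = N 1 1 ∧
      M 1 2 = N 1 2) ∧ M 2 0 = N 2 0 ∧ M 2 1 = N 2 1 ∧ M 2 2 = N 2 2) : M = N := by
  obtain ⟨⟨h1, h2, h3⟩, ⟨h4, h5, h6⟩, h7, h8, h9⟩ := h
  ext k l
  fin_cases k <;> fin_cases l <;> assumption

theorem vecMul_three (ξ : Fin 3 → ℂ) (M : Matrix (Fin 3) (Fin 3) ℂ) : ξ ᵥ* M =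
    ![ξ 0 * M 0 0 + ξ 1 * M 1 0 + ξ 2 * M 2 0, ξ 0 * M 0 1 + ξ 1 * M 1 1 + ξ 2 * M 2 1,
      ξ 0 * M 0 2 + ξ 1 * M 1 2 + ξ 2 * M 2 2] := by
  ext i; fin_cases i <;> simp [Matrix.vecMul, dotProduct, Fin.sum_univ_three]

theorem mulVec_three (ξ : Fin 3 → ℂ) (M : Matrix (Fin 3) (Fin 3) ℂ) : M *ᵥ ξ =
    ![M 0 0 * ξ 0 + M 0 1 * ξ 1 + M 0 2 * ξ 2, M 1 0 * ξ 0 + M 1 1 * ξ 1 + M 1 2 * ξ 2,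
      M 2 0 * ξ 0 + M 2 1 * ξ 1 + M 2 2 * ξ 2] := by
  ext i; fin_cases i <;> simp [Matrix.mulVec, dotProduct, Fin.sum_univ_three]

theorem vec_eq_entries {u v : Fin 6 → ℂ} (h : u = v) :
    u 0 = v 0 ∧ u 1 = v 1 ∧ u 2 = v 2 ∧ u 3 = v 3 ∧ u 4 = v 4 ∧ u 5 = v 5 := by
  subst h; simp

set_option maxHeartbeats 1000000

/-- The two third vectors are chosen so that the adjugate carries each plane into the other. β and γ
do not both vanish, as otherwise the second generator would be a point of V and the triples would be
dependent. The same pattern serves the other normal forms. -/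
theorem conicFrame_diag {β γ : ℂ} (hβγ : β ≠ 0 ∨ γ ≠ 0) :
    ConicFrame ![![0, 0, 0, 0, 1, 0], ![1, 0, 0, β, 0, γ], ![1, 0, 0, 0, 0, 0]]
      ![![1, 0, 0, 0, 0, 0], ![0, 0, 0, 0, 1, 0], ![0, 0, 0, γ, 0, β]]
      !![0, -1, 0; 1, 0, -(β * γ); 1, 0, 0] !![0, 0, 1; 0, 1, 0; 0, 0, 0] := by
  refine ⟨?_, ?_, ⟨!![1, 0, 0; 0, 0, 0; 0, 0, 0], !![0, 0, 0; 0, 0, β; 0, γ, 0],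
    !![0, 1, 0; 0, 0, β * γ; 0, 0, 0], ?_, ?_⟩, ⟨1, ?_⟩, ⟨1, ?_⟩⟩
  · apply indep_three
    intro r s t h
    have := vec_eq_entries h
    simp at this
    grind
  · apply indep_three
    intro r s t h
    have := vec_eq_entries h
    simp at this
    grind
  · intro r s t h
    have := matrix_eq_entries h
    simp at this
    grind
  · intro i j
    apply matrix_ext_entries
    fin_cases i <;> fin_cases j <;> simp [symMat]
    ring
  · intro ξ
    rw [vecMul_three, vecMul_three]
    simp only [Fin.sum_univ_three, cross_apply, Matrix.of_apply, Matrix.cons_val]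
    ext k
    fin_cases k <;> simp only [crem, Pi.add_apply, Pi.smul_apply, smul_eq_mul, Matrix.cons_val,
      Fin.zero_eta, Fin.mk_one, Fin.reduceFinMk] <;> ring
  · intro ξ
    rw [mulVec_three, mulVec_three]
    simp only [Fin.sum_univ_three, cross_apply, Matrix.of_apply, Matrix.cons_val]
    ext k
    fin_cases k <;> simp only [crem, Pi.add_apply, Pi.smul_apply, smul_eq_mul, Matrix.cons_val,
      Fin.zero_eta, Fin.mk_one, Fin.reduceFinMk] <;> ring

theorem pencilPair_diag (b : Bil) {β γ : ℂ} (hβγ : β ≠ 0 ∨ γ ≠ 0)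
    {Y₀ Y₁ : Fin 6 → ℂ} (H : PencilPair b ![0, 0, 0, 0, 1, 0] ![1, 0, 0, β, 0, γ] Y₀ Y₁) :
    Y₀ ∈ Submodule.span ℂ (Set.range ![![1, 0, 0, 0, 0, 0], ![0, 0, 0, 0, 1, 0], ![0, 0, 0, γ, 0, β]]) ∧
    Y₁ ∈ Submodule.span ℂ (Set.range ![![1, 0, 0, 0, 0, 0], ![0, 0, 0, 0, 1, 0], ![0, 0, 0, γ, 0, β]]) := by
  obtain ⟨⟨l, hl⟩, hY⟩ := H
  have := matrix_eq_entries hl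
  simp [symMat] at this
  constructor
  · apply mem_span_three (Y₀ 0) (Y₀ 4) (-Y₁ 4)
    ext k
    fin_cases k <;> simp <;> grind
  -- The diagonal entries of the scalar matrix give β Y₁₃ = γ Y₁₅, so the two coordinates are
  -- proportional to (γ, β).
  · obtain ⟨c, hc⟩ : ∃ c, Y₁ 3 = c * γ ∧ Y₁ 5 = c * β := by
      rcases hβγ with h | h
      · exact ⟨Y₁ 5 / β, by field_simp; grind, by field_simp⟩
      · exact ⟨Y₁ 3 / γ, by field_simp, by field_simp; grind⟩
    apply mem_span_three (Y₁ 0) (Y₁ 4) c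
    ext k
    fin_cases k <;> simp <;> grind

/-- Pencils containing the product of two variables and a form not vanishing at its vertex. -/
theorem adaptedFrame_diag (b : Bil) {β γ : ℂ} (hβγ : β ≠ 0 ∨ γ ≠ 0)
    (hb : LineRel b ![0, 0, 0, 0, 1, 0] ![1, 0, 0, β, 0, γ]) :
    AdaptedFrame b ![![0, 0, 0, 0, 1, 0], ![1, 0, 0, β, 0, γ], ![1, 0, 0, 0, 0, 0]]
      ![![1, 0, 0, 0, 0, 0], ![0, 0, 0, 0, 1, 0], ![0, 0, 0, γ, 0, β]]
      !![0, -1, 0; 1, 0, -(β * γ); 1, 0, 0] !![0, 0, 1; 0, 1, 0; 0, 0, 0] := by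
  -- The first rows (0, -1, 0) and (0, 0, 1) of the two forms dictate k₁ and k₂; the other
  -- identities are the relations saying that the cubic contains the line.
  refine ⟨conicFrame_diag hβγ, ⟨-b ![0, 0, 0, 0, 1, 0] ![0, 0, 0, 0, 1, 0],
    b ![0, 0, 0, 0, 1, 0] ![0, 0, 0, γ, 0, β], ?_⟩, ?_, Or.inl ⟨![1, 0, 0], ![0, 0, 1], ?_⟩⟩
  · obtain ⟨h0, h1, h2, h3⟩ := hb
    rw [bil_expand] at h0 h3
    rw [bil_expand, bil_expand b ![1, 0, 0, β, 0, γ]] at h1 h2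
    simp [crem, pol] at h0 h1 h2 h3
    intro j
    constructor <;> fin_cases j <;> simp [bil_expand b _ ![_, _, _, _, _, _]] <;> grind
  · rintro Y ⟨H1, H2⟩ k
    fin_cases k
    exacts [(pencilPair_diag b hβγ H1).1, (pencilPair_diag b hβγ H1).2, (pencilPair_diag b hβγ H2).2]
  · simp [conicForm, cross_apply, Matrix.vecHead, Matrix.vecTail]

theorem conicFrame_vertex (δ : ℂ) :
    ConicFrame ![![0, 0, 0, 0, 1, 0], ![0, 1, 0, 0, 0, δ], ![0, 0, 0, 1, 0, 0]]
      ![![1, 0, 0, 0, 0, 0], ![0, 0, 1, 0, 0, 0], ![0, δ, 0, 0, 0, 1]]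
      !![0, 1, 0; 1, 0, 0; 0, 0, δ] !![0, 0, 1; 0, 1, 0; 0, 0, 0] := by
  refine ⟨?_, ?_, ⟨!![0, 0, 0; 1, 0, 0; 0, 0, 0], !![0, 0, 0; 0, 0, 1; δ, 0, 0],
    !![0, 0, 0; 0, 0, δ; 0, 0, 0], ?_, ?_⟩, ⟨-1, ?_⟩, ⟨-1, ?_⟩⟩
  · apply indep_three
    intro r s t h
    have := vec_eq_entries h
    simp at this
    grind
  · apply indep_three
    intro r s t h
    have := vec_eq_entries h
    simp at this
    grind
  · intro r s t h
    have := matrix_eq_entries h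
    simp at this
    grind
  · intro i j
    apply matrix_ext_entries
    fin_cases i <;> fin_cases j <;> simp [symMat]
  · intro ξ
    rw [vecMul_three, vecMul_three]
    simp only [Fin.sum_univ_three, cross_apply, Matrix.of_apply, Matrix.cons_val]
    ext k
    fin_cases k <;> simp only [crem, Pi.add_apply, Pi.smul_apply, smul_eq_mul, Matrix.cons_val,
      Fin.zero_eta, Fin.mk_one, Fin.reduceFinMk] <;> ring
  · intro ξ
    rw [mulVec_three, mulVec_three]
    simp only [Fin.sum_univ_three, cross_apply, Matrix.of_apply, Matrix.cons_val]
    ext k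
    fin_cases k <;> simp only [crem, Pi.add_apply, Pi.smul_apply, smul_eq_mul, Matrix.cons_val,
      Fin.zero_eta, Fin.mk_one, Fin.reduceFinMk] <;> ring

theorem pencilPair_vertex (b : Bil) (δ : ℂ)
    {Y₀ Y₁ : Fin 6 → ℂ} (H : PencilPair b ![0, 0, 0, 0, 1, 0] ![0, 1, 0, 0, 0, δ] Y₀ Y₁) :
    Y₀ ∈ Submodule.span ℂ (Set.range ![![1, 0, 0, 0, 0, 0], ![0, 0, 1, 0, 0, 0], ![0, δ, 0, 0, 0, 1]]) ∧
    Y₁ ∈ Submodule.span ℂ (Set.range ![![1, 0, 0, 0, 0, 0], ![0, 0, 1, 0, 0, 0], ![0, δ, 0, 0, 0, 1]]) := by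
  obtain ⟨⟨l, hl⟩, hY⟩ := H
  have := matrix_eq_entries hl
  simp [symMat] at this
  constructor
  · apply mem_span_three (Y₀ 0) (Y₀ 2) (Y₀ 5)
    ext k
    fin_cases k <;> simp <;> grind
  · apply mem_span_three (Y₁ 0) (Y₁ 2) (Y₁ 5)
    ext k
    fin_cases k <;> simp <;> grind

/-- Pencils containing `yz` and `xy + δ z²`. -/
theorem adaptedFrame_vertex (b : Bil) (δ : ℂ)
    (hb : LineRel b ![0, 0, 0, 0, 1, 0] ![0, 1, 0, 0, 0, δ]) :
    AdaptedFrame b ![![0, 0, 0, 0, 1, 0], ![0, 1, 0, 0, 0, δ], ![0, 0, 0, 1, 0, 0]]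
      ![![1, 0, 0, 0, 0, 0], ![0, 0, 1, 0, 0, 0], ![0, δ, 0, 0, 0, 1]]
      !![0, 1, 0; 1, 0, 0; 0, 0, δ] !![0, 0, 1; 0, 1, 0; 0, 0, 0] := by
  refine ⟨conicFrame_vertex δ, ⟨b ![0, 0, 0, 0, 1, 0] ![0, 0, 1, 0, 0, 0],
    b ![0, 0, 0, 0, 1, 0] ![0, δ, 0, 0, 0, 1], ?_⟩, ?_, Or.inl ⟨![1, 0, 0], ![0, 0, 1], ?_⟩⟩
  · obtain ⟨h0, h1, h2, h3⟩ := hb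
    rw [bil_expand] at h0 h3
    rw [bil_expand, bil_expand b ![0, 1, 0, 0, 0, δ]] at h1 h2
    simp [crem, pol] at h0 h1 h2 h3
    intro j
    constructor <;> fin_cases j <;> simp [bil_expand b _ ![_, _, _, _, _, _]] <;> grind
  · rintro Y ⟨H1, H2⟩ k
    fin_cases k
    exacts [(pencilPair_vertex b δ H1).1, (pencilPair_vertex b δ H1).2, (pencilPair_vertex b δ H2).2]
  · simp [conicForm, cross_apply, Matrix.vecHead, Matrix.vecTail]

theorem conicFrame_sum  :
    ConicFrame ![![0, 0, 0, 0, 1, 0], ![0, 1, 1, 0, 0, 0], ![0, 0, 0, 1, 0, 1]]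
      ![![1, 0, 0, 0, 0, 0], ![0, 1, 1, 0, 0, 0], ![0, 0, 0, 1, -1, 1]]
      !![0, 1, 0; 1, 0, 0; 0, 1, 0] !![0, 0, 1; 0, 1, 0; 0, 0, -1] := by
  refine ⟨?_, ?_, ⟨!![0, 0, 0; 1, 0, 0; 1, 0, 0], !![0, 0, 0; 0, -1, 1; 0, 1, -1],
    !![0, 0, 0; 0, 2, 0; 0, 0, 0], ?_, ?_⟩, ⟨-1, ?_⟩, ⟨-1, ?_⟩⟩
  · apply indep_three
    intro r s t h
    have := vec_eq_entries h
    simp at this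
    grind
  · apply indep_three
    intro r s t h
    have := vec_eq_entries h
    simp at this
    grind
  · intro r s t h
    have := matrix_eq_entries h
    simp at this
    grind
  · intro i j
    apply matrix_ext_entries
    fin_cases i <;> fin_cases j <;> simp [symMat]
    norm_num
  · intro ξ
    rw [vecMul_three, vecMul_three]
    simp only [Fin.sum_univ_three, cross_apply, Matrix.of_apply, Matrix.cons_val]
    ext k
    fin_cases k <;> simp only [crem, Pi.add_apply, Pi.smul_apply, smul_eq_mul, Matrix.cons_val,
      Fin.zero_eta, Fin.mk_one, Fin.reduceFinMk] <;> ring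
  · intro ξ
    rw [mulVec_three, mulVec_three]
    simp only [Fin.sum_univ_three, cross_apply, Matrix.of_apply, Matrix.cons_val]
    ext k
    fin_cases k <;> simp only [crem, Pi.add_apply, Pi.smul_apply, smul_eq_mul, Matrix.cons_val,
      Fin.zero_eta, Fin.mk_one, Fin.reduceFinMk] <;> ring

theorem pencilPair_sum (b : Bil)
    {Y₀ Y₁ : Fin 6 → ℂ} (H : PencilPair b ![0, 0, 0, 0, 1, 0] ![0, 1, 1, 0, 0, 0] Y₀ Y₁) :
    Y₀ ∈ Submodule.span ℂ (Set.range ![![1, 0, 0, 0, 0, 0], ![0, 1, 1, 0, 0, 0], ![0, 0, 0, 1, -1, 1]]) ∧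
    Y₁ ∈ Submodule.span ℂ (Set.range ![![1, 0, 0, 0, 0, 0], ![0, 1, 1, 0, 0, 0], ![0, 0, 0, 1, -1, 1]]) := by
  obtain ⟨⟨l, hl⟩, hY⟩ := H
  have := matrix_eq_entries hl
  simp [symMat] at this
  constructor
  · apply mem_span_three (Y₀ 0) (Y₀ 1) (Y₀ 3)
    ext k
    fin_cases k <;> simp <;> grind
  · apply mem_span_three (Y₁ 0) (Y₁ 1) (Y₁ 3)
    ext k
    fin_cases k <;> simp <;> grind

/-- The pencil spanned by `yz` and `x(y + z)`. -/
theorem adaptedFrame_sum (b : Bil)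
    (hb : LineRel b ![0, 0, 0, 0, 1, 0] ![0, 1, 1, 0, 0, 0]) :
    AdaptedFrame b ![![0, 0, 0, 0, 1, 0], ![0, 1, 1, 0, 0, 0], ![0, 0, 0, 1, 0, 1]]
      ![![1, 0, 0, 0, 0, 0], ![0, 1, 1, 0, 0, 0], ![0, 0, 0, 1, -1, 1]]
      !![0, 1, 0; 1, 0, 0; 0, 1, 0] !![0, 0, 1; 0, 1, 0; 0, 0, -1] := by
  refine ⟨conicFrame_sum , ⟨b ![0, 0, 0, 0, 1, 0] ![0, 1, 1, 0, 0, 0],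
    b ![0, 0, 0, 0, 1, 0] ![0, 0, 0, 1, -1, 1], ?_⟩, ?_, Or.inl ⟨![1, 0, 0], ![0, 0, 1], ?_⟩⟩
  · obtain ⟨h0, h1, h2, h3⟩ := hb
    rw [bil_expand] at h0 h3
    rw [bil_expand, bil_expand b ![0, 1, 1, 0, 0, 0]] at h1 h2
    simp [crem, pol] at h0 h1 h2 h3
    intro j
    constructor <;> fin_cases j <;> simp [bil_expand b _ ![_, _, _, _, _, _]] <;> grind
  · rintro Y ⟨H1, H2⟩ k
    fin_cases k
    exacts [(pencilPair_sum b H1).1, (pencilPair_sum b H1).2, (pencilPair_sum b H2).2]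
  · simp [conicForm, cross_apply, Matrix.vecHead, Matrix.vecTail]

theorem conicFrame_secantPoint {β γ : ℂ} (hβγ : β ≠ 0 ∨ γ ≠ 0) :
    ConicFrame ![![1, 0, 0, 0, 0, 0], ![0, 0, 0, 0, 1, 0], ![0, 0, 0, β, 0, γ]]
      ![![1, 0, 0, 0, 0, 0], ![0, 0, 0, 0, 1, 0], ![0, 0, 0, γ, 0, β]]
      !![1, 0, 0; 0, -1, 0; 0, 0, -(β * γ)] !![0, 0, 0; 0, 0, 1; 0, 1, 0] := by
  refine ⟨?_, ?_, ⟨!![1, 0, 0; 0, 0, 0; 0, 0, 0], !![0, 0, 0; 0, 0, β; 0, γ, 0],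
    !![0, 0, 0; 0, 1, 0; 0, 0, β * γ], ?_, ?_⟩, ⟨1, ?_⟩, ⟨1, ?_⟩⟩
  · apply indep_three
    intro r s t h
    have := vec_eq_entries h
    simp at this
    grind
  · apply indep_three
    intro r s t h
    have := vec_eq_entries h
    simp at this
    grind
  · intro r s t h
    have := matrix_eq_entries h
    simp at this
    grind
  · intro i j
    apply matrix_ext_entries
    fin_cases i <;> fin_cases j <;> simp [symMat]
    ring
  · intro ξ
    rw [vecMul_three, vecMul_three]
    simp only [Fin.sum_univ_three, cross_apply, Matrix.of_apply, Matrix.cons_val]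
    ext k
    fin_cases k <;> simp only [crem, Pi.add_apply, Pi.smul_apply, smul_eq_mul, Matrix.cons_val,
      Fin.zero_eta, Fin.mk_one, Fin.reduceFinMk] <;> ring
  · intro ξ
    rw [mulVec_three, mulVec_three]
    simp only [Fin.sum_univ_three, cross_apply, Matrix.of_apply, Matrix.cons_val]
    ext k
    fin_cases k <;> simp only [crem, Pi.add_apply, Pi.smul_apply, smul_eq_mul, Matrix.cons_val,
      Fin.zero_eta, Fin.mk_one, Fin.reduceFinMk] <;> ring

/-- The matrix equations leave the coordinates 3 and 5 of `Y₀` free. The equation b = 0 relates them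
through β and γ, up to sign derivatives of the cubic at the point of V, which is where smoothness
enters. -/
theorem pencilPair_secantPoint (b : Bil) {β γ : ℂ} (hβγ : β ≠ 0 ∨ γ ≠ 0) (hβ : b ![1, 0, 0, 0, 0, 0] (Pi.single 3 1) = β)
    (hγ : b ![1, 0, 0, 0, 0, 0] (Pi.single 5 1) = -γ)
    (hb : LineRel b ![1, 0, 0, 0, 0, 0] ![0, 0, 0, 0, 1, 0])
    {Y₀ Y₁ : Fin 6 → ℂ} (H : PencilPair b ![1, 0, 0, 0, 0, 0] ![0, 0, 0, 0, 1, 0] Y₀ Y₁) :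
    Y₀ ∈ Submodule.span ℂ (Set.range ![![1, 0, 0, 0, 0, 0], ![0, 0, 0, 0, 1, 0], ![0, 0, 0, γ, 0, β]]) ∧
    Y₁ ∈ Submodule.span ℂ (Set.range ![![1, 0, 0, 0, 0, 0], ![0, 0, 0, 0, 1, 0], ![0, 0, 0, γ, 0, β]]) := by
  obtain ⟨⟨l, hl⟩, hY⟩ := H
  have := matrix_eq_entries hl
  simp [symMat] at this
  obtain ⟨h0, h1, h2, h3⟩ := hb
  rw [bil_expand] at h3
  rw [bil_expand, bil_expand b ![0, 0, 0, 0, 1, 0]] at h1 h2 hY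
  simp [crem, pol] at h1 h2 h3
  have hY' : Y₀ 3 * β = Y₀ 5 * γ := by grind
  constructor
  · obtain ⟨c, hc⟩ : ∃ c, Y₀ 3 = c * γ ∧ Y₀ 5 = c * β := by
      rcases hβγ with h | h
      · exact ⟨Y₀ 5 / β, by field_simp; grind, by field_simp⟩
      · exact ⟨Y₀ 3 / γ, by field_simp, by field_simp; grind⟩
    apply mem_span_three (Y₀ 0) (Y₀ 4) c
    ext k
    fin_cases k <;> simp <;> grind
  · apply mem_span_three (Y₁ 0) (Y₁ 4) 0
    ext k
    fin_cases k <;> simp <;> grind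

/-- Pencils spanned by `x²` and `yz`. -/
theorem adaptedFrame_secantPoint (b : Bil) {β γ : ℂ} (hβγ : β ≠ 0 ∨ γ ≠ 0) (hβ : b ![1, 0, 0, 0, 0, 0] (Pi.single 3 1) = β)
    (hγ : b ![1, 0, 0, 0, 0, 0] (Pi.single 5 1) = -γ)
    (hb : LineRel b ![1, 0, 0, 0, 0, 0] ![0, 0, 0, 0, 1, 0]) :
    AdaptedFrame b ![![1, 0, 0, 0, 0, 0], ![0, 0, 0, 0, 1, 0], ![0, 0, 0, β, 0, γ]]
      ![![1, 0, 0, 0, 0, 0], ![0, 0, 0, 0, 1, 0], ![0, 0, 0, γ, 0, β]]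
      !![1, 0, 0; 0, -1, 0; 0, 0, -(β * γ)] !![0, 0, 0; 0, 0, 1; 0, 1, 0] := by
  refine ⟨conicFrame_secantPoint hβγ, ⟨b ![1, 0, 0, 0, 0, 0] ![1, 0, 0, 0, 0, 0],
    b ![0, 0, 0, 0, 1, 0] ![0, 0, 0, γ, 0, β], ?_⟩, ?_, Or.inl ⟨![1, 0, 0], ![0, 0, 1], ?_⟩⟩
  · obtain ⟨h0, h1, h2, h3⟩ := hb
    rw [bil_expand] at h0 h3
    rw [bil_expand, bil_expand b ![0, 0, 0, 0, 1, 0]] at h1 h2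
    simp [crem, pol] at h0 h1 h2 h3
    intro j
    constructor <;> fin_cases j <;> simp [bil_expand b _ ![_, _, _, _, _, _]] <;> grind
  · rintro Y ⟨H1, H2⟩ k
    fin_cases k
    exacts [(pencilPair_secantPoint b hβγ hβ hγ hb H1).1, (pencilPair_secantPoint b hβγ hβ hγ hb H1).2, (pencilPair_secantPoint b hβγ hβ hγ hb H2).2]
  · simp [conicForm, cross_apply, Matrix.vecHead, Matrix.vecTail]

end VeroneseFano
end

/-! ### Frames of pencils in normal form, II: lines through V that need more of the gradient. -/

open MvPolynomial
noncomputable section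
namespace VeroneseFano

open Matrix

set_option maxHeartbeats 1000000

theorem conicFrame_osculating {g₂ g₃ : ℂ} (hg : g₂ ≠ 0 ∨ g₃ ≠ 0) :
    ConicFrame ![![1, 0, 0, 0, 0, 0], ![0, 0, 1, 1, 0, 0], ![0, g₂, g₃, 0, 0, 0]]
      ![![0, 0, 0, 0, 0, 1], ![0, 0, 1, 1, 0, 0], ![0, 0, 0, g₃, -g₂, 0]]
      !![0, 1, 0; 1, 0, 0; g₃, 0, -(g₂ ^ 2)] !![0, 0, 0; 0, 0, -1; 0, 1, 0] := by
  refine ⟨?_, ?_, ⟨!![0, 0, 1; 0, 0, 0; 0, 0, 0], !![0, g₂, 0; 0, -g₃, g₂; 0, 0, 0],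
    !![0, 0, 0; 0, 1, 0; 0, g₃, 0], ?_, ?_⟩, ⟨-1, ?_⟩, ⟨1, ?_⟩⟩
  · apply indep_three
    intro r s t h
    have := vec_eq_entries h
    simp at this
    grind
  · apply indep_three
    intro r s t h
    have := vec_eq_entries h
    simp at this
    grind
  · intro r s t h
    have := matrix_eq_entries h
    simp at this
    grind
  · intro i j
    apply matrix_ext_entries
    fin_cases i <;> fin_cases j <;> simp [symMat]
    split_ands <;> ring
  · intro ξ
    rw [vecMul_three, vecMul_three]
    simp only [Fin.sum_univ_three, cross_apply, Matrix.of_apply, Matrix.cons_val]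
    ext k
    fin_cases k <;> simp only [crem, Pi.add_apply, Pi.smul_apply, smul_eq_mul, Matrix.cons_val,
      Fin.zero_eta, Fin.mk_one, Fin.reduceFinMk] <;> ring
  · intro ξ
    rw [mulVec_three, mulVec_three]
    simp only [Fin.sum_univ_three, cross_apply, Matrix.of_apply, Matrix.cons_val]
    ext k
    fin_cases k <;> simp only [crem, Pi.add_apply, Pi.smul_apply, smul_eq_mul, Matrix.cons_val,
      Fin.zero_eta, Fin.mk_one, Fin.reduceFinMk] <;> ring

theorem pencilPair_osculating (b : Bil) {g₂ g₃ : ℂ} (hg : g₂ ≠ 0 ∨ g₃ ≠ 0) (hg₂ : b ![1, 0, 0, 0, 0, 0] (Pi.single 3 1) = g₂)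
    (hg₃ : b ![1, 0, 0, 0, 0, 0] (Pi.single 4 1) = g₃)
    (hb : LineRel b ![1, 0, 0, 0, 0, 0] ![0, 0, 1, 1, 0, 0])
    {Y₀ Y₁ : Fin 6 → ℂ} (H : PencilPair b ![1, 0, 0, 0, 0, 0] ![0, 0, 1, 1, 0, 0] Y₀ Y₁) :
    Y₀ ∈ Submodule.span ℂ (Set.range ![![0, 0, 0, 0, 0, 1], ![0, 0, 1, 1, 0, 0], ![0, 0, 0, g₃, -g₂, 0]]) ∧
    Y₁ ∈ Submodule.span ℂ (Set.range ![![0, 0, 0, 0, 0, 1], ![0, 0, 1, 1, 0, 0], ![0, 0, 0, g₃, -g₂, 0]]) := by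
  obtain ⟨⟨l, hl⟩, hY⟩ := H
  have := matrix_eq_entries hl
  simp [symMat] at this
  obtain ⟨h0, h1, h2, h3⟩ := hb
  rw [bil_expand] at h3
  rw [bil_expand, bil_expand b ![0, 0, 1, 1, 0, 0]] at h1 h2 hY
  simp [crem, pol] at h1 h2 h3
  have hY' : (Y₀ 3 + Y₁ 5) * g₂ + Y₀ 4 * g₃ = 0 := by grind
  constructor
  · obtain ⟨c, hc⟩ : ∃ c, Y₀ 3 + Y₁ 5 = c * g₃ ∧ Y₀ 4 = -(c * g₂) := by
      rcases hg with h | h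
      · exact ⟨-Y₀ 4 / g₂, by field_simp; grind, by field_simp⟩
      · exact ⟨(Y₀ 3 + Y₁ 5) / g₃, by field_simp, by field_simp; grind⟩
    apply mem_span_three (Y₀ 5) (-Y₁ 5) c
    ext k
    fin_cases k <;> simp <;> grind
  · apply mem_span_three (Y₁ 5) (Y₁ 3) 0
    ext k
    fin_cases k <;> simp <;> grind

/-- Pencils spanned by `x²` and `y² + xz`. -/
theorem adaptedFrame_osculating (b : Bil) {g₂ g₃ : ℂ} (hg : g₂ ≠ 0 ∨ g₃ ≠ 0) (hg₂ : b ![1, 0, 0, 0, 0, 0] (Pi.single 3 1) = g₂)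
    (hg₃ : b ![1, 0, 0, 0, 0, 0] (Pi.single 4 1) = g₃)
    (hb : LineRel b ![1, 0, 0, 0, 0, 0] ![0, 0, 1, 1, 0, 0]) :
    AdaptedFrame b ![![1, 0, 0, 0, 0, 0], ![0, 0, 1, 1, 0, 0], ![0, g₂, g₃, 0, 0, 0]]
      ![![0, 0, 0, 0, 0, 1], ![0, 0, 1, 1, 0, 0], ![0, 0, 0, g₃, -g₂, 0]]
      !![0, 1, 0; 1, 0, 0; g₃, 0, -(g₂ ^ 2)] !![0, 0, 0; 0, 0, -1; 0, 1, 0] := by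
  refine ⟨conicFrame_osculating hg, ⟨b ![1, 0, 0, 0, 0, 0] ![0, 0, 1, 1, 0, 0],
    -b ![0, 0, 1, 1, 0, 0] ![0, 0, 0, g₃, -g₂, 0], ?_⟩, ?_, Or.inl ⟨![0, 1, 0], ![0, 0, 1], ?_⟩⟩
  · obtain ⟨h0, h1, h2, h3⟩ := hb
    rw [bil_expand] at h0 h3
    rw [bil_expand, bil_expand b ![0, 0, 1, 1, 0, 0]] at h1 h2
    simp [crem, pol] at h0 h1 h2 h3
    intro j
    constructor <;> fin_cases j <;> simp [bil_expand b _ ![_, _, _, _, _, _]] <;> grind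
  · rintro Y ⟨H1, H2⟩ k
    fin_cases k
    exacts [(pencilPair_osculating b hg hg₂ hg₃ hb H1).1, (pencilPair_osculating b hg hg₂ hg₃ hb H1).2, (pencilPair_osculating b hg hg₂ hg₃ hb H2).2]
  · simp [conicForm, cross_apply, Matrix.vecHead, Matrix.vecTail]

/-- In the application g and h hold gradient coordinates of the cubic at the two points of V on the
line. The fibres of the graph over these points are the lines ⟨y₀, y₁⟩ and ⟨y₀, y₂⟩, and the conic
η₁η₂ = 0 is their union. -/
theorem conicFrame_secant {g₁ g₂ h₁ h₂ : ℂ} (hg : g₁ ≠ 0 ∨ g₂ ≠ 0) (hh : h₁ ≠ 0 ∨ h₂ ≠ 0) :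
    ConicFrame ![![1, 0, 0, 0, 0, 0], ![0, 0, 0, 1, 0, 0], ![0, g₁ * h₁, g₂ * h₁, 0, h₂ * g₁, h₂ * g₂]]
      ![![0, 0, 0, 0, 0, 1], ![0, 0, 0, g₂, -g₁, 0], ![h₂, 0, -h₁, 0, 0, 0]]
      !![0, 0, 1; 0, 0, 0; -g₂, g₁ ^ 2, 0] !![0, 0, 0; 0, 1, 0; -h₂, 0, h₁ ^ 2] := by
  refine ⟨?_, ?_, ⟨!![h₂, 0, -h₁; 0, 0, 0; 0, 0, 0], !![0, 0, 0; 0, g₂, -g₁; 0, 0, 0],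
    !![0, 0, 0; 0, 0, 0; h₂ * g₂, -(h₂ * g₁ ^ 2), -(g₂ * h₁ ^ 2)], ?_, ?_⟩, ⟨-1, ?_⟩, ⟨1, ?_⟩⟩
  · apply indep_three
    intro r s t h
    have := vec_eq_entries h
    simp at this
    grind
  · apply indep_three
    intro r s t h
    have := vec_eq_entries h
    simp at this
    grind
  · intro r s t h
    have := matrix_eq_entries h
    simp at this
    grind
  · intro i j
    apply matrix_ext_entries
    fin_cases i <;> fin_cases j <;> simp [symMat] <;> split_ands <;> ring
  · intro ξ
    rw [vecMul_three, vecMul_three]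
    simp only [Fin.sum_univ_three, cross_apply, Matrix.of_apply, Matrix.cons_val]
    ext k
    fin_cases k <;> simp only [crem, Pi.add_apply, Pi.smul_apply, smul_eq_mul, Matrix.cons_val,
      Fin.zero_eta, Fin.mk_one, Fin.reduceFinMk] <;> ring
  · intro ξ
    rw [mulVec_three, mulVec_three]
    simp only [Fin.sum_univ_three, cross_apply, Matrix.of_apply, Matrix.cons_val]
    ext k
    fin_cases k <;> simp only [crem, Pi.add_apply, Pi.smul_apply, smul_eq_mul, Matrix.cons_val,
      Fin.zero_eta, Fin.mk_one, Fin.reduceFinMk] <;> ring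

/-- Pencils spanned by `x²` and `y²`. -/
theorem adaptedFrame_secant (b : Bil) {g₁ g₂ h₁ h₂ : ℂ} (hg : g₁ ≠ 0 ∨ g₂ ≠ 0) (hh : h₁ ≠ 0 ∨ h₂ ≠ 0) (hg₁ : b ![1, 0, 0, 0, 0, 0] (Pi.single 3 1) = g₁)
    (hg₂ : b ![1, 0, 0, 0, 0, 0] (Pi.single 4 1) = g₂)
    (hh₁ : b ![0, 0, 0, 1, 0, 0] (Pi.single 0 1) = h₁)
    (hh₂ : b ![0, 0, 0, 1, 0, 0] (Pi.single 2 1) = h₂)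
    (hb : LineRel b ![1, 0, 0, 0, 0, 0] ![0, 0, 0, 1, 0, 0]) :
    AdaptedFrame b ![![1, 0, 0, 0, 0, 0], ![0, 0, 0, 1, 0, 0], ![0, g₁ * h₁, g₂ * h₁, 0, h₂ * g₁, h₂ * g₂]]
      ![![0, 0, 0, 0, 0, 1], ![0, 0, 0, g₂, -g₁, 0], ![h₂, 0, -h₁, 0, 0, 0]]
      !![0, 0, 1; 0, 0, 0; -g₂, g₁ ^ 2, 0] !![0, 0, 0; 0, 1, 0; -h₂, 0, h₁ ^ 2] := by
  refine ⟨conicFrame_secant hg hh, ⟨b ![1, 0, 0, 0, 0, 0] ![h₂, 0, -h₁, 0, 0, 0],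
    b ![0, 0, 0, 1, 0, 0] ![0, 0, 0, g₂, -g₁, 0], ?_⟩, ?_, Or.inl ⟨![0, 1, 0], ![0, 0, 1], ?_⟩⟩
  · obtain ⟨h0, h1, h2, h3⟩ := hb
    rw [bil_expand] at h0 h3
    rw [bil_expand, bil_expand b ![0, 0, 0, 1, 0, 0]] at h1 h2
    simp [crem, pol] at h0 h1 h2 h3
    intro j
    constructor <;> fin_cases j <;> simp [bil_expand b _ ![_, _, _, _, _, _]] <;> grind
  · rintro Y ⟨⟨⟨l, hl⟩, hY⟩, ⟨⟨l', hl'⟩, hY'⟩⟩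
    have e := matrix_eq_entries hl
    have e' := matrix_eq_entries hl'
    simp [symMat] at e e'
    obtain ⟨h0, h1, h2, h3⟩ := hb
    simp only [Matrix.cons_val_zero, Matrix.cons_val_one] at hY hY'
    rw [bil_expand, bil_expand b ![0, 0, 0, 1, 0, 0]] at h1 h2 hY hY'
    simp [crem, pol] at h1 h2
    -- `Y 1` belongs to both pairs, so the matrix equations reduce it to a multiple of y₀, on which
    -- b vanishes against both generators. Hence the two equations b = 0 constrain `Y 0` and `Y 2`
    -- separately. A single pair would not suffice.
    have i1 : Y 0 3 * g₁ + Y 0 4 * g₂ = 0 := by grind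
    have i2 : Y 2 0 * h₁ + Y 2 2 * h₂ = 0 := by grind
    intro k
    fin_cases k
    · obtain ⟨c, hc⟩ : ∃ c, Y 0 3 = c * g₂ ∧ Y 0 4 = -(c * g₁) := by
        rcases hg with h | h
        · exact ⟨-Y 0 4 / g₁, by field_simp; grind, by field_simp⟩
        · exact ⟨Y 0 3 / g₂, by field_simp, by field_simp; grind⟩
      apply mem_span_three (Y 0 5) c 0
      ext k
      fin_cases k <;> simp <;> grind
    · apply mem_span_three (Y 1 5) 0 0
      ext k
      fin_cases k <;> simp <;> grind
    · obtain ⟨c, hc⟩ : ∃ c, Y 2 0 = c * h₂ ∧ Y 2 2 = -(c * h₁) := by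
        rcases hh with h | h
        · exact ⟨-Y 2 2 / h₁, by field_simp; grind, by field_simp⟩
        · exact ⟨Y 2 0 / h₂, by field_simp, by field_simp; grind⟩
      apply mem_span_three (Y 2 5) 0 c
      ext k
      fin_cases k <;> simp <;> grind
  · simp [conicForm, cross_apply, Matrix.vecHead, Matrix.vecTail]

/-- In the application ⟨y₀, y₁⟩ is the fibre of the graph over the point of tangency and y₂ is its
first-order displacement along the line, through x₀y₂ + x₁y₁ = 0. The parameters k and l are free
for the matrix equations; they serve to impose the same relation on b. -/
theorem conicFrame_tangent {g₁ g₂ k l : ℂ} (hg : g₁ ≠ 0 ∨ g₂ ≠ 0) :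
    ConicFrame ![![1, 0, 0, 0, 0, 0], ![0, 1, 0, 0, 0, 0], ![0, 0, g₁ * k + g₂ * l, g₁ ^ 2, g₁ * g₂, g₂ ^ 2]]
      ![![0, 0, 0, 0, 0, 1], ![0, 0, 0, g₂, -g₁, 0], ![0, -g₂, g₁, k, l, 0]]
      !![0, 0, 0; 0, 0, 1; g₂, -(g₁ ^ 2), g₁ * l] !![0, 0, 1; 0, -1, 0; k, l * g₁, -(l ^ 2)] := by
  refine ⟨?_, ?_, ⟨!![0, k, l; 0, 0, g₁; 0, 0, g₂], !![0, -g₂, g₁; 0, 0, 0; 0, 0, 0],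
    !![0, 0, 0; 0, 0, -g₂; 0, 0, (g₁ * k + g₂ * l) * g₁], ?_, ?_⟩, ⟨-1, ?_⟩, ⟨1, ?_⟩⟩
  · apply indep_three
    intro r s t h
    have := vec_eq_entries h
    simp at this
    grind
  · apply indep_three
    intro r s t h
    have := vec_eq_entries h
    simp at this
    grind
  · intro r s t h
    have := matrix_eq_entries h
    simp at this
    grind
  · intro i j
    apply matrix_ext_entries
    fin_cases i <;> fin_cases j <;> simp [symMat] <;> split_ands <;> ring
  · intro ξ
    rw [vecMul_three, vecMul_three]
    simp only [Fin.sum_univ_three, cross_apply, Matrix.of_apply, Matrix.cons_val]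
    ext k
    fin_cases k <;> simp only [crem, Pi.add_apply, Pi.smul_apply, smul_eq_mul, Matrix.cons_val,
      Fin.zero_eta, Fin.mk_one, Fin.reduceFinMk] <;> ring
  · intro ξ
    rw [mulVec_three, mulVec_three]
    simp only [Fin.sum_univ_three, cross_apply, Matrix.of_apply, Matrix.cons_val]
    ext k
    fin_cases k <;> simp only [crem, Pi.add_apply, Pi.smul_apply, smul_eq_mul, Matrix.cons_val,
      Fin.zero_eta, Fin.mk_one, Fin.reduceFinMk] <;> ring

/-- Pencils spanned by `x²` and `xy`. -/
theorem adaptedFrame_tangent (b : Bil) {g₁ g₂ k l : ℂ} (hg : g₁ ≠ 0 ∨ g₂ ≠ 0) (hg₁ : b ![1, 0, 0, 0, 0, 0] (Pi.single 3 1) = g₁)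
    (hg₂ : b ![1, 0, 0, 0, 0, 0] (Pi.single 4 1) = g₂)
    (hkl : g₁ * k + g₂ * l = g₂ * b ![1, 0, 0, 0, 0, 0] (Pi.single 1 1) -
      g₁ * b ![1, 0, 0, 0, 0, 0] (Pi.single 2 1) - g₂ * b ![0, 1, 0, 0, 0, 0] (Pi.single 3 1) +
      g₁ * b ![0, 1, 0, 0, 0, 0] (Pi.single 4 1))
    (hb : LineRel b ![1, 0, 0, 0, 0, 0] ![0, 1, 0, 0, 0, 0]) :
    AdaptedFrame b ![![1, 0, 0, 0, 0, 0], ![0, 1, 0, 0, 0, 0], ![0, 0, g₁ * k + g₂ * l, g₁ ^ 2, g₁ * g₂, g₂ ^ 2]]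
      ![![0, 0, 0, 0, 0, 1], ![0, 0, 0, g₂, -g₁, 0], ![0, -g₂, g₁, k, l, 0]]
      !![0, 0, 0; 0, 0, 1; g₂, -(g₁ ^ 2), g₁ * l] !![0, 0, 1; 0, -1, 0; k, l * g₁, -(l ^ 2)] := by
  refine ⟨conicFrame_tangent hg, ⟨b ![0, 1, 0, 0, 0, 0] ![0, -g₂, g₁, k, l, 0],
    b ![1, 0, 0, 0, 0, 0] ![0, -g₂, g₁, k, l, 0], ?_⟩, ?_, Or.inr ⟨⟨-1, by simp, ?_⟩, ⟨![1, 0, 0], ![0, 1, 0], ?_, ?_⟩, ?_, ?_⟩⟩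
  · obtain ⟨h0, h1, h2, h3⟩ := hb
    rw [bil_expand] at h0 h3
    rw [bil_expand, bil_expand b ![0, 1, 0, 0, 0, 0]] at h1 h2
    simp [crem, pol] at h0 h1 h2 h3
    intro j
    constructor <;> fin_cases j <;> simp [bil_expand b _ ![_, _, _, _, _, _]] <;> grind
  · rintro Y ⟨⟨⟨l', hl'⟩, hY⟩, ⟨⟨l'', hl''⟩, hY'⟩⟩
    have e := matrix_eq_entries hl'
    have e' := matrix_eq_entries hl''
    simp [symMat] at e e'
    obtain ⟨h0, h1, h2, h3⟩ := hb
    rw [bil_expand] at h3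
    simp only [Matrix.cons_val_zero, Matrix.cons_val_one] at hY hY'
    rw [bil_expand, bil_expand b ![0, 1, 0, 0, 0, 0]] at h1 h2 hY hY'
    simp [crem, pol] at h1 h2 h3
    have i1 : Y 1 3 * g₁ + Y 1 4 * g₂ = 0 := by grind
    obtain ⟨c, hc⟩ : ∃ c, Y 1 3 = c * g₂ ∧ Y 1 4 = -(c * g₁) := by
      rcases hg with h | h
      · exact ⟨-Y 1 4 / g₁, by field_simp; grind, by field_simp⟩
      · exact ⟨Y 1 3 / g₂, by field_simp, by field_simp; grind⟩
    have i2 : (Y 0 3 - c * k) * g₁ + (Y 0 4 - c * l) * g₂ = 0 := by grind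
    intro k'
    fin_cases k'
    · obtain ⟨d, hd⟩ : ∃ d, Y 0 3 - c * k = d * g₂ ∧ Y 0 4 - c * l = -(d * g₁) := by
        rcases hg with h | h
        · exact ⟨-(Y 0 4 - c * l) / g₁, by field_simp; grind, by field_simp⟩
        · exact ⟨(Y 0 3 - c * k) / g₂, by field_simp, by field_simp; grind⟩
      apply mem_span_three (Y 0 5) d c
      ext k
      fin_cases k <;> simp <;> grind
    · apply mem_span_three (Y 1 5) c 0
      ext k
      fin_cases k <;> simp <;> grind
    · apply mem_span_three (Y 2 5) 0 0
      ext k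
      fin_cases k <;> simp <;> grind
  · intro η
    simp [conicForm, cross_apply, Matrix.vecHead, Matrix.vecTail]
    ring
  · simp [ver]
  · simp [symProd]
  · refine ⟨?_, ?_, ?_, ?_⟩ <;> ext i j <;> fin_cases i <;> fin_cases j <;> simp [symMat]
  · obtain ⟨h0, h1, h2, h3⟩ := hb
    rw [bil_expand] at h0 h3
    rw [bil_expand, bil_expand b ![0, 1, 0, 0, 0, 0]] at h1 h2
    simp [crem, pol] at h0 h1 h2 h3
    refine ⟨?_, ?_, ?_, ?_⟩ <;> simp [bil_expand b _ ![_, _, _, _, _, _]] <;> grind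

end VeroneseFano
end

/-! ### From normal forms to arbitrary coordinates. -/

open MvPolynomial
noncomputable section
namespace VeroneseFano

open Matrix

theorem ver_single : ver (![1, 0, 0] : Fin 3 → ℂ) = ![1, 0, 0, 0, 0, 0] := by
  simp [ver]

/-- The polarisation of f at e₀e₀ᵀ has only the coordinates 3, 4, 5, so the gradient of the cubic
there consists of the values of b(e₀e₀ᵀ, ·) at these three basis vectors. -/
theorem smooth_at_single {b : Bil} {L : Submodule ℂ (Fin 6 → ℂ)} (h : GoodLine b L)
    (hL : ![1, 0, 0, 0, 0, 0] ∈ L) (h5 : b ![1, 0, 0, 0, 0, 0] (Pi.single 5 1) = 0) :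
    b ![1, 0, 0, 0, 0, 0] (Pi.single 3 1) ≠ 0 ∨ b ![1, 0, 0, 0, 0, 0] (Pi.single 4 1) ≠ 0 := by
  obtain ⟨n, hn⟩ := h.2 ![1, 0, 0] (by simp) (by rwa [ver_single])
  rw [ver_single, bil_expand] at hn
  by_contra! h0
  apply hn
  simp [pol, h0, h5]

theorem hasFrame_diag {b : Bil} {β γ : ℂ} (hβγ : β ≠ 0 ∨ γ ≠ 0)
    (h : GoodLine b (Submodule.span ℂ {![0, 0, 0, 0, 1, 0], ![1, 0, 0, β, 0, γ]})) :
    HasFrame b (Submodule.span ℂ {![0, 0, 0, 0, 1, 0], ![1, 0, 0, β, 0, γ]}) :=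
  ⟨_, _, _, _, adaptedFrame_diag b hβγ (lineRel_of_forall h.1), rfl⟩

theorem hasFrame_vertex {b : Bil} {δ : ℂ}
    (h : GoodLine b (Submodule.span ℂ {![0, 0, 0, 0, 1, 0], ![0, 1, 0, 0, 0, δ]})) :
    HasFrame b (Submodule.span ℂ {![0, 0, 0, 0, 1, 0], ![0, 1, 0, 0, 0, δ]}) :=
  ⟨_, _, _, _, adaptedFrame_vertex b δ (lineRel_of_forall h.1), rfl⟩

theorem hasFrame_sum {b : Bil}
    (h : GoodLine b (Submodule.span ℂ {![0, 0, 0, 0, 1, 0], ![0, 1, 1, 0, 0, 0]})) :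
    HasFrame b (Submodule.span ℂ {![0, 0, 0, 0, 1, 0], ![0, 1, 1, 0, 0, 0]}) :=
  ⟨_, _, _, _, adaptedFrame_sum b (lineRel_of_forall h.1), rfl⟩

theorem hasFrame_secantPoint {b : Bil}
    (h : GoodLine b (Submodule.span ℂ {![1, 0, 0, 0, 0, 0], ![0, 0, 0, 0, 1, 0]})) :
    HasFrame b (Submodule.span ℂ {![1, 0, 0, 0, 0, 0], ![0, 0, 0, 0, 1, 0]}) := by
  have hb := lineRel_of_forall h.1
  obtain ⟨n, hn⟩ := h.2 ![1, 0, 0] (by simp) (by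
    rw [ver_single]; exact Submodule.subset_span (by simp))
  rw [ver_single, bil_expand] at hn
  have h4 : b ![1, 0, 0, 0, 0, 0] (Pi.single 4 1) = 0 := by
    have := hb.2.1
    rw [bil_expand, bil_expand b ![0, 0, 0, 0, 1, 0]] at this
    simpa [pol, crem] using this
  refine ⟨_, _, _, _, adaptedFrame_secantPoint b (β := b ![1, 0, 0, 0, 0, 0] (Pi.single 3 1))
    (γ := -b ![1, 0, 0, 0, 0, 0] (Pi.single 5 1)) ?_ rfl (by ring) hb, rfl⟩
  by_contra! h0
  apply hn
  simp [pol, h0.1, neg_eq_zero.mp h0.2, h4]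

theorem hasFrame_osculating {b : Bil}
    (h : GoodLine b (Submodule.span ℂ {![1, 0, 0, 0, 0, 0], ![0, 0, 1, 1, 0, 0]})) :
    HasFrame b (Submodule.span ℂ {![1, 0, 0, 0, 0, 0], ![0, 0, 1, 1, 0, 0]}) := by
  have hb := lineRel_of_forall h.1
  refine ⟨_, _, _, _, adaptedFrame_osculating b (smooth_at_single h
    (Submodule.subset_span (by simp)) ?_) rfl rfl hb, rfl⟩
  have := hb.2.1
  rw [bil_expand, bil_expand b ![0, 0, 1, 1, 0, 0]] at this
  simpa [pol, crem] using this

theorem hasFrame_secant {b : Bil}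
    (h : GoodLine b (Submodule.span ℂ {![1, 0, 0, 0, 0, 0], ![0, 0, 0, 1, 0, 0]})) :
    HasFrame b (Submodule.span ℂ {![1, 0, 0, 0, 0, 0], ![0, 0, 0, 1, 0, 0]}) := by
  have hb := lineRel_of_forall h.1
  refine ⟨_, _, _, _, adaptedFrame_secant b (smooth_at_single h
    (Submodule.subset_span (by simp)) ?_) ?_ rfl rfl rfl rfl hb, rfl⟩
  · have := hb.2.1
    rw [bil_expand, bil_expand b ![0, 0, 0, 1, 0, 0]] at this
    simpa [pol, crem] using this
  · have h5 : b ![0, 0, 0, 1, 0, 0] (Pi.single 5 1) = 0 := by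
      have := hb.2.2.1
      rw [bil_expand, bil_expand b ![0, 0, 0, 1, 0, 0]] at this
      simpa [pol, crem] using this
    have hv : ver (![0, 1, 0] : Fin 3 → ℂ) = ![0, 0, 0, 1, 0, 0] := by simp [ver]
    obtain ⟨n, hn⟩ := h.2 ![0, 1, 0] (by simp) (by
      rw [hv]; exact Submodule.subset_span (by simp))
    rw [hv, bil_expand] at hn
    by_contra! h0
    apply hn
    simp [pol, h0, h5]

theorem hasFrame_tangent {b : Bil}
    (h : GoodLine b (Submodule.span ℂ {![1, 0, 0, 0, 0, 0], ![0, 1, 0, 0, 0, 0]})) :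
    HasFrame b (Submodule.span ℂ {![1, 0, 0, 0, 0, 0], ![0, 1, 0, 0, 0, 0]}) := by
  have hb := lineRel_of_forall h.1
  have hg := smooth_at_single h (Submodule.subset_span (by simp)) (by
    have := hb.2.2.1
    rw [bil_expand, bil_expand b ![0, 1, 0, 0, 0, 0]] at this
    simpa [pol, crem] using this)
  -- The equation for k and l below is b(x₀, y₂) + b(x₁, y₁) = 0 written out; it is solvable because
  -- the gradient (g₁, g₂) is nonzero.
  have solve : ∀ g₁ g₂ c : ℂ, g₁ ≠ 0 ∨ g₂ ≠ 0 → ∃ k l, g₁ * k + g₂ * l = c := by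
    intro g₁ g₂ c h
    rcases h with h | h
    · exact ⟨c / g₁, 0, by field_simp; ring⟩
    · exact ⟨0, c / g₂, by field_simp; ring⟩
  obtain ⟨k, l, hkl⟩ := solve _ _ (b ![1, 0, 0, 0, 0, 0] (Pi.single 4 1) *
    b ![1, 0, 0, 0, 0, 0] (Pi.single 1 1) -
      b ![1, 0, 0, 0, 0, 0] (Pi.single 3 1) * b ![1, 0, 0, 0, 0, 0] (Pi.single 2 1) -
      b ![1, 0, 0, 0, 0, 0] (Pi.single 4 1) * b ![0, 1, 0, 0, 0, 0] (Pi.single 3 1) +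
      b ![1, 0, 0, 0, 0, 0] (Pi.single 3 1) * b ![0, 1, 0, 0, 0, 0] (Pi.single 4 1)) hg
  exact ⟨_, _, _, _, adaptedFrame_tangent b hg rfl rfl hkl hb, rfl⟩

/-- The determinant of three vectors. -/
def tri (e₁ e₂ e₃ : Fin 3 → ℂ) : ℂ :=
  e₁ 0 * (e₂ 1 * e₃ 2 - e₂ 2 * e₃ 1) - e₁ 1 * (e₂ 0 * e₃ 2 - e₂ 2 * e₃ 0) +
    e₁ 2 * (e₂ 0 * e₃ 1 - e₂ 1 * e₃ 0)

/-- The symmetric matrix with given coordinates in the basis `e₁`, `e₂`, `e₃`. -/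
def symComb (e₁ e₂ e₃ : Fin 3 → ℂ) (c : Fin 6 → ℂ) : Fin 6 → ℂ :=
  c 0 • ver e₁ + c 1 • symProd e₁ e₂ + c 2 • symProd e₁ e₃ + c 3 • ver e₂ + c 4 • symProd e₂ e₃ +
    c 5 • ver e₃

theorem exists_act_eq_symComb {e₁ e₂ e₃ : Fin 3 → ℂ} (h : tri e₁ e₂ e₃ ≠ 0) :
    ∃ g k : Matrix (Fin 3) (Fin 3) ℂ, k * g = 1 ∧ ∀ c, act g c = symComb e₁ e₂ e₃ c := by
  let g : Matrix (Fin 3) (Fin 3) ℂ :=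
    !![e₁ 0, e₂ 0, e₃ 0; e₁ 1, e₂ 1, e₃ 1; e₁ 2, e₂ 2, e₃ 2]
  have hg : g.det ≠ 0 := by
    intro h0
    apply h
    rw [← h0, Matrix.det_fin_three]
    simp [g, tri]
    ring
  refine ⟨g, g⁻¹, Matrix.nonsing_inv_mul _ (isUnit_iff_ne_zero.mpr hg), fun c => ?_⟩
  ext i
  fin_cases i <;>
    simp [g, act, ofSym, symComb, ver, symProd, symMat, Matrix.mul_apply, Fin.sum_univ_three] <;>
    ring

theorem symComb_surjective {e₁ e₂ e₃ : Fin 3 → ℂ} (h : tri e₁ e₂ e₃ ≠ 0) (v : Fin 6 → ℂ) :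
    ∃ c, symComb e₁ e₂ e₃ c = v := by
  obtain ⟨g, k, hk, hg⟩ := exists_act_eq_symComb h
  refine ⟨act k v, ?_⟩
  rw [← hg, ← act_mul, mul_eq_one_comm.mp hk, act_one]

/-- By dimension, two independent vectors of L whose coordinates in some basis e₁, e₂, e₃ are in
normal form suffice to identify L with the image of a normal pencil under the matrix with columns
e₁, e₂, e₃. -/
theorem HasFrame.of_symComb {b : Bil} {L : Submodule ℂ (Fin 6 → ℂ)}
    (hL : Module.finrank ℂ L = 2) (hgood : GoodLine b L) {e₁ e₂ e₃ : Fin 3 → ℂ}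
    (he : tri e₁ e₂ e₃ ≠ 0) {c d : Fin 6 → ℂ} (hcd : LinearIndependent ℂ ![c, d])
    (hc : symComb e₁ e₂ e₃ c ∈ L) (hd : symComb e₁ e₂ e₃ d ∈ L)
    (H : ∀ b, GoodLine b (Submodule.span ℂ {c, d}) → HasFrame b (Submodule.span ℂ {c, d})) :
    HasFrame b L := by
  obtain ⟨g, k, hk, hg⟩ := exists_act_eq_symComb he
  have hmap : (Submodule.span ℂ {c, d}).map (VeroneseFano.act g) = L := by
    apply Submodule.eq_of_le_of_finrank_eq
    · rw [Submodule.map_span, Set.image_pair, Submodule.span_le]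
      rintro x (rfl | rfl)
      · rw [hg]; exact hc
      · rw [hg]; exact hd
    · have h2 := finrank_span_eq_card hcd
      rw [hL, ← (Submodule.equivMapOfInjective _ (act_injective hk) _).finrank_eq]
      have hr : Set.range ![c, d] = {c, d} := by
        rw [Matrix.range_cons, Matrix.range_cons, Matrix.range_empty, Set.union_empty]; rfl
      rw [hr] at h2
      simpa using h2
  rw [← hmap] at hgood ⊢
  exact (H _ (hgood.pull hk)).act hk

end VeroneseFano
end

/-! ### Classification of pencils of ternary quadratic forms. -/

open MvPolynomial
noncomputable section
namespace VeroneseFano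

open Matrix

theorem exists_binary_factor (A B C : ℂ) : ∃ α₁ β₁ α₂ β₂ : ℂ,
    A = 2 * (α₁ * α₂) ∧ B = α₁ * β₂ + β₁ * α₂ ∧ C = 2 * (β₁ * β₂) := by
  by_cases hA : A = 0
  · exact ⟨0, 1, B, C / 2, by simp [hA], by ring, by ring⟩
  · obtain ⟨s, hs⟩ := IsAlgClosed.exists_pow_nat_eq (B ^ 2 - A * C) (n := 2) (by norm_num)
    refine ⟨1, (B + s) / A, A / 2, B - (B + s) / A * (A / 2), by ring, by ring, ?_⟩
    field_simp
    linear_combination hs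

theorem exists_binary_square {A B C : ℂ} (h : B ^ 2 = A * C) : ∃ α β : ℂ,
    A = α * α ∧ B = α * β ∧ C = β * β := by
  obtain ⟨α, hα⟩ := IsAlgClosed.exists_pow_nat_eq A (n := 2) (by norm_num)
  by_cases h0 : α = 0
  · obtain ⟨β, hβ⟩ := IsAlgClosed.exists_pow_nat_eq C (n := 2) (by norm_num)
    have hA : A = 0 := by rw [← hα, h0]; ring
    have hB : B = 0 := by simpa [hA] using h
    exact ⟨0, β, by simp [hA], by simp [hB], by rw [← hβ]; ring⟩
  · refine ⟨α, B / α, by rw [← hα]; ring, by field_simp, ?_⟩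
    have hA : A ≠ 0 := by rw [← hα]; exact pow_ne_zero 2 h0
    field_simp
    rw [h, ← hα]; ring

/-- A kernel vector with a nonzero coordinate expresses one row by the others, so the form is
determined by a binary form, and binary forms over ℂ split into linear factors. -/
theorem exists_symProd_of_det_eq_zero {a : Fin 6 → ℂ} (h : (symMat a).det = 0) :
    ∃ l₁ l₂, a = symProd l₁ l₂ := by
  obtain ⟨k, hk, hak⟩ := Matrix.exists_mulVec_eq_zero_iff.mpr h
  have h0 := congrFun hak 0
  have h1 := congrFun hak 1
  have h2 := congrFun hak 2
  simp [symMat, Matrix.mulVec, dotProduct, Fin.sum_univ_three] at h0 h1 h2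
  by_cases k2 : k 2 = 0
  · by_cases k1 : k 1 = 0
    · have k0 : k 0 ≠ 0 := fun h' => hk (by ext i; fin_cases i <;> simp [h', k1, k2])
      simp [k1, k2, k0] at h0 h1 h2
      obtain ⟨α₁, β₁, α₂, β₂, e1, e2, e3⟩ := exists_binary_factor (a 3) (a 4) (a 5)
      refine ⟨![0, α₁, β₁], ![0, α₂, β₂], ?_⟩
      ext i; fin_cases i <;> simp [symProd, *]
    · simp [k2] at h0 h1 h2
      obtain ⟨α₁, β₁, α₂, β₂, e1, e2, e3⟩ := exists_binary_factor (a 0) (a 2) (a 5)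
      refine ⟨![α₁, -(α₁ * k 0) / k 1, β₁], ![α₂, -(α₂ * k 0) / k 1, β₂], ?_⟩
      have e4 : a 1 = -(a 0 * k 0) / k 1 := by field_simp; linear_combination h0
      have e5 : a 4 = -(a 2 * k 0) / k 1 := by field_simp; linear_combination h2
      have e6 : a 3 = -(a 1 * k 0) / k 1 := by field_simp; linear_combination h1
      ext i; fin_cases i <;> simp only [symProd, e6, e4, e5, e1, e2, e3,
        Matrix.cons_val, Fin.zero_eta, Fin.mk_one, Fin.reduceFinMk] <;> field_simp <;> ring
  · obtain ⟨α₁, β₁, α₂, β₂, e1, e2, e3⟩ := exists_binary_factor (a 0) (a 1) (a 3)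
    refine ⟨![α₁, β₁, -(α₁ * k 0 + β₁ * k 1) / k 2], ![α₂, β₂, -(α₂ * k 0 + β₂ * k 1) / k 2], ?_⟩
    have e4 : a 2 = -(a 0 * k 0 + a 1 * k 1) / k 2 := by field_simp; linear_combination h0
    have e5 : a 4 = -(a 1 * k 0 + a 3 * k 1) / k 2 := by field_simp; linear_combination h1
    have e6 : a 5 = -(a 2 * k 0 + a 4 * k 1) / k 2 := by field_simp; linear_combination h2
    ext i; fin_cases i <;> simp only [symProd, e6, e4, e5, e1, e2, e3,
        Matrix.cons_val, Fin.zero_eta, Fin.mk_one, Fin.reduceFinMk] <;> field_simp <;> ring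

theorem exists_tri_ne_zero {e₂ e₃ : Fin 3 → ℂ} (h : e₂ ⨯₃ e₃ ≠ 0) : ∃ e₁, tri e₁ e₂ e₃ ≠ 0 := by
  by_contra! h0
  apply h
  have h1 := h0 ![1, 0, 0]
  have h2 := h0 ![0, 1, 0]
  have h3 := h0 ![0, 0, 1]
  simp [tri] at h1 h2 h3
  ext i; fin_cases i <;> simp [crossProduct]
  · linear_combination h1
  · linear_combination h2
  · linear_combination h3

theorem exists_basis_extending {e : Fin 3 → ℂ} (h : e ≠ 0) : ∃ e₂ e₃, tri e e₂ e₃ ≠ 0 := by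
  by_contra! h0
  apply h
  have h1 := h0 ![0, 1, 0] ![0, 0, 1]
  have h2 := h0 ![0, 0, 1] ![1, 0, 0]
  have h3 := h0 ![1, 0, 0] ![0, 1, 0]
  simp [tri] at h1 h2 h3
  ext i; fin_cases i <;> simp [*]

theorem exists_smul_of_cross_eq_zero {l m : Fin 3 → ℂ} (h : l ⨯₃ m = 0) (hl : l ≠ 0) :
    ∃ t : ℂ, m = t • l := by
  have h0 := congrFun h 0
  have h1 := congrFun h 1
  have h2 := congrFun h 2
  simp [crossProduct] at h0 h1 h2
  obtain ⟨i, hi⟩ := Function.ne_iff.mp hl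
  refine ⟨m i / l i, ?_⟩
  have hi' : l i ≠ 0 := hi
  ext j
  simp only [Pi.smul_apply, smul_eq_mul]
  field_simp
  fin_cases i <;> fin_cases j <;> simp
  all_goals first | ring1 | linear_combination h0 | linear_combination -h0 |
    linear_combination h1 | linear_combination -h1 | linear_combination h2 | linear_combination -h2

theorem exists_not_mem_span_singleton {L : Submodule ℂ (Fin 6 → ℂ)}
    (hL : Module.finrank ℂ L = 2) (a : Fin 6 → ℂ) :
    ∃ w ∈ L, ∀ t : ℂ, w ≠ t • a := by
  by_contra! h0
  have : L ≤ Submodule.span ℂ {a} := fun w hw => by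
    obtain ⟨t, rfl⟩ := h0 w hw
    exact Submodule.smul_mem _ _ (Submodule.mem_span_singleton_self a)
  have h1 := Submodule.finrank_mono this
  have h2 := finrank_span_le_card (R := ℂ) ({a} : Set (Fin 6 → ℂ))
  simp at h2
  omega

theorem indep_pair {c d : Fin 6 → ℂ} (h : ∀ s t : ℂ, s • c + t • d = 0 → s = 0 ∧ t = 0) :
    LinearIndependent ℂ ![c, d] := LinearIndependent.pair_iff.mpr h

theorem hasFrame_tangent_of_symComb {b : Bil} {L : Submodule ℂ (Fin 6 → ℂ)}
    (hL : Module.finrank ℂ L = 2) (hgood : GoodLine b L) {e e₂ e₃ : Fin 3 → ℂ}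
    (htri : tri e e₂ e₃ ≠ 0) (heL : ver e ∈ L) {c : Fin 6 → ℂ} (hw : symComb e e₂ e₃ c ∈ L)
    (hwe : ∀ t : ℂ, symComb e e₂ e₃ c ≠ t • ver e) (h3 : c 3 = 0) (h4 : c 4 = 0)
    (h5 : c 5 = 0) : HasFrame b L := by
  have hver : ∀ l m, symComb e l m ![1, 0, 0, 0, 0, 0] ∈ L := fun l m => by
    simpa [symComb] using heL
  have key : ∀ l, symComb e (c 1 • e₂ + c 2 • e₃) l ![0, 1, 0, 0, 0, 0] ∈ L := fun l => by
    have : symComb e (c 1 • e₂ + c 2 • e₃) l ![0, 1, 0, 0, 0, 0] =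
        symComb e e₂ e₃ c - c 0 • ver e := by
      ext i
      fin_cases i <;> simp only [symComb, symProd, ver, h3, h4, h5, Pi.add_apply, Pi.sub_apply, Pi.smul_apply,
        smul_eq_mul, Matrix.cons_val, Fin.zero_eta, Fin.mk_one, Fin.reduceFinMk] <;> ring
    rw [this]
    exact L.sub_mem hw (L.smul_mem _ heL)
  have hi : LinearIndependent ℂ
      ![(![1, 0, 0, 0, 0, 0] : Fin 6 → ℂ), ![0, 1, 0, 0, 0, 0]] := by
    apply indep_pair
    intro s t h
    exact ⟨by simpa using congrFun h 0, by simpa using congrFun h 1⟩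
  by_cases hc1 : c 1 = 0
  · have hc2 : c 2 ≠ 0 := fun hc2 => hwe (c 0) (by
      simp [symComb, hc1, hc2, h3, h4, h5])
    refine HasFrame.of_symComb hL hgood (e₁ := e) (e₂ := c 1 • e₂ + c 2 • e₃) (e₃ := e₂) ?_
      hi (hver _ _) (key _) (fun b => hasFrame_tangent)
    intro h
    apply htri
    apply (mul_eq_zero.mp (?_ : c 2 * _ = 0)).resolve_left hc2
    rw [← neg_eq_zero, ← h]
    simp [tri, hc1]; ring
  · refine HasFrame.of_symComb hL hgood (e₁ := e) (e₂ := c 1 • e₂ + c 2 • e₃) (e₃ := e₃) ?_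
      hi (hver _ _) (key _) (fun b => hasFrame_tangent)
    intro h
    apply htri
    apply (mul_eq_zero.mp (?_ : c 1 * _ = 0)).resolve_left hc1
    rw [← h]
    simp [tri]; ring

theorem hasFrame_secant_of_symComb {b : Bil} {L : Submodule ℂ (Fin 6 → ℂ)}
    (hL : Module.finrank ℂ L = 2) (hgood : GoodLine b L) {e e₂ e₃ : Fin 3 → ℂ}
    (htri : tri e e₂ e₃ ≠ 0) (heL : ver e ∈ L) {c : Fin 6 → ℂ} (hw : symComb e e₂ e₃ c ∈ L)
    {α β : ℂ} (ha : c 3 = α * α) (hb : c 4 = α * β) (hc : c 5 = β * β)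
    (h0 : ¬ (α = 0 ∧ β = 0)) (hD : c 1 * β - c 2 * α = 0) : HasFrame b L := by
  have hver : ∀ l m, symComb e l m ![1, 0, 0, 0, 0, 0] ∈ L := fun l m => by
    simpa [symComb] using heL
  obtain ⟨t, ht1, ht2⟩ : ∃ t, c 1 = t * α ∧ c 2 = t * β := by
    by_cases hα : α = 0
    · have hβ : β ≠ 0 := fun h => h0 ⟨hα, h⟩
      refine ⟨c 2 / β, ?_, by field_simp⟩
      rw [hα] at hD ⊢
      simp [hβ] at hD
      simp [hD]
    · refine ⟨c 1 / α, by field_simp, ?_⟩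
      field_simp
      linear_combination -hD
  have key : ∀ l, symComb e (α • e₂ + β • e₃ + t • e) l ![0, 0, 0, 1, 0, 0] ∈ L :=
      fun l => by
    have : symComb e (α • e₂ + β • e₃ + t • e) l ![0, 0, 0, 1, 0, 0] =
        symComb e e₂ e₃ c + (t ^ 2 - c 0) • ver e := by
      ext i
      fin_cases i <;> simp only [symComb, symProd, ver, ha, hb, hc, ht1, ht2, Pi.add_apply, Pi.smul_apply,
        smul_eq_mul, Matrix.cons_val, Fin.zero_eta, Fin.mk_one, Fin.reduceFinMk] <;> ring
    rw [this]
    exact L.add_mem hw (L.smul_mem _ heL)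
  have hi : LinearIndependent ℂ
      ![(![1, 0, 0, 0, 0, 0] : Fin 6 → ℂ), ![0, 0, 0, 1, 0, 0]] := by
    apply indep_pair
    intro s t h
    exact ⟨by simpa using congrFun h 0, by simpa using congrFun h 3⟩
  by_cases hα : α = 0
  · have hβ : β ≠ 0 := fun h => h0 ⟨hα, h⟩
    refine HasFrame.of_symComb hL hgood (e₁ := e) (e₂ := α • e₂ + β • e₃ + t • e)
      (e₃ := e₂) ?_ hi (hver _ _) (key _) (fun b => hasFrame_secant)
    intro h
    apply htri
    apply (mul_eq_zero.mp (?_ : β * _ = 0)).resolve_left hβ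
    rw [← neg_eq_zero, ← h]
    simp [tri, hα]; ring
  · refine HasFrame.of_symComb hL hgood (e₁ := e) (e₂ := α • e₂ + β • e₃ + t • e)
      (e₃ := e₃) ?_ hi (hver _ _) (key _) (fun b => hasFrame_secant)
    intro h
    apply htri
    apply (mul_eq_zero.mp (?_ : α * _ = 0)).resolve_left hα
    rw [← h]
    simp [tri]; ring

theorem hasFrame_osculating_of_symComb {b : Bil} {L : Submodule ℂ (Fin 6 → ℂ)}
    (hL : Module.finrank ℂ L = 2) (hgood : GoodLine b L) {e e₂ e₃ : Fin 3 → ℂ}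
    (htri : tri e e₂ e₃ ≠ 0) (heL : ver e ∈ L) {c : Fin 6 → ℂ} (hw : symComb e e₂ e₃ c ∈ L)
    {α β : ℂ} (ha : c 3 = α * α) (hb : c 4 = α * β) (hc : c 5 = β * β)
    (hD : c 1 * β - c 2 * α ≠ 0) : HasFrame b L := by
  have hver : ∀ l m, symComb e l m ![1, 0, 0, 0, 0, 0] ∈ L := fun l m => by
    simpa [symComb] using heL
  refine HasFrame.of_symComb hL hgood (e₁ := e) (e₂ := α • e₂ + β • e₃)
    (e₃ := c 1 • e₂ + c 2 • e₃) (c := ![1, 0, 0, 0, 0, 0]) (d := ![0, 0, 1, 1, 0, 0]) ?_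
    ?_ (hver _ _) ?_ (fun b => hasFrame_osculating)
  · intro h
    apply htri
    apply (mul_eq_zero.mp (?_ : (c 1 * β - c 2 * α) * _ = 0)).resolve_left hD
    rw [← neg_eq_zero, ← h]
    simp [tri]; ring
  · apply indep_pair
    intro s t h
    exact ⟨by simpa using congrFun h 0, by simpa using congrFun h 3⟩
  · have : symComb e (α • e₂ + β • e₃) (c 1 • e₂ + c 2 • e₃) ![0, 0, 1, 1, 0, 0] =
        symComb e e₂ e₃ c - c 0 • ver e := by
      ext i
      fin_cases i <;> simp only [symComb, symProd, ver, ha, hb, hc, Pi.add_apply, Pi.sub_apply, Pi.smul_apply,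
        smul_eq_mul, Matrix.cons_val, Fin.zero_eta, Fin.mk_one, Fin.reduceFinMk] <;> ring
    rw [this]
    exact L.sub_mem hw (L.smul_mem _ heL)

theorem hasFrame_secantPoint_of_symComb {b : Bil} {L : Submodule ℂ (Fin 6 → ℂ)}
    (hL : Module.finrank ℂ L = 2) (hgood : GoodLine b L) {e e₂ e₃ : Fin 3 → ℂ}
    (htri : tri e e₂ e₃ ≠ 0) (heL : ver e ∈ L) {c : Fin 6 → ℂ} (hw : symComb e e₂ e₃ c ∈ L)
    (h1 : c 4 ^ 2 ≠ c 3 * c 5) : HasFrame b L := by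
  have hver : ∀ l m, symComb e l m ![1, 0, 0, 0, 0, 0] ∈ L := fun l m => by
    simpa [symComb] using heL
  obtain ⟨α₁, β₁, α₂, β₂, h3, h4, h5⟩ := exists_binary_factor (c 3) (c 4) (c 5)
  have hD : α₁ * β₂ - β₁ * α₂ ≠ 0 := fun h => h1 (by
    rw [h3, h4, h5]; linear_combination (α₁ * β₂ - β₁ * α₂) * h)
  obtain ⟨p, q, hp, hq⟩ : ∃ p q, c 1 = q * α₁ + p * α₂ ∧ c 2 = q * β₁ + p * β₂ := by
    refine ⟨(α₁ * c 2 - β₁ * c 1) / (α₁ * β₂ - β₁ * α₂),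
      (c 1 * β₂ - c 2 * α₂) / (α₁ * β₂ - β₁ * α₂), ?_, ?_⟩ <;>
      rw [div_mul_eq_mul_div, div_mul_eq_mul_div, ← add_div, eq_div_iff hD] <;> ring
  refine HasFrame.of_symComb hL hgood (e₁ := e) (e₂ := α₁ • e₂ + β₁ • e₃ + p • e)
    (e₃ := α₂ • e₂ + β₂ • e₃ + q • e) (c := ![1, 0, 0, 0, 0, 0]) (d := ![0, 0, 0, 0, 1, 0]) ?_
    ?_ (hver _ _) ?_ (fun b => hasFrame_secantPoint)
  · intro h
    apply htri
    apply (mul_eq_zero.mp (?_ : (α₁ * β₂ - β₁ * α₂) * _ = 0)).resolve_left hD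
    rw [← h]
    simp [tri]; ring
  · apply indep_pair
    intro s t h
    exact ⟨by simpa using congrFun h 0, by simpa using congrFun h 4⟩
  · have : symComb e (α₁ • e₂ + β₁ • e₃ + p • e) (α₂ • e₂ + β₂ • e₃ + q • e)
        ![0, 0, 0, 0, 1, 0] = symComb e e₂ e₃ c + (2 * p * q - c 0) • ver e := by
      ext i
      fin_cases i <;> simp only [symComb, symProd, ver, h3, h4, h5, hp, hq, Pi.add_apply, Pi.smul_apply,
        smul_eq_mul, Matrix.cons_val, Fin.zero_eta, Fin.mk_one, Fin.reduceFinMk] <;> ring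
    rw [this]
    exact L.add_mem hw (L.smul_mem _ heL)

/-- Modulo e eᵀ the second generator is a linear part (c₁, c₂) times e plus the binary form (c₃, c₄,
c₅) in e₂, e₃. Rank two gives `secantPoint` and rank zero `tangent`. In rank one, where the binary
form is a square (α, β)², the line is a `secant` if (c₁, c₂) is proportional to (α, β), and
`osculating` otherwise. -/
theorem hasFrame_of_ver_mem {b : Bil} {L : Submodule ℂ (Fin 6 → ℂ)}
    (hL : Module.finrank ℂ L = 2) (hgood : GoodLine b L) {e : Fin 3 → ℂ} (he : e ≠ 0)
    (heL : ver e ∈ L) : HasFrame b L := by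
  obtain ⟨e₂, e₃, htri⟩ := exists_basis_extending he
  obtain ⟨w, hw, hwe⟩ := exists_not_mem_span_singleton hL (ver e)
  obtain ⟨c, rfl⟩ := symComb_surjective htri w
  by_cases h1 : c 4 ^ 2 = c 3 * c 5
  · obtain ⟨α, β, ha, hb, hc⟩ := exists_binary_square h1
    by_cases hD : c 1 * β - c 2 * α = 0
    · by_cases h0 : α = 0 ∧ β = 0
      · exact hasFrame_tangent_of_symComb hL hgood htri heL hw hwe (by simp [ha, h0])
          (by simp [hb, h0]) (by simp [hc, h0])
      · exact hasFrame_secant_of_symComb hL hgood htri heL hw ha hb hc h0 hD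
    · exact hasFrame_osculating_of_symComb hL hgood htri heL hw ha hb hc hD
  · exact hasFrame_secantPoint_of_symComb hL hgood htri heL hw h1

theorem exists_det_eq_zero {L : Submodule ℂ (Fin 6 → ℂ)} (hL : Module.finrank ℂ L = 2) :
    ∃ a ∈ L, a ≠ 0 ∧ (symMat a).det = 0 := by
  obtain ⟨v, hv, hv0⟩ := exists_not_mem_span_singleton hL 0
  have hv0 : v ≠ 0 := by simpa using hv0
  obtain ⟨u, hu, huv⟩ := exists_not_mem_span_singleton hL v
  by_cases hd : (symMat v).det = 0
  · exact ⟨v, hv, hv0, hd⟩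
  -- For an invertible v, the matrix μ v - u is singular exactly when μ is an eigenvalue of v⁻¹u.
  · obtain ⟨μ, hμ⟩ := IsAlgClosed.exists_root ((symMat v)⁻¹ * symMat u).charpoly (by
      rw [Matrix.charpoly_degree_eq_dim]; simp)
    refine ⟨μ • v - u, L.sub_mem (L.smul_mem _ hv) hu,
      fun h => huv μ (sub_eq_zero.mp h).symm, ?_⟩
    rw [Polynomial.IsRoot, Matrix.eval_charpoly] at hμ
    have : symMat (μ • v - u) =
        symMat v * (Matrix.scalar (Fin 3) μ - (symMat v)⁻¹ * symMat u) := by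
      rw [mul_sub, ← Matrix.mul_assoc,
        Matrix.mul_nonsing_inv _ (isUnit_iff_ne_zero.mpr hd), one_mul, sub_eq_add_neg (μ • v) u,
        symMat_add, symMat_smul, ← neg_one_smul ℂ u, symMat_smul]
      simp [Matrix.scalar_apply, Matrix.smul_eq_mul_diagonal, sub_eq_add_neg]
    rw [this, Matrix.det_mul, hμ, mul_zero]

/-- Completing the square in e₁ removes the coefficients c₁ and c₂, and the e₂e₃ term is absorbed by
the other generator. If both remaining coefficients β, γ were zero, the line would meet V. -/
theorem hasFrame_diag_of_symComb {b : Bil} {L : Submodule ℂ (Fin 6 → ℂ)}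
    (hL : Module.finrank ℂ L = 2) (hgood : GoodLine b L) {e₁ e₂ e₃ : Fin 3 → ℂ}
    (htri : tri e₁ e₂ e₃ ≠ 0) (hN : ∀ e, ver e ∈ L → e = 0) (ha : symProd e₂ e₃ ∈ L)
    {c : Fin 6 → ℂ} (hw : symComb e₁ e₂ e₃ c ∈ L) (hc0 : c 0 ≠ 0) : HasFrame b L := by
  set p := c 1 / c 0 with hp
  set q := c 2 / c 0 with hq
  have h1 : c 1 = p * c 0 := by rw [hp]; field_simp
  have h2 : c 2 = q * c 0 := by rw [hq]; field_simp
  obtain ⟨β, hβ⟩ : ∃ β, c 3 = (β + p ^ 2) * c 0 := ⟨c 3 / c 0 - p ^ 2, by field_simp; ring⟩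
  obtain ⟨γ, hγ⟩ : ∃ γ, c 5 = (γ + q ^ 2) * c 0 := ⟨c 5 / c 0 - q ^ 2, by field_simp; ring⟩
  have ht : tri (e₁ + p • e₂ + q • e₃) e₂ e₃ ≠ 0 := by
    intro h
    apply htri
    rw [← h]
    simp [tri]; ring
  have key : symComb (e₁ + p • e₂ + q • e₃) e₂ e₃ ![1, 0, 0, β, 0, γ] ∈ L := by
    have : symComb (e₁ + p • e₂ + q • e₃) e₂ e₃ ![1, 0, 0, β, 0, γ] =
        (c 0)⁻¹ • symComb e₁ e₂ e₃ c + (p * q - c 4 / c 0) • symProd e₂ e₃ := by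
      ext i
      fin_cases i <;> simp only [symComb, symProd, ver, h1, h2, hβ, hγ, Pi.add_apply, Pi.smul_apply,
        smul_eq_mul, Matrix.cons_val, Fin.zero_eta, Fin.mk_one, Fin.reduceFinMk] <;> field_simp <;> ring
    rw [this]
    exact L.add_mem (L.smul_mem _ hw) (L.smul_mem _ ha)
  refine HasFrame.of_symComb hL hgood ht (c := ![0, 0, 0, 0, 1, 0]) (d := ![1, 0, 0, β, 0, γ]) ?_
    (by simpa [symComb] using ha) key (fun b => hasFrame_diag ?_)
  · apply indep_pair
    intro s t h
    have h0 : t = 0 := by simpa using congrFun h 0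
    exact ⟨by simpa [h0] using congrFun h 4, h0⟩
  · by_contra! h
    rw [h.1, h.2] at key
    have := hN (e₁ + p • e₂ + q • e₃) (by simpa [symComb] using key)
    rw [this] at ht
    simp [tri] at ht

theorem hasFrame_vertex_of_symComb {b : Bil} {L : Submodule ℂ (Fin 6 → ℂ)}
    (hL : Module.finrank ℂ L = 2) (hgood : GoodLine b L) {e₁ e₂ e₃ : Fin 3 → ℂ}
    (htri : tri e₁ e₂ e₃ ≠ 0) (ha : symProd e₂ e₃ ∈ L)
    {c : Fin 6 → ℂ} (hw : symComb e₁ e₂ e₃ c ∈ L) (hc0 : c 0 = 0) (hc1 : c 1 ≠ 0)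
    (hc2 : c 2 = 0) : HasFrame b L := by
  refine HasFrame.of_symComb hL hgood (e₁ := c 1 • e₁ + (c 3 / 2) • e₂) (e₂ := e₂) (e₃ := e₃) ?_
    (c := ![0, 0, 0, 0, 1, 0]) (d := ![0, 1, 0, 0, 0, c 5]) ?_
    (by simpa [symComb] using ha) ?_ (fun b => hasFrame_vertex)
  · intro h
    apply htri
    apply (mul_eq_zero.mp (?_ : c 1 * _ = 0)).resolve_left hc1
    rw [← h]
    simp [tri]; ring
  · apply indep_pair
    intro s t h
    exact ⟨by simpa using congrFun h 4, by simpa using congrFun h 1⟩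
  · have : symComb (c 1 • e₁ + (c 3 / 2) • e₂) e₂ e₃ ![0, 1, 0, 0, 0, c 5] =
        symComb e₁ e₂ e₃ c - c 4 • symProd e₂ e₃ := by
      ext i
      fin_cases i <;> simp only [symComb, symProd, ver, hc0, hc2, Pi.add_apply, Pi.sub_apply, Pi.smul_apply,
        smul_eq_mul, Matrix.cons_val, Fin.zero_eta, Fin.mk_one, Fin.reduceFinMk] <;> ring
    rw [this]
    exact L.sub_mem hw (L.smul_mem _ ha)

theorem hasFrame_sum_of_symComb {b : Bil} {L : Submodule ℂ (Fin 6 → ℂ)}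
    (hL : Module.finrank ℂ L = 2) (hgood : GoodLine b L) {e₁ e₂ e₃ : Fin 3 → ℂ}
    (htri : tri e₁ e₂ e₃ ≠ 0) (ha : symProd e₂ e₃ ∈ L)
    {c : Fin 6 → ℂ} (hw : symComb e₁ e₂ e₃ c ∈ L) (hc0 : c 0 = 0) (hc1 : c 1 ≠ 0)
    (hc2 : c 2 ≠ 0) : HasFrame b L := by
  obtain ⟨α, hα⟩ : ∃ α, c 3 = α * (2 * c 1) := ⟨c 3 / (2 * c 1), by field_simp⟩
  obtain ⟨β, hβ⟩ : ∃ β, c 5 = β * (2 * c 2) := ⟨c 5 / (2 * c 2), by field_simp⟩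
  refine HasFrame.of_symComb hL hgood (e₁ := e₁ + α • e₂ + β • e₃) (e₂ := c 1 • e₂)
    (e₃ := c 2 • e₃) ?_ (c := ![0, 0, 0, 0, 1, 0]) (d := ![0, 1, 1, 0, 0, 0]) ?_
    ?_ ?_ (fun b => hasFrame_sum)
  · intro h
    apply htri
    apply (mul_eq_zero.mp (?_ : (c 1 * c 2) * _ = 0)).resolve_left (mul_ne_zero hc1 hc2)
    rw [← h]
    simp [tri]; ring
  · apply indep_pair
    intro s t h
    exact ⟨by simpa using congrFun h 4, by simpa using congrFun h 1⟩
  · have : symComb (e₁ + α • e₂ + β • e₃) (c 1 • e₂) (c 2 • e₃) ![0, 0, 0, 0, 1, 0] =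
        (c 1 * c 2) • symProd e₂ e₃ := by
      ext i
      fin_cases i <;> simp only [symComb, symProd, Pi.add_apply, Pi.smul_apply,
        smul_eq_mul, Matrix.cons_val, Fin.zero_eta, Fin.mk_one, Fin.reduceFinMk] <;> ring
    rw [this]
    exact L.smul_mem _ ha
  · have : symComb (e₁ + α • e₂ + β • e₃) (c 1 • e₂) (c 2 • e₃) ![0, 1, 1, 0, 0, 0] =
        symComb e₁ e₂ e₃ c + (β * c 1 + α * c 2 - c 4) • symProd e₂ e₃ := by
      ext i
      fin_cases i <;> simp only [symComb, symProd, ver, hc0, hα, hβ, Pi.add_apply, Pi.smul_apply,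
        smul_eq_mul, Matrix.cons_val, Fin.zero_eta, Fin.mk_one, Fin.reduceFinMk] <;> ring
    rw [this]
    exact L.add_mem hw (L.smul_mem _ ha)

theorem symComb_swap (e₁ e₂ e₃ : Fin 3 → ℂ) (c : Fin 6 → ℂ) :
    symComb e₁ e₃ e₂ ![c 0, c 2, c 1, c 5, c 4, c 3] = symComb e₁ e₂ e₃ c := by
  ext i
  fin_cases i <;> simp only [symComb, symProd, ver, Pi.add_apply, Pi.smul_apply,
        smul_eq_mul, Matrix.cons_val, Fin.zero_eta, Fin.mk_one, Fin.reduceFinMk] <;> ring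

theorem symProd_comm {R : Type*} [CommRing R] (e e' : Fin 3 → R) : symProd e e' = symProd e' e := by
  ext i
  fin_cases i <;> simp only [symProd,
        Matrix.cons_val, Fin.zero_eta, Fin.mk_one, Fin.reduceFinMk] <;> ring

/-- If L misses V, a singular member is a product e₂e₃ of independent factors. The cases are read
off from the other generator: its e₁e₁ᵀ coefficient c₀ is nonzero (`diag`), or it vanishes and one
or two of the mixed coefficients c₁, c₂ survive (`vertex`, `sum`). -/
theorem hasFrame_of_goodLine {b : Bil} {L : Submodule ℂ (Fin 6 → ℂ)}
    (hL : Module.finrank ℂ L = 2) (hgood : GoodLine b L) : HasFrame b L := by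
  by_cases hN : ∃ e : Fin 3 → ℂ, e ≠ 0 ∧ ver e ∈ L
  · obtain ⟨e, he, heL⟩ := hN
    exact hasFrame_of_ver_mem hL hgood he heL
  have hN' : ∀ e, ver e ∈ L → e = 0 := fun e he => by
    by_contra h
    exact hN ⟨e, h, he⟩
  obtain ⟨a, ha, ha0, hdet⟩ := exists_det_eq_zero hL
  obtain ⟨e₂, e₃, rfl⟩ := exists_symProd_of_det_eq_zero hdet
  have hcross : e₂ ⨯₃ e₃ ≠ 0 := by
    intro h
    have h2 : e₂ ≠ 0 := by
      rintro rfl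
      apply ha0
      ext i; fin_cases i <;> simp [symProd]
    obtain ⟨t, rfl⟩ := exists_smul_of_cross_eq_zero h h2
    have e : symProd e₂ (t • e₂) = (2 * t) • ver e₂ := by
      ext i; fin_cases i <;> simp only [symProd, ver, Pi.smul_apply,
        smul_eq_mul, Matrix.cons_val, Fin.zero_eta, Fin.mk_one, Fin.reduceFinMk] <;> ring
    rw [e] at ha ha0
    have ht : 2 * t ≠ 0 := fun h => ha0 (by rw [h, zero_smul])
    exact h2 (hN' e₂ ((Submodule.smul_mem_iff _ ht).mp ha))
  obtain ⟨e₁, htri⟩ := exists_tri_ne_zero hcross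
  obtain ⟨w, hw, hwe⟩ := exists_not_mem_span_singleton hL (symProd e₂ e₃)
  obtain ⟨c, rfl⟩ := symComb_surjective htri w
  by_cases hc0 : c 0 = 0
  · by_cases hc1 : c 1 = 0
    · by_cases hc2 : c 2 = 0
      -- Both generators now involve only e₂ and e₃. A multiple of e₂e₃ completes the second one to
      -- a square, which would be a point of V on the line.
      · exfalso
        obtain ⟨α, hα⟩ := IsAlgClosed.exists_pow_nat_eq (c 3) (n := 2) (by norm_num)
        obtain ⟨β, hβ⟩ := IsAlgClosed.exists_pow_nat_eq (c 5) (n := 2) (by norm_num)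
        have key : ver (α • e₂ + β • e₃) =
            symComb e₁ e₂ e₃ c + (α * β - c 4) • symProd e₂ e₃ := by
          ext i
          fin_cases i <;> simp only [symComb, symProd, ver, hc0, hc1, hc2, ← hα, ← hβ, Pi.add_apply, Pi.smul_apply,
        smul_eq_mul, Matrix.cons_val, Fin.zero_eta, Fin.mk_one, Fin.reduceFinMk] <;> ring
        have h0 := hN' (α • e₂ + β • e₃) (by
          rw [key]; exact L.add_mem hw (L.smul_mem _ ha))
        apply hwe (c 4 - α * β)
        have : ver (α • e₂ + β • e₃) = 0 := by rw [h0]; ext i; fin_cases i <;> simp [ver]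
        rw [this] at key
        rw [eq_neg_of_add_eq_zero_left key.symm, ← neg_smul, neg_sub]
      · have := symComb_swap e₁ e₂ e₃ c
        rw [← this] at hw
        rw [symProd_comm] at ha
        refine hasFrame_vertex_of_symComb hL hgood ?_ ha hw (by simpa using hc0)
          (by simpa using hc2) (by simpa using hc1)
        intro h
        apply htri
        rw [← neg_eq_zero, ← h]
        simp [tri]; ring
    · by_cases hc2 : c 2 = 0
      · exact hasFrame_vertex_of_symComb hL hgood htri ha hw hc0 hc1 hc2
      · exact hasFrame_sum_of_symComb hL hgood htri ha hw hc0 hc1 hc2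
  · exact hasFrame_diag_of_symComb hL hgood htri hN' ha hw hc0

end VeroneseFano
end

/-! ### Cubics through the Veronese surface are of the form b(a, f(a)). -/

open MvPolynomial
noncomputable section
namespace VeroneseFano

open Matrix

/-- The extension of a bilinear form to the coordinates in a `ℂ`-algebra. -/
def Bil.ext (b : Bil) {R : Type*} [CommRing R] [Algebra ℂ R] (x y : Fin 6 → R) : R :=
  ∑ i, ∑ j, algebraMap ℂ R (b (Pi.single i 1) (Pi.single j 1)) * (x i * y j)

theorem pi_sum_single (a : Fin 6 → ℂ) : a = ∑ i, a i • Pi.single i (1 : ℂ) := by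
  ext j
  simp [Finset.sum_apply, Pi.single_apply]

theorem Bil.ext_apply (b : Bil) (x y : Fin 6 → ℂ) : b.ext x y = b x y := by
  conv_rhs => rw [pi_sum_single x, pi_sum_single y]
  simp only [Bil.ext, map_sum, map_smul, LinearMap.sum_apply, LinearMap.smul_apply, smul_eq_mul,
    Algebra.algebraMap_self, RingHom.id_apply, Finset.mul_sum]
  rw [Finset.sum_comm]
  refine Finset.sum_congr rfl fun i _ => Finset.sum_congr rfl fun j _ => ?_
  ring

theorem map_crem {R S : Type*} [CommRing R] [CommRing S] (f : R →+* S) (x : Fin 6 → R) :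
    (fun i => f (crem x i)) = crem fun i => f (x i) := by
  ext i; fin_cases i <;> simp [crem]

theorem map_pol {R S : Type*} [CommRing R] [CommRing S] (f : R →+* S) (x y : Fin 6 → R) :
    (fun i => f (pol x y i)) = pol (fun i => f (x i)) fun i => f (y i) := by
  ext i; fin_cases i <;> simp [pol, map_ofNat]

theorem map_ver {R S : Type*} [CommRing R] [CommRing S] (f : R →+* S) (x : Fin 3 → R) :
    (fun i => f (ver x i)) = ver fun i => f (x i) := by
  ext i; fin_cases i <;> simp [ver]

section ext

variable {R S : Type*} [CommRing R] [Algebra ℂ R] [CommRing S] [Algebra ℂ S]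

theorem Bil.map_ext (b : Bil) (f : R →ₐ[ℂ] S) (x y : Fin 6 → R) :
    f (b.ext x y) = b.ext (fun i => f (x i)) (fun i => f (y i)) := by
  simp [Bil.ext]

theorem Bil.ext_add_left (b : Bil) (x x' y : Fin 6 → R) :
    b.ext (x + x') y = b.ext x y + b.ext x' y := by
  simp only [Bil.ext, ← Finset.sum_add_distrib, Pi.add_apply]
  refine Finset.sum_congr rfl fun i _ => Finset.sum_congr rfl fun j _ => ?_
  ring

theorem Bil.ext_add_right (b : Bil) (x y y' : Fin 6 → R) :
    b.ext x (y + y') = b.ext x y + b.ext x y' := by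
  simp only [Bil.ext, ← Finset.sum_add_distrib, Pi.add_apply]
  refine Finset.sum_congr rfl fun i _ => Finset.sum_congr rfl fun j _ => ?_
  ring

theorem Bil.ext_smul_left (b : Bil) (t : R) (x y : Fin 6 → R) :
    b.ext (t • x) y = t * b.ext x y := by
  simp only [Bil.ext, Finset.mul_sum, Pi.smul_apply, smul_eq_mul]
  refine Finset.sum_congr rfl fun i _ => Finset.sum_congr rfl fun j _ => ?_
  ring

theorem Bil.ext_smul_right (b : Bil) (t : R) (x y : Fin 6 → R) :
    b.ext x (t • y) = t * b.ext x y := by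
  simp only [Bil.ext, Finset.mul_sum, Pi.smul_apply, smul_eq_mul]
  refine Finset.sum_congr rfl fun i _ => Finset.sum_congr rfl fun j _ => ?_
  ring

theorem Bil.add_ext (b c : Bil) (x y : Fin 6 → R) : (b + c).ext x y = b.ext x y + c.ext x y := by
  simp only [Bil.ext, ← Finset.sum_add_distrib, LinearMap.add_apply, map_add]
  refine Finset.sum_congr rfl fun i _ => Finset.sum_congr rfl fun j _ => ?_
  ring

theorem Bil.smul_ext (b : Bil) (t : ℂ) (x y : Fin 6 → R) : (t • b).ext x y = t • b.ext x y := by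
  simp only [Bil.ext, LinearMap.smul_apply, smul_eq_mul, map_mul, Algebra.smul_def,
    Finset.mul_sum]
  refine Finset.sum_congr rfl fun i _ => Finset.sum_congr rfl fun j _ => ?_
  ring

end ext

/-- The cubic form `b(a, f(a))`. -/
def cubicOf (b : Bil) : Poly := b.ext X (crem X)

theorem aeval_cubicOf {R : Type*} [CommRing R] [Algebra ℂ R] (b : Bil) (x : Fin 6 → R) :
    aeval x (cubicOf b) = b.ext x (crem x) := by
  rw [cubicOf, Bil.map_ext]
  have := map_crem (aeval (R := ℂ) x : Poly →ₐ[ℂ] R).toRingHom X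
  simp only [AlgHom.toRingHom_eq_coe, RingHom.coe_coe, aeval_X] at this
  simp only [aeval_X, this]

theorem eval_cubicOf (b : Bil) (a : Fin 6 → ℂ) : eval a (cubicOf b) = b a (crem a) := by
  rw [← Bil.ext_apply, ← aeval_cubicOf, aeval_eq_eval]

/-- `cubicOf` as a linear map. -/
def cubicOfL : Bil →ₗ[ℂ] Poly where
  toFun := cubicOf
  map_add' b c := Bil.add_ext b c _ _
  map_smul' t b := Bil.smul_ext b t _ _

theorem crem_X_isHomogeneous (j : Fin 6) : (crem (X : Fin 6 → Poly) j).IsHomogeneous 2 := by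
  have h : ∀ i j : Fin 6, (X i * X j : Poly).IsHomogeneous 2 := fun i j =>
    (isHomogeneous_X ℂ i).mul (isHomogeneous_X ℂ j)
  fin_cases j <;> exact (h _ _).sub (h _ _)

theorem cubicOf_isHomogeneous (b : Bil) : (cubicOf b).IsHomogeneous 3 := by
  refine IsHomogeneous.sum _ _ _ fun i _ => IsHomogeneous.sum _ _ _ fun j _ => ?_
  have h := (isHomogeneous_C (Fin 6) (b (Pi.single i 1) (Pi.single j 1))).mul
    ((isHomogeneous_X ℂ i).mul (crem_X_isHomogeneous j))
  exact h

theorem X_mul_crem_mem (i j : Fin 6) :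
    (X i * crem (X : Fin 6 → Poly) j) ∈ LinearMap.range cubicOfL := by
  refine ⟨LinearMap.mk₂ ℂ (fun x y => x i * y j) ?_ ?_ ?_ ?_, ?_⟩
  · intros; simp [add_mul]
  · intros; simp [mul_assoc]
  · intros; simp [mul_add]
  · intros; simp; ring
  · change Bil.ext _ X (crem X) = _
    rw [Bil.ext, Finset.sum_eq_single i, Finset.sum_eq_single j]
    · simp
    · intro k _ hk; simp [hk.symm]
    · simp
    · intro k _ hk; simp [Pi.single_apply, hk.symm]
    · simp

/-- The position of the entry `(p, q)` of a symmetric matrix in the coordinate vector. -/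
def entry (p q : Fin 3) : Fin 6 := (!![0, 1, 2; 1, 3, 4; 2, 4, 5] : Matrix _ _ (Fin 6)) p q

theorem entry_comm (p q : Fin 3) : entry p q = entry q p := by
  revert p q; decide

theorem entry_surjective (i : Fin 6) : ∃ p q, entry p q = i := by
  revert i; decide

theorem minor_mem (p q r s : Fin 3) :
    (X (entry p q) * X (entry r s) - X (entry p r) * X (entry q s) : Poly) ∈
      Submodule.span ℂ (Set.range (crem (X : Fin 6 → Poly))) := by
  have h : ∀ j, crem (X : Fin 6 → Poly) j ∈ Submodule.span ℂ (Set.range (crem (X : Fin 6 → Poly))) :=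
    fun j => Submodule.subset_span ⟨j, rfl⟩
  have key : ∃ (j : Fin 6) (ε : ℂ), (X (entry p q) * X (entry r s) -
      X (entry p r) * X (entry q s) : Poly) = ε • crem X j := by
    fin_cases p <;> fin_cases q <;> fin_cases r <;> fin_cases s <;>
      simp only [entry, Matrix.of_apply, Matrix.cons_val, Fin.zero_eta, Fin.mk_one, Fin.reduceFinMk,
        crem] <;>
      first
        | exact ⟨0, 0, by rw [zero_smul]; ring1⟩
        | (refine ⟨0, 1, ?_⟩; simp only [one_smul, Matrix.cons_val]; first | done | ring1)
        | (refine ⟨1, 1, ?_⟩; simp only [one_smul, Matrix.cons_val]; first | done | ring1)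
        | (refine ⟨2, 1, ?_⟩; simp only [one_smul, Matrix.cons_val]; first | done | ring1)
        | (refine ⟨3, 1, ?_⟩; simp only [one_smul, Matrix.cons_val]; first | done | ring1)
        | (refine ⟨4, 1, ?_⟩; simp only [one_smul, Matrix.cons_val]; first | done | ring1)
        | (refine ⟨5, 1, ?_⟩; simp only [one_smul, Matrix.cons_val]; first | done | ring1)
        | (refine ⟨0, -1, ?_⟩; simp only [neg_one_smul, Matrix.cons_val]; first | done | ring1)
        | (refine ⟨1, -1, ?_⟩; simp only [neg_one_smul, Matrix.cons_val]; first | done | ring1)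
        | (refine ⟨2, -1, ?_⟩; simp only [neg_one_smul, Matrix.cons_val]; first | done | ring1)
        | (refine ⟨3, -1, ?_⟩; simp only [neg_one_smul, Matrix.cons_val]; first | done | ring1)
        | (refine ⟨4, -1, ?_⟩; simp only [neg_one_smul, Matrix.cons_val]; first | done | ring1)
        | (refine ⟨5, -1, ?_⟩; simp only [neg_one_smul, Matrix.cons_val]; first | done | ring1)
  obtain ⟨j, ε, e⟩ := key
  rw [e]
  exact Submodule.smul_mem _ _ (h j)

theorem X_mul_mem_range {g : Poly}
    (hg : g ∈ Submodule.span ℂ (Set.range (crem (X : Fin 6 → Poly)))) (i : Fin 6) :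
    X i * g ∈ LinearMap.range cubicOfL := by
  induction hg using Submodule.span_induction with
  | mem x hx => obtain ⟨j, rfl⟩ := hx; exact X_mul_crem_mem i j
  | zero => rw [mul_zero]; exact Submodule.zero_mem _
  | add x y _ _ hx hy => rw [mul_add]; exact Submodule.add_mem _ hx hy
  | smul t x _ hx => rw [mul_smul_comm]; exact Submodule.smul_mem _ _ hx

/-- The monomial of degree three attached to a word of six indices. -/
def wordMonomial (p : Fin 6 → Fin 3) : Poly :=
  X (entry (p 0) (p 1)) * X (entry (p 2) (p 3)) * X (entry (p 4) (p 5))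

/-- An adjacent swap within one of the three pairs changes nothing by symmetry of the matrix. Across
two pairs the difference is a coordinate times a 2 × 2 minor. -/
theorem wordMonomial_swap (i : Fin 5) (p : Fin 6 → Fin 3) :
    wordMonomial (p ∘ Equiv.swap i.castSucc i.succ) - wordMonomial p ∈
      LinearMap.range cubicOfL := by
  have z : ∀ {A B : Poly}, A = B → A - B ∈ LinearMap.range cubicOfL := fun h => by
    rw [sub_eq_zero.mpr h]; exact Submodule.zero_mem _
  fin_cases i
  · apply z
    simp [wordMonomial, Equiv.swap_apply_def, entry_comm (p 1) (p 0)]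
  · have := X_mul_mem_range (minor_mem (p 0) (p 2) (p 1) (p 3)) (entry (p 4) (p 5))
    convert this using 1
    simp [wordMonomial, Equiv.swap_apply_def]
    ring
  · apply z
    simp [wordMonomial, Equiv.swap_apply_def, entry_comm (p 3) (p 2)]
  · have := X_mul_mem_range (minor_mem (p 2) (p 4) (p 3) (p 5)) (entry (p 0) (p 1))
    convert this using 1
    simp [wordMonomial, Equiv.swap_apply_def]
    ring
  · apply z
    simp [wordMonomial, Equiv.swap_apply_def, entry_comm (p 5) (p 4)]

theorem wordMonomial_perm (σ : Equiv.Perm (Fin 6)) (p : Fin 6 → Fin 3) :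
    wordMonomial (p ∘ σ) - wordMonomial p ∈ LinearMap.range cubicOfL := by
  have hσ : σ ∈ Submonoid.closure
      (Set.range fun i : Fin 5 => Equiv.swap i.castSucc i.succ) := by
    rw [Equiv.Perm.mclosure_swap_castSucc_succ]; trivial
  induction hσ using Submonoid.closure_induction generalizing p with
  | mem x hx => obtain ⟨i, rfl⟩ := hx; exact wordMonomial_swap i p
  | one => simp
  | mul x y _ _ hx hy =>
    have := Submodule.add_mem _ (hy (p ∘ x)) (hx p)
    rw [sub_add_sub_cancel] at this
    exact this

/-- The exponents of the monomial `∏ t (p i)`. -/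
def wordWeight (p : Fin 6 → Fin 3) : Fin 3 →₀ ℕ := ∑ i, Finsupp.single (p i) 1

/-- Words of equal weight use each letter equally often, so they differ by a permutation of
positions, a product of adjacent swaps. -/
theorem wordMonomial_sub_mem {p p' : Fin 6 → Fin 3} (h : wordWeight p = wordWeight p') :
    wordMonomial p - wordMonomial p' ∈ LinearMap.range cubicOfL := by
  have hc : ∀ (p : Fin 6 → Fin 3) k, wordWeight p k = Fintype.card {i // p i = k} := fun p k => by
    rw [Fintype.card_subtype, Finset.card_filter, wordWeight, Finsupp.finsetSum_apply]
    exact Finset.sum_congr rfl fun i _ => by rw [Finsupp.single_apply]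
  have e : ∀ k, Nonempty ({i // p i = k} ≃ {i // p' i = k}) := fun k =>
    Fintype.card_eq.mp (by rw [← hc, ← hc, h])
  let σ := Equiv.ofFiberEquiv fun k => (e k).some
  have : p = p' ∘ σ := funext fun i => (Equiv.ofFiberEquiv_map (fun k => (e k).some) i).symm
  rw [this]
  exact wordMonomial_perm σ p'

theorem aeval_ver_wordMonomial (p : Fin 6 → Fin 3) :
    aeval (ver (X : Fin 3 → MvPolynomial (Fin 3) ℂ)) (wordMonomial p) =
      monomial (wordWeight p) 1 := by
  have h : ∀ p q, ver (X : Fin 3 → MvPolynomial (Fin 3) ℂ) (entry p q) =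
      monomial (Finsupp.single p 1 + Finsupp.single q 1) 1 := fun p q => by
    have : ver (X : Fin 3 → MvPolynomial (Fin 3) ℂ) (entry p q) = X p * X q := by
      fin_cases p <;> fin_cases q <;> simp [ver, entry] <;> ring
    rw [this, X, X, monomial_mul, one_mul]
  simp only [wordMonomial, map_mul, aeval_X, h, monomial_mul, one_mul, wordWeight,
    Fin.sum_univ_six, add_assoc]

theorem eval_aeval_ver (t : Fin 3 → ℂ) (P : Poly) :
    eval t (aeval (ver (X : Fin 3 → MvPolynomial (Fin 3) ℂ)) P) = eval (ver t) P := by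
  have h : ver t = fun i => eval t (ver (X : Fin 3 → MvPolynomial (Fin 3) ℂ) i) := by
    rw [map_ver]; simp
  rw [h, ← aeval_eq_eval, ← aeval_eq_eval, comp_aeval_apply]

open scoped Pointwise in
theorem mem_span_wordMonomial {F : Poly} (hF : F.IsHomogeneous 3) :
    F ∈ Submodule.span ℂ (Set.range wordMonomial) := by
  have h : F ∈ homogeneousSubmodule (Fin 6) ℂ 3 := hF
  rw [← homogeneousSubmodule_one_pow, homogeneousSubmodule_one_eq_span_X, Submodule.span_pow] at h
  refine Submodule.span_mono ?_ h
  rw [pow_three']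
  rintro _ ⟨_, ⟨_, ⟨i, rfl⟩, _, ⟨j, rfl⟩, rfl⟩, _, ⟨k, rfl⟩, rfl⟩
  obtain ⟨p₀, p₁, rfl⟩ := entry_surjective i
  obtain ⟨p₂, p₃, rfl⟩ := entry_surjective j
  obtain ⟨p₄, p₅, rfl⟩ := entry_surjective k
  exact ⟨![p₀, p₁, p₂, p₃, p₄, p₅], rfl⟩

/-- Fix a representative monomial for every weight. Modulo the range of `cubicOfL` a cubic becomes a
combination of representatives whose coefficients are those of its restriction to V, and these
vanish. -/
theorem exists_cubicOf {F : Poly} (hF : F ∈ cubicsThroughVeronese) : ∃ b, F = cubicOf b := by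
  classical
  obtain ⟨c, rfl⟩ := (Submodule.mem_span_range_iff_exists_fun ℂ).mp (mem_span_wordMonomial hF.1)
  let N : (Fin 3 →₀ ℕ) → Poly := fun w =>
    if h : ∃ p, wordWeight p = w then wordMonomial h.choose else 0
  have hN : ∀ p, wordMonomial p - N (wordWeight p) ∈ LinearMap.range cubicOfL := fun p => by
    have h : ∃ p', wordWeight p' = wordWeight p := ⟨p, rfl⟩
    simp only [N, dif_pos h]
    exact wordMonomial_sub_mem h.choose_spec.symm
  have h0 : ∑ p, c p • monomial (R := ℂ) (wordWeight p) 1 = 0 := by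
    apply MvPolynomial.funext
    intro t
    have := hF.2 (ver t) ⟨t, rfl⟩
    rw [map_zero, ← this]
    simp only [← aeval_ver_wordMonomial, ← map_smul, ← map_sum]
    exact eval_aeval_ver _ _
  have h1 : ∑ p, c p • N (wordWeight p) = 0 := by
    have e : ∑ p, c p • N (wordWeight p) =
        ∑ w ∈ Finset.univ.image wordWeight, (∑ p with wordWeight p = w, c p) • N w := by
      rw [← Finset.sum_fiberwise_of_maps_to (s := Finset.univ) (t := Finset.univ.image wordWeight)
        (g := wordWeight) (fun p hp => Finset.mem_image_of_mem _ hp)]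
      refine Finset.sum_congr rfl fun w _ => ?_
      rw [Finset.sum_smul]
      refine Finset.sum_congr rfl fun p hp => ?_
      rw [(Finset.mem_filter.mp hp).2]
    rw [e]
    refine Finset.sum_eq_zero fun w _ => ?_
    have := congrArg (coeff w) h0
    simp only [coeff_sum, coeff_smul, coeff_monomial, coeff_zero, smul_eq_mul, mul_ite, mul_one,
      mul_zero] at this
    rw [Finset.sum_filter, this, zero_smul]
  have h2 : ∑ p, c p • (wordMonomial p - N (wordWeight p)) ∈ LinearMap.range cubicOfL :=
    Submodule.sum_mem _ fun p _ => Submodule.smul_mem _ _ (hN p)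
  simp only [smul_sub, Finset.sum_sub_distrib, h1, sub_zero] at h2
  obtain ⟨b, hb⟩ := h2
  exact ⟨b, hb.symm⟩

theorem cubicOf_mem (b : Bil) : cubicOf b ∈ cubicsThroughVeronese := by
  refine ⟨cubicOf_isHomogeneous b, fun a ha => ?_⟩
  obtain ⟨e, rfl⟩ := mem_veroneseCone.mp ha
  rw [eval_cubicOf, crem_ver, map_zero]

end VeroneseFano
end

/-! ### Smoothness, squarefreeness and the dual cubic. -/

open MvPolynomial
noncomputable section
namespace VeroneseFano

open Matrix

/-- By the Nullstellensatz a power of G is divisible by F, and a squarefree element generates a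
radical ideal. -/
theorem dvd_of_forall_eval_eq_zero {σ : Type*} [Finite σ] {F G : MvPolynomial σ ℂ}
    (hF : Squarefree F) (h : ∀ a, eval a F = 0 → eval a G = 0) : F ∣ G := by
  have h1 : G ∈ vanishingIdeal ℂ (zeroLocus ℂ (Ideal.span {F})) := by
    intro a ha
    rw [aeval_eq_eval]
    apply h
    have := ha F (Ideal.mem_span_singleton_self F)
    rwa [aeval_eq_eval] at this
  rw [vanishingIdeal_zeroLocus_eq_radical] at h1
  obtain ⟨n, hn⟩ := h1
  exact hF.isRadical n G (Ideal.mem_span_singleton.mp hn)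

/-- If G had no zero except possibly the origin, the Nullstellensatz would make it divide a power of
each variable; a nonunit cannot divide powers of two different variables. -/
theorem exists_eval_eq_zero_of_not_isUnit {σ : Type*} [Finite σ] {i₀ i₁ : σ} (hi : i₀ ≠ i₁)
    {G : MvPolynomial σ ℂ} (hG : ¬ IsUnit G) :
    ∃ a, a ≠ 0 ∧ eval a G = 0 := by
  by_contra! h
  have hX : ∀ i : σ, ∃ k, Associated G (X i ^ k) := fun i => by
    have h1 : (X i : MvPolynomial σ ℂ) ∈ vanishingIdeal ℂ (zeroLocus ℂ (Ideal.span {G})) := by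
      intro a ha
      have h2 := ha G (Ideal.mem_span_singleton_self G)
      rw [aeval_eq_eval] at h2
      have : a = 0 := by
        by_contra h0
        exact h a h0 h2
      simp [this]
    rw [vanishingIdeal_zeroLocus_eq_radical] at h1
    obtain ⟨n, hn⟩ := h1
    obtain ⟨k, -, hk⟩ := (dvd_prime_pow (X_prime (i := i)) n).mp (Ideal.mem_span_singleton.mp hn)
    exact ⟨k, hk⟩
  obtain ⟨k, hk⟩ := hX i₀
  obtain ⟨m, hm⟩ := hX i₁
  have hk0 : k ≠ 0 := by
    rintro rfl
    rw [pow_zero] at hk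
    exact hG (hk.isUnit_iff.mpr isUnit_one)
  have h1 : (X i₀ : MvPolynomial σ ℂ) ∣ X i₁ := by
    apply (X_prime (i := i₀)).dvd_of_dvd_pow (n := m)
    exact (dvd_pow_self _ hk0).trans ((hk.symm.trans hm).dvd)
  rw [X_dvd_X] at h1
  exact hi h1

/-- All zeros of a repeated factor are singular points, and a nonunit factor has a nonzero zero. -/
theorem IsSmoothHypersurface.squarefree {F : Poly} (hF : IsSmoothHypersurface F) :
    Squarefree F := by
  rintro G ⟨H, rfl⟩
  by_contra hG
  obtain ⟨a, ha, h0⟩ := exists_eval_eq_zero_of_not_isUnit (zero_ne_one (α := Fin 6)) hG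
  obtain ⟨i, hi⟩ := hF a ha (by simp [h0])
  apply hi
  simp [Derivation.leibniz, h0]

theorem eval_pderiv_cubicOf (b : Bil) (a : Fin 6 → ℂ) (i : Fin 6) :
    eval a (pderiv i (cubicOf b)) =
      b (Pi.single i 1) (crem a) + b a (pol a (Pi.single i 1)) := by
  have h1 : ∀ j, eval a (crem (X : Fin 6 → Poly) j) = crem a j := fun j => by
    have := congrFun (map_crem (eval a) (X : Fin 6 → Poly)) j
    simpa using this
  have h2 : ∀ j, eval a (pderiv i (crem (X : Fin 6 → Poly) j)) = pol a (Pi.single i 1) j := by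
    intro j
    fin_cases j <;> simp [crem, pol, pderiv_X, Derivation.leibniz] <;>
      simp only [apply_ite (eval a), Pi.single_apply, map_one, map_zero] <;> ring
  rw [← Bil.ext_apply, ← Bil.ext_apply, cubicOf]
  simp only [Bil.ext, map_sum, Derivation.leibniz, smul_eq_mul, map_add,
    map_mul, algebraMap_eq, pderiv_C, h1, h2, eval_X, eval_C, mul_zero, add_zero,
    ← Finset.sum_add_distrib, pderiv_X, Algebra.algebraMap_self, RingHom.id_apply]
  refine Finset.sum_congr rfl fun k _ => Finset.sum_congr rfl fun j _ => ?_
  rw [Pi.single_apply, Pi.single_apply]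
  by_cases h : k = i
  · subst h; simp; ring
  · simp [h]

theorem pol_add_right {R : Type*} [CommRing R] (a x y : Fin 6 → R) :
    pol a (x + y) = pol a x + pol a y := by
  ext i; fin_cases i <;> simp [pol] <;> ring

theorem pol_smul_right {R : Type*} [CommRing R] (t : R) (a x : Fin 6 → R) :
    pol a (t • x) = t • pol a x := by
  ext i; fin_cases i <;> simp [pol] <;> ring

/-- As f vanishes on V, only the term b(e eᵀ, ·) applied to the polarisation of f remains in the
gradient there. -/
theorem goodLine_of_smooth {b : Bil} (hF : IsSmoothHypersurface (cubicOf b))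
    {L : Submodule ℂ (Fin 6 → ℂ)} (hL : LiesOn L (cubicOf b)) : GoodLine b L := by
  refine ⟨fun a ha => by rw [← eval_cubicOf]; exact hL a ha, fun e he heL => ?_⟩
  have h0 : ver e ≠ 0 := by
    intro h
    apply he
    have h0 := congrFun h 0
    have h1 := congrFun h 3
    have h2 := congrFun h 5
    simp [ver] at h0 h1 h2
    ext i; fin_cases i <;> simp [*]
  obtain ⟨i, hi⟩ := hF _ h0 (hL _ heL)
  rw [eval_pderiv_cubicOf, crem_ver, map_zero, zero_add] at hi
  exact ⟨_, hi⟩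

/-- `F = b(a, f(a))` and `F' = c b(f(y), y)` are smooth cubics without planes. -/
structure DualCubics (b : Bil) (F F' : Poly) : Prop where
  eq : F = cubicOf b
  eq' : ∃ c : ℂ, c ≠ 0 ∧ F' = c • cubicOf b.flip
  smooth : IsSmoothHypersurface F
  smooth' : IsSmoothHypersurface F'
  noPlane : ContainsNoPlane F
  noPlane' : ContainsNoPlane F'

theorem DualCubics.symm {b : Bil} {F F' : Poly} (h : DualCubics b F F') :
    ∃ c : ℂ, DualCubics (c • b.flip) F' F := by
  obtain ⟨c, hc, e⟩ := h.eq'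
  refine ⟨c, ?_, ⟨c⁻¹, inv_ne_zero hc, ?_⟩, h.smooth', h.smooth, h.noPlane', h.noPlane⟩
  · rw [e]
    exact (cubicOfL.map_smul c b.flip).symm
  · have : (c • b.flip).flip = c • b := by ext; simp
    rw [this, h.eq]
    change _ = c⁻¹ • cubicOfL (c • b)
    rw [map_smul, smul_smul, inv_mul_cancel₀ hc, one_smul]
    rfl

theorem eq_C_mul_of_dvd {F G : Poly} {n : ℕ} (hF : F.IsHomogeneous n) (hG : G.IsHomogeneous n)
    (hG0 : G ≠ 0) (h : F ∣ G) : ∃ c : ℂ, c ≠ 0 ∧ F = c • G := by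
  obtain ⟨H, rfl⟩ := h
  have hF0 : F ≠ 0 := left_ne_zero_of_mul hG0
  have hH0 : H ≠ 0 := right_ne_zero_of_mul hG0
  have h1 := hG.totalDegree hG0
  rw [totalDegree_mul_of_isDomain hF0 hH0, hF.totalDegree hF0] at h1
  obtain ⟨c, rfl⟩ : ∃ c, H = C c := ⟨_, totalDegree_eq_zero_iff_eq_C.mp (by omega)⟩
  have hc : c ≠ 0 := fun h => hH0 (by rw [h, C_0])
  refine ⟨c⁻¹, inv_ne_zero hc, ?_⟩
  rw [smul_eq_C_mul, mul_left_comm, ← C_mul, inv_mul_cancel₀ hc, C_1, mul_one]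

theorem crem_crem (a : Fin 6 → ℂ) : crem (crem a) = (symMat a).det • a := by
  rw [← cremona_cremona, cremona_eq, cremona_eq]

theorem eval_cubicOf_flip_crem (b : Bil) (a : Fin 6 → ℂ) :
    eval (crem a) (cubicOf b.flip) = (symMat a).det * eval a (cubicOf b) := by
  rw [eval_cubicOf, eval_cubicOf, crem_crem, LinearMap.flip_apply, map_smul, LinearMap.smul_apply,
    smul_eq_mul]

/-- The determinant as a polynomial. -/
def detPoly : Poly :=
  X 0 * (X 3 * X 5 - X 4 * X 4) + X 1 * (X 2 * X 4 - X 1 * X 5) + X 2 * (X 1 * X 4 - X 2 * X 3)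

theorem eval_detPoly (a : Fin 6 → ℂ) : eval a detPoly = (symMat a).det := by
  simp [detPoly, symMat, Matrix.det_fin_three]
  ring

theorem detPoly_ne_zero : detPoly ≠ 0 := by
  intro h
  have := eval_detPoly ![1, 0, 0, 1, 0, 1]
  rw [h] at this
  simp [symMat, Matrix.det_fin_three] at this

theorem cubicOf_flip_ne_zero {b : Bil} (h : cubicOf b ≠ 0) : cubicOf b.flip ≠ 0 := by
  intro h0
  have : detPoly * cubicOf b = 0 := by
    apply MvPolynomial.funext
    intro a
    rw [map_mul, eval_detPoly, ← eval_cubicOf_flip_crem, h0]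
    simp
  exact h ((mul_eq_zero.mp this).resolve_left detPoly_ne_zero)

theorem IsSmoothHypersurface.ne_zero {F : Poly} (hF : IsSmoothHypersurface F) : F ≠ 0 := by
  rintro rfl
  obtain ⟨i, hi⟩ := hF (Pi.single 0 1) (by simp) (by simp)
  simp at hi

/-- The identity f(f(a)) = det(a) a makes b(f(y), y) vanish on f(X). So F' divides it, and both are
cubic forms. -/
theorem IsCubicPair.exists_dualCubics {F F' : Poly} (h : IsCubicPair F F') :
    ∃ b, DualCubics b F F' := by
  obtain ⟨b, rfl⟩ := exists_cubicOf h.mem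
  refine ⟨b, rfl, ?_, h.smooth, h.smooth', h.noPlane, h.noPlane'⟩
  apply eq_C_mul_of_dvd h.homogeneous' (cubicOf_isHomogeneous _)
    (cubicOf_flip_ne_zero h.smooth.ne_zero)
  rw [← Ideal.mem_span_singleton, ← h.image]
  rintro _ ⟨a, ha, rfl⟩
  rw [aeval_eq_eval, cremona_eq, eval_cubicOf_flip_crem, show eval a (cubicOf b) = 0 from ha,
    mul_zero]

end VeroneseFano
end

/-! ### The closed graph over points of the Veronese surface. -/

open MvPolynomial
noncomputable section
namespace VeroneseFano

open Matrix

/-- Evaluation of a polynomial in one further variable. -/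
def evalBoth {R : Type*} [CommRing R] [Algebra ℂ R] (x : Fin 6 → R) (t : R) :
    Polynomial Poly →ₐ[ℂ] R :=
  { Polynomial.eval₂RingHom (aeval x : Poly →ₐ[ℂ] R).toRingHom t with
    commutes' := fun c => by
      simp [Polynomial.algebraMap_apply] }

theorem evalBoth_apply {R : Type*} [CommRing R] [Algebra ℂ R] (x : Fin 6 → R) (t : R)
    (p : Polynomial Poly) :
    evalBoth x t p = Polynomial.eval₂ (aeval x : Poly →ₐ[ℂ] R).toRingHom t p := rfl

theorem evalBoth_graph {R : Type*} [CommRing R] [Algebra ℂ R] (x : Fin 6 → R) (t : R)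
    (g : MvPolynomial (Fin 6 ⊕ Fin 6) ℂ) :
    evalBoth x t (aeval (Sum.elim (fun i => Polynomial.C (X i : Poly))
      fun j => Polynomial.X * Polynomial.C (crem (X : Fin 6 → Poly) j)) g) =
      aeval (Sum.elim x (t • crem x)) g := by
  rw [comp_aeval_apply]
  congr 2
  ext s
  rcases s with i | j
  · simp [evalBoth_apply]
  · have := congrFun (map_crem (aeval x : Poly →ₐ[ℂ] R).toRingHom X) j
    simp only [AlgHom.toRingHom_eq_coe, RingHom.coe_coe, aeval_X] at this
    simp only [Sum.elim_inr, evalBoth_apply, Polynomial.eval₂_mul, Polynomial.eval₂_X,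
      Polynomial.eval₂_C, Pi.smul_apply, smul_eq_mul]
    exact congrArg (t * ·) this

/-- Each coefficient in t of g(x, t f(x)) vanishes on the squarefree hypersurface F = 0. The
resulting identity holds over every algebra, so generic points can be substituted. -/
theorem graphIdeal_dvd {F : Poly} (hF : Squarefree F) {g : MvPolynomial (Fin 6 ⊕ Fin 6) ℂ}
    (hg : g ∈ graphIdeal F) :
    Polynomial.C F ∣ aeval (Sum.elim (fun i => Polynomial.C (X i : Poly))
      fun j => Polynomial.X * Polynomial.C (crem (X : Fin 6 → Poly) j)) g := by
  rw [Polynomial.C_dvd_iff_dvd_coeff]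
  intro k
  apply dvd_of_forall_eval_eq_zero hF
  intro a ha
  rw [← Polynomial.coeff_map]
  rw [show Polynomial.map (eval a) _ = 0 from ?_, Polynomial.coeff_zero]
  apply Polynomial.funext
  intro t
  have h := hg (Sum.elim a (t • crem a)) ⟨a, t, ha, by rw [cremona_eq]⟩
  rw [Polynomial.eval_zero, ← h, ← evalBoth_graph, Polynomial.eval_map, evalBoth_apply]
  congr 1

theorem graphIdeal_identity {F : Poly} (hF : Squarefree F) {g : MvPolynomial (Fin 6 ⊕ Fin 6) ℂ}
    (hg : g ∈ graphIdeal F) : ∃ H : Polynomial Poly,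
    ∀ {R : Type} [CommRing R] [Algebra ℂ R] (x : Fin 6 → R) (t : R),
      aeval (Sum.elim x (t • crem x)) g =
        aeval x F * Polynomial.eval₂ (aeval x : Poly →ₐ[ℂ] R).toRingHom t H := by
  obtain ⟨H, hH⟩ := graphIdeal_dvd hF hg
  refine ⟨H, fun {R} _ _ x t => ?_⟩
  rw [← evalBoth_graph, hH, map_mul, evalBoth_apply, evalBoth_apply, Polynomial.eval₂_C]
  rfl

/-- The generic point of the Veronese surface with a generic tangent direction of the graph. -/
theorem exists_eq_mul_of_mem_graphIdeal {b : Bil} (hF : Squarefree (cubicOf b))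
    (hB : ∃ e n, b (ver e) (pol (ver e) n) ≠ 0) {g : MvPolynomial (Fin 6 ⊕ Fin 6) ℂ}
    (hg : g ∈ graphIdeal (cubicOf b)) :
    ∃ h : MvPolynomial (Fin 3 ⊕ Fin 6) ℂ,
      aeval (Sum.elim (ver fun i => X (Sum.inl i))
        (pol (ver fun i => X (Sum.inl i)) fun j => X (Sum.inr j))) g =
      b.ext (ver fun i => X (Sum.inl i))
        (pol (ver fun i => X (Sum.inl i)) fun j => (X (Sum.inr j) : MvPolynomial (Fin 3 ⊕ Fin 6) ℂ))
          * h := by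
  obtain ⟨H, hH⟩ := graphIdeal_identity hF hg
  set S := MvPolynomial (Fin 3 ⊕ Fin 6) ℂ with hS
  set e : Fin 3 → S := fun i => X (Sum.inl i) with he
  set n : Fin 6 → S := fun j => X (Sum.inr j) with hn
  -- An arc leaving V at `ver e` in direction n, with the variable τ of `Polynomial S` as parameter.
  -- Along it f(x) = τ y, so (x, y) is a graph point with t = 1/τ, and it has a limit at τ = 0.
  let x : Fin 6 → Polynomial S := (fun i => Polynomial.C (ver e i)) +
    (Polynomial.X : Polynomial S) • fun i => Polynomial.C (n i)
  let y : Fin 6 → Polynomial S := (fun i => Polynomial.C (pol (ver e) n i)) +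
    (Polynomial.X : Polynomial S) • fun i => Polynomial.C (crem n i)
  have hxy : crem x = (Polynomial.X : Polynomial S) • y := by
    simp only [x, y]
    rw [map_ver (Polynomial.C : S →+* _), map_pol (Polynomial.C : S →+* _),
      map_ver (Polynomial.C : S →+* _), map_crem (Polynomial.C : S →+* _), crem_add, crem_ver,
      crem_smul, pol_smul_right, zero_add, smul_add, smul_smul, pow_two]
  let A : Polynomial S := aeval (Sum.elim x y) g
  let B : Polynomial S := b.ext x y
  let W : Polynomial S := Polynomial.X *
    Polynomial.eval₂ (aeval x : Poly →ₐ[ℂ] Polynomial S).toRingHom Polynomial.X H.reverse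
  -- Over the fraction field, substitute t = 1/τ and F(x) = τ b(x, y); the reversed polynomial of H
  -- clears the negative powers of τ.
  have key : Polynomial.X ^ H.natDegree * A = B * W := by
    let K := FractionRing (Polynomial S)
    apply IsFractionRing.injective (Polynomial S) K
    let ι : Polynomial S →ₐ[ℂ] K := Algebra.algHom ℂ (Polynomial S) K
    change ι _ = ι _
    have hτ : ι Polynomial.X ≠ 0 := fun h0 => Polynomial.X_ne_zero (R := S)
      (IsFractionRing.injective (Polynomial S) K (by rw [map_zero]; exact h0))
    set τ := ι Polynomial.X with hτd
    have h1 := hH (fun i => ι (x i)) τ⁻¹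
    have h2 : τ⁻¹ • crem (fun i => ι (x i)) = fun i => ι (y i) := by
      have := map_crem ι.toRingHom x
      simp only [AlgHom.toRingHom_eq_coe, RingHom.coe_coe] at this
      rw [← this, hxy]
      ext i
      simp only [Pi.smul_apply, smul_eq_mul, map_mul]
      rw [← mul_assoc, inv_mul_cancel₀ hτ, one_mul]
    have h3 : crem (fun i => ι (x i)) = τ • fun i => ι (y i) := by
      rw [← h2, smul_smul, mul_inv_cancel₀ hτ, one_smul]
    have h4 : (Sum.elim (fun i => ι (x i)) fun i => ι (y i)) = fun s => ι (Sum.elim x y s) := by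
      ext s; rcases s with i | i <;> rfl
    rw [h2, h4, ← comp_aeval_apply, aeval_cubicOf, h3, Bil.ext_smul_right, ← Bil.map_ext] at h1
    let _ : Invertible τ⁻¹ := invertibleOfNonzero (inv_ne_zero hτ)
    have h5 := Polynomial.eval₂_reverse_mul_pow
      (aeval (fun i => ι (x i)) : Poly →ₐ[ℂ] K).toRingHom τ⁻¹ H
    rw [← h5, invOf_eq_inv, inv_inv] at h1
    have h6 : ι (Polynomial.eval₂ (aeval x : Poly →ₐ[ℂ] Polynomial S).toRingHom Polynomial.X
        H.reverse) =
        Polynomial.eval₂ (aeval (fun i => ι (x i)) : Poly →ₐ[ℂ] K).toRingHom τ H.reverse := by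
      have := Polynomial.hom_eval₂ H.reverse (aeval x : Poly →ₐ[ℂ] Polynomial S).toRingHom
        ι.toRingHom Polynomial.X
      simp only [AlgHom.toRingHom_eq_coe, RingHom.coe_coe] at this ⊢
      rw [this]
      congr 1
      apply MvPolynomial.ringHom_ext
      · intro r
        simpa using ι.commutes r
      · intro i
        simp
    simp only [map_mul, map_pow, A, B, W]
    rw [h1, h6]
    have h7 : τ ^ H.natDegree * τ⁻¹ ^ H.natDegree = 1 := by
      rw [← mul_pow, mul_inv_cancel₀ hτ, one_pow]
    linear_combination (τ * ι (b.ext x y) *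
      Polynomial.eval₂ (aeval fun i => ι (x i)).toRingHom τ H.reverse) * h7
  let ev : Polynomial S →ₐ[ℂ] S := (Polynomial.aeval (0 : S)).restrictScalars ℂ
  have hevx : (fun i => ev (x i)) = ver e := by
    ext i; simp [ev, x]
  have hevy : (fun i => ev (y i)) = pol (ver e) n := by
    ext i; simp [ev, y]
  have hevB : ev B = b.ext (ver e) (pol (ver e) n) := by
    rw [Bil.map_ext, hevx, hevy]
  -- The value of B at τ = 0 is the generic gradient of the cubic along V, which is not zero. Hence
  -- the power of τ divides W and can be cancelled.
  have hB0 : ¬ (Polynomial.X : Polynomial S) ∣ B := by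
    intro h
    rw [Polynomial.X_dvd_iff] at h
    have h0 : ev B = 0 := by
      simpa [ev, Polynomial.coeff_zero_eq_aeval_zero] using h
    obtain ⟨e₀, n₀, h1⟩ := hB
    apply h1
    rw [← Bil.ext_apply]
    have h2 : b.ext (ver e₀) (pol (ver e₀) n₀) =
        (aeval (Sum.elim e₀ n₀) : S →ₐ[ℂ] ℂ) (b.ext (ver e) (pol (ver e) n)) := by
      have h3 := map_ver (aeval (Sum.elim e₀ n₀) : S →ₐ[ℂ] ℂ).toRingHom e
      have h4 := map_pol (aeval (Sum.elim e₀ n₀) : S →ₐ[ℂ] ℂ).toRingHom (ver e) n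
      simp only [AlgHom.toRingHom_eq_coe, RingHom.coe_coe] at h3 h4
      rw [Bil.map_ext, h4, h3]
      simp [e, n]
    rw [h2, ← hevB, h0, map_zero]
  have hdvd : Polynomial.X ^ H.natDegree ∣ W :=
    Polynomial.prime_X.pow_dvd_of_dvd_mul_left _ hB0 ⟨A, key.symm⟩
  obtain ⟨W', hW'⟩ := hdvd
  have hA : A = B * W' := by
    have : Polynomial.X ^ H.natDegree * A = Polynomial.X ^ H.natDegree * (B * W') := by
      rw [key, hW']; ring
    exact mul_left_cancel₀ (pow_ne_zero _ Polynomial.X_ne_zero) this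
  refine ⟨ev W', ?_⟩
  rw [← hevB, ← map_mul, ← hA]
  simp only [A]
  rw [comp_aeval_apply]
  congr 2
  refine _root_.funext fun s => ?_
  rcases s with i | i
  · exact (congrFun hevx i).symm
  · exact (congrFun hevy i).symm

/-- Specialising the generic identity over an arbitrary algebra; points over the dual numbers are
needed for lines tangent to V. -/
theorem aeval_eq_zero_of_mem_graphIdeal {b : Bil} (hF : Squarefree (cubicOf b))
    (hB : ∃ e n, b (ver e) (pol (ver e) n) ≠ 0) {g : MvPolynomial (Fin 6 ⊕ Fin 6) ℂ}
    (hg : g ∈ graphIdeal (cubicOf b)) {R : Type*} [CommRing R] [Algebra ℂ R] (e : Fin 3 → R)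
    (n : Fin 6 → R) (h : b.ext (ver e) (pol (ver e) n) = 0) :
    aeval (Sum.elim (ver e) (pol (ver e) n)) g = 0 := by
  obtain ⟨k, hk⟩ := exists_eq_mul_of_mem_graphIdeal hF hB hg
  let φ : MvPolynomial (Fin 3 ⊕ Fin 6) ℂ →ₐ[ℂ] R := aeval (Sum.elim e n)
  have h3 : (fun i => φ (ver (fun i => X (Sum.inl i)) i)) = ver e := by
    have := map_ver φ.toRingHom fun i => X (Sum.inl i)
    simp only [AlgHom.toRingHom_eq_coe, RingHom.coe_coe] at this
    rw [this]; simp [φ]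
  have h4 : (fun i => φ (pol (ver fun i => X (Sum.inl i)) (fun j => X (Sum.inr j)) i)) =
      pol (ver e) n := by
    have := map_pol φ.toRingHom (ver fun i => X (Sum.inl i)) fun j => X (Sum.inr j)
    simp only [AlgHom.toRingHom_eq_coe, RingHom.coe_coe] at this
    rw [this, h3]; simp [φ]
  have h5 := congrArg φ hk
  rw [map_mul, Bil.map_ext, h3, h4, h, zero_mul, comp_aeval_apply] at h5
  rw [← h5]
  congr 2
  refine _root_.funext fun s => ?_
  rcases s with i | i
  · exact (congrFun h3 i).symm
  · exact (congrFun h4 i).symm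

/-- The product of a symmetric matrix and a vector, over an arbitrary ring. -/
def symVec {R : Type*} [CommRing R] (y : Fin 6 → R) (e : Fin 3 → R) : Fin 3 → R :=
  ![y 0 * e 0 + y 1 * e 1 + y 2 * e 2, y 1 * e 0 + y 3 * e 1 + y 4 * e 2,
    y 2 * e 0 + y 4 * e 1 + y 5 * e 2]

/-- Polarising f at e eᵀ sends n to [e] n [e]ᵀ, where [e] is the matrix of the cross product with e.
Since [e][d] = d eᵀ - 1 acts as -1 on matrices killed by e, the preimage [d] y [d]ᵀ works. -/
theorem exists_pol_ver_eq {R : Type*} [CommRing R] {y : Fin 6 → R} {e d : Fin 3 → R}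
    (hed : e 0 * d 0 + e 1 * d 1 + e 2 * d 2 = 1) (hy : symVec y e = 0) :
    ∃ n, pol (ver e) n = y := by
  have h0 := congrFun hy 0
  have h1 := congrFun hy 1
  have h2 := congrFun hy 2
  simp only [symVec, Matrix.cons_val, Pi.zero_apply] at h0 h1 h2
  let D : Matrix (Fin 3) (Fin 3) R := !![0, -d 2, d 1; d 2, 0, -d 0; -d 1, d 0, 0]
  let Y : Matrix (Fin 3) (Fin 3) R := !![y 0, y 1, y 2; y 1, y 3, y 4; y 2, y 4, y 5]
  refine ⟨ofSym (D * Y * Dᵀ), ?_⟩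
  ext i
  fin_cases i <;>
    simp [pol, ver, ofSym, D, Y, Matrix.mul_apply, Fin.sum_univ_three, -neg_mul, -mul_neg]
  · linear_combination (e 0 * d 0 + e 1 * d 1 + e 2 * d 2 + 1) * y 0 * hed -
      (e 0 * d 0 + e 1 * d 1 + e 2 * d 2) * (d 0 * h0 + d 0 * h0) +
      d 0 * d 0 * (e 0 * h0 + e 1 * h1 + e 2 * h2)
  · linear_combination (e 0 * d 0 + e 1 * d 1 + e 2 * d 2 + 1) * y 1 * hed -
      (e 0 * d 0 + e 1 * d 1 + e 2 * d 2) * (d 0 * h1 + d 1 * h0) +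
      d 0 * d 1 * (e 0 * h0 + e 1 * h1 + e 2 * h2)
  · linear_combination (e 0 * d 0 + e 1 * d 1 + e 2 * d 2 + 1) * y 2 * hed -
      (e 0 * d 0 + e 1 * d 1 + e 2 * d 2) * (d 0 * h2 + d 2 * h0) +
      d 0 * d 2 * (e 0 * h0 + e 1 * h1 + e 2 * h2)
  · linear_combination (e 0 * d 0 + e 1 * d 1 + e 2 * d 2 + 1) * y 3 * hed -
      (e 0 * d 0 + e 1 * d 1 + e 2 * d 2) * (d 1 * h1 + d 1 * h1) +
      d 1 * d 1 * (e 0 * h0 + e 1 * h1 + e 2 * h2)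
  · linear_combination (e 0 * d 0 + e 1 * d 1 + e 2 * d 2 + 1) * y 4 * hed -
      (e 0 * d 0 + e 1 * d 1 + e 2 * d 2) * (d 1 * h2 + d 2 * h1) +
      d 1 * d 2 * (e 0 * h0 + e 1 * h1 + e 2 * h2)
  · linear_combination (e 0 * d 0 + e 1 * d 1 + e 2 * d 2 + 1) * y 5 * hed -
      (e 0 * d 0 + e 1 * d 1 + e 2 * d 2) * (d 2 * h2 + d 2 * h2) +
      d 2 * d 2 * (e 0 * h0 + e 1 * h1 + e 2 * h2)

end VeroneseFano
end

/-! ### Points of the graph and the duality between equations and triples. -/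

open MvPolynomial
noncomputable section
namespace VeroneseFano

open Matrix

theorem exists_ver_of_crem_eq_zero {a : Fin 6 → ℂ} (h : crem a = 0) : ∃ e, a = ver e := by
  have h0 := congrFun h 0
  have h1 := congrFun h 1
  have h2 := congrFun h 2
  have h3 := congrFun h 3
  have h4 := congrFun h 4
  have h5 := congrFun h 5
  simp only [crem, Matrix.cons_val, Pi.zero_apply] at h0 h1 h2 h3 h4 h5
  by_cases ha : a 0 = 0
  · have a1 : a 1 = 0 := by simpa [ha] using h5
    have a2 : a 2 = 0 := by simpa [ha] using h3
    obtain ⟨α, β, e3, e4, e5⟩ := exists_binary_square (A := a 3) (B := a 4) (C := a 5)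
      (by linear_combination -h0)
    refine ⟨![0, α, β], ?_⟩
    ext i; fin_cases i <;> simp [ver, *]
  · obtain ⟨s, hs⟩ := IsAlgClosed.exists_pow_nat_eq (a 0) (n := 2) (by norm_num)
    have hs0 : s ≠ 0 := by rintro rfl; apply ha; rw [← hs]; ring
    refine ⟨![s, a 1 / s, a 2 / s], ?_⟩
    ext i; fin_cases i <;> simp [ver]
    · rw [← hs]; ring
    · field_simp
    · field_simp
    · field_simp; rw [hs]; linear_combination h5
    · field_simp; rw [hs]; linear_combination -h4
    · field_simp; rw [hs]; linear_combination h3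

theorem ver_ne_zero {e : Fin 3 → ℂ} (he : e ≠ 0) : ver e ≠ 0 := by
  intro h
  apply he
  have h0 := congrFun h 0
  have h1 := congrFun h 3
  have h2 := congrFun h 5
  simp [ver] at h0 h1 h2
  ext i; fin_cases i <;> simp [*]

theorem symMat_ver_mul_apply (e : Fin 3 → ℂ) (y : Fin 6 → ℂ) (k j : Fin 3) :
    (symMat (ver e) * symMat y) k j = e k * symVec y e j := by
  fin_cases k <;> fin_cases j <;>
    simp [symMat, ver, symVec, Matrix.mul_apply, Fin.sum_univ_three] <;> ring

theorem symMat_symProd_mul_apply (l m : Fin 3 → ℂ) (y : Fin 6 → ℂ) (k j : Fin 3) :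
    (symMat (symProd l m) * symMat y) k j = l k * symVec y m j + m k * symVec y l j := by
  fin_cases k <;> fin_cases j <;>
    simp [symMat, symProd, symVec, Matrix.mul_apply, Fin.sum_univ_three] <;> ring

theorem symMat_mul_eq_zero {y : Fin 6 → ℂ} {e : Fin 3 → ℂ} (he : e ≠ 0)
    (h : symMat (ver e) * symMat y = 0) : symVec y e = 0 := by
  obtain ⟨k, hk⟩ := Function.ne_iff.mp he
  have hk' : e k ≠ 0 := hk
  ext j
  have := congrFun (congrFun h k) j
  rw [symMat_ver_mul_apply] at this
  exact (mul_eq_zero.mp this).resolve_left hk'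

theorem symVec_eq_zero_of_symProd {y : Fin 6 → ℂ} {l m : Fin 3 → ℂ}
    (h : symMat (symProd l m) * symMat y = 0) (hlm : l ⨯₃ m ≠ 0) :
    symVec y l = 0 ∧ symVec y m = 0 := by
  have key : ∀ i j, l i * symVec y m j + m i * symVec y l j = 0 := by
    intro i j
    rw [← symMat_symProd_mul_apply, h]
    rfl
  have key2 : ∀ k j, (l ⨯₃ m) k * symVec y m j = 0 ∧ (l ⨯₃ m) k * symVec y l j = 0 := by
    intro k j
    have h0 := key 0 j
    have h1 := key 1 j
    have h2 := key 2 j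
    fin_cases k <;> simp only [cross_apply, Fin.zero_eta, Fin.mk_one, Fin.reduceFinMk,
      Matrix.cons_val] <;> constructor
    · linear_combination m 2 * h1 - m 1 * h2
    · linear_combination l 1 * h2 - l 2 * h1
    · linear_combination m 0 * h2 - m 2 * h0
    · linear_combination l 2 * h0 - l 0 * h2
    · linear_combination m 1 * h0 - m 0 * h1
    · linear_combination l 0 * h1 - l 1 * h0
  obtain ⟨k, hk⟩ := Function.ne_iff.mp hlm
  have hk' : (l ⨯₃ m) k ≠ 0 := hk
  exact ⟨_root_.funext fun j => (mul_eq_zero.mp (key2 k j).2).resolve_left hk',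
    _root_.funext fun j => (mul_eq_zero.mp (key2 k j).1).resolve_left hk'⟩

theorem crem_symProd (l m : Fin 3 → ℂ) : crem (symProd l m) = -ver (l ⨯₃ m) := by
  ext i; fin_cases i <;> simp [crem, symProd, ver, crossProduct] <;> ring

theorem exists_eq_smul_ver_cross {y : Fin 6 → ℂ} {l m : Fin 3 → ℂ} (hl : symVec y l = 0)
    (hm : symVec y m = 0) (hlm : l ⨯₃ m ≠ 0) : ∃ t : ℂ, y = t • ver (l ⨯₃ m) := by
  have l0 := congrFun hl 0
  have l1 := congrFun hl 1
  have l2 := congrFun hl 2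
  have m0 := congrFun hm 0
  have m1 := congrFun hm 1
  have m2 := congrFun hm 2
  simp only [symVec, Matrix.cons_val, Pi.zero_apply] at l0 l1 l2 m0 m1 m2
  have r : ∀ p q r : ℂ, p * l 0 + q * l 1 + r * l 2 = 0 → p * m 0 + q * m 1 + r * m 2 = 0 →
      ∃ c : ℂ, ![p, q, r] = c • (l ⨯₃ m) := by
    intro p q r h1 h2
    apply exists_smul_of_cross_eq_zero _ hlm
    ext i
    fin_cases i <;> simp only [cross_apply, Fin.zero_eta, Fin.mk_one, Fin.reduceFinMk,
      Matrix.cons_val, Pi.zero_apply]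
    · linear_combination m 0 * h1 - l 0 * h2
    · linear_combination m 1 * h1 - l 1 * h2
    · linear_combination m 2 * h1 - l 2 * h2
  obtain ⟨c0, e0⟩ := r _ _ _ l0 m0
  obtain ⟨c1, e1⟩ := r _ _ _ l1 m1
  obtain ⟨c2, e2⟩ := r _ _ _ l2 m2
  set w := l ⨯₃ m with hw
  have y0 : y 0 = c0 * w 0 := by simpa using congrFun e0 0
  have y1 : y 1 = c0 * w 1 := by simpa using congrFun e0 1
  have y2 : y 2 = c0 * w 2 := by simpa using congrFun e0 2
  have z1 : y 1 = c1 * w 0 := by simpa using congrFun e1 0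
  have y3 : y 3 = c1 * w 1 := by simpa using congrFun e1 1
  have y4 : y 4 = c1 * w 2 := by simpa using congrFun e1 2
  have z2 : y 2 = c2 * w 0 := by simpa using congrFun e2 0
  have z4 : y 4 = c2 * w 1 := by simpa using congrFun e2 1
  have y5 : y 5 = c2 * w 2 := by simpa using congrFun e2 2
  obtain ⟨t, ht⟩ := exists_smul_of_cross_eq_zero (l := w) (m := ![c0, c1, c2]) (by
    ext i
    fin_cases i <;> simp only [cross_apply, Fin.zero_eta, Fin.mk_one, Fin.reduceFinMk,
      Matrix.cons_val, Pi.zero_apply]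
    · linear_combination y4 - z4
    · linear_combination z2 - y2
    · linear_combination y1 - z1) hlm
  have h0 : c0 = t * w 0 := by simpa using congrFun ht 0
  have h1 : c1 = t * w 1 := by simpa using congrFun ht 1
  have h2 : c2 = t * w 2 := by simpa using congrFun ht 2
  refine ⟨t, ?_⟩
  ext i
  fin_cases i <;> simp [ver, y0, y1, y2, y3, y4, y5, h0, h1, h2] <;> ring

/-- The bilinear equations together with F(a) = 0 and a ≠ 0 put (a, y) on the graph closure. Off V
the equation a y ∈ ℂ forces y to be a multiple of f(a), by inversion in rank three and by the
one-dimensional kernel in rank two. On V it says y e = 0, and y is a limit along an arc. -/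
theorem eval_eq_zero_of_mem_graphIdeal {b : Bil} (hF : Squarefree (cubicOf b))
    (hB : ∃ e n, b (ver e) (pol (ver e) n) ≠ 0) {a y : Fin 6 → ℂ} (ha : a ≠ 0) {l : ℂ}
    (hl : symMat a * symMat y = l • 1) (hba : b a (crem a) = 0) (hby : b a y = 0)
    {g : MvPolynomial (Fin 6 ⊕ Fin 6) ℂ} (hg : g ∈ graphIdeal (cubicOf b)) :
    aeval (Sum.elim a y) g = 0 := by
  have hl0 : (symMat a).det = 0 → l = 0 := fun h0 => by
    have := congrArg Matrix.det hl
    rw [Matrix.det_mul, h0, zero_mul, Matrix.det_smul, Matrix.det_one, mul_one] at this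
    simpa using this.symm
  by_cases hc : crem a = 0
  · obtain ⟨e, rfl⟩ := exists_ver_of_crem_eq_zero hc
    have he : e ≠ 0 := by rintro rfl; apply ha; ext i; fin_cases i <;> simp [ver]
    rw [hl0 (by simp [symMat, ver, Matrix.det_fin_three]; ring), zero_smul]
      at hl
    replace hl := symMat_mul_eq_zero he hl
    obtain ⟨k, hk⟩ := Function.ne_iff.mp he
    have hk' : e k ≠ 0 := hk
    obtain ⟨n, rfl⟩ := exists_pol_ver_eq (d := Pi.single k (e k)⁻¹) (by
      fin_cases k <;> simp at hk' ⊢ <;> exact mul_inv_cancel₀ hk') hl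
    exact aeval_eq_zero_of_mem_graphIdeal hF hB hg e n (by rw [Bil.ext_apply]; exact hby)
  · obtain ⟨t, rfl⟩ : ∃ t : ℂ, y = t • crem a := by
      by_cases hd : (symMat a).det = 0
      · rw [hl0 hd, zero_smul] at hl
        obtain ⟨u, v, rfl⟩ := exists_symProd_of_det_eq_zero hd
        rw [crem_symProd] at hc
        have huv : u ⨯₃ v ≠ 0 := fun h => hc (by
          rw [h]; ext i; fin_cases i <;> simp [ver])
        obtain ⟨h1, h2⟩ := symVec_eq_zero_of_symProd hl huv
        obtain ⟨t, rfl⟩ := exists_eq_smul_ver_cross h1 h2 huv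
        exact ⟨-t, by rw [crem_symProd, smul_neg, neg_smul, neg_neg]⟩
      · refine ⟨l / (symMat a).det, ?_⟩
        apply symMat_injective
        rw [symMat_smul, ← cremona_eq, symMat_cremona]
        have := congrArg ((symMat a).adjugate * ·) hl
        simp only [← Matrix.mul_assoc, Matrix.adjugate_mul, smul_mul_assoc, one_mul,
          mul_smul_comm, mul_one] at this
        rw [div_eq_inv_mul, mul_smul, ← this, smul_smul, inv_mul_cancel₀ hd, one_smul]
    exact hg _ ⟨a, t, by rw [eval_cubicOf]; exact hba, by rw [cremona_eq]⟩

/-- The bilinear forms that vanish on the graph over the cubic `b(a, f(a)) = 0`. -/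
def graphForms (b : Bil) : Submodule ℂ Bil where
  carrier := {T | ∀ a, b a (crem a) = 0 → T a (crem a) = 0}
  zero_mem' := fun _ _ => rfl
  add_mem' := fun {T T'} h h' a ha => by
    rw [LinearMap.add_apply, LinearMap.add_apply, h a ha, h' a ha, add_zero]
  smul_mem' := fun c T h a ha => by
    rw [LinearMap.smul_apply, LinearMap.smul_apply, h a ha, smul_zero]

theorem self_mem_graphForms (b : Bil) : b ∈ graphForms b := fun _ h => h

/-- The bilinear form `tr(M x y)`. -/
def traceForm (M : Matrix (Fin 3) (Fin 3) ℂ) : Bil :=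
  LinearMap.mk₂ ℂ (fun x y => (M * (symMat x * symMat y)).trace)
    (fun x x' y => by rw [symMat_add, add_mul, mul_add, Matrix.trace_add])
    (fun c x y => by rw [symMat_smul, smul_mul_assoc, mul_smul_comm, Matrix.trace_smul])
    (fun x y y' => by rw [symMat_add, mul_add, mul_add, Matrix.trace_add])
    (fun c x y => by rw [symMat_smul, mul_smul_comm, mul_smul_comm, Matrix.trace_smul])

theorem traceForm_apply (M : Matrix (Fin 3) (Fin 3) ℂ) (x y : Fin 6 → ℂ) :
    traceForm M x y = (M * (symMat x * symMat y)).trace := rfl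

theorem traceForm_mem (b : Bil) {M : Matrix (Fin 3) (Fin 3) ℂ} (hM : M.trace = 0) :
    traceForm M ∈ graphForms b := by
  intro a _
  rw [traceForm_apply, ← cremona_eq, symMat_cremona, Matrix.mul_adjugate, mul_smul_comm, mul_one,
    Matrix.trace_smul, hM, smul_zero]

theorem exists_smul_one_of_trace {N : Matrix (Fin 3) (Fin 3) ℂ}
    (h : ∀ M : Matrix (Fin 3) (Fin 3) ℂ, M.trace = 0 → (M * N).trace = 0) :
    ∃ l : ℂ, N = l • 1 := by
  refine ⟨N 0 0, ?_⟩
  have h1 := h !![0, 1, 0; 0, 0, 0; 0, 0, 0] (by simp [Matrix.trace_fin_three])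
  have h2 := h !![0, 0, 1; 0, 0, 0; 0, 0, 0] (by simp [Matrix.trace_fin_three])
  have h3 := h !![0, 0, 0; 1, 0, 0; 0, 0, 0] (by simp [Matrix.trace_fin_three])
  have h4 := h !![0, 0, 0; 0, 0, 1; 0, 0, 0] (by simp [Matrix.trace_fin_three])
  have h5 := h !![0, 0, 0; 0, 0, 0; 1, 0, 0] (by simp [Matrix.trace_fin_three])
  have h6 := h !![0, 0, 0; 0, 0, 0; 0, 1, 0] (by simp [Matrix.trace_fin_three])
  have h7 := h !![1, 0, 0; 0, -1, 0; 0, 0, 0] (by simp [Matrix.trace_fin_three])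
  have h8 := h !![1, 0, 0; 0, 0, 0; 0, 0, -1] (by simp [Matrix.trace_fin_three])
  simp [Matrix.trace_fin_three, Matrix.vecMul, dotProduct, Fin.sum_univ_three] at h1 h2 h3 h4 h5 h6 h7 h8
  ext i j
  fin_cases i <;> fin_cases j <;> simp [*]
  · linear_combination -h7
  · linear_combination -h8

theorem pencilPair_of_graphForms {b : Bil} {u v Y₀ Y₁ : Fin 6 → ℂ}
    (h : ∀ T ∈ graphForms b, T u Y₀ + T v Y₁ = 0) : PencilPair b u v Y₀ Y₁ := by
  refine ⟨exists_smul_one_of_trace fun M hM => ?_, h b (self_mem_graphForms b)⟩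
  rw [mul_add, Matrix.trace_add]
  exact h _ (traceForm_mem b hM)

/-- The functional on triples of vectors defined by two of the bilinear equations of the graph. -/
def tripleForm (b : Bil) (u v : Fin 6 → ℂ) :
    (graphForms b × graphForms b) →ₗ[ℂ] Module.Dual ℂ (Fin 3 → Fin 6 → ℂ) where
  toFun T := (T.1.1 u) ∘ₗ LinearMap.proj 0 + (T.1.1 v + T.2.1 u) ∘ₗ LinearMap.proj 1 +
    (T.2.1 v) ∘ₗ LinearMap.proj 2
  map_add' T T' := by ext; simp; ring
  map_smul' c T := by ext; simp; ring

/-- The expression s(sT(u) + tT(v)) + t(sT'(u) + tT'(v)) has coefficients T(u), T(v) + T'(u), T'(v)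
in s², st, t². Every common zero of these triples of functionals is a `PencilTriple`, so the double
annihilator produces T and T'. -/
theorem exists_graphForms_of_forall_triple {b : Bil} {u v : Fin 6 → ℂ}
    {κ : Fin 3 → Module.Dual ℂ (Fin 6 → ℂ)}
    (h : ∀ Y, PencilTriple b u v Y → κ 0 (Y 0) + κ 1 (Y 1) + κ 2 (Y 2) = 0) :
    ∃ T ∈ graphForms b, ∃ T' ∈ graphForms b, T u = κ 0 ∧ T v + T' u = κ 1 ∧ T' v = κ 2 := by
  let k : Module.Dual ℂ (Fin 3 → Fin 6 → ℂ) := (κ 0) ∘ₗ LinearMap.proj 0 +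
    (κ 1) ∘ₗ LinearMap.proj 1 + (κ 2) ∘ₗ LinearMap.proj 2
  have hk : k ∈ LinearMap.range (tripleForm b u v) := by
    rw [← Subspace.dualCoannihilator_dualAnnihilator_eq (W := LinearMap.range (tripleForm b u v)),
      Submodule.mem_dualAnnihilator]
    intro Y hY
    rw [Submodule.mem_dualCoannihilator] at hY
    apply h
    constructor
    · apply pencilPair_of_graphForms
      intro T hT
      simpa [tripleForm] using hY _ ⟨(⟨T, hT⟩, 0), rfl⟩
    · apply pencilPair_of_graphForms
      intro T hT
      simpa [tripleForm] using hY _ ⟨(0, ⟨T, hT⟩), rfl⟩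
  obtain ⟨⟨⟨T, hT⟩, ⟨T', hT'⟩⟩, e⟩ := hk
  refine ⟨T, hT, T', hT', ?_, ?_, ?_⟩
  · ext i
    simpa [tripleForm, k] using LinearMap.congr_fun e (Pi.single 0 (Pi.single i 1))
  · ext i
    simpa [tripleForm, k] using LinearMap.congr_fun e (Pi.single 1 (Pi.single i 1))
  · ext i
    simpa [tripleForm, k] using LinearMap.congr_fun e (Pi.single 2 (Pi.single i 1))

end VeroneseFano
end

/-! ### Ideals of linear subspaces and elimination of linear forms. -/

open MvPolynomial
noncomputable section
namespace VeroneseFano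

open Matrix

theorem exists_dual_family {V ι : Type*} [AddCommGroup V] [Module ℂ V] [Fintype ι] [DecidableEq ι]
    {v : ι → V} (hv : LinearIndependent ℂ v) :
    ∃ ℓ : ι → Module.Dual ℂ V, ∀ i j, ℓ i (v j) = if i = j then 1 else 0 := by
  obtain ⟨g, hg⟩ := (Fintype.linearCombination ℂ v).exists_leftInverse_of_injective
    (LinearMap.ker_eq_bot'.mpr fun c hc => _root_.funext
      (Fintype.linearIndependent_iff.mp hv c (by simpa [Fintype.linearCombination_apply] using hc)))
  refine ⟨fun i => LinearMap.proj i ∘ₗ g, fun i j => ?_⟩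
  have := LinearMap.congr_fun hg (Pi.single j 1)
  simp only [LinearMap.comp_apply, Fintype.linearCombination_apply_single, one_smul,
    LinearMap.id_apply] at this
  simp [this, Pi.single_apply]

/-- The linear form attached to a functional. -/
def linForm (κ : Module.Dual ℂ (Fin 6 → ℂ)) : Poly := ∑ i, C (κ (Pi.single i 1)) * X i

theorem eval_linForm (κ : Module.Dual ℂ (Fin 6 → ℂ)) (a : Fin 6 → ℂ) :
    eval a (linForm κ) = κ a := by
  conv_rhs => rw [pi_sum_single a]
  simp [linForm, mul_comm]

theorem linForm_isHomogeneous (κ : Module.Dual ℂ (Fin 6 → ℂ)) : (linForm κ).IsHomogeneous 1 :=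
  IsHomogeneous.sum _ _ _ fun i _ => isHomogeneous_C_mul_X _ i

/-- `linForm` as a linear map. -/
def linFormL : Module.Dual ℂ (Fin 6 → ℂ) →ₗ[ℂ] Poly where
  toFun := linForm
  map_add' κ κ' := by simp [linForm, add_mul, Finset.sum_add_distrib]
  map_smul' c κ := by simp [linForm, Finset.smul_sum, smul_eq_C_mul, mul_assoc]

theorem linForm_add (κ κ' : Module.Dual ℂ (Fin 6 → ℂ)) :
    linForm (κ + κ') = linForm κ + linForm κ' := linFormL.map_add κ κ'

section param

variable {n : ℕ}

/-- Restriction of polynomials to the linear space spanned by `y`. -/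
def param (y : Fin n → Fin 6 → ℂ) : Poly →ₐ[ℂ] MvPolynomial (Fin n) ℂ :=
  aeval fun i => ∑ j, C (y j i) * X j

theorem aeval_param {R : Type*} [CommRing R] [Algebra ℂ R] (y : Fin n → Fin 6 → ℂ) (η : Fin n → R)
    (G : Poly) : aeval η (param y G) =
      aeval (fun i => ∑ j, algebraMap ℂ R (y j i) * η j) G := by
  rw [param, comp_aeval_apply]
  congr 2
  ext i
  simp

theorem eval_param (y : Fin n → Fin 6 → ℂ) (η : Fin n → ℂ) (G : Poly) :
    eval η (param y G) = eval (∑ j, η j • y j) G := by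
  rw [← aeval_eq_eval, aeval_param, aeval_eq_eval]
  congr 2
  ext i
  simp [Finset.sum_apply, mul_comm]

theorem mem_linearIdeal_span (y : Fin n → Fin 6 → ℂ) (G : Poly) :
    G ∈ linearIdeal (Submodule.span ℂ (Set.range y)) ↔ param y G = 0 := by
  constructor
  · intro h
    apply MvPolynomial.funext
    intro η
    rw [eval_param, map_zero, ← aeval_eq_eval]
    exact h _ ((Submodule.mem_span_range_iff_exists_fun ℂ).mpr ⟨η, rfl⟩)
  · intro h a ha
    obtain ⟨η, rfl⟩ := (Submodule.mem_span_range_iff_exists_fun ℂ).mp ha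
    rw [aeval_eq_eval, ← eval_param, h, map_zero]

theorem param_isHomogeneous (y : Fin n → Fin 6 → ℂ) {G : Poly} {d : ℕ} (h : G.IsHomogeneous d) :
    (param y G).IsHomogeneous d := by
  have := h.aeval (n := 1) (fun i => ∑ j, C (y j i) * X j : Fin 6 → MvPolynomial (Fin n) ℂ)
    fun i => IsHomogeneous.sum _ _ _ fun j _ => isHomogeneous_C_mul_X _ j
  rwa [one_mul] at this

/-- A section of `param`. -/
def sect (ℓ : Fin n → Module.Dual ℂ (Fin 6 → ℂ)) : MvPolynomial (Fin n) ℂ →ₐ[ℂ] Poly :=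
  aeval fun j => linForm (ℓ j)

theorem param_sect {y : Fin n → Fin 6 → ℂ} {ℓ : Fin n → Module.Dual ℂ (Fin 6 → ℂ)}
    (h : ∀ i j, ℓ i (y j) = if i = j then 1 else 0) (p : MvPolynomial (Fin n) ℂ) :
    param y (sect ℓ p) = p := by
  rw [sect, comp_aeval_apply]
  have : (fun i => param y (linForm (ℓ i))) = X := by
    ext1 i
    apply MvPolynomial.funext
    intro η
    rw [eval_param, eval_linForm]
    simp [h]
  rw [this, aeval_X_left_apply]

/-- Modulo linear forms vanishing on the subspace, each coordinate equals the section of its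
restriction, hence so does each polynomial. -/
theorem linearIdeal_eq_span {y : Fin n → Fin 6 → ℂ} (hy : LinearIndependent ℂ y) :
    linearIdeal (Submodule.span ℂ (Set.range y)) =
      Ideal.span (linForm '' {κ | ∀ a ∈ Submodule.span ℂ (Set.range y), κ a = 0}) := by
  obtain ⟨ℓ, hℓ⟩ := exists_dual_family hy
  apply le_antisymm
  · intro G hG
    rw [mem_linearIdeal_span] at hG
    set I := Ideal.span (linForm '' {κ | ∀ a ∈ Submodule.span ℂ (Set.range y), κ a = 0})
    have h : (Ideal.Quotient.mkₐ ℂ I) =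
        (Ideal.Quotient.mkₐ ℂ I).comp ((sect ℓ).comp (param y)) := by
      apply MvPolynomial.algHom_ext
      intro i
      rw [← sub_eq_zero, AlgHom.comp_apply, ← map_sub, Ideal.Quotient.mkₐ_eq_mk,
        Ideal.Quotient.eq_zero_iff_mem]
      apply Ideal.subset_span
      refine ⟨LinearMap.proj i - ∑ j, y j i • ℓ j, ?_, ?_⟩
      · intro a ha
        obtain ⟨η, rfl⟩ := (Submodule.mem_span_range_iff_exists_fun ℂ).mp ha
        simp [hℓ]
      · apply MvPolynomial.funext
        intro a
        rw [eval_linForm]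
        simp [param, sect, eval_linForm]
    have h2 := AlgHom.congr_fun h G
    rw [AlgHom.comp_apply, AlgHom.comp_apply, hG, map_zero, map_zero, Ideal.Quotient.mkₐ_eq_mk,
      Ideal.Quotient.eq_zero_iff_mem] at h2
    exact h2
  · rw [Ideal.span_le]
    rintro _ ⟨κ, hκ, rfl⟩ a ha
    rw [aeval_eq_eval, eval_linForm]
    exact hκ a ha

/-- Restriction to the subspace is surjective with kernel its linear ideal, so membership becomes
divisibility in the coordinate ring of the subspace. All comparisons of conics take this form. -/
theorem mem_linearIdeal_sup {y : Fin n → Fin 6 → ℂ} (hy : LinearIndependent ℂ y) (q G : Poly) :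
    G ∈ linearIdeal (Submodule.span ℂ (Set.range y)) ⊔ Ideal.span {q} ↔
      param y q ∣ param y G := by
  obtain ⟨ℓ, hℓ⟩ := exists_dual_family hy
  constructor
  · intro h
    obtain ⟨A, hA, B, hB, rfl⟩ := Submodule.mem_sup.mp h
    obtain ⟨r, rfl⟩ := Ideal.mem_span_singleton.mp hB
    rw [map_add, (mem_linearIdeal_span y A).mp hA, zero_add, map_mul]
    exact dvd_mul_right _ _
  · rintro ⟨r, hr⟩
    have h1 : G - q * sect ℓ r ∈ linearIdeal (Submodule.span ℂ (Set.range y)) := by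
      rw [mem_linearIdeal_span, map_sub, map_mul, param_sect hℓ, hr, sub_self]
    rw [← sub_add_cancel G (q * sect ℓ r)]
    exact Submodule.add_mem_sup h1 (Ideal.mul_mem_right _ _ (Ideal.mem_span_singleton_self q))

end param

theorem Bil.ext_algebraMap_left (T : Bil) {R : Type*} [CommRing R] [Algebra ℂ R] (u : Fin 6 → ℂ)
    (y : Fin 6 → R) : T.ext (fun i => algebraMap ℂ R (u i)) y = aeval y (linForm (T u)) := by
  simp only [Bil.ext, linForm, map_sum, map_mul, aeval_X, algHom_C]
  rw [Finset.sum_comm]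
  refine Finset.sum_congr rfl fun j _ => ?_
  conv_rhs => rw [pi_sum_single u]
  simp only [map_sum, map_smul, LinearMap.sum_apply, LinearMap.smul_apply, smul_eq_mul, map_mul,
    Finset.sum_mul]
  refine Finset.sum_congr rfl fun i _ => ?_
  ring

theorem Bil.ext_comb (T : Bil) {R : Type*} [CommRing R] [Algebra ℂ R] {u v : Fin 6 → ℂ}
    {x : Fin 6 → R} (y : Fin 6 → R) {s t : R}
    (hx : ∀ i, x i = s * algebraMap ℂ R (u i) + t * algebraMap ℂ R (v i)) :
    T.ext x y = s * aeval y (linForm (T u)) + t * aeval y (linForm (T v)) := by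
  have : x = s • (fun i => algebraMap ℂ R (u i)) + t • fun i => algebraMap ℂ R (v i) :=
    _root_.funext hx
  rw [this, Bil.ext_add_left, Bil.ext_smul_left, Bil.ext_smul_left, Bil.ext_algebraMap_left,
    Bil.ext_algebraMap_left]

/-- Applied to scalar multiples k₀κ, k₁κ, k₂κ, the duality with triples kills every binary quadratic
form in s, t times κ(y); the square of a coordinate of x is such a form. -/
theorem pencil_mul_linForm_eq_zero {b : Bil} {u v : Fin 6 → ℂ} {P : Submodule ℂ (Fin 6 → ℂ)}
    (hP : ∀ Y, PencilTriple b u v Y → ∀ k, Y k ∈ P) {R : Type*} [CommRing R] [Algebra ℂ R]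
    {x y : Fin 6 → R} {s t : R}
    (hx : ∀ i, x i = s * algebraMap ℂ R (u i) + t * algebraMap ℂ R (v i))
    (hT : ∀ T ∈ graphForms b, T.ext x y = 0) {κ : Module.Dual ℂ (Fin 6 → ℂ)}
    (hκ : ∀ a ∈ P, κ a = 0) (i : Fin 6) : x i ^ 2 * aeval y (linForm κ) = 0 := by
  have hk : ∀ k : Fin 3 → ℂ, (algebraMap ℂ R (k 0) * s ^ 2 + algebraMap ℂ R (k 1) * (s * t) +
        algebraMap ℂ R (k 2) * t ^ 2) * aeval y (linForm κ) = 0 := by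
    intro k
    obtain ⟨T, hT1, T', hT2, e0, e1, e2⟩ := exists_graphForms_of_forall_triple (b := b) (u := u)
      (v := v) (κ := fun i => k i • κ) (fun Y hY => by simp [hκ _ (hP Y hY _)])
    have h1 := hT T hT1
    have h2 := hT T' hT2
    rw [Bil.ext_comb T y hx] at h1
    rw [Bil.ext_comb T' y hx] at h2
    have f : ∀ c : ℂ, aeval y (linForm (c • κ)) = algebraMap ℂ R c * aeval y (linForm κ) :=
      fun c => by
        rw [show linForm (c • κ) = c • linForm κ from linFormL.map_smul c κ, map_smul,
          Algebra.smul_def]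
    have e0' := congrArg (fun κ => aeval y (linForm κ)) e0
    have e1' := congrArg (fun κ => aeval y (linForm κ)) e1
    have e2' := congrArg (fun κ => aeval y (linForm κ)) e2
    simp only [f, linForm_add, map_add] at e0' e1' e2'
    linear_combination s * h1 + t * h2 - s ^ 2 * e0' - s * t * e1' - t ^ 2 * e2'
  -- The coefficients of (s u_i + t v_i)².
  have := hk ![u i ^ 2, 2 * u i * v i, v i ^ 2]
  simp only [Matrix.cons_val, map_mul, map_pow, map_ofNat] at this
  rw [hx]
  linear_combination this

end VeroneseFano
end

/-! ### The equation of the conic, and its vanishing on the total transform. -/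

open MvPolynomial
noncomputable section
namespace VeroneseFano

open Matrix

theorem exists_eval_add_of_isHomogeneous_one {σ : Type*} {g : MvPolynomial σ ℂ}
    (hg : g.IsHomogeneous 1) (a c : σ → ℂ) : eval (a + c) g = eval a g + eval c g := by
  have h : g ∈ homogeneousSubmodule σ ℂ 1 := hg
  rw [homogeneousSubmodule_one_eq_span_X] at h
  clear hg
  induction h using Submodule.span_induction with
  | mem x hx => obtain ⟨i, rfl⟩ := hx; simp
  | zero => simp
  | add x y _ _ hx hy => rw [map_add, map_add, map_add, hx, hy]; ring
  | smul t x _ hx => rw [smul_eval, smul_eval, smul_eval, hx]; ring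

/-- A repeated nonunit factor makes a quadratic form a constant times the square of a linear form,
and such a form has vanishing 2 × 2 Gram determinants. -/
theorem squarefree_of_gram_ne_zero {σ : Type*} {c : MvPolynomial σ ℂ} (hc : c.IsHomogeneous 2)
    (h : ∃ η η', 4 * eval η c * eval η' c - (eval (η + η') c - eval η c - eval η' c) ^ 2 ≠ 0) :
    Squarefree c := by
  rintro g ⟨k, rfl⟩
  by_contra hg
  obtain ⟨η, η', h⟩ := h
  have h0 : g * g * k ≠ 0 := fun h0 => h (by rw [h0]; simp)
  have hg0 : g ≠ 0 := left_ne_zero_of_mul (left_ne_zero_of_mul h0)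
  have hk0 : k ≠ 0 := right_ne_zero_of_mul h0
  have hdeg := hc.totalDegree h0
  rw [totalDegree_mul_of_isDomain (mul_ne_zero hg0 hg0) hk0,
    totalDegree_mul_of_isDomain hg0 hg0] at hdeg
  have hdg : g.totalDegree ≠ 0 := fun hd => by
    rw [totalDegree_eq_zero_iff_eq_C] at hd
    rw [hd] at hg hg0
    exact hg ((isUnit_iff_ne_zero.mpr fun h => hg0 (by rw [h, C_0])).map C)
  have hdg1 : g.totalDegree = 1 := by omega
  obtain ⟨κ, rfl⟩ : ∃ κ, k = C κ := ⟨_, totalDegree_eq_zero_iff_eq_C.mp (by omega)⟩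
  have hκ : κ ≠ 0 := fun h => hk0 (by rw [h, C_0])
  have hsum := sum_homogeneousComponent g
  rw [hdg1, Finset.sum_range_succ, Finset.sum_range_one, homogeneousComponent_zero] at hsum
  have h00 : eval 0 (g * g * C κ) = 0 := by
    have := congrArg (eval (0 : σ → ℂ)) (homogeneousComponent_of_mem (m := 0) (n := 2) hc)
    rw [homogeneousComponent_zero] at this
    simpa [eval_zero, constantCoeff_eq] using this
  have hc0 : coeff 0 g = 0 := by
    rw [map_mul, map_mul, eval_C, eval_zero, constantCoeff_eq] at h00
    exact mul_self_eq_zero.mp ((mul_eq_zero.mp h00).resolve_right hκ)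
  rw [hc0, C_0, zero_add] at hsum
  have hadd : eval (η + η') g = eval η g + eval η' g := by
    rw [← hsum]
    exact exists_eval_add_of_isHomogeneous_one (homogeneousComponent_isHomogeneous 1 g) _ _
  apply h
  simp only [map_mul, eval_C, hadd]
  ring

section frame

variable {b : Bil} {x y : Fin 3 → Fin 6 → ℂ} {s₁ s₂ : Matrix (Fin 3) (Fin 3) ℂ}

/-- A, B and 1 are independent. The functionals reading off the A and B coefficients kill 1, so they
are traces against traceless matrices; s₁ and s₂ are therefore restrictions of equations of the
graph. -/
theorem ConicFrame.exists_traceForms (h : ConicFrame x y s₁ s₂) :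
    ∃ M₁ M₂ : Matrix (Fin 3) (Fin 3) ℂ, M₁.trace = 0 ∧ M₂.trace = 0 ∧ ∀ i j,
      traceForm M₁ (x i) (y j) = s₁ i j ∧ traceForm M₂ (x i) (y j) = s₂ i j := by
  obtain ⟨A, B, τ, hAB, hmul⟩ := h.mul
  have hi : LinearIndependent ℂ ![A, B, 1] := by
    rw [Fintype.linearIndependent_iff]
    intro c hc
    simp only [Fin.sum_univ_three, Matrix.cons_val] at hc
    obtain ⟨h0, h1⟩ := hAB _ _ _ hc
    rw [h0, h1, zero_smul, zero_smul, zero_add, zero_add] at hc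
    have h2 : c 2 = 0 := by simpa using congrFun (congrFun hc 0) 0
    intro i
    fin_cases i <;> assumption
  obtain ⟨ℓ, hℓ⟩ := exists_dual_family hi
  have hM : ∀ φ : Module.Dual ℂ (Matrix (Fin 3) (Fin 3) ℂ), ∃ M : Matrix (Fin 3) (Fin 3) ℂ,
      ∀ N, (M * N).trace = φ N := by
    intro φ
    refine ⟨Matrix.of fun i j => φ (Matrix.single j i 1), fun N => ?_⟩
    conv_rhs => rw [Matrix.matrix_eq_sum_single N]
    simp only [map_sum, Matrix.trace, Matrix.diag, Matrix.mul_apply, Matrix.of_apply]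
    rw [Finset.sum_comm]
    refine Finset.sum_congr rfl fun i _ => Finset.sum_congr rfl fun j _ => ?_
    rw [show Matrix.single i j (N i j) = N i j • Matrix.single i j 1 by simp, map_smul, smul_eq_mul,
      mul_comm]
  have hf : ∀ k : Fin 3, k ≠ 2 → ∃ M : Matrix (Fin 3) (Fin 3) ℂ, M.trace = 0 ∧ ∀ i j,
      traceForm M (x i) (y j) = s₁ i j * ℓ k A + s₂ i j * ℓ k B := by
    intro k hk
    obtain ⟨M, hM⟩ := hM (ℓ k)
    have h1 : ℓ k 1 = 0 := by simpa [hk] using hℓ k 2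
    refine ⟨M, by rw [← mul_one M, hM, h1], fun i j => ?_⟩
    rw [traceForm_apply, hmul, hM, map_add, map_add, map_smul, map_smul, map_smul, h1]
    simp
  obtain ⟨M₁, hM₁, e₁⟩ := hf 0 (by decide)
  obtain ⟨M₂, hM₂, e₂⟩ := hf 1 (by decide)
  have hA0 : ℓ 0 A = 1 := by simpa using hℓ 0 0
  have hB0 : ℓ 0 B = 0 := by simpa using hℓ 0 1
  have hA1 : ℓ 1 A = 0 := by simpa using hℓ 1 0
  have hB1 : ℓ 1 B = 1 := by simpa using hℓ 1 1
  refine ⟨M₁, M₂, hM₁, hM₂, fun i j => ⟨?_, ?_⟩⟩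
  · rw [e₁, hA0, hB0]; ring
  · rw [e₂, hA1, hB1]; ring

theorem ConicFrame.exists_forms (h : ConicFrame x y s₁ s₂) (b : Bil) :
    ∃ T₁ ∈ graphForms b, ∃ T₂ ∈ graphForms b, ∀ i j,
      T₁ (x i) (y j) = s₁ i j ∧ T₂ (x i) (y j) = s₂ i j := by
  obtain ⟨M₁, M₂, h₁, h₂, h⟩ := h.exists_traceForms
  exact ⟨_, traceForm_mem b h₁, _, traceForm_mem b h₂, h⟩

/-- The equation of the total transform of the line spanned by `u` and `v`. -/
def conicEq (T₁ T₂ : Bil) (u v : Fin 6 → ℂ) : Poly :=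
  linForm (T₁ u) * linForm (T₂ v) - linForm (T₁ v) * linForm (T₂ u)

theorem conicEq_isHomogeneous (T₁ T₂ : Bil) (u v : Fin 6 → ℂ) :
    (conicEq T₁ T₂ u v).IsHomogeneous 2 :=
  ((linForm_isHomogeneous _).mul (linForm_isHomogeneous _)).sub
    ((linForm_isHomogeneous _).mul (linForm_isHomogeneous _))

theorem form_sum {T : Bil} {s : Matrix (Fin 3) (Fin 3) ℂ} (h : ∀ i j, T (x i) (y j) = s i j)
    (i : Fin 3) (η : Fin 3 → ℂ) : T (x i) (∑ j, η j • y j) = (s *ᵥ η) i := by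
  simp [h, Matrix.mulVec, dotProduct, mul_comm]

theorem eval_param_conicEq {T₁ T₂ : Bil}
    (h : ∀ i j, T₁ (x i) (y j) = s₁ i j ∧ T₂ (x i) (y j) = s₂ i j) (η : Fin 3 → ℂ) :
    eval η (param y (conicEq T₁ T₂ (x 0) (x 1))) = conicForm s₁ s₂ η := by
  rw [eval_param, conicEq, map_sub, map_mul, map_mul, eval_linForm, eval_linForm, eval_linForm,
    eval_linForm, form_sum (fun i j => (h i j).1), form_sum (fun i j => (h i j).1),
    form_sum (fun i j => (h i j).2), form_sum (fun i j => (h i j).2), conicForm, cross_apply]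
  rfl

/-- Cramer's rule: two linear equations in s, t hold, so their determinant annihilates s and t,
hence every coordinate of x. -/
theorem pencil_mul_conicEq_eq_zero {u v : Fin 6 → ℂ} {R : Type*} [CommRing R] [Algebra ℂ R]
    {x y : Fin 6 → R} {s t : R}
    (hx : ∀ i, x i = s * algebraMap ℂ R (u i) + t * algebraMap ℂ R (v i))
    {T₁ T₂ : Bil} (h₁ : T₁.ext x y = 0) (h₂ : T₂.ext x y = 0) (i : Fin 6) :
    x i * aeval y (conicEq T₁ T₂ u v) = 0 := by
  rw [Bil.ext_comb T₁ y hx] at h₁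
  rw [Bil.ext_comb T₂ y hx] at h₂
  rw [hx, conicEq, map_sub, map_mul, map_mul]
  linear_combination (algebraMap ℂ R (u i) * aeval y (linForm (T₂ v)) -
    algebraMap ℂ R (v i) * aeval y (linForm (T₂ u))) * h₁ -
    (algebraMap ℂ R (u i) * aeval y (linForm (T₁ v)) -
    algebraMap ℂ R (v i) * aeval y (linForm (T₁ u))) * h₂

theorem AdaptedFrame.le_totalTransformIdeal (h : AdaptedFrame b x y s₁ s₂) {T₁ T₂ : Bil}
    (hT₁ : T₁ ∈ graphForms b) (hT₂ : T₂ ∈ graphForms b) :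
    linearIdeal (Submodule.span ℂ (Set.range y)) ⊔ Ideal.span {conicEq T₁ T₂ (x 0) (x 1)} ≤
      totalTransformIdeal (cubicOf b) (Submodule.span ℂ {x 0, x 1}) := by
  set I := preimageIdeal (cubicOf b) (Submodule.span ℂ {x 0, x 1}) with hI
  let π : MvPolynomial (Fin 6 ⊕ Fin 6) ℂ →ₐ[ℂ] _ := Ideal.Quotient.mkₐ ℂ I
  obtain ⟨ℓ, hℓ⟩ := exists_dual_family h.indep_x
  -- In the quotient the coordinates of the first factor lie on the pencil, with parameters s, t
  -- given by the dual functionals of x₀ and x₁.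
  have hx : ∀ i, π (X (Sum.inl i)) =
      π (rename Sum.inl (linForm (ℓ 0))) * algebraMap ℂ _ (x 0 i) +
        π (rename Sum.inl (linForm (ℓ 1))) * algebraMap ℂ _ (x 1 i) := by
    intro i
    have hmem : X i - (linForm (ℓ 0) * C (x 0 i) + linForm (ℓ 1) * C (x 1 i)) ∈
        linearIdeal (Submodule.span ℂ {x 0, x 1}) := by
      intro a ha
      obtain ⟨s, t, rfl⟩ := Submodule.mem_span_pair.mp ha
      rw [aeval_eq_eval]
      simp [eval_linForm, hℓ]
    have h2 := Ideal.mem_map_of_mem (rename (Sum.inl : Fin 6 → Fin 6 ⊕ Fin 6)) hmem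
    have h3 : π (rename Sum.inl (X i - (linForm (ℓ 0) * C (x 0 i) +
        linForm (ℓ 1) * C (x 1 i)))) = 0 :=
      Ideal.Quotient.eq_zero_iff_mem.mpr (Ideal.mem_sup_right h2)
    simp only [map_sub, map_add, map_mul, rename_X, rename_C, sub_eq_zero] at h3
    rw [h3]
    rfl
  have hT : ∀ T ∈ graphForms b,
      T.ext (fun i => π (X (Sum.inl i))) (fun i => π (X (Sum.inr i))) = 0 := by
    intro T hT
    rw [← Bil.map_ext]
    apply Ideal.Quotient.eq_zero_iff_mem.mpr
    apply Ideal.mem_sup_left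
    rintro _ ⟨a, t, ha, rfl⟩
    rw [Bil.map_ext]
    simp only [aeval_X, Sum.elim_inl, Sum.elim_inr]
    rw [Bil.ext_apply, cremona_eq, map_smul]
    rw [eval_cubicOf] at ha
    rw [hT a ha, smul_zero]
  have hr : ∀ G : Poly, aeval (fun i => π (X (Sum.inr i))) G = π (rename Sum.inr G) := by
    intro G
    have : aeval (fun i => π (X (Sum.inr i))) = π.comp (rename Sum.inr) := by
      apply MvPolynomial.algHom_ext
      intro i
      simp
    rw [this]
    rfl
  rw [linearIdeal_eq_span h.indep_y, sup_le_iff, Ideal.span_le, Ideal.span_le]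
  constructor
  · rintro _ ⟨κ, hκ, rfl⟩ i j
    refine ⟨2, Ideal.Quotient.eq_zero_iff_mem.mp (?_ : π _ = 0)⟩
    have := pencil_mul_linForm_eq_zero (P := Submodule.span ℂ (Set.range y)) h.triple hx hT hκ i
    rw [hr] at this
    rw [map_mul, map_pow, map_mul]
    linear_combination π (X (Sum.inr j)) ^ 2 * this
  · rintro _ rfl i j
    refine ⟨1, Ideal.Quotient.eq_zero_iff_mem.mp (?_ : π _ = 0)⟩
    have := pencil_mul_conicEq_eq_zero hx (hT _ hT₁) (hT _ hT₂) i
    rw [hr] at this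
    rw [map_mul, map_pow, map_mul]
    linear_combination π (X (Sum.inr j)) * this

end frame

end VeroneseFano
end

/-! ### The total transform is exactly the conic. -/

open MvPolynomial
noncomputable section
namespace VeroneseFano

open Matrix

section frame

variable {b : Bil} {x y : Fin 3 → Fin 6 → ℂ} {s₁ s₂ : Matrix (Fin 3) (Fin 3) ℂ}

theorem preimageIdeal_le_ker {F : Poly} {L : Submodule ℂ (Fin 6 → ℂ)} {R : Type*} [CommRing R]
    [Algebra ℂ R] {a y : Fin 6 → R} (h₁ : ∀ g ∈ graphIdeal F, aeval (Sum.elim a y) g = 0)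
    (h₂ : ∀ G ∈ linearIdeal L, aeval a G = 0) {g : MvPolynomial (Fin 6 ⊕ Fin 6) ℂ}
    (hg : g ∈ preimageIdeal F L) : aeval (Sum.elim a y) g = 0 := by
  have : preimageIdeal F L ≤ RingHom.ker (aeval (R := ℂ) (Sum.elim a y)) := by
    refine sup_le (fun g hg => h₁ g hg) ?_
    rw [Ideal.map_le_iff_le_comap]
    intro G hG
    rw [Ideal.mem_comap, RingHom.mem_ker, aeval_rename]
    exact h₂ G hG
  exact this hg

theorem aeval_eq_zero_of_mem_totalTransformIdeal {F : Poly} {L : Submodule ℂ (Fin 6 → ℂ)}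
    {R : Type*} [CommRing R] [Algebra ℂ R] {a y : Fin 6 → R}
    (h₁ : ∀ g ∈ graphIdeal F, aeval (Sum.elim a y) g = 0) (h₂ : ∀ G ∈ linearIdeal L, aeval a G = 0)
    {i j : Fin 6} (hi : IsUnit (a i)) (hj : IsUnit (y j)) {G : Poly}
    (hG : G ∈ totalTransformIdeal F L) : aeval y G = 0 := by
  obtain ⟨N, hN⟩ := hG i j
  have := preimageIdeal_le_ker h₁ h₂ hN
  rw [map_mul, map_pow, map_mul, aeval_X, aeval_X, aeval_rename] at this
  exact (((hi.mul hj).pow N).mul_right_eq_zero).mp this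

/-- On the conic the 2 × 2 system in (s, t) is degenerate. Its kernel gives the point of the line
over which the conic point lifts to the graph. -/
theorem ConicFrame.exists_point (h : ConicFrame x y s₁ s₂) {η : Fin 3 → ℂ}
    (hη : conicForm s₁ s₂ η = 0) : ∃ s t : ℂ, s • x 0 + t • x 1 ≠ 0 ∧
      s * (s₁ *ᵥ η) 0 + t * (s₁ *ᵥ η) 1 = 0 ∧ s * (s₂ *ᵥ η) 0 + t * (s₂ *ᵥ η) 1 = 0 := by
  have hne : ∀ s t : ℂ, s ≠ 0 ∨ t ≠ 0 → s • x 0 + t • x 1 ≠ 0 := by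
    intro s t hst h0
    have := Fintype.linearIndependent_iff.mp h.indep_x ![s, t, 0]
      (by simpa [Fin.sum_univ_three] using h0)
    rcases hst with hs | ht
    · exact hs (this 0)
    · exact ht (this 1)
  rw [conicForm, cross_apply] at hη
  simp only [Matrix.cons_val] at hη
  set p := s₁ *ᵥ η
  set r := s₂ *ᵥ η
  by_cases h1 : p 1 ≠ 0 ∨ -p 0 ≠ 0
  · exact ⟨p 1, -p 0, hne _ _ h1, by ring, by linear_combination -hη⟩
  · have h1 : p 1 = 0 ∧ p 0 = 0 := by simpa using h1
    by_cases h2 : r 1 ≠ 0 ∨ -r 0 ≠ 0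
    · exact ⟨r 1, -r 0, hne _ _ h2, by rw [h1.1, h1.2]; ring, by ring⟩
    · have h2 : r 1 = 0 ∧ r 0 = 0 := by simpa using h2
      exact ⟨1, 0, hne _ _ (Or.inl one_ne_zero), by rw [h1.1, h1.2]; ring,
        by rw [h2.1, h2.2]; ring⟩

theorem ConicFrame.mul_sum (h : ConicFrame x y s₁ s₂) : ∃ (A B : Matrix (Fin 3) (Fin 3) ℂ)
    (τ : Matrix (Fin 3) (Fin 3) ℂ), ∀ i η, symMat (x i) * symMat (∑ j, η j • y j) =
      (s₁ *ᵥ η) i • A + (s₂ *ᵥ η) i • B + (τ *ᵥ η) i • 1 := by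
  obtain ⟨A, B, τ, -, hmul⟩ := h.mul
  refine ⟨A, B, τ, fun i η => ?_⟩
  simp only [← symMatL_apply, map_sum, map_smul, Finset.mul_sum, mul_smul_comm]
  simp only [symMatL_apply, hmul, smul_add, smul_smul, Finset.sum_add_distrib, ← Finset.sum_smul,
    Matrix.mulVec, dotProduct, mul_comm]

theorem AdaptedFrame.eval_eq_zero (h : AdaptedFrame b x y s₁ s₂) (hF : Squarefree (cubicOf b))
    (hB : ∃ e n, b (ver e) (pol (ver e) n) ≠ 0)
    (hL : ∀ a ∈ Submodule.span ℂ {x 0, x 1}, b a (crem a) = 0) {η : Fin 3 → ℂ} (hη0 : η ≠ 0)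
    (hη : conicForm s₁ s₂ η = 0) {G : Poly}
    (hG : G ∈ totalTransformIdeal (cubicOf b) (Submodule.span ℂ {x 0, x 1})) :
    eval (∑ j, η j • y j) G = 0 := by
  obtain ⟨s, t, hst, e₁, e₂⟩ := h.exists_point hη
  obtain ⟨A, B, τ, hmul⟩ := h.mul_sum
  obtain ⟨k₁, k₂, hb⟩ := h.bil
  have hy : ∑ j, η j • y j ≠ 0 := fun h0 =>
    hη0 (_root_.funext (Fintype.linearIndependent_iff.mp h.indep_y η h0))
  have ha : s • x 0 + t • x 1 ∈ Submodule.span ℂ {x 0, x 1} :=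
    Submodule.mem_span_pair.mpr ⟨s, t, rfl⟩
  have hprod : symMat (s • x 0 + t • x 1) * symMat (∑ j, η j • y j) =
      (s * (τ *ᵥ η) 0 + t * (τ *ᵥ η) 1) • 1 := by
    rw [symMat_add, symMat_smul, symMat_smul, add_mul, smul_mul_assoc, smul_mul_assoc, hmul, hmul]
    have : s • ((s₁ *ᵥ η) 0 • A + (s₂ *ᵥ η) 0 • B + (τ *ᵥ η) 0 • (1 : Matrix (Fin 3) (Fin 3) ℂ)) +
        t • ((s₁ *ᵥ η) 1 • A + (s₂ *ᵥ η) 1 • B + (τ *ᵥ η) 1 • 1) =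
        (s * (s₁ *ᵥ η) 0 + t * (s₁ *ᵥ η) 1) • A + (s * (s₂ *ᵥ η) 0 + t * (s₂ *ᵥ η) 1) • B +
          (s * (τ *ᵥ η) 0 + t * (τ *ᵥ η) 1) • 1 := by module
    rw [this, e₁, e₂, zero_smul, zero_smul, zero_add, zero_add]
  have hby : b (s • x 0 + t • x 1) (∑ j, η j • y j) = 0 := by
    have h0 : b (x 0) (∑ j, η j • y j) = k₁ * (s₁ *ᵥ η) 0 + k₂ * (s₂ *ᵥ η) 0 := by
      simp only [map_sum, map_smul, smul_eq_mul, (hb _).1, Matrix.mulVec, dotProduct,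
        Finset.mul_sum, ← Finset.sum_add_distrib]
      exact Finset.sum_congr rfl fun j _ => by ring
    have h1 : b (x 1) (∑ j, η j • y j) = k₁ * (s₁ *ᵥ η) 1 + k₂ * (s₂ *ᵥ η) 1 := by
      simp only [map_sum, map_smul, smul_eq_mul, (hb _).2, Matrix.mulVec, dotProduct,
        Finset.mul_sum, ← Finset.sum_add_distrib]
      exact Finset.sum_congr rfl fun j _ => by ring
    rw [map_add, map_smul, map_smul, LinearMap.add_apply, LinearMap.smul_apply,
      LinearMap.smul_apply, h0, h1, smul_eq_mul, smul_eq_mul]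
    linear_combination k₁ * e₁ + k₂ * e₂
  obtain ⟨i, hi⟩ := Function.ne_iff.mp hst
  obtain ⟨j, hj⟩ := Function.ne_iff.mp hy
  rw [← aeval_eq_eval]
  exact aeval_eq_zero_of_mem_totalTransformIdeal
    (fun g hg => eval_eq_zero_of_mem_graphIdeal hF hB hst hprod (hL _ ha) hby hg)
    (fun G hG => hG _ ha) (isUnit_iff_ne_zero.mpr hi) (isUnit_iff_ne_zero.mpr hj) hG

/-- The charts of the total transform do not see the origin of the affine cone, and G need not be
homogeneous; its value at 0 follows by continuity along a line. -/
theorem eval_zero_of_line {G : Poly} {a : Fin 6 → ℂ} (h : ∀ t : ℂ, t ≠ 0 → eval (t • a) G = 0) :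
    eval 0 G = 0 := by
  let p : Polynomial ℂ := aeval (fun i => Polynomial.C (a i) * Polynomial.X) G
  have hp : ∀ t, p.eval t = eval (t • a) G := by
    intro t
    have := comp_aeval_apply (R := ℂ) (fun i => Polynomial.C (a i) * Polynomial.X)
      (Polynomial.aeval t : Polynomial ℂ →ₐ[ℂ] ℂ) G
    rw [← Polynomial.coe_aeval_eq_eval]
    change Polynomial.aeval t p = _
    rw [this, aeval_eq_eval]
    congr 2
    ext i
    rw [map_mul, Polynomial.aeval_C, Polynomial.aeval_X, Pi.smul_apply, smul_eq_mul, mul_comm]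
    rfl
  have h0 : p = 0 := by
    apply Polynomial.eq_zero_of_infinite_isRoot
    apply (Set.finite_singleton (0 : ℂ)).infinite_compl.mono
    intro t ht
    exact (hp t).trans (h t ht)
  have := hp 0
  rw [h0, zero_smul] at this
  rw [← this, Polynomial.eval_zero]

theorem AdaptedFrame.dvd_of_reduced (h : AdaptedFrame b x y s₁ s₂) (hF : Squarefree (cubicOf b))
    (hB : ∃ e n, b (ver e) (pol (ver e) n) ≠ 0)
    (hL : ∀ a ∈ Submodule.span ℂ {x 0, x 1}, b a (crem a) = 0) (hr : ConicReduced s₁ s₂)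
    {q : Poly} (hq : q.IsHomogeneous 2) (hqs : ∀ η, eval η (param y q) = conicForm s₁ s₂ η)
    {G : Poly} (hG : G ∈ totalTransformIdeal (cubicOf b) (Submodule.span ℂ {x 0, x 1})) :
    param y q ∣ param y G := by
  have hsq : Squarefree (param y q) := squarefree_of_gram_ne_zero (param_isHomogeneous y hq) (by
    obtain ⟨η, η', h⟩ := hr
    exact ⟨η, η', by simpa only [hqs] using h⟩)
  apply dvd_of_forall_eval_eq_zero hsq
  intro η hη
  rw [eval_param]
  rw [hqs] at hη
  by_cases hη0 : η = 0
  · obtain ⟨η', hη', h0⟩ := exists_eval_eq_zero_of_not_isUnit (zero_ne_one (α := Fin 3))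
      (G := param y q) (fun hu => by
        have h1 := hu.map (eval (0 : Fin 3 → ℂ))
        rw [hqs] at h1
        simp [conicForm] at h1)
    rw [hη0]
    simp only [Pi.zero_apply, zero_smul, Finset.sum_const_zero]
    apply eval_zero_of_line (a := ∑ j, η' j • y j)
    intro t ht
    have := h.eval_eq_zero hF hB hL (η := t • η') (smul_ne_zero ht hη') (by
      rw [hqs] at h0
      have e : conicForm s₁ s₂ (t • η') = t * t * conicForm s₁ s₂ η' := by
        simp only [conicForm, Matrix.mulVec_smul, map_smul, LinearMap.smul_apply, Pi.smul_apply,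
          smul_eq_mul]
        ring
      rw [e, h0, mul_zero]) hG
    simpa [Finset.smul_sum, smul_smul] using this
  · exact h.eval_eq_zero hF hB hL hη0 hη hG

/-- Over the dual numbers the tangent line becomes a point of V itself, namely the point of e + εe'.
-/
theorem pencil_ver {R : Type*} [CommRing R] [Algebra ℂ R] {ε : R} (hε : ε * ε = 0)
    (e e' : Fin 3 → ℂ) :
    ver (fun i => algebraMap ℂ R (e i) + ε * algebraMap ℂ R (e' i)) =
      fun i => 1 * algebraMap ℂ R (ver e i) + ε * algebraMap ℂ R (symProd e e' i) := by
  ext i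
  fin_cases i <;> simp only [ver, symProd, Fin.zero_eta, Fin.mk_one, Fin.reduceFinMk, Matrix.cons_val, map_mul, map_add, one_mul, map_ofNat]
  · linear_combination algebraMap ℂ R (e' 0) * algebraMap ℂ R (e' 0) * hε
  · linear_combination algebraMap ℂ R (e' 0) * algebraMap ℂ R (e' 1) * hε
  · linear_combination algebraMap ℂ R (e' 0) * algebraMap ℂ R (e' 2) * hε
  · linear_combination algebraMap ℂ R (e' 1) * algebraMap ℂ R (e' 1) * hε
  · linear_combination algebraMap ℂ R (e' 1) * algebraMap ℂ R (e' 2) * hε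
  · linear_combination algebraMap ℂ R (e' 2) * algebraMap ℂ R (e' 2) * hε

theorem symVec_add_right {R : Type*} [CommRing R] (y : Fin 6 → R) (e e' : Fin 3 → R) :
    symVec y (e + e') = symVec y e + symVec y e' := by
  ext i; fin_cases i <;> simp [symVec] <;> ring

theorem symVec_add_left {R : Type*} [CommRing R] (y y' : Fin 6 → R) (e : Fin 3 → R) :
    symVec (y + y') e = symVec y e + symVec y' e := by
  ext i; fin_cases i <;> simp [symVec] <;> ring

theorem symVec_smul_right {R : Type*} [CommRing R] (t : R) (y : Fin 6 → R) (e : Fin 3 → R) :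
    symVec y (t • e) = t • symVec y e := by
  ext i; fin_cases i <;> simp [symVec] <;> ring

theorem symVec_smul_left {R : Type*} [CommRing R] (t : R) (y : Fin 6 → R) (e : Fin 3 → R) :
    symVec (t • y) e = t • symVec y e := by
  ext i; fin_cases i <;> simp [symVec] <;> ring

theorem symVec_algebraMap {R : Type*} [CommRing R] [Algebra ℂ R] (y : Fin 6 → ℂ) (e : Fin 3 → ℂ) :
    symVec (fun i => algebraMap ℂ R (y i)) (fun i => algebraMap ℂ R (e i)) =
      fun i => algebraMap ℂ R (symVec y e i) := by
  ext i; fin_cases i <;> simp [symVec]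

theorem fst_algebraMap_dualNumber (z : ℂ) : (algebraMap ℂ (DualNumber ℂ) z).fst = z := rfl

/-- The relations in `ConicDouble` say that Y = η₀y₀ + η₁y₁ + εη₁y₂ satisfies Y E = 0 and b(E Eᵀ, Y)
= 0 for E = e + εe'. So (E Eᵀ, Y) is a dual-number point of the preimage of the line, moving off η₂
= 0 to first order. -/
theorem AdaptedFrame.aeval_eq_zero_of_double (h : AdaptedFrame b x y s₁ s₂)
    (hF : Squarefree (cubicOf b)) (hB : ∃ e n, b (ver e) (pol (ver e) n) ≠ 0)
    (hd : ConicDouble b x y s₁ s₂) {G : Poly}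
    (hG : G ∈ totalTransformIdeal (cubicOf b) (Submodule.span ℂ {x 0, x 1})) {η₀ η₁ : ℂ}
    (hη : η₁ ≠ 0) :
    aeval ![algebraMap ℂ (DualNumber ℂ) η₀, algebraMap ℂ (DualNumber ℂ) η₁,
      DualNumber.eps * algebraMap ℂ (DualNumber ℂ) η₁] (param y G) = 0 := by
  obtain ⟨-, ⟨e, e', hx₀, hx₁⟩, ⟨m₀, m₁, m₂, m₃⟩, c₀, c₁, c₂, c₃⟩ := hd
  have he : e ≠ 0 := by
    rintro rfl
    apply h.indep_x.ne_zero 0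
    rw [hx₀]; ext i; fin_cases i <;> simp [ver]
  rw [hx₀] at m₀ m₂ m₃
  rw [hx₁] at m₁ m₃
  replace m₀ := symMat_mul_eq_zero he m₀
  replace m₂ := symMat_mul_eq_zero he m₂
  obtain ⟨k, hk⟩ := Function.ne_iff.mp he
  have hk' : e k ≠ 0 := hk
  replace m₁ : symVec (y 0) e' = 0 := by
    ext j
    have := congrFun (congrFun m₁ k) j
    rw [symMat_symProd_mul_apply, m₀, Pi.zero_apply, mul_zero, add_zero] at this
    exact (mul_eq_zero.mp this).resolve_left hk'
  replace m₃ : symVec (y 2) e + symVec (y 1) e' = 0 := by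
    ext j
    have := congrFun (congrFun m₃ k) j
    rw [Matrix.add_apply, symMat_ver_mul_apply, symMat_symProd_mul_apply, m₂, Pi.zero_apply,
      mul_zero, add_zero, ← mul_add] at this
    exact (mul_eq_zero.mp this).resolve_left hk'
  set R := DualNumber ℂ
  set ε : R := DualNumber.eps with hεd
  have hε : ε * ε = 0 := DualNumber.eps_mul_eps
  set ι := algebraMap ℂ R with hι
  let E : Fin 3 → R := fun i => ι (e i) + ε * ι (e' i)
  let Y : Fin 6 → R := ι η₀ • (fun i => ι (y 0 i)) + ι η₁ • (fun i => ι (y 1 i)) +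
    (ε * ι η₁) • fun i => ι (y 2 i)
  have hE : E = (fun i => ι (e i)) + ε • fun i => ι (e' i) := rfl
  have hver : ver E = fun i => 1 * ι (x 0 i) + ε * ι (x 1 i) := by
    rw [hx₀, hx₁]
    exact pencil_ver hε e e'
  have hz : (fun _ => ι 0 : Fin 3 → R) = 0 := by ext1; simp
  have hsv : ∀ (y : Fin 6 → ℂ) (e : Fin 3 → ℂ), symVec (fun i => ι (y i)) (fun i => ι (e i)) =
      fun i => ι (symVec y e i) := symVec_algebraMap
  have hYE : symVec Y E = 0 := by
    have m₃' : (fun i => ι (symVec (y 2) e i)) + (fun i => ι (symVec (y 1) e' i)) = 0 := by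
      ext1 i
      rw [Pi.add_apply, ← map_add, ← Pi.add_apply, m₃]
      simp
    rw [hE]
    simp only [Y, symVec_add_left, symVec_add_right, symVec_smul_left, symVec_smul_right,
      hsv, m₀, m₁, m₂, Pi.zero_apply, hz, smul_zero, zero_add, add_zero]
    have h1 : ε * (ε * ι η₁) = 0 := by rw [← mul_assoc, hε, zero_mul]
    rw [smul_add, smul_smul, smul_smul, h1, zero_smul, add_zero, ← smul_add, m₃', smul_zero]
  have hbY : b.ext (ver E) Y = 0 := by
    have hTy : ∀ u : Fin 6 → ℂ, aeval Y (linForm (b u)) =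
        ι η₀ * ι (b u (y 0)) + ι η₁ * ι (b u (y 1)) + (ε * ι η₁) * ι (b u (y 2)) := by
      intro u
      rw [← Bil.ext_algebraMap_left]
      simp only [Y, Bil.ext_add_right, Bil.ext_smul_right]
      have hc : ∀ w : Fin 6 → ℂ, b.ext (fun i => ι (u i)) (fun i => ι (w i)) = ι (b u w) := by
        intro w
        rw [← Bil.ext_apply]
        exact (Bil.map_ext b (Algebra.ofId ℂ R) u w).symm
      rw [hc, hc, hc]
    rw [Bil.ext_comb b Y (congrFun hver), hTy, hTy, c₀, c₁, c₂]
    have c₃' : ι (b (x 0) (y 2)) + ι (b (x 1) (y 1)) = 0 := by rw [← map_add, c₃, map_zero]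
    simp only [map_zero]
    linear_combination ε * ι η₁ * c₃' + ι η₁ * ι (b (x 1) (y 2)) * hε
  -- E is unimodular over the dual numbers: the coordinate e_k + εe'_k with e_k ≠ 0 has the inverse
  -- 1/e_k - εe'_k/e_k².
  obtain ⟨n, hn⟩ := exists_pol_ver_eq (y := Y) (e := E)
    (d := Pi.single k (ι (e k)⁻¹ - ε * ι (e' k * (e k)⁻¹ ^ 2))) (by
      have h1 : (ι (e k) + ε * ι (e' k)) * (ι (e k)⁻¹ - ε * ι (e' k * (e k)⁻¹ ^ 2)) = 1 := by
        have h2 : ι (e k) * ι (e k)⁻¹ = 1 := by rw [← map_mul, mul_inv_cancel₀ hk', map_one]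
        rw [map_mul, map_pow]
        linear_combination (1 - ε * ι (e' k) * ι (e k)⁻¹) * h2 -
          ι (e' k) * ι (e' k) * ι (e k)⁻¹ ^ 2 * hε
      rw [← Fin.sum_univ_three (fun i => E i * Pi.single (M := fun _ => R) k
        (ι (e k)⁻¹ - ε * ι (e' k * (e k)⁻¹ ^ 2)) i)]
      exact (dotProduct_single E _ k).trans h1) hYE
  have hunit : ∀ z w : ℂ, z ≠ 0 → IsUnit (ι z + ε * ι w) := by
    intro z w hz
    rw [TrivSqZeroExt.isUnit_iff_isUnit_fst, isUnit_iff_ne_zero]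
    rw [TrivSqZeroExt.fst_add, TrivSqZeroExt.fst_mul, hεd, DualNumber.fst_eps, zero_mul, add_zero]
    exact hz
  obtain ⟨i, hi⟩ := Function.ne_iff.mp (h.indep_x.ne_zero 0)
  have hy : η₀ • y 0 + η₁ • y 1 ≠ 0 := by
    intro h0
    have := Fintype.linearIndependent_iff.mp h.indep_y ![η₀, η₁, 0]
      (by simpa [Fin.sum_univ_three] using h0)
    exact hη (this 1)
  obtain ⟨j, hj⟩ := Function.ne_iff.mp hy
  have key := aeval_eq_zero_of_mem_totalTransformIdeal (a := ver E) (y := Y) (i := i) (j := j)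
    (fun g hg => by
      have := aeval_eq_zero_of_mem_graphIdeal hF hB hg E n (by rw [hn]; exact hbY)
      rwa [hn] at this)
    (fun G hG => by
      have hL : Submodule.span ℂ {x 0, x 1} = Submodule.span ℂ (Set.range ![x 0, x 1]) := by
        congr 1
        rw [Matrix.range_cons, Matrix.range_cons, Matrix.range_empty, Set.union_empty]
        rfl
      rw [hL, mem_linearIdeal_span] at hG
      have h1 := aeval_param ![x 0, x 1] ![1, ε] G
      rw [hG, map_zero] at h1
      rw [hver, h1]
      congr 2
      ext1 i
      simp [Fin.sum_univ_two, mul_comm, ι])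
    (by
      rw [hver]
      simp only [one_mul]
      exact hunit _ _ hi)
    (by
      have : Y j = ι ((η₀ • y 0 + η₁ • y 1) j) + ε * ι (η₁ * y 2 j) := by
        simp only [Y, Pi.add_apply, Pi.smul_apply, smul_eq_mul, map_add, map_mul]
        ring
      rw [this]
      exact hunit _ _ hj) hG
  rw [aeval_param, ← key]
  congr 2
  ext1 i
  simp only [Fin.sum_univ_three, Y, ι, Pi.add_apply, Pi.smul_apply, smul_eq_mul, Matrix.cons_val]
  ring

theorem X_two_dvd_of_forall {g : MvPolynomial (Fin 3) ℂ}
    (h : ∀ η₀ η₁ : ℂ, η₁ ≠ 0 → eval ![η₀, η₁, 0] g = 0) : X 2 ∣ g := by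
  have h1 : X 2 ∣ X 1 * g := by
    apply dvd_of_forall_eval_eq_zero X_prime.irreducible.squarefree
    intro a ha
    rw [eval_X] at ha
    have : a = ![a 0, a 1, 0] := by ext i; fin_cases i <;> simp [ha]
    rw [map_mul, eval_X]
    by_cases h1 : a 1 = 0
    · rw [h1, zero_mul]
    · rw [this, h _ _ h1, mul_zero]
  refine ((X_prime (i := (2 : Fin 3))).dvd_or_dvd h1).resolve_left fun h2 => ?_
  rw [X_dvd_X] at h2
  exact absurd h2 (by decide)

theorem AdaptedFrame.dvd_of_double (h : AdaptedFrame b x y s₁ s₂) (hF : Squarefree (cubicOf b))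
    (hB : ∃ e n, b (ver e) (pol (ver e) n) ≠ 0) (hd : ConicDouble b x y s₁ s₂)
    {q : Poly} (hqs : ∀ η, eval η (param y q) = conicForm s₁ s₂ η)
    {G : Poly} (hG : G ∈ totalTransformIdeal (cubicOf b) (Submodule.span ℂ {x 0, x 1})) :
    param y q ∣ param y G := by
  obtain ⟨k, hk, hkη⟩ := hd.1
  have hq : param y q = C k * X 2 ^ 2 := by
    apply MvPolynomial.funext
    intro η
    rw [hqs, hkη]
    simp
  have hu : IsUnit (C k : MvPolynomial (Fin 3) ℂ) := (isUnit_iff_ne_zero.mpr hk).map C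
  rw [hq, hu.mul_left_dvd]
  have key := fun η₀ η₁ hη => h.aeval_eq_zero_of_double hF hB hd hG (η₀ := η₀) (η₁ := η₁) hη
  have hfst : ∀ (η₀ η₁ : ℂ) (p : MvPolynomial (Fin 3) ℂ),
      TrivSqZeroExt.fst (aeval ![algebraMap ℂ (DualNumber ℂ) η₀, algebraMap ℂ (DualNumber ℂ) η₁,
        DualNumber.eps * algebraMap ℂ (DualNumber ℂ) η₁] p) = eval ![η₀, η₁, 0] p := by
    intro η₀ η₁ p
    have := comp_aeval_apply (R := ℂ) ![algebraMap ℂ (DualNumber ℂ) η₀,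
      algebraMap ℂ (DualNumber ℂ) η₁, DualNumber.eps * algebraMap ℂ (DualNumber ℂ) η₁]
      (TrivSqZeroExt.fstHom ℂ ℂ ℂ) p
    rw [TrivSqZeroExt.fstHom_apply] at this
    rw [this, aeval_eq_eval]
    congr 2
    ext i
    fin_cases i
    · rfl
    · rfl
    · exact (TrivSqZeroExt.fst_mul _ _).trans (by rw [DualNumber.fst_eps, zero_mul]; rfl)
  -- The constant part of the dual-number equation gives one factor η₂.
  obtain ⟨p, hp⟩ := X_two_dvd_of_forall (g := param y G) fun η₀ η₁ hη => by
    rw [← hfst, key _ _ hη, TrivSqZeroExt.fst_zero]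
  -- After substituting η₂ = εη₁ the ε-part is η₁ times the value of the quotient on η₂ = 0, which
  -- gives the second factor.
  obtain ⟨r, hr⟩ := X_two_dvd_of_forall (g := p) fun η₀ η₁ hη => by
    have h1 := key η₀ η₁ hη
    rw [hp, map_mul, aeval_X] at h1
    have h2 := congrArg TrivSqZeroExt.snd h1
    rw [TrivSqZeroExt.snd_mul] at h2
    rw [hfst] at h2
    have h3 : TrivSqZeroExt.fst (![algebraMap ℂ (DualNumber ℂ) η₀, algebraMap ℂ (DualNumber ℂ) η₁,
        DualNumber.eps * algebraMap ℂ (DualNumber ℂ) η₁] 2) = 0 :=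
      (TrivSqZeroExt.fst_mul _ _).trans (by rw [DualNumber.fst_eps, zero_mul])
    have h4 : TrivSqZeroExt.snd (![algebraMap ℂ (DualNumber ℂ) η₀, algebraMap ℂ (DualNumber ℂ) η₁,
        DualNumber.eps * algebraMap ℂ (DualNumber ℂ) η₁] 2) = η₁ := by
      refine (TrivSqZeroExt.snd_mul _ _).trans ?_
      rw [DualNumber.fst_eps, DualNumber.snd_eps, fst_algebraMap_dualNumber, zero_smul, zero_add,
        MulOpposite.smul_eq_mul_unop, MulOpposite.unop_op, one_mul]
    rw [h3, h4, zero_smul, zero_add, MulOpposite.smul_eq_mul_unop, MulOpposite.unop_op,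
      TrivSqZeroExt.snd_zero] at h2
    exact (mul_eq_zero.mp h2).resolve_left hη
  exact ⟨r, by rw [hp, hr]; ring⟩

theorem AdaptedFrame.totalTransformIdeal_eq (h : AdaptedFrame b x y s₁ s₂)
    (hF : Squarefree (cubicOf b)) (hB : ∃ e n, b (ver e) (pol (ver e) n) ≠ 0)
    (hL : ∀ a ∈ Submodule.span ℂ {x 0, x 1}, b a (crem a) = 0) {T₁ T₂ : Bil}
    (hT₁ : T₁ ∈ graphForms b) (hT₂ : T₂ ∈ graphForms b)
    (hT : ∀ i j, T₁ (x i) (y j) = s₁ i j ∧ T₂ (x i) (y j) = s₂ i j) :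
    totalTransformIdeal (cubicOf b) (Submodule.span ℂ {x 0, x 1}) =
      linearIdeal (Submodule.span ℂ (Set.range y)) ⊔ Ideal.span {conicEq T₁ T₂ (x 0) (x 1)} := by
  refine le_antisymm (fun G hG => ?_) (h.le_totalTransformIdeal hT₁ hT₂)
  rw [mem_linearIdeal_sup h.indep_y]
  rcases h.conic with hr | hd
  · exact h.dvd_of_reduced hF hB hL hr (conicEq_isHomogeneous _ _ _ _) (eval_param_conicEq hT) hG
  · exact h.dvd_of_double hF hB hd (eval_param_conicEq hT) hG

end frame

end VeroneseFano
end

/-! ### Existence and uniqueness of the residual line. -/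

open MvPolynomial
noncomputable section
namespace VeroneseFano

open Matrix

theorem le_of_linearIdeal_le {P Q : Submodule ℂ (Fin 6 → ℂ)}
    (h : ∀ κ : Module.Dual ℂ (Fin 6 → ℂ), (∀ a ∈ Q, κ a = 0) → ∀ a ∈ P, κ a = 0) : P ≤ Q := by
  intro a ha
  by_contra haQ
  obtain ⟨κ, hκ, hκQ⟩ := Submodule.exists_dual_map_eq_bot_of_notMem haQ inferInstance
  refine hκ (h κ (fun c hc => ?_) a ha)
  have := Submodule.mem_map_of_mem (f := κ) hc
  rwa [hκQ, Submodule.mem_bot] at this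

theorem linForm_mem_linearIdeal {P : Submodule ℂ (Fin 6 → ℂ)} {κ : Module.Dual ℂ (Fin 6 → ℂ)} :
    linForm κ ∈ linearIdeal P ↔ ∀ a ∈ P, κ a = 0 := by
  constructor
  · intro h a ha
    rw [← eval_linForm, ← aeval_eq_eval]
    exact h a ha
  · intro h a ha
    rw [aeval_eq_eval, eval_linForm]
    exact h a ha

theorem linearIdeal_injective {P Q : Submodule ℂ (Fin 6 → ℂ)} (h : linearIdeal P = linearIdeal Q) :
    P = Q := by
  apply le_antisymm <;> apply le_of_linearIdeal_le <;> intro κ hκ <;>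
    rw [← linForm_mem_linearIdeal] at hκ ⊢
  · rwa [h]
  · rwa [← h]

theorem exists_span_eq_of_finrank {V : Type*} [AddCommGroup V] [Module ℂ V] {P : Submodule ℂ V}
    {n : ℕ} (hn : n ≠ 0) (h : Module.finrank ℂ P = n) :
    ∃ y : Fin n → V, LinearIndependent ℂ y ∧ Submodule.span ℂ (Set.range y) = P := by
  have : Module.Finite ℂ P := Module.finite_of_finrank_pos (by omega)
  let B := Module.finBasisOfFinrankEq ℂ P h
  refine ⟨fun i => B i, B.linearIndependent.map' P.subtype P.ker_subtype, ?_⟩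
  have := congrArg (Submodule.map P.subtype) B.span_eq
  rw [Submodule.map_span, ← Set.range_comp, Submodule.map_top, Submodule.range_subtype] at this
  exact this

theorem squarefree_of_isHomogeneous_one {σ : Type*} {g : MvPolynomial σ ℂ} (hg : g.IsHomogeneous 1)
    (h0 : g ≠ 0) : Squarefree g := by
  intro x hx
  have hx0 : x ≠ 0 := by
    rintro rfl
    rw [zero_mul, zero_dvd_iff] at hx
    exact h0 hx
  obtain ⟨r, hr⟩ := hx
  have hr0 : r ≠ 0 := by
    rintro rfl
    rw [mul_zero] at hr
    exact h0 hr
  have h1 := hg.totalDegree h0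
  rw [hr, totalDegree_mul_of_isDomain (mul_ne_zero hx0 hx0) hr0,
    totalDegree_mul_of_isDomain hx0 hx0] at h1
  rw [totalDegree_eq_zero_iff_eq_C.mp (show x.totalDegree = 0 by omega)] at hx0 ⊢
  exact (isUnit_iff_ne_zero.mpr fun h => hx0 (by rw [h, C_0])).map C

theorem eq_zero_of_isHomogeneous_of_dvd {σ : Type*} {f g : MvPolynomial σ ℂ} {m n : ℕ}
    (hf : f.IsHomogeneous m) (hg : g.IsHomogeneous n) (hn : n < m) (h : f ∣ g) : g = 0 := by
  by_contra h0
  obtain ⟨r, rfl⟩ := h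
  have h1 := hg.totalDegree h0
  rw [totalDegree_mul_of_isDomain (left_ne_zero_of_mul h0) (right_ne_zero_of_mul h0),
    hf.totalDegree (left_ne_zero_of_mul h0)] at h1
  omega

/-- A nonzero linear form on the plane is not divisible by the quadratic equation, so the linear
forms in the ideal are those of the plane, and the ideal determines the plane. -/
theorem IsPlaneConic.le {J : Ideal Poly} {P P' : Submodule ℂ (Fin 6 → ℂ)} {q q' : Poly}
    (h : IsPlaneConic J P q) (h' : IsPlaneConic J P' q') : P ≤ P' := by
  obtain ⟨hP, hq, hqP, hJ⟩ := h
  obtain ⟨y, hy, rfl⟩ := exists_span_eq_of_finrank (by norm_num) hP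
  apply le_of_linearIdeal_le
  intro κ hκ
  have h1 : linForm κ ∈ J := by
    rw [h'.2.2.2]
    exact Ideal.mem_sup_left (linForm_mem_linearIdeal.mpr hκ)
  rw [hJ, mem_linearIdeal_sup hy] at h1
  rw [← linForm_mem_linearIdeal, mem_linearIdeal_span]
  exact eq_zero_of_isHomogeneous_of_dvd (param_isHomogeneous y hq)
    (param_isHomogeneous y (linForm_isHomogeneous κ)) (by norm_num) h1

/-- A line of `X` has at most one residual line. -/
theorem IsResidualLine.unique {F F' : Poly} {L L₁ L₂ : Submodule ℂ (Fin 6 → ℂ)}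
    (h₁ : IsResidualLine F F' L L₁) (h₂ : IsResidualLine F F' L L₂) : L₁ = L₂ := by
  obtain ⟨P, q₁, m₁, hc₁, hm₁, hL₁, hF₁⟩ := h₁
  obtain ⟨P₂, q₂, m₂, hc₂, hm₂, hL₂, hF₂⟩ := h₂
  obtain rfl : P = P₂ := le_antisymm (hc₁.le hc₂) (hc₂.le hc₁)
  obtain ⟨hP, hq₁, hqP₁, hJ₁⟩ := hc₁
  obtain ⟨-, hq₂, hqP₂, hJ₂⟩ := hc₂
  obtain ⟨y, hy, rfl⟩ := exists_span_eq_of_finrank (by norm_num) hP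
  rw [mem_linearIdeal_span] at hqP₁ hqP₂ hF₁ hF₂
  have d₁ : param y q₁ ∣ param y q₂ := by
    rw [← mem_linearIdeal_sup hy, ← hJ₁, hJ₂]
    exact Ideal.mem_sup_right (Ideal.mem_span_singleton_self _)
  have d₂ : param y q₂ ∣ param y q₁ := by
    rw [← mem_linearIdeal_sup hy, ← hJ₂, hJ₁]
    exact Ideal.mem_sup_right (Ideal.mem_span_singleton_self _)
  -- The conic fixes its equation on the plane up to a unit; cancelling it in the plane cubic fixes
  -- the residual linear form up to a unit.
  obtain ⟨u, hu⟩ := associated_of_dvd_dvd d₁ d₂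
  rw [map_sub, map_mul, sub_eq_zero] at hF₁ hF₂
  have hm : param y m₁ = u * param y m₂ := by
    rw [hF₁, ← hu, mul_assoc] at hF₂
    exact mul_left_cancel₀ hqP₁ hF₂
  apply linearIdeal_injective
  rw [hL₁, hL₂]
  ext G
  rw [mem_linearIdeal_sup hy, mem_linearIdeal_sup hy, hm, Units.mul_left_dvd]

section

variable {b : Bil} {x y : Fin 3 → Fin 6 → ℂ} {s₁ s₂ : Matrix (Fin 3) (Fin 3) ℂ}

/-- The functional cutting out the residual line. -/
def residualForm (b T₁ T₂ : Bil) (k₁ k₂ : ℂ) (a : Fin 6 → ℂ) : Module.Dual ℂ (Fin 6 → ℂ) :=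
  b a - k₁ • T₁ a - k₂ • T₂ a

/-- The line of the plane `P` on which `μ` vanishes. -/
def lineIn (P : Submodule ℂ (Fin 6 → ℂ)) (μ : Module.Dual ℂ (Fin 6 → ℂ)) :
    Submodule ℂ (Fin 6 → ℂ) := P ⊓ LinearMap.ker μ

/-- f(y) has coordinates proportional to (s₁ η) × (s₂ η). Being orthogonal to s₁ η and s₂ η, it
kills the part k₁s₁ + k₂s₂ of b, and only the third coordinate times the defect of b(x₂, ·)
survives. -/
theorem ConicFrame.dual_formula (h : ConicFrame x y s₁ s₂) {T₁ T₂ : Bil}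
    (hT : ∀ i j, T₁ (x i) (y j) = s₁ i j ∧ T₂ (x i) (y j) = s₂ i j) {k₁ k₂ : ℂ}
    (hb : ∀ j, b (x 0) (y j) = k₁ * s₁ 0 j + k₂ * s₂ 0 j ∧
      b (x 1) (y j) = k₁ * s₁ 1 j + k₂ * s₂ 1 j) : ∃ c : ℂ, ∀ η : Fin 3 → ℂ,
    b (crem (∑ j, η j • y j)) (∑ j, η j • y j) =
      c * conicForm s₁ s₂ η * residualForm b T₁ T₂ k₁ k₂ (x 2) (∑ j, η j • y j) := by
  obtain ⟨c, hc⟩ := h.crem_y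
  refine ⟨c, fun η => ?_⟩
  have h0 : b (x 0) (∑ j, η j • y j) = k₁ * (s₁ *ᵥ η) 0 + k₂ * (s₂ *ᵥ η) 0 := by
    simp only [map_sum, map_smul, smul_eq_mul, (hb _).1, Matrix.mulVec, dotProduct,
      Finset.mul_sum, ← Finset.sum_add_distrib]
    exact Finset.sum_congr rfl fun j _ => by ring
  have h1 : b (x 1) (∑ j, η j • y j) = k₁ * (s₁ *ᵥ η) 1 + k₂ * (s₂ *ᵥ η) 1 := by
    simp only [map_sum, map_smul, smul_eq_mul, (hb _).2, Matrix.mulVec, dotProduct,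
      Finset.mul_sum, ← Finset.sum_add_distrib]
    exact Finset.sum_congr rfl fun j _ => by ring
  have h2 : b (x 2) (∑ j, η j • y j) = k₁ * (s₁ *ᵥ η) 2 + k₂ * (s₂ *ᵥ η) 2 +
      residualForm b T₁ T₂ k₁ k₂ (x 2) (∑ j, η j • y j) := by
    rw [residualForm, LinearMap.sub_apply, LinearMap.sub_apply, LinearMap.smul_apply,
      LinearMap.smul_apply, form_sum (fun i j => (hT i j).1), form_sum (fun i j => (hT i j).2),
      smul_eq_mul, smul_eq_mul]
    ring
  rw [hc, Fin.sum_univ_three]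
  simp only [map_smul, map_add, LinearMap.smul_apply, LinearMap.add_apply, smul_eq_mul, h0, h1, h2,
    conicForm, cross_apply, Matrix.cons_val]
  ring

theorem finrank_lineIn (hy : LinearIndependent ℂ y) {μ : Module.Dual ℂ (Fin 6 → ℂ)}
    (hμ : ∃ a ∈ Submodule.span ℂ (Set.range y), μ a ≠ 0) :
    Module.finrank ℂ (lineIn (Submodule.span ℂ (Set.range y)) μ) = 2 := by
  set P := Submodule.span ℂ (Set.range y)
  have hP : Module.finrank ℂ P = 3 := by
    rw [finrank_span_eq_card hy, Fintype.card_fin]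
  have h0 : μ.domRestrict P ≠ 0 := by
    obtain ⟨a, ha, h⟩ := hμ
    exact fun h' => h (LinearMap.congr_fun h' ⟨a, ha⟩)
  have h1 := Module.Dual.finrank_ker_add_one_of_ne_zero h0
  have h2 : lineIn P μ = (LinearMap.ker (μ.domRestrict P)).map P.subtype := by
    ext a
    simp [lineIn, and_comm]
  rw [h2, Submodule.finrank_map_subtype_eq]
  omega

theorem linearIdeal_lineIn (hy : LinearIndependent ℂ y) {μ : Module.Dual ℂ (Fin 6 → ℂ)}
    (hμ : ∃ a ∈ Submodule.span ℂ (Set.range y), μ a ≠ 0) :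
    linearIdeal (lineIn (Submodule.span ℂ (Set.range y)) μ) =
      linearIdeal (Submodule.span ℂ (Set.range y)) ⊔ Ideal.span {linForm μ} := by
  ext G
  rw [mem_linearIdeal_sup hy]
  constructor
  · intro hG
    apply dvd_of_forall_eval_eq_zero
    · apply squarefree_of_isHomogeneous_one (param_isHomogeneous y (linForm_isHomogeneous μ))
      rw [Ne, ← mem_linearIdeal_span, linForm_mem_linearIdeal]
      push Not
      exact hμ
    · intro η hη
      rw [eval_param, eval_linForm] at hη
      rw [eval_param, ← aeval_eq_eval]
      exact hG _ ⟨(Submodule.mem_span_range_iff_exists_fun ℂ).mpr ⟨η, rfl⟩, hη⟩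
  · rintro ⟨r, hr⟩ a ⟨ha, hμa⟩
    obtain ⟨η, rfl⟩ := (Submodule.mem_span_range_iff_exists_fun ℂ).mp ha
    rw [aeval_eq_eval, ← eval_param, hr, map_mul, eval_param, eval_linForm,
      LinearMap.mem_ker.mp hμa, zero_mul]

theorem DualCubics.exists_ver {F F' : Poly} (h : DualCubics b F F') :
    ∃ e n, b (ver e) (pol (ver e) n) ≠ 0 := by
  have hs := h.smooth
  rw [h.eq] at hs
  have h0 : ver (Pi.single 0 1 : Fin 3 → ℂ) ≠ 0 := fun h => by
    have := congrFun h 0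
    simp [ver] at this
  obtain ⟨i, hi⟩ := hs _ h0 (by rw [eval_cubicOf, crem_ver, map_zero])
  rw [eval_pderiv_cubicOf, crem_ver, map_zero, zero_add] at hi
  exact ⟨_, _, hi⟩

/-- The residual line of a line with an adapted frame. -/
theorem AdaptedFrame.isResidualLine {F F' : Poly} (hD : DualCubics b F F')
    (h : AdaptedFrame b x y s₁ s₂) (hL : LiesOn (Submodule.span ℂ {x 0, x 1}) F) {T₁ T₂ : Bil}
    (hT₁ : T₁ ∈ graphForms b) (hT₂ : T₂ ∈ graphForms b)
    (hT : ∀ i j, T₁ (x i) (y j) = s₁ i j ∧ T₂ (x i) (y j) = s₂ i j) {k₁ k₂ : ℂ}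
    (hb : ∀ j, b (x 0) (y j) = k₁ * s₁ 0 j + k₂ * s₂ 0 j ∧
      b (x 1) (y j) = k₁ * s₁ 1 j + k₂ * s₂ 1 j) :
    (∃ c : ℂ, c ≠ 0 ∧ ∀ η : Fin 3 → ℂ, eval (∑ j, η j • y j) F' =
      c * conicForm s₁ s₂ η * residualForm b T₁ T₂ k₁ k₂ (x 2) (∑ j, η j • y j)) ∧
    (∃ a ∈ Submodule.span ℂ (Set.range y), residualForm b T₁ T₂ k₁ k₂ (x 2) a ≠ 0) ∧
    IsResidualLine F F' (Submodule.span ℂ {x 0, x 1})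
      (lineIn (Submodule.span ℂ (Set.range y)) (residualForm b T₁ T₂ k₁ k₂ (x 2))) := by
  set μ := residualForm b T₁ T₂ k₁ k₂ (x 2)
  obtain ⟨c', hc', eF'⟩ := hD.eq'
  obtain ⟨c, hc⟩ := h.dual_formula hT hb
  have hF' : ∀ η : Fin 3 → ℂ, eval (∑ j, η j • y j) F' =
      (c' * c) * conicForm s₁ s₂ η * μ (∑ j, η j • y j) := by
    intro η
    rw [eF', smul_eval, eval_cubicOf, LinearMap.flip_apply, hc]
    ring
  have hfin : Module.finrank ℂ (Submodule.span ℂ (Set.range y)) = 3 := by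
    rw [finrank_span_eq_card h.indep_y, Fintype.card_fin]
  -- Since X' contains no plane, the product of constant, conic and linear form is not identically
  -- zero, so none of the three factors is.
  obtain ⟨η, hη⟩ : ∃ η : Fin 3 → ℂ, eval (∑ j, η j • y j) F' ≠ 0 := by
    by_contra! H
    apply hD.noPlane' _ hfin
    intro a ha
    obtain ⟨η, rfl⟩ := (Submodule.mem_span_range_iff_exists_fun ℂ).mp ha
    exact H η
  rw [hF'] at hη
  have hcc : c' * c ≠ 0 := left_ne_zero_of_mul (left_ne_zero_of_mul hη)
  have hq := right_ne_zero_of_mul (left_ne_zero_of_mul hη)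
  have hμ : ∃ a ∈ Submodule.span ℂ (Set.range y), μ a ≠ 0 :=
    ⟨_, (Submodule.mem_span_range_iff_exists_fun ℂ).mpr ⟨η, rfl⟩, right_ne_zero_of_mul hη⟩
  have hLF : ∀ a ∈ Submodule.span ℂ {x 0, x 1}, b a (crem a) = 0 := by
    intro a ha
    rw [← eval_cubicOf, ← hD.eq]
    exact hL a ha
  refine ⟨⟨_, hcc, hF'⟩, hμ, _, conicEq T₁ T₂ (x 0) (x 1), linForm ((c' * c) • μ),
    ⟨hfin, conicEq_isHomogeneous _ _ _ _, ?_, ?_⟩, linForm_isHomogeneous _, ?_, ?_⟩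
  · intro hmem
    apply hq
    rw [← eval_param_conicEq hT, (mem_linearIdeal_span _ _).mp hmem, map_zero]
  · have hs := hD.smooth
    rw [hD.eq] at hs ⊢
    exact h.totalTransformIdeal_eq hs.squarefree hD.exists_ver hLF hT₁ hT₂ hT
  · rw [linearIdeal_lineIn h.indep_y hμ]
    congr 1
    have : linForm ((c' * c) • μ) = C (c' * c) * linForm μ := by
      rw [← smul_eq_C_mul]
      exact linFormL.map_smul _ _
    rw [this, Ideal.span_singleton_mul_left_unit]
    exact (isUnit_iff_ne_zero.mpr hcc).map C
  · rw [mem_linearIdeal_span]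
    apply MvPolynomial.funext
    intro η
    rw [map_sub, map_sub, map_mul, map_mul, eval_param, hF', eval_param_conicEq hT, eval_param,
      eval_linForm, LinearMap.smul_apply, smul_eq_mul, map_zero]
    ring

theorem DualCubics.exists_frame {F F' : Poly} (hD : DualCubics b F F') (L : FanoLines F) :
    ∃ x y s₁ s₂, AdaptedFrame b x y s₁ s₂ ∧ L.1 = Submodule.span ℂ {x 0, x 1} := by
  apply hasFrame_of_goodLine L.2.1
  obtain ⟨L, -, hL⟩ := L
  have hs := hD.smooth
  rw [hD.eq] at hs hL
  exact goodLine_of_smooth hs hL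

theorem DualCubics.exists_isResidualLine {F F' : Poly} (hD : DualCubics b F F') (L : FanoLines F) :
    ∃ L' : FanoLines F', IsResidualLine F F' L.1 L'.1 := by
  obtain ⟨x, y, s₁, s₂, h, hL⟩ := hD.exists_frame L
  obtain ⟨T₁, hT₁, T₂, hT₂, hT⟩ := h.exists_forms b
  obtain ⟨k₁, k₂, hb⟩ := h.bil
  obtain ⟨⟨c, -, hc⟩, hμ, hres⟩ := h.isResidualLine hD (hL ▸ L.2.2) hT₁ hT₂ hT hb
  refine ⟨⟨_, finrank_lineIn h.indep_y hμ, ?_⟩, hL ▸ hres⟩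
  rintro a ⟨ha, hμa⟩
  obtain ⟨η, rfl⟩ := (Submodule.mem_span_range_iff_exists_fun ℂ).mp ha
  rw [hc, LinearMap.mem_ker.mp hμa, mul_zero]

end

end VeroneseFano
end

/-! ### Triples under change of basis, and the transposed frame. -/

open MvPolynomial
noncomputable section
namespace VeroneseFano

open Matrix

theorem pol_ver_ver {R : Type*} [CommRing R] (e e' : Fin 3 → R) :
    pol (ver e) (ver e') = ver (e ⨯₃ e') := by
  ext i; fin_cases i <;> simp [pol, ver, crossProduct] <;> ring

/-- V contains no line: the sum of e eᵀ and e'e'ᵀ has rank one only if e and e' are proportional. -/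
theorem exists_crem_ne_zero {L : Submodule ℂ (Fin 6 → ℂ)} (hL : Module.finrank ℂ L = 2) :
    ∃ u ∈ L, crem u ≠ 0 := by
  by_contra! H
  obtain ⟨u, hu, hs⟩ := exists_span_eq_of_finrank two_ne_zero hL
  have hmem : ∀ i, u i ∈ L := fun i => hs ▸ Submodule.subset_span ⟨i, rfl⟩
  obtain ⟨e, he⟩ := exists_ver_of_crem_eq_zero (H _ (hmem 0))
  obtain ⟨e', he'⟩ := exists_ver_of_crem_eq_zero (H _ (hmem 1))
  have h2 := H _ (L.add_mem (hmem 0) (hmem 1))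
  rw [crem_add, he, he', crem_ver, crem_ver, zero_add, add_zero, pol_ver_ver] at h2
  have h3 : e ⨯₃ e' = 0 := by
    by_contra h
    exact ver_ne_zero h h2
  have h4 : e ≠ 0 := by
    rintro rfl
    apply hu.ne_zero 0
    rw [he]
    ext i; fin_cases i <;> simp [ver]
  obtain ⟨t, rfl⟩ := exists_smul_of_cross_eq_zero h3 h4
  have h5 := Fintype.linearIndependent_iff.mp hu ![t ^ 2, -1] (by
    rw [Fin.sum_univ_two, he, he']
    ext i; fin_cases i <;> simp [ver] <;> ring)
  exact one_ne_zero (neg_eq_zero.mp (h5 1))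

theorem PencilPair.add {b : Bil} {u v Y₀ Y₁ Z₀ Z₁ : Fin 6 → ℂ} (h : PencilPair b u v Y₀ Y₁)
    (h' : PencilPair b u v Z₀ Z₁) : PencilPair b u v (Y₀ + Z₀) (Y₁ + Z₁) := by
  obtain ⟨⟨l, hl⟩, hb⟩ := h
  obtain ⟨⟨l', hl'⟩, hb'⟩ := h'
  refine ⟨⟨l + l', ?_⟩, ?_⟩
  · rw [add_smul, ← hl, ← hl', symMat_add, symMat_add, mul_add, mul_add]
    abel
  · rw [map_add, map_add]
    linear_combination hb + hb'

theorem PencilPair.smul {b : Bil} {u v Y₀ Y₁ : Fin 6 → ℂ} (t : ℂ) (h : PencilPair b u v Y₀ Y₁) :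
    PencilPair b u v (t • Y₀) (t • Y₁) := by
  obtain ⟨⟨l, hl⟩, hb⟩ := h
  refine ⟨⟨t * l, ?_⟩, ?_⟩
  · rw [mul_smul, ← hl, symMat_smul, symMat_smul, mul_smul_comm, mul_smul_comm, smul_add]
  · rw [map_smul, map_smul, ← smul_add, hb, smul_zero]

theorem PencilPair.change {b : Bil} {u v Y₀ Y₁ : Fin 6 → ℂ} {p q r s : ℂ}
    (h : PencilPair b (p • u + q • v) (r • u + s • v) Y₀ Y₁) :
    PencilPair b u v (p • Y₀ + r • Y₁) (q • Y₀ + s • Y₁) := by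
  obtain ⟨⟨l, hl⟩, hb⟩ := h
  refine ⟨⟨l, ?_⟩, ?_⟩
  · rw [← hl]
    simp only [symMat_add, symMat_smul, mul_add, add_mul, smul_mul_assoc, mul_smul_comm]
    abel
  · simp only [map_add, map_smul, LinearMap.add_apply, LinearMap.smul_apply] at hb ⊢
    rw [← hb]
    abel

/-- A triple transforms like the coefficients of a binary quadratic form, by the symmetric square of
the base change. -/
theorem PencilTriple.change {b : Bil} {u v : Fin 6 → ℂ} {Y : Fin 3 → Fin 6 → ℂ} {p q r s : ℂ}
    (h : PencilTriple b (p • u + q • v) (r • u + s • v) Y) :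
    PencilTriple b u v ![p ^ 2 • Y 0 + (2 * p * r) • Y 1 + r ^ 2 • Y 2,
      (p * q) • Y 0 + (p * s + q * r) • Y 1 + (r * s) • Y 2,
      q ^ 2 • Y 0 + (2 * q * s) • Y 1 + s ^ 2 • Y 2] := by
  obtain ⟨h₁, h₂⟩ := h
  constructor
  · convert (h₁.change.smul p).add (h₂.change.smul r) using 1 <;>
      simp only [Matrix.cons_val] <;> module
  · convert (h₁.change.smul q).add (h₂.change.smul s) using 1 <;>
      simp only [Matrix.cons_val] <;> module

theorem exists_change_of_span_eq {x : Fin 3 → Fin 6 → ℂ} (hx : LinearIndependent ℂ x)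
    {u v : Fin 6 → ℂ} (h : Submodule.span ℂ {u, v} = Submodule.span ℂ {x 0, x 1}) :
    ∃ p q r s : ℂ, u = p • x 0 + q • x 1 ∧ v = r • x 0 + s • x 1 ∧ p * s - q * r ≠ 0 := by
  have hu : u ∈ Submodule.span ℂ {x 0, x 1} := h ▸ Submodule.subset_span (by simp)
  have hv : v ∈ Submodule.span ℂ {x 0, x 1} := h ▸ Submodule.subset_span (by simp)
  have h0 : x 0 ∈ Submodule.span ℂ {u, v} := h ▸ Submodule.subset_span (by simp)
  have h1 : x 1 ∈ Submodule.span ℂ {u, v} := h ▸ Submodule.subset_span (by simp)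
  obtain ⟨p, q, rfl⟩ := Submodule.mem_span_pair.mp hu
  obtain ⟨r, s, rfl⟩ := Submodule.mem_span_pair.mp hv
  obtain ⟨p', q', e⟩ := Submodule.mem_span_pair.mp h0
  obtain ⟨r', s', e'⟩ := Submodule.mem_span_pair.mp h1
  refine ⟨p, q, r, s, rfl, rfl, fun hd => ?_⟩
  have k := Fintype.linearIndependent_iff.mp hx ![p' * p + q' * r - 1, p' * q + q' * s, 0] (by
    rw [Fin.sum_univ_three, ← sub_eq_zero.mpr e]
    simp only [Matrix.cons_val]
    module)
  have k' := Fintype.linearIndependent_iff.mp hx ![r' * p + s' * r, r' * q + s' * s - 1, 0] (by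
    rw [Fin.sum_univ_three, ← sub_eq_zero.mpr e']
    simp only [Matrix.cons_val]
    module)
  have k0 := k 0
  have k1 := k 1
  have k0' := k' 0
  have k1' := k' 1
  simp only [Matrix.cons_val] at k0 k1 k0' k1'
  have : (p' * s' - q' * r') * (p * s - q * r) = 1 := by
    linear_combination (r' * q + s' * s) * k0 + k1' - k1 * (r' * p + s' * r)
  rw [hd, mul_zero] at this
  exact zero_ne_one this

section

variable {b : Bil} {x y : Fin 3 → Fin 6 → ℂ} {s₁ s₂ : Matrix (Fin 3) (Fin 3) ℂ}

theorem AdaptedFrame.triple_mem (h : AdaptedFrame b x y s₁ s₂) {u v : Fin 6 → ℂ}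
    (huv : Submodule.span ℂ {u, v} = Submodule.span ℂ {x 0, x 1}) {Y : Fin 3 → Fin 6 → ℂ}
    (hY : PencilTriple b u v Y) (k : Fin 3) : Y k ∈ Submodule.span ℂ (Set.range y) := by
  obtain ⟨p, q, r, s, rfl, rfl, hd⟩ := exists_change_of_span_eq h.indep_x huv
  have key := h.triple _ hY.change
  set P := Submodule.span ℂ (Set.range y)
  have k0 := key 0
  have k1 := key 1
  have k2 := key 2
  simp only [Matrix.cons_val] at k0 k1 k2
  -- The symmetric square is inverted up to this squared determinant, so the components of the
  -- original triple lie in the plane too.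
  have hd2 : (p * s - q * r) ^ 2 ≠ 0 := pow_ne_zero 2 hd
  fin_cases k
  · rw [← P.smul_mem_iff hd2]
    convert P.add_mem (P.sub_mem (P.smul_mem (s ^ 2) k0) (P.smul_mem (2 * r * s) k1))
      (P.smul_mem (r ^ 2) k2) using 1
    simp only [Fin.zero_eta]
    module
  · rw [← P.smul_mem_iff hd2]
    convert P.sub_mem (P.sub_mem (P.smul_mem (p * s + q * r) k1) (P.smul_mem (q * s) k0))
      (P.smul_mem (p * r) k2) using 1
    simp only [Fin.mk_one]
    module
  · rw [← P.smul_mem_iff hd2]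
    convert P.add_mem (P.sub_mem (P.smul_mem (q ^ 2) k0) (P.smul_mem (2 * p * q) k1))
      (P.smul_mem (p ^ 2) k2) using 1
    simp only [Fin.reduceFinMk]
    module

theorem ConicFrame.transpose (h : ConicFrame x y s₁ s₂) : ConicFrame y x s₁ᵀ s₂ᵀ := by
  refine ⟨h.indep_y, h.indep_x, ?_, ?_, ?_⟩
  · obtain ⟨A, B, τ, hAB, hmul⟩ := h.mul
    refine ⟨Aᵀ, Bᵀ, τᵀ, fun r s t h0 => hAB r s t ?_, fun i j => ?_⟩
    · rw [← Matrix.transpose_inj]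
      simpa using h0
    · rw [← Matrix.transpose_inj]
      simp [Matrix.transpose_mul, symMat_transpose, hmul]
  · simpa only [Matrix.vecMul_transpose] using h.crem_y
  · simpa only [Matrix.mulVec_transpose] using h.crem_x

theorem ConicFrame.mul_sum_sum (h : ConicFrame x y s₁ s₂) : ∃ A B : Matrix (Fin 3) (Fin 3) ℂ,
    ∀ ξ η, ∃ t : ℂ, symMat (∑ i, ξ i • x i) * symMat (∑ j, η j • y j) =
      (ξ ⬝ᵥ s₁ *ᵥ η) • A + (ξ ⬝ᵥ s₂ *ᵥ η) • B + t • 1 := by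
  obtain ⟨A, B, τ, hmul⟩ := h.mul_sum
  refine ⟨A, B, fun ξ η => ⟨ξ ⬝ᵥ τ *ᵥ η, ?_⟩⟩
  rw [← symMatL_apply (∑ i, ξ i • x i)]
  simp only [map_sum, map_smul, Finset.sum_mul, smul_mul_assoc]
  simp only [symMatL_apply, hmul, smul_add, smul_smul, Finset.sum_add_distrib, ← Finset.sum_smul,
    dotProduct]

theorem exists_dotProduct_eq {a₁ a₂ : Fin 3 → ℂ} (h : a₁ ⨯₃ a₂ ≠ 0) (p r : ℂ) :
    ∃ ζ : Fin 3 → ℂ, a₁ ⬝ᵥ ζ = p ∧ a₂ ⬝ᵥ ζ = r := by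
  obtain ⟨k, hk⟩ := Function.ne_iff.mp h
  rw [Pi.zero_apply] at hk
  set w : Fin 3 → ℂ := Pi.single k 1
  have hw : w ⬝ᵥ (a₁ ⨯₃ a₂) ≠ 0 := by rwa [single_one_dotProduct]
  have e₁ : a₁ ⬝ᵥ (a₂ ⨯₃ w) = w ⬝ᵥ (a₁ ⨯₃ a₂) := by rw [triple_product_permutation,
    triple_product_permutation]
  have e₂ : a₂ ⬝ᵥ (w ⨯₃ a₁) = w ⬝ᵥ (a₁ ⨯₃ a₂) := by rw [triple_product_permutation]
  refine ⟨(w ⬝ᵥ (a₁ ⨯₃ a₂))⁻¹ • (p • (a₂ ⨯₃ w) + r • (w ⨯₃ a₁)), ?_, ?_⟩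
  · rw [dotProduct_smul, dotProduct_add, dotProduct_smul, dotProduct_smul, e₁, dot_cross_self]
    simp only [smul_eq_mul]
    field_simp
    ring
  · rw [dotProduct_smul, dotProduct_add, dotProduct_smul, dotProduct_smul, e₂, dot_self_cross]
    simp only [smul_eq_mul]
    field_simp
    ring

theorem ConicFrame.pencilPair (h : ConicFrame x y s₁ s₂) {ξ ξ' : Fin 3 → ℂ} {k₁ k₂ : ℂ}
    (hb : ∀ η, b (∑ i, ξ i • x i) (∑ j, η j • y j) =
      k₁ * (ξ ⬝ᵥ s₁ *ᵥ η) + k₂ * (ξ ⬝ᵥ s₂ *ᵥ η))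
    (hb' : ∀ η, b (∑ i, ξ' i • x i) (∑ j, η j • y j) =
      k₁ * (ξ' ⬝ᵥ s₁ *ᵥ η) + k₂ * (ξ' ⬝ᵥ s₂ *ᵥ η)) {η₀ η₁ : Fin 3 → ℂ}
    (e₁ : ξ ⬝ᵥ s₁ *ᵥ η₀ + ξ' ⬝ᵥ s₁ *ᵥ η₁ = 0) (e₂ : ξ ⬝ᵥ s₂ *ᵥ η₀ + ξ' ⬝ᵥ s₂ *ᵥ η₁ = 0) :
    PencilPair b (∑ i, ξ i • x i) (∑ i, ξ' i • x i) (∑ j, η₀ j • y j) (∑ j, η₁ j • y j) := by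
  obtain ⟨A, B, hm⟩ := h.mul_sum_sum
  obtain ⟨t, ht⟩ := hm ξ η₀
  obtain ⟨t', ht'⟩ := hm ξ' η₁
  refine ⟨⟨t + t', ?_⟩, ?_⟩
  · rw [ht, ht', eq_neg_of_add_eq_zero_left e₁, eq_neg_of_add_eq_zero_left e₂]
    module
  · rw [hb, hb']
    linear_combination k₁ * e₁ + k₂ * e₂

/-- Every vector of the plane of `y` is the last component of a triple. -/
theorem ConicFrame.exists_triple (h : ConicFrame x y s₁ s₂) {ξ ξ' : Fin 3 → ℂ} {k₁ k₂ : ℂ}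
    (hc : crem (∑ i, ξ i • x i) ≠ 0)
    (hb : ∀ η, b (∑ i, ξ i • x i) (∑ j, η j • y j) =
      k₁ * (ξ ⬝ᵥ s₁ *ᵥ η) + k₂ * (ξ ⬝ᵥ s₂ *ᵥ η))
    (hb' : ∀ η, b (∑ i, ξ' i • x i) (∑ j, η j • y j) =
      k₁ * (ξ' ⬝ᵥ s₁ *ᵥ η) + k₂ * (ξ' ⬝ᵥ s₂ *ᵥ η)) (η₂ : Fin 3 → ℂ) :
    ∃ Y : Fin 3 → Fin 6 → ℂ, Y 2 = ∑ j, η₂ j • y j ∧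
      PencilTriple b (∑ i, ξ i • x i) (∑ i, ξ' i • x i) Y := by
  obtain ⟨c, hc'⟩ := h.crem_x
  have hn : (ξ ᵥ* s₁) ⨯₃ (ξ ᵥ* s₂) ≠ 0 := by
    intro h0
    apply hc
    rw [hc', h0]
    simp
  -- As f does not vanish at the first generator, s₁ and s₂ give independent functionals there. So
  -- η₂ is arbitrary, and η₁ and η₀ are solved for successively.
  have key : ∀ η₂, ∃ η₁, ξ ⬝ᵥ s₁ *ᵥ η₁ + ξ' ⬝ᵥ s₁ *ᵥ η₂ = 0 ∧
      ξ ⬝ᵥ s₂ *ᵥ η₁ + ξ' ⬝ᵥ s₂ *ᵥ η₂ = 0 := by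
    intro η₂
    obtain ⟨η₁, e₁, e₂⟩ := exists_dotProduct_eq hn (-(ξ' ⬝ᵥ s₁ *ᵥ η₂)) (-(ξ' ⬝ᵥ s₂ *ᵥ η₂))
    refine ⟨η₁, ?_, ?_⟩
    · rw [Matrix.dotProduct_mulVec, e₁]; ring
    · rw [Matrix.dotProduct_mulVec, e₂]; ring
  obtain ⟨η₁, h₁, h₁'⟩ := key η₂
  obtain ⟨η₀, h₀, h₀'⟩ := key η₁
  exact ⟨![∑ j, η₀ j • y j, ∑ j, η₁ j • y j, ∑ j, η₂ j • y j], rfl,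
    h.pencilPair hb hb' h₀ h₀', h.pencilPair hb hb' h₁ h₁'⟩

/-- The decomposition of b on the product of the two planes. On both ξ₂ = 0 and μ = 0 it reduces to
k₁s₁ + k₂s₂, so the frame of a line also serves its residual line. -/
theorem bil_sum_eq {T₁ T₂ : Bil} (hT : ∀ i j, T₁ (x i) (y j) = s₁ i j ∧ T₂ (x i) (y j) = s₂ i j)
    {k₁ k₂ : ℂ} (hb : ∀ j, b (x 0) (y j) = k₁ * s₁ 0 j + k₂ * s₂ 0 j ∧
      b (x 1) (y j) = k₁ * s₁ 1 j + k₂ * s₂ 1 j) (ξ η : Fin 3 → ℂ) :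
    b (∑ i, ξ i • x i) (∑ j, η j • y j) = k₁ * (ξ ⬝ᵥ s₁ *ᵥ η) + k₂ * (ξ ⬝ᵥ s₂ *ᵥ η) +
      ξ 2 * residualForm b T₁ T₂ k₁ k₂ (x 2) (∑ j, η j • y j) := by
  have h2 : residualForm b T₁ T₂ k₁ k₂ (x 2) (∑ j, η j • y j) =
      b (x 2) (∑ j, η j • y j) - k₁ * (s₁ *ᵥ η) 2 - k₂ * (s₂ *ᵥ η) 2 := by
    rw [residualForm, LinearMap.sub_apply, LinearMap.sub_apply, LinearMap.smul_apply,
      LinearMap.smul_apply, form_sum (fun i j => (hT i j).1), form_sum (fun i j => (hT i j).2),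
      smul_eq_mul, smul_eq_mul]
  rw [h2]
  simp only [Fin.sum_univ_three, map_add, map_smul, LinearMap.add_apply, LinearMap.smul_apply,
    smul_eq_mul, (hb _).1, (hb _).2, dotProduct, Matrix.mulVec]
  ring

end

end VeroneseFano
end

/-! ### The residual line of the residual line. -/

open MvPolynomial
noncomputable section
namespace VeroneseFano

open Matrix

theorem exists_span_pair_eq {V : Type*} [AddCommGroup V] [Module ℂ V] {L : Submodule ℂ V}
    (hL : Module.finrank ℂ L = 2) {u : V} (hu : u ∈ L) (hu0 : u ≠ 0) :
    ∃ v ∈ L, Submodule.span ℂ {u, v} = L := by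
  have : Module.Finite ℂ L := Module.finite_of_finrank_pos (by omega)
  obtain ⟨v, hv, hvu⟩ : ∃ v ∈ L, v ∉ Submodule.span ℂ {u} := by
    by_contra! H
    have h1 := Submodule.finrank_mono (show L ≤ Submodule.span ℂ {u} from H)
    rw [finrank_span_singleton hu0] at h1
    omega
  refine ⟨v, hv, ?_⟩
  have hi : LinearIndependent ℂ ![u, v] := by
    rw [LinearIndependent.pair_iff' hu0]
    intro a ha
    exact hvu (Submodule.mem_span_singleton.mpr ⟨a, ha⟩)
  have h1 := finrank_span_eq_card hi
  rw [Matrix.range_cons, Matrix.range_cons, Matrix.range_empty, Set.union_empty] at h1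
  refine Submodule.eq_of_le_of_finrank_eq ?_ ?_
  · rw [Submodule.span_le]
    rintro _ (rfl | rfl)
    exacts [hu, hv]
  · rw [hL]
    exact h1

theorem exists_coords {n : ℕ} {y : Fin n → Fin 6 → ℂ} {a : Fin 6 → ℂ}
    (h : a ∈ Submodule.span ℂ (Set.range y)) : ∃ η : Fin n → ℂ, ∑ j, η j • y j = a :=
  (Submodule.mem_span_range_iff_exists_fun ℂ).mp h

/-- A nonzero quadratic form can be cancelled. Third differences of the quadratic form G along ξ₀ +
sξ vanish, so G ≠ 0 at s = 0 forces G ≠ 0 at one of s = 1, 2, 3, and there the linear factor is s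
times its value at ξ. -/
theorem residual_quadric_ne_zero {s₁ s₂ : Matrix (Fin 3) (Fin 3) ℂ} {m : Fin 3 → ℂ}
    {g : (Fin 3 → ℂ) →ₗ[ℂ] ℂ} (h : ∀ ξ, ((ξ ᵥ* s₁) ⨯₃ (ξ ᵥ* s₂)) ⬝ᵥ m * g ξ = 0)
    {ξ₀ : Fin 3 → ℂ} (h₀ : ((ξ₀ ᵥ* s₁) ⨯₃ (ξ₀ ᵥ* s₂)) ⬝ᵥ m ≠ 0) : g = 0 := by
  apply LinearMap.ext
  intro ξ
  set G : (Fin 3 → ℂ) → ℂ := fun ξ => ((ξ ᵥ* s₁) ⨯₃ (ξ ᵥ* s₂)) ⬝ᵥ m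
  have hdiff : G ξ₀ - 3 * G (ξ₀ + (1 : ℂ) • ξ) + 3 * G (ξ₀ + (2 : ℂ) • ξ) -
      G (ξ₀ + (3 : ℂ) • ξ) = 0 := by
    simp only [G, Matrix.add_vecMul, Matrix.smul_vecMul, map_add, map_smul, LinearMap.add_apply,
      LinearMap.smul_apply, add_dotProduct, smul_dotProduct, smul_eq_mul]
    ring
  have hg₀ : g ξ₀ = 0 := (mul_eq_zero.mp (h ξ₀)).resolve_left h₀
  have key : ∀ s : ℂ, s ≠ 0 → G (ξ₀ + s • ξ) ≠ 0 → g ξ = 0 := by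
    intro s hs hG
    have h1 := (mul_eq_zero.mp (h (ξ₀ + s • ξ))).resolve_left hG
    rw [map_add, hg₀, zero_add, map_smul, smul_eq_mul] at h1
    exact (mul_eq_zero.mp h1).resolve_left hs
  by_contra hne
  have h1 : G (ξ₀ + (1 : ℂ) • ξ) = 0 := by_contra fun h => hne (key 1 (by norm_num) h)
  have h2 : G (ξ₀ + (2 : ℂ) • ξ) = 0 := by_contra fun h => hne (key 2 (by norm_num) h)
  have h3 : G (ξ₀ + (3 : ℂ) • ξ) = 0 := by_contra fun h => hne (key 3 (by norm_num) h)
  rw [h1, h2, h3] at hdiff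
  exact h₀ (by simpa using hdiff)

section

variable {b : Bil} {x y : Fin 3 → Fin 6 → ℂ} {s₁ s₂ : Matrix (Fin 3) (Fin 3) ℂ}

theorem dotProduct_transpose_mulVec (s : Matrix (Fin 3) (Fin 3) ℂ) (ξ η : Fin 3 → ℂ) :
    η ⬝ᵥ sᵀ *ᵥ ξ = ξ ⬝ᵥ s *ᵥ η := by
  rw [Matrix.dotProduct_mulVec, Matrix.vecMul_transpose, dotProduct_comm]

/-- The plane of a frame is recovered from the residual line. -/
theorem AdaptedFrame.span_eq (h : AdaptedFrame b x y s₁ s₂) {T₁ T₂ : Bil}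
    (hT : ∀ i j, T₁ (x i) (y j) = s₁ i j ∧ T₂ (x i) (y j) = s₂ i j) {k₁ k₂ : ℂ}
    (hb : ∀ j, b (x 0) (y j) = k₁ * s₁ 0 j + k₂ * s₂ 0 j ∧
      b (x 1) (y j) = k₁ * s₁ 1 j + k₂ * s₂ 1 j) {c : ℂ} {X Y : Fin 3 → Fin 6 → ℂ}
    {t₁ t₂ : Matrix (Fin 3) (Fin 3) ℂ} (h' : AdaptedFrame (c • b.flip) X Y t₁ t₂)
    (hX : Submodule.span ℂ {X 0, X 1} =
      lineIn (Submodule.span ℂ (Set.range y)) (residualForm b T₁ T₂ k₁ k₂ (x 2)))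
    (hfin : Module.finrank ℂ (Submodule.span ℂ {X 0, X 1}) = 2) :
    Submodule.span ℂ (Set.range x) = Submodule.span ℂ (Set.range Y) := by
  obtain ⟨u, hu, hc⟩ := exists_crem_ne_zero hfin
  have hu0 : u ≠ 0 := by
    rintro rfl
    apply hc
    ext i; fin_cases i <;> simp [crem]
  obtain ⟨v, hv, huv⟩ := exists_span_pair_eq hfin hu hu0
  rw [hX] at hu hv
  obtain ⟨⟨α, rfl⟩, hμu⟩ := And.imp_left exists_coords hu
  obtain ⟨⟨β, rfl⟩, hμv⟩ := And.imp_left exists_coords hv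
  rw [SetLike.mem_coe, LinearMap.mem_ker] at hμu hμv
  -- On the residual line the defect μ vanishes, so the transposed form is a combination of the
  -- transposed s₁, s₂ against the whole plane of x. Every vector of that plane then occurs in a
  -- triple along the residual line.
  have hb' : ∀ γ : Fin 3 → ℂ,
      residualForm b T₁ T₂ k₁ k₂ (x 2) (∑ j, γ j • y j) = 0 → ∀ ζ : Fin 3 → ℂ,
      (c • b.flip) (∑ j, γ j • y j) (∑ i, ζ i • x i) =
        (c * k₁) * (γ ⬝ᵥ s₁ᵀ *ᵥ ζ) + (c * k₂) * (γ ⬝ᵥ s₂ᵀ *ᵥ ζ) := by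
    intro γ hγ ζ
    rw [LinearMap.smul_apply, LinearMap.smul_apply, LinearMap.flip_apply, bil_sum_eq hT hb, hγ,
      dotProduct_transpose_mulVec, dotProduct_transpose_mulVec, smul_eq_mul]
    ring
  refine Submodule.eq_of_le_of_finrank_eq ?_ ?_
  · intro z hz
    obtain ⟨ζ, rfl⟩ := exists_coords hz
    obtain ⟨Z, hZ, hZt⟩ := h.toConicFrame.transpose.exists_triple hc (hb' α hμu) (hb' β hμv) ζ
    rw [← hZ]
    exact h'.triple_mem huv hZt 2
  · rw [finrank_span_eq_card h.indep_x, finrank_span_eq_card h'.indep_y]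

/-- Restriction of the cubic to the plane of the frame. -/
theorem ConicFrame.cubic_formula (h : ConicFrame x y s₁ s₂) {T₁ T₂ : Bil}
    (hT : ∀ i j, T₁ (x i) (y j) = s₁ i j ∧ T₂ (x i) (y j) = s₂ i j) {k₁ k₂ : ℂ}
    (hb : ∀ j, b (x 0) (y j) = k₁ * s₁ 0 j + k₂ * s₂ 0 j ∧
      b (x 1) (y j) = k₁ * s₁ 1 j + k₂ * s₂ 1 j) : ∃ c : ℂ, ∀ ξ : Fin 3 → ℂ,
    eval (∑ i, ξ i • x i) (cubicOf b) = c * ξ 2 * (((ξ ᵥ* s₁) ⨯₃ (ξ ᵥ* s₂)) ⬝ᵥ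
      fun j => residualForm b T₁ T₂ k₁ k₂ (x 2) (y j)) := by
  obtain ⟨c, hc⟩ := h.crem_x
  refine ⟨c, fun ξ => ?_⟩
  have : crem (∑ i, ξ i • x i) = ∑ j, (c • ((ξ ᵥ* s₁) ⨯₃ (ξ ᵥ* s₂))) j • y j := by
    rw [hc, Finset.smul_sum]
    exact Finset.sum_congr rfl fun j _ => by rw [Pi.smul_apply, smul_assoc]
  rw [eval_cubicOf, this, bil_sum_eq hT hb, Matrix.dotProduct_mulVec, Matrix.dotProduct_mulVec,
    dotProduct_smul, dotProduct_smul, dot_self_cross, dot_cross_self]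
  simp only [map_sum, map_smul, dotProduct, Pi.smul_apply, smul_eq_mul, Finset.mul_sum]
  simp only [mul_zero, zero_add]
  exact Finset.sum_congr rfl fun j _ => by ring

/-- F on the plane of x is computed twice: as ξ₂ times a quadric, and as the conic of the residual
line times its own residual form μ. The quadric and the conic are proportional, so μ is proportional
to ξ₂. -/
theorem lineIn_eq_of_frames {F F' : Poly} (hD : DualCubics b F F')
    (h : AdaptedFrame b x y s₁ s₂) {T₁ T₂ : Bil}
    (hT : ∀ i j, T₁ (x i) (y j) = s₁ i j ∧ T₂ (x i) (y j) = s₂ i j) {k₁ k₂ : ℂ}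
    (hb : ∀ j, b (x 0) (y j) = k₁ * s₁ 0 j + k₂ * s₂ 0 j ∧
      b (x 1) (y j) = k₁ * s₁ 1 j + k₂ * s₂ 1 j)
    (hμ : ∃ a ∈ Submodule.span ℂ (Set.range y), residualForm b T₁ T₂ k₁ k₂ (x 2) a ≠ 0)
    {c : ℂ} {X Y : Fin 3 → Fin 6 → ℂ}
    {t₁ t₂ : Matrix (Fin 3) (Fin 3) ℂ} (h' : AdaptedFrame (c • b.flip) X Y t₁ t₂)
    (hX : Submodule.span ℂ {X 0, X 1} =
      lineIn (Submodule.span ℂ (Set.range y)) (residualForm b T₁ T₂ k₁ k₂ (x 2)))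
    (hfin : Module.finrank ℂ (Submodule.span ℂ {X 0, X 1}) = 2)
    {c' : ℂ} {μ : Module.Dual ℂ (Fin 6 → ℂ)}
    (hF : ∀ η : Fin 3 → ℂ, eval (∑ j, η j • Y j) F =
      c' * conicForm t₁ t₂ η * μ (∑ j, η j • Y j))
    (hμ' : ∃ a ∈ Submodule.span ℂ (Set.range Y), μ a ≠ 0)
    (hfin' : Module.finrank ℂ (Submodule.span ℂ {x 0, x 1}) = 2) :
    Submodule.span ℂ {x 0, x 1} = lineIn (Submodule.span ℂ (Set.range Y)) μ := by
  have hspan := h.span_eq hT hb h' hX hfin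
  obtain ⟨c₁, hc₁⟩ := h.cubic_formula hT hb
  set ν := residualForm b T₁ T₂ k₁ k₂ (x 2)
  set m : Fin 3 → ℂ := fun j => ν (y j)
  obtain ⟨M₁, M₂, hM₁, hM₂, hM⟩ := h'.exists_traceForms
  obtain ⟨A, B, hAB⟩ := h.toConicFrame.transpose.mul_sum_sum
  have hX0 : X 0 ∈ Submodule.span ℂ {X 0, X 1} := Submodule.subset_span (by simp)
  have hX1 : X 1 ∈ Submodule.span ℂ {X 0, X 1} := Submodule.subset_span (by simp)
  rw [hX] at hX0 hX1
  obtain ⟨⟨α, hα⟩, hμ0⟩ := And.imp_left exists_coords hX0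
  obtain ⟨⟨β, hβ⟩, hμ1⟩ := And.imp_left exists_coords hX1
  rw [SetLike.mem_coe, LinearMap.mem_ker] at hμ0 hμ1
  have hm : m ≠ 0 := by
    intro h0
    obtain ⟨a, ha, hne⟩ := hμ
    obtain ⟨η, rfl⟩ := exists_coords ha
    apply hne
    simp only [map_sum, map_smul]
    exact Finset.sum_eq_zero fun j _ => by rw [show ν (y j) = 0 from congrFun h0 j, smul_zero]
  have hdot : ∀ γ : Fin 3 → ℂ, ν (∑ j, γ j • y j) = γ ⬝ᵥ m := by
    intro γ
    simp [m, dotProduct]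
  rw [← hα, hdot] at hμ0
  rw [← hβ, hdot] at hμ1
  -- α and β lie on the line m = 0 of the plane, so their cross product is a multiple of m.
  obtain ⟨t, ht⟩ : ∃ t : ℂ, α ⨯₃ β = t • m := by
    apply exists_smul_of_cross_eq_zero _ hm
    rw [cross_cross_eq_smul_sub_smul', dotProduct_comm, hμ0, hμ1, zero_smul,
      zero_smul, sub_zero]
  have htr : ∀ {M : Matrix (Fin 3) (Fin 3) ℂ} (_ : M.trace = 0) (γ ξ : Fin 3 → ℂ),
      traceForm M (∑ j, γ j • y j) (∑ i, ξ i • x i) =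
        ((ξ ᵥ* s₁) ⬝ᵥ γ) * (M * A).trace + ((ξ ᵥ* s₂) ⬝ᵥ γ) * (M * B).trace := by
    intro M hM γ ξ
    obtain ⟨r, hr⟩ := hAB γ ξ
    rw [traceForm_apply, hr, mul_add, mul_add, Matrix.trace_add, Matrix.trace_add, mul_smul_comm,
      mul_smul_comm, mul_smul_comm, Matrix.trace_smul, Matrix.trace_smul, Matrix.trace_smul,
      mul_one, hM, smul_zero, add_zero, Matrix.mulVec_transpose, Matrix.mulVec_transpose,
      smul_eq_mul, smul_eq_mul, dotProduct_comm γ, dotProduct_comm γ]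
  set δ := (M₁ * A).trace * (M₂ * B).trace - (M₁ * B).trace * (M₂ * A).trace
  have hconic : ∀ ξ η : Fin 3 → ℂ, ∑ j, η j • Y j = ∑ i, ξ i • x i →
      conicForm t₁ t₂ η = δ * t * (((ξ ᵥ* s₁) ⨯₃ (ξ ᵥ* s₂)) ⬝ᵥ m) := by
    intro ξ η e
    have e₁ := fun i => form_sum (fun i j => (hM i j).1) i η
    have e₂ := fun i => form_sum (fun i j => (hM i j).2) i η
    -- By the Binet–Cauchy identity the 2 × 2 determinant defining the conic of the residual line
    -- becomes a dot product with α × β, that is, with t m.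
    rw [mul_assoc, ← smul_eq_mul t, ← dotProduct_smul, ← ht, cross_dot_cross, conicForm, cross_apply]
    simp only [Matrix.cons_val]
    rw [← e₁, ← e₁, ← e₂, ← e₂, e, ← hα, ← hβ, htr hM₁, htr hM₁, htr hM₂, htr hM₂]
    ring
  have key : ∀ ξ : Fin 3 → ℂ, c₁ * ξ 2 * (((ξ ᵥ* s₁) ⨯₃ (ξ ᵥ* s₂)) ⬝ᵥ m) =
      c' * (δ * t * (((ξ ᵥ* s₁) ⨯₃ (ξ ᵥ* s₂)) ⬝ᵥ m)) * μ (∑ i, ξ i • x i) := by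
    intro ξ
    have hmem : ∑ i, ξ i • x i ∈ Submodule.span ℂ (Set.range Y) := by
      rw [← hspan]
      exact (Submodule.mem_span_range_iff_exists_fun ℂ).mpr ⟨ξ, rfl⟩
    obtain ⟨η, hη⟩ := exists_coords hmem
    rw [← hc₁, ← hD.eq, ← hconic ξ η hη, ← hη, hF]
  obtain ⟨ξ₀, hξ₀⟩ : ∃ ξ : Fin 3 → ℂ, eval (∑ i, ξ i • x i) F ≠ 0 := by
    by_contra! H
    apply hD.noPlane (Submodule.span ℂ (Set.range x))
      (by rw [finrank_span_eq_card h.indep_x, Fintype.card_fin])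
    intro a ha
    obtain ⟨ξ, rfl⟩ := exists_coords ha
    exact H ξ
  rw [hD.eq, hc₁] at hξ₀
  have hκ : c' * δ * t ≠ 0 := by
    intro h0
    apply hξ₀
    rw [key]
    linear_combination (((ξ₀ ᵥ* s₁) ⨯₃ (ξ₀ ᵥ* s₂)) ⬝ᵥ m) * μ (∑ i, ξ₀ i • x i) * h0
  have hg := residual_quadric_ne_zero (s₁ := s₁) (s₂ := s₂) (m := m)
    (g := c₁ • LinearMap.proj 2 - (c' * δ * t) • (μ ∘ₗ Fintype.linearCombination ℂ x)) (by
      intro ξ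
      simp only [LinearMap.sub_apply, LinearMap.smul_apply, LinearMap.proj_apply,
        LinearMap.comp_apply, Fintype.linearCombination_apply, smul_eq_mul]
      linear_combination key ξ) (right_ne_zero_of_mul hξ₀)
  have hker : ∀ k : Fin 3, k ≠ 2 → x k ∈ lineIn (Submodule.span ℂ (Set.range Y)) μ := by
    intro k hk
    refine ⟨hspan ▸ Submodule.subset_span ⟨k, rfl⟩, ?_⟩
    have := LinearMap.congr_fun hg (Pi.single k 1)
    simp only [LinearMap.sub_apply, LinearMap.smul_apply, LinearMap.proj_apply,
      LinearMap.comp_apply, Fintype.linearCombination_apply_single, smul_eq_mul, one_smul,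
      LinearMap.zero_apply, Pi.single_eq_of_ne hk.symm, mul_zero, zero_sub, neg_eq_zero] at this
    exact (mul_eq_zero.mp this).resolve_left hκ
  refine Submodule.eq_of_le_of_finrank_eq ?_ ?_
  · rw [Submodule.span_le]
    rintro _ (rfl | rfl)
    exacts [hker 0 (by decide), hker 1 (by decide)]
  · rw [hfin', finrank_lineIn h'.indep_y hμ']

/-- The residual line of the residual line is the original line. -/
theorem DualCubics.isResidualLine_symm {F F' : Poly} (hD : DualCubics b F F') {L : FanoLines F}
    {L' : FanoLines F'} (hres : IsResidualLine F F' L.1 L'.1) : IsResidualLine F' F L'.1 L.1 := by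
  obtain ⟨x, y, s₁, s₂, h, hL⟩ := hD.exists_frame L
  obtain ⟨T₁, hT₁, T₂, hT₂, hT⟩ := h.exists_forms b
  obtain ⟨k₁, k₂, hb⟩ := h.bil
  obtain ⟨-, hμ, hr⟩ := h.isResidualLine hD (hL ▸ L.2.2) hT₁ hT₂ hT hb
  obtain ⟨c, hD'⟩ := hD.symm
  obtain ⟨X, Y, t₁, t₂, h', hL'⟩ := hD'.exists_frame L'
  obtain ⟨U₁, hU₁, U₂, hU₂, hU⟩ := h'.exists_forms (c • b.flip)
  obtain ⟨l₁, l₂, hb'⟩ := h'.bil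
  obtain ⟨⟨c', -, hF⟩, hμ', hr'⟩ := h'.isResidualLine hD' (hL' ▸ L'.2.2) hU₁ hU₂ hU hb'
  have e := hres.unique (hL ▸ hr)
  have := lineIn_eq_of_frames hD h hT hb hμ h' (hL' ▸ e) (hL' ▸ L'.2.1) hF hμ' (hL ▸ L.2.1)
  rw [hL, hL', this]
  exact hr'

end

end VeroneseFano
end

/-! ### Polynomial families of solutions of linear systems, and Plücker coordinates. -/

open MvPolynomial
noncomputable section
namespace VeroneseFano

open Matrix

section polyFun

variable {σ : Type*}

/-- The algebra of polynomial functions. -/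
def polyFun (σ : Type*) : Subalgebra ℂ ((σ → ℂ) → ℂ) :=
  (AlgHom.pi fun p : σ → ℂ => aeval p).range

theorem mem_polyFun {f : (σ → ℂ) → ℂ} :
    f ∈ polyFun σ ↔ ∃ P : MvPolynomial σ ℂ, ∀ p, eval p P = f p := by
  rw [polyFun, AlgHom.mem_range]
  refine exists_congr fun P => ⟨fun h p => ?_, fun h => _root_.funext fun p => ?_⟩
  · rw [← h, ← aeval_eq_eval]
    rfl
  · rw [← h, ← aeval_eq_eval]
    rfl

theorem const_mem_polyFun (c : ℂ) : (fun _ => c) ∈ polyFun σ := (polyFun σ).algebraMap_mem c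

theorem apply_mem_polyFun (i : σ) : (fun p => p i) ∈ polyFun σ :=
  mem_polyFun.mpr ⟨X i, fun _ => eval_X _⟩

theorem polyFun_add {f g : (σ → ℂ) → ℂ} (hf : f ∈ polyFun σ) (hg : g ∈ polyFun σ) :
    (fun p => f p + g p) ∈ polyFun σ := (polyFun σ).add_mem hf hg

theorem polyFun_sub {f g : (σ → ℂ) → ℂ} (hf : f ∈ polyFun σ) (hg : g ∈ polyFun σ) :
    (fun p => f p - g p) ∈ polyFun σ := (polyFun σ).sub_mem hf hg

theorem polyFun_mul {f g : (σ → ℂ) → ℂ} (hf : f ∈ polyFun σ) (hg : g ∈ polyFun σ) :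
    (fun p => f p * g p) ∈ polyFun σ := (polyFun σ).mul_mem hf hg

theorem polyFun_sum {ι : Type*} (s : Finset ι) {f : ι → (σ → ℂ) → ℂ} (hf : ∀ i, f i ∈ polyFun σ) :
    (fun p => ∑ i ∈ s, f i p) ∈ polyFun σ := by
  have := (polyFun σ).sum_mem (t := s) fun i _ => hf i
  convert this using 1
  ext p
  simp

theorem polyFun_eval {n : Type*} {y : n → (σ → ℂ) → ℂ} (hy : ∀ i, y i ∈ polyFun σ)
    (G : MvPolynomial n ℂ) : (fun p => eval (fun i => y i p) G) ∈ polyFun σ := by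
  choose P hP using fun i => mem_polyFun.mp (hy i)
  refine mem_polyFun.mpr ⟨aeval P G, fun p => ?_⟩
  rw [← aeval_eq_eval, comp_aeval_apply, aeval_eq_eval]
  simp only [aeval_eq_eval, hP]

theorem polyFun_det {m : Type*} [Fintype m] [DecidableEq m] {A : (σ → ℂ) → Matrix m m ℂ}
    (hA : ∀ i j, (fun p => A p i j) ∈ polyFun σ) : (fun p => (A p).det) ∈ polyFun σ := by
  have : (fun p => (A p).det) =
      ∑ s : Equiv.Perm m, (Equiv.Perm.sign s : ℂ) • ∏ i, fun p => A p (s i) i := by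
    ext p
    simp [Matrix.det_apply']
  rw [this]
  exact (polyFun σ).sum_mem fun s _ => (polyFun σ).smul_mem
    ((polyFun σ).prod_mem fun i _ => hA _ _) _

theorem polyFun_adjugate {m : Type*} [Fintype m] [DecidableEq m] {A : (σ → ℂ) → Matrix m m ℂ}
    (hA : ∀ i j, (fun p => A p i j) ∈ polyFun σ) (i j : m) :
    (fun p => (A p).adjugate i j) ∈ polyFun σ := by
  simp only [Matrix.adjugate_apply]
  apply polyFun_det
  intro k l
  by_cases h : k = j
  · subst h
    simp only [Matrix.updateRow_self]
    exact const_mem_polyFun _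
  · simp only [Matrix.updateRow_ne h]
    exact hA k l

variable {ι m : Type*} [Fintype m]

/-- The solutions of a system of linear equations whose coefficients depend on `p`. -/
def solutions (N : ι → m → (σ → ℂ) → ℂ) (p : σ → ℂ) : Submodule ℂ (m → ℂ) where
  carrier := {Y | ∀ i, ∑ k, N i k p * Y k = 0}
  zero_mem' := fun i => by simp
  add_mem' := fun h h' i => by simp [mul_add, Finset.sum_add_distrib, h i, h' i]
  smul_mem' := fun c Y h i => by simp [mul_left_comm _ c, ← Finset.mul_sum, h i]

theorem finrank_solutions_of_det_ne_zero [DecidableEq m] {M : Matrix m m ℂ} (hM : M.det ≠ 0)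
    (Z : Submodule ℂ (m → ℂ)) :
    Module.finrank ℂ (Z.comap M.toLin') = Module.finrank ℂ Z := by
  let e := LinearEquiv.ofIsUnitDet (f := M.toLin') (v := Pi.basisFun ℂ m) (v' := Pi.basisFun ℂ m)
    (by rw [LinearMap.toMatrix_eq_toMatrix', LinearMap.toMatrix'_toLin']
        exact isUnit_iff_ne_zero.mpr hM)
  have : Z.comap M.toLin' = Z.map (e.symm : (m → ℂ) →ₗ[ℂ] m → ℂ) :=
    Submodule.comap_equiv_eq_map_symm e Z
  rw [this]
  exact e.symm.finrank_map_eq Z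

/-- A solution at `p₀` of a linear system with polynomial coefficients extends polynomially to those
points near `p₀` at which the space of solutions does not drop. -/
theorem exists_polyFun_solution [DecidableEq m] {N : ι → m → (σ → ℂ) → ℂ}
    (hN : ∀ i k, N i k ∈ polyFun σ) {p₀ : σ → ℂ} {Y₀ : m → ℂ} (hY₀ : Y₀ ∈ solutions N p₀) :
    ∃ (Y : m → (σ → ℂ) → ℂ) (δ : (σ → ℂ) → ℂ), (∀ k, Y k ∈ polyFun σ) ∧ δ ∈ polyFun σ ∧
      δ p₀ ≠ 0 ∧ (∀ k, Y k p₀ = δ p₀ * Y₀ k) ∧ ∀ p, δ p ≠ 0 →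
        Module.finrank ℂ (solutions N p₀) ≤ Module.finrank ℂ (solutions N p) →
        (fun k => Y k p) ∈ solutions N p := by
  classical
  -- A basis of the row space at p₀, completed by constant rows, gives a square matrix M(p)
  -- invertible near p₀.
  obtain ⟨B, hBS, hspan, hB⟩ := exists_linearIndependent ℂ (Set.range fun i k => N i k p₀)
  have hB' : LinearIndepOn ℂ id B := hB
  let E := Module.Basis.extend hB'
  have hfin : Fintype (hB'.extend (Set.subset_univ B)) := FiniteDimensional.fintypeBasisIndex E
  have hcard : Fintype.card (hB'.extend (Set.subset_univ B)) = Fintype.card m := by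
    rw [← Module.finrank_eq_card_basis E, Module.finrank_fintype_fun_eq_card]
  let e := Fintype.equivOfCardEq hcard
  have hrow : ∀ a : m → ℂ, ∃ ρ : m → (σ → ℂ) → ℂ, (∀ k, ρ k ∈ polyFun σ) ∧
      (∀ k, ρ k p₀ = a k) ∧ (a ∈ B → ∃ i, ρ = N i) := by
    intro a
    by_cases ha : a ∈ B
    · obtain ⟨i, hi⟩ := hBS ha
      exact ⟨N i, hN i, fun k => congrFun hi k, fun _ => ⟨i, rfl⟩⟩
    · exact ⟨fun k _ => a k, fun k => const_mem_polyFun _, fun _ => rfl, fun h => absurd h ha⟩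
  choose ρ hρ hρ₀ hρB using hrow
  let M : (σ → ℂ) → Matrix m m ℂ := fun p => Matrix.of fun i k => ρ (e.symm i).1 k p
  have hMmem : ∀ i k, (fun p => M p i k) ∈ polyFun σ := fun i k => hρ _ k
  have hM₀ : (M p₀).det ≠ 0 := by
    rw [← isUnit_iff_ne_zero, ← Matrix.isUnit_iff_isUnit_det,
      ← Matrix.linearIndependent_rows_iff_isUnit]
    have : (M p₀).row = E ∘ e.symm := by
      ext i k
      simp [M, hρ₀, E]
    rw [this]
    exact E.linearIndependent.comp _ e.symm.injective
  -- The vectors with zero entries at the rows taken from the system. Solutions at p lie in the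
  -- preimage of Z under M(p), with equality at p₀, and equality elsewhere as soon as the dimension
  -- does not drop.
  let Z : Submodule ℂ (m → ℂ) :=
    { carrier := {w | ∀ i, (e.symm i).1 ∈ B → w i = 0}
      zero_mem' := fun _ _ => rfl
      add_mem' := fun h h' i hi => by rw [Pi.add_apply, h i hi, h' i hi, add_zero]
      smul_mem' := fun c w h i hi => by rw [Pi.smul_apply, h i hi, smul_zero] }
  have hle : ∀ p, solutions N p ≤ Z.comap (M p).toLin' := by
    intro p Y hY i hi
    obtain ⟨i', h'⟩ := hρB _ hi
    rw [Matrix.toLin'_apply]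
    change ∑ k, ρ (e.symm i).1 k p * Y k = 0
    rw [h']
    exact hY i'
  have heq : Z.comap (M p₀).toLin' ≤ solutions N p₀ := by
    intro Y hY i
    have h1 : (fun k => N i k p₀) ∈ Submodule.span ℂ B := by
      rw [hspan]
      exact Submodule.subset_span ⟨i, rfl⟩
    have h2 : Submodule.span ℂ B ≤ LinearMap.ker (Fintype.linearCombination ℂ Y) := by
      rw [Submodule.span_le]
      intro a ha
      have h3 := hY (e ⟨a, hB'.subset_extend _ ha⟩) (by simpa using ha)
      rw [Matrix.toLin'_apply] at h3
      rw [SetLike.mem_coe, LinearMap.mem_ker]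
      rw [Fintype.linearCombination_apply]
      change ∑ k, a k * Y k = 0
      rw [← h3]
      change _ = ∑ k, ρ (e.symm (e ⟨a, _⟩)).1 k p₀ * Y k
      simp [hρ₀]
    have h3 := LinearMap.mem_ker.mp (h2 h1)
    rwa [Fintype.linearCombination_apply] at h3
  set w := M p₀ *ᵥ Y₀ with hw
  have hwZ : w ∈ Z := hle p₀ hY₀
  -- Cramer's rule: Y(p) = adj(M(p)) M(p₀) Y₀ is polynomial in p, and M(p) Y(p) is det(M(p)) times a
  -- fixed vector of Z.
  refine ⟨fun k p => ((M p).adjugate *ᵥ w) k, fun p => (M p).det, fun k => ?_, polyFun_det hMmem,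
    hM₀, fun k => ?_, fun p hp hdim => ?_⟩
  · exact polyFun_sum _ fun i => polyFun_mul (polyFun_adjugate hMmem k i) (const_mem_polyFun _)
  · change ((M p₀).adjugate *ᵥ (M p₀ *ᵥ Y₀)) k = (M p₀).det * Y₀ k
    rw [Matrix.mulVec_mulVec, Matrix.adjugate_mul, Matrix.smul_mulVec, Matrix.one_mulVec]
    rfl
  · have h1 : solutions N p = Z.comap (M p).toLin' := by
      apply Submodule.eq_of_le_of_finrank_le (hle p)
      rw [finrank_solutions_of_det_ne_zero hp, ← finrank_solutions_of_det_ne_zero hM₀]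
      exact (Submodule.finrank_mono heq).trans hdim
    rw [h1, Submodule.mem_comap, Matrix.toLin'_apply]
    change M p *ᵥ ((M p).adjugate *ᵥ w) ∈ Z
    rw [Matrix.mulVec_mulVec, Matrix.mul_adjugate, Matrix.smul_mulVec, Matrix.one_mulVec]
    exact Z.smul_mem _ hwZ

end polyFun

section plucker

/-- The Plücker coordinates of `u ∧ v`. -/
def wedge (u v : Fin 6 → ℂ) : Fin 6 × Fin 6 → ℂ := fun k => u k.1 * v k.2 - u k.2 * v k.1

theorem isPluckerVector_wedge (u v : Fin 6 → ℂ) :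
    IsPluckerVector (Submodule.span ℂ {u, v}) (wedge u v) := ⟨u, v, rfl, rfl⟩

theorem span_pair_smul_left {c : ℂ} (hc : c ≠ 0) (u v : Fin 6 → ℂ) :
    Submodule.span ℂ {c • u, v} = Submodule.span ℂ {u, v} := by
  rw [Submodule.span_insert, Submodule.span_insert (x := u),
    Submodule.span_singleton_smul_eq (isUnit_iff_ne_zero.mpr hc)]

theorem IsPluckerVector.smul {L : Submodule ℂ (Fin 6 → ℂ)} {p : Fin 6 × Fin 6 → ℂ}
    (h : IsPluckerVector L p) {c : ℂ} (hc : c ≠ 0) : IsPluckerVector L (c • p) := by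
  obtain ⟨u, v, rfl, rfl⟩ := h
  refine ⟨c • u, v, (span_pair_smul_left hc u v).symm, ?_⟩
  ext k
  simp only [Pi.smul_apply, smul_eq_mul]
  ring

theorem wedge_comb (u v : Fin 6 → ℂ) (p q r s : ℂ) :
    wedge (p • u + q • v) (r • u + s • v) = (p * s - q * r) • wedge u v := by
  ext k
  simp only [wedge, Pi.add_apply, Pi.smul_apply, smul_eq_mul]
  ring

theorem wedge_ne_zero {u v : Fin 6 → ℂ} (h : LinearIndependent ℂ ![u, v]) : wedge u v ≠ 0 := by
  intro h0
  have hv := h.ne_zero 1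
  obtain ⟨i, hi⟩ := Function.ne_iff.mp hv
  have := Fintype.linearIndependent_iff.mp h ![v i, -u i] (by
    ext j
    have := congrFun h0 (j, i)
    simp only [wedge, Pi.zero_apply] at this
    simp only [Fin.sum_univ_two, Matrix.cons_val, Pi.add_apply, Pi.smul_apply, smul_eq_mul,
      Pi.zero_apply]
    linear_combination this) 0
  exact hi this

theorem linearIndependent_pair_of_finrank {u v : Fin 6 → ℂ}
    (h : Module.finrank ℂ (Submodule.span ℂ {u, v}) = 2) : LinearIndependent ℂ ![u, v] := by
  rw [linearIndependent_iff_card_eq_finrank_span, Set.finrank, Matrix.range_cons,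
    Matrix.range_cons, Matrix.range_empty, Set.union_empty]
  exact h.symm

theorem IsPluckerVector.ne_zero {L : Submodule ℂ (Fin 6 → ℂ)} {p : Fin 6 × Fin 6 → ℂ}
    (h : IsPluckerVector L p) (hL : Module.finrank ℂ L = 2) : p ≠ 0 := by
  obtain ⟨u, v, rfl, rfl⟩ := h
  exact wedge_ne_zero (linearIndependent_pair_of_finrank hL)

theorem IsPluckerVector.exists_smul {L : Submodule ℂ (Fin 6 → ℂ)} {p p' : Fin 6 × Fin 6 → ℂ}
    (h : IsPluckerVector L p) (h' : IsPluckerVector L p') (hL : Module.finrank ℂ L = 2) :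
    ∃ c : ℂ, c ≠ 0 ∧ p' = c • p := by
  have hp' := h'.ne_zero hL
  obtain ⟨u, v, rfl, rfl⟩ := h
  obtain ⟨u', v', e, rfl⟩ := h'
  have hu : u' ∈ Submodule.span ℂ {u, v} := e ▸ Submodule.subset_span (by simp)
  have hv : v' ∈ Submodule.span ℂ {u, v} := e ▸ Submodule.subset_span (by simp)
  obtain ⟨a, b, rfl⟩ := Submodule.mem_span_pair.mp hu
  obtain ⟨c, d, rfl⟩ := Submodule.mem_span_pair.mp hv
  have h1 := wedge_comb u v a b c d
  refine ⟨_, fun h0 => hp' ?_, h1⟩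
  rw [h0, zero_smul] at h1
  exact h1

theorem eval_smul_of_isHomogeneous {σ : Type*} {g : MvPolynomial σ ℂ} {d : ℕ}
    (hg : g.IsHomogeneous d) (t : ℂ) (p : σ → ℂ) : eval (t • p) g = t ^ d * eval p g := by
  rw [eval_eq, eval_eq, Finset.mul_sum]
  refine Finset.sum_congr rfl fun m hm => ?_
  have h1 : ∑ i ∈ m.support, m i = d := by
    have := hg (mem_support_iff.mp hm)
    rwa [Finsupp.weight_apply, Finsupp.sum, Finset.sum_congr rfl fun i _ => by
      rw [Pi.one_apply, smul_eq_mul, mul_one]] at this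
  simp only [Pi.smul_apply, smul_eq_mul, mul_pow, Finset.prod_mul_distrib]
  rw [Finset.prod_pow_eq_pow_sum, h1]
  ring

theorem eval_smul_eq_sum {σ : Type*} (g : MvPolynomial σ ℂ) (t : ℂ) (p : σ → ℂ) {n : ℕ}
    (hn : g.totalDegree < n) : eval (t • p) g =
      ∑ d ∈ Finset.range n, t ^ d * eval p (homogeneousComponent d g) := by
  conv_lhs => rw [← sum_homogeneousComponent g]
  rw [map_sum]
  have h1 : ∀ d, eval (t • p) (homogeneousComponent d g) =
      t ^ d * eval p (homogeneousComponent d g) := fun d =>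
    eval_smul_of_isHomogeneous (homogeneousComponent_isHomogeneous d g) t p
  simp only [h1]
  apply Finset.sum_subset
  · intro d hd
    rw [Finset.mem_range] at hd ⊢
    omega
  · intro d _ hd
    rw [Finset.mem_range] at hd
    rw [homogeneousComponent_eq_zero _ _ (by omega), map_zero, mul_zero]

/-- To show that a map is a morphism, the polynomials need not be homogeneous. -/
theorem exists_homogeneous_of_plucker {F F' : Poly} {φ : FanoLines F → FanoLines F'}
    {L₀ : FanoLines F} {p₀ : Fin 6 × Fin 6 → ℂ} (hp₀ : IsPluckerVector L₀.1 p₀)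
    {g : Fin 6 × Fin 6 → MvPolynomial (Fin 6 × Fin 6) ℂ} (hg₀ : ∃ k, eval p₀ (g k) ≠ 0)
    (hg : ∀ (L : FanoLines F) (p : Fin 6 × Fin 6 → ℂ), IsPluckerVector L.1 p →
      (∃ k, eval p (g k) ≠ 0) → IsPluckerVector (φ L).1 fun k => eval p (g k)) :
    ∃ (d : ℕ) (g : Fin 6 × Fin 6 → MvPolynomial (Fin 6 × Fin 6) ℂ),
      (∀ k, (g k).IsHomogeneous d) ∧
      (∀ p, IsPluckerVector L₀.1 p → ∃ k, eval p (g k) ≠ 0) ∧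
      ∀ (L : FanoLines F) (p : Fin 6 × Fin 6 → ℂ), IsPluckerVector L.1 p →
        (∃ k, eval p (g k) ≠ 0) → IsPluckerVector (φ L).1 fun k => eval p (g k) := by
  obtain ⟨k₀, hk₀⟩ := hg₀
  -- A degree whose homogeneous component does not vanish at p₀; the components of this degree
  -- replace g.
  obtain ⟨d, hd⟩ : ∃ d, eval p₀ (homogeneousComponent d (g k₀)) ≠ 0 := by
    by_contra! H
    apply hk₀
    rw [← sum_homogeneousComponent (g k₀), map_sum]
    exact Finset.sum_eq_zero fun d _ => H d
  refine ⟨d, fun k => homogeneousComponent d (g k),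
    fun k => homogeneousComponent_isHomogeneous d _, fun p hp => ⟨k₀, ?_⟩, fun L p hp hne => ?_⟩
  · obtain ⟨c, hc, rfl⟩ := hp₀.exists_smul hp L₀.2.1
    have h1 : eval (c • p₀) (homogeneousComponent d (g k₀)) =
        c ^ d * eval p₀ (homogeneousComponent d (g k₀)) :=
      eval_smul_of_isHomogeneous (homogeneousComponent_isHomogeneous d (g k₀)) c p₀
    rw [h1]
    exact mul_ne_zero (pow_ne_zero _ hc) hd
  · obtain ⟨u, v, huv⟩ : ∃ u v, (φ L).1 = Submodule.span ℂ {u, v} := by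
      obtain ⟨y, -, hy⟩ := exists_span_eq_of_finrank two_ne_zero (φ L).2.1
      refine ⟨y 0, y 1, ?_⟩
      rw [← hy]
      congr 1
      ext a
      simp [Fin.exists_fin_two, eq_comm]
    have hw : IsPluckerVector (φ L).1 (wedge u v) := huv ▸ isPluckerVector_wedge u v
    set w := wedge u v
    obtain ⟨k₁, hk₁⟩ := Function.ne_iff.mp (hw.ne_zero (φ L).2.1)
    rw [Pi.zero_apply] at hk₁
    -- Rescaling p does not change the line, so g(t p) stays proportional to the Plücker vector w.
    -- Comparing coefficients of t^d transfers this to the component of degree d.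
    have key : ∀ k (t : ℂ), t ≠ 0 → w k₁ * eval (t • p) (g k) - w k * eval (t • p) (g k₁) = 0 := by
      intro k t ht
      by_cases h : ∃ k, eval (t • p) (g k) ≠ 0
      · obtain ⟨c, -, hc⟩ := hw.exists_smul (hg L _ (hp.smul ht) h) (φ L).2.1
        have e := fun k => congrFun hc k
        simp only [Pi.smul_apply, smul_eq_mul] at e
        rw [e, e]
        ring
      · push Not at h
        rw [h, h]
        ring
    have hcoeff : ∀ k, w k₁ * eval p (homogeneousComponent d (g k)) -
        w k * eval p (homogeneousComponent d (g k₁)) = 0 := by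
      intro k
      set n := max (max (g k).totalDegree (g k₁).totalDegree) d + 1
      let f : Polynomial ℂ := ∑ i ∈ Finset.range n, Polynomial.C
        (w k₁ * eval p (homogeneousComponent i (g k)) -
          w k * eval p (homogeneousComponent i (g k₁))) * Polynomial.X ^ i
      have hf : f = 0 := by
        apply Polynomial.eq_zero_of_infinite_isRoot
        apply (Set.finite_singleton (0 : ℂ)).infinite_compl.mono
        intro t ht
        have := key k t ht
        rw [eval_smul_eq_sum (g k) t p (n := n) (by omega),
          eval_smul_eq_sum (g k₁) t p (n := n) (by omega)] at this
        change Polynomial.eval t f = 0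
        rw [← this, Polynomial.eval_finsetSum, Finset.mul_sum, Finset.mul_sum,
          ← Finset.sum_sub_distrib]
        refine Finset.sum_congr rfl fun i _ => ?_
        simp only [Polynomial.eval_mul, Polynomial.eval_C, Polynomial.eval_pow, Polynomial.eval_X]
        ring
      have h1 := congrArg (Polynomial.coeff · d) hf
      simp only [f, Polynomial.finsetSum_coeff, Polynomial.coeff_C_mul_X_pow,
        Polynomial.coeff_zero, Finset.sum_ite_eq, Finset.mem_range] at h1
      rwa [if_pos (by omega)] at h1
    set c := eval p (homogeneousComponent d (g k₁)) / w k₁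
    have hc : (fun k => eval p (homogeneousComponent d (g k))) = c • w := by
      ext k
      rw [Pi.smul_apply, smul_eq_mul, div_mul_eq_mul_div, eq_div_iff hk₁]
      linear_combination hcoeff k
    rw [hc]
    apply hw.smul
    intro h0
    obtain ⟨k, hk⟩ := hne
    apply hk
    have := congrFun hc k
    rw [h0, zero_smul] at this
    exact this

end plucker

end VeroneseFano
end

/-! ### Triples along a line: constant dimension and polynomial families. -/

open MvPolynomial
noncomputable section
namespace VeroneseFano

open Matrix

/-- The bilinear equations `x y ∈ ℂ • 1` and `b(x, y) = 0`. -/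
def pencilForms (b : Bil) : Set Bil :=
  {T | T = b ∨ ∃ M : Matrix (Fin 3) (Fin 3) ℂ, M.trace = 0 ∧ T = traceForm M}

theorem traceForm_mem_pencilForms (b : Bil) {M : Matrix (Fin 3) (Fin 3) ℂ} (hM : M.trace = 0) :
    traceForm M ∈ pencilForms b := Or.inr ⟨M, hM, rfl⟩

theorem pencilPair_iff {b : Bil} {u v Y₀ Y₁ : Fin 6 → ℂ} :
    PencilPair b u v Y₀ Y₁ ↔ ∀ T ∈ pencilForms b, T u Y₀ + T v Y₁ = 0 := by
  constructor
  · rintro ⟨⟨l, hl⟩, hb⟩ T (rfl | ⟨M, hM, rfl⟩)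
    · exact hb
    · rw [traceForm_apply, traceForm_apply, ← Matrix.trace_add, ← mul_add, hl, mul_smul_comm,
        mul_one, Matrix.trace_smul, hM, smul_zero]
  · intro h
    refine ⟨exists_smul_one_of_trace fun M hM => ?_, h b (Or.inl rfl)⟩
    rw [mul_add, Matrix.trace_add]
    exact h _ (traceForm_mem_pencilForms b hM)

section

variable {σ : Type*}

theorem polyFun_dual (κ : Module.Dual ℂ (Fin 6 → ℂ)) {y : (σ → ℂ) → Fin 6 → ℂ}
    (hy : ∀ j, (fun p => y p j) ∈ polyFun σ) : (fun p => κ (y p)) ∈ polyFun σ := by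
  simp only [← eval_linForm]
  exact polyFun_eval hy _

theorem polyFun_bil (T : Bil) {u y : (σ → ℂ) → Fin 6 → ℂ} (hu : ∀ j, (fun p => u p j) ∈ polyFun σ)
    (hy : ∀ j, (fun p => y p j) ∈ polyFun σ) : (fun p => T (u p) (y p)) ∈ polyFun σ := by
  have : (fun p => T (u p) (y p)) = fun p => ∑ j, T.flip (Pi.single j 1) (u p) * y p j := by
    ext p
    conv_lhs => rw [pi_sum_single (y p)]
    simp [mul_comm]
  rw [this]
  exact polyFun_sum _ fun j => polyFun_mul (polyFun_dual _ hu) (hy j)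

/-- The linear system defining triples. -/
def tripleSystem (b : Bil) (u v : (σ → ℂ) → Fin 6 → ℂ) :
    pencilForms b × Fin 2 → Fin 3 × Fin 6 → (σ → ℂ) → ℂ := fun i l p =>
  (if l.1 = i.2.castSucc then i.1.1 (u p) (Pi.single l.2 1) else 0) +
    if l.1 = i.2.succ then i.1.1 (v p) (Pi.single l.2 1) else 0

theorem tripleSystem_mem {b : Bil} {u v : (σ → ℂ) → Fin 6 → ℂ}
    (hu : ∀ j, (fun p => u p j) ∈ polyFun σ) (hv : ∀ j, (fun p => v p j) ∈ polyFun σ)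
    (i : pencilForms b × Fin 2) (l : Fin 3 × Fin 6) : tripleSystem b u v i l ∈ polyFun σ := by
  apply polyFun_add
  · split_ifs
    · exact polyFun_bil _ hu fun j => const_mem_polyFun _
    · exact const_mem_polyFun _
  · split_ifs
    · exact polyFun_bil _ hv fun j => const_mem_polyFun _
    · exact const_mem_polyFun _

theorem mem_solutions_tripleSystem {b : Bil} {u v : (σ → ℂ) → Fin 6 → ℂ} {p : σ → ℂ}
    {Y : Fin 3 × Fin 6 → ℂ} : Y ∈ solutions (tripleSystem b u v) p ↔
      PencilTriple b (u p) (v p) fun l j => Y (l, j) := by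
  have h1 : ∀ (κ : Module.Dual ℂ (Fin 6 → ℂ)) (y : Fin 6 → ℂ),
      ∑ j, κ (Pi.single j 1) * y j = κ y := by
    intro κ y
    conv_rhs => rw [pi_sum_single y]
    simp [mul_comm]
  have h : ∀ i : pencilForms b × Fin 2, ∑ l, tripleSystem b u v i l p * Y l =
      i.1.1 (u p) (fun j => Y (i.2.castSucc, j)) + i.1.1 (v p) (fun j => Y (i.2.succ, j)) := by
    intro i
    simp only [tripleSystem, add_mul, Finset.sum_add_distrib, Fintype.sum_prod_type, ite_mul,
      zero_mul]
    rw [← h1, ← h1]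
    congr 1
    · rw [Finset.sum_eq_single i.2.castSucc]
      · simp
      · intro l _ hl
        simp [hl]
      · simp
    · rw [Finset.sum_eq_single i.2.succ]
      · simp
      · intro l _ hl
        simp [hl]
      · simp
  constructor
  · intro hY
    constructor
    · exact pencilPair_iff.mpr fun T hT => (h (⟨T, hT⟩, 0)).symm.trans (hY _)
    · exact pencilPair_iff.mpr fun T hT => (h (⟨T, hT⟩, 1)).symm.trans (hY _)
  · rintro ⟨h0, h1⟩ ⟨⟨T, hT⟩, k⟩
    rw [h]
    fin_cases k
    · exact pencilPair_iff.mp h0 T hT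
    · exact pencilPair_iff.mp h1 T hT

end

section

variable {b : Bil} {x y : Fin 3 → Fin 6 → ℂ} {s₁ s₂ : Matrix (Fin 3) (Fin 3) ℂ}

theorem form_sum_sum {T : Bil} {s : Matrix (Fin 3) (Fin 3) ℂ} (h : ∀ i j, T (x i) (y j) = s i j)
    (ξ η : Fin 3 → ℂ) : T (∑ i, ξ i • x i) (∑ j, η j • y j) = ξ ⬝ᵥ s *ᵥ η := by
  rw [show T (∑ i, ξ i • x i) = ∑ i, ξ i • T (x i) by simp, LinearMap.sum_apply]
  exact Finset.sum_congr rfl fun i _ => by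
    rw [LinearMap.smul_apply, form_sum h, smul_eq_mul]

theorem AdaptedFrame.exists_coords_bil (h : AdaptedFrame b x y s₁ s₂) : ∃ k₁ k₂ : ℂ,
    ∀ a ∈ Submodule.span ℂ {x 0, x 1}, ∃ ξ : Fin 3 → ℂ, ∑ i, ξ i • x i = a ∧
      ∀ η : Fin 3 → ℂ, b (∑ i, ξ i • x i) (∑ j, η j • y j) =
        k₁ * (ξ ⬝ᵥ s₁ *ᵥ η) + k₂ * (ξ ⬝ᵥ s₂ *ᵥ η) := by
  obtain ⟨k₁, k₂, hb⟩ := h.bil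
  obtain ⟨M₁, M₂, -, -, hM⟩ := h.exists_traceForms
  refine ⟨k₁, k₂, fun a ha => ?_⟩
  obtain ⟨p, q, rfl⟩ := Submodule.mem_span_pair.mp ha
  refine ⟨![p, q, 0], by simp [Fin.sum_univ_three], fun η => ?_⟩
  rw [bil_sum_eq hM hb]
  simp

/-- The triples along a line which is not contained in the Veronese surface form a space of
dimension five. -/
theorem AdaptedFrame.finrank_solutions {σ : Type*} (h : AdaptedFrame b x y s₁ s₂)
    {u v : (σ → ℂ) → Fin 6 → ℂ} {p : σ → ℂ}
    (huv : Submodule.span ℂ {u p, v p} = Submodule.span ℂ {x 0, x 1}) (hc : crem (u p) ≠ 0) :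
    Module.finrank ℂ (solutions (tripleSystem b u v) p) = 5 := by
  obtain ⟨k₁, k₂, hmem⟩ := h.exists_coords_bil
  obtain ⟨M₁, M₂, hM₁, hM₂, hM⟩ := h.exists_traceForms
  obtain ⟨ξ, hξ, hbξ⟩ := hmem (u p) (huv ▸ Submodule.subset_span (by simp))
  obtain ⟨ξ', hξ', hbξ'⟩ := hmem (v p) (huv ▸ Submodule.subset_span (by simp))
  -- In coordinates of the plane a triple has nine entries subject to four equations, s₁ and s₂ for
  -- each pair. These are independent when f does not vanish at the first generator, which leaves
  -- dimension 9 - 4 = 5.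
  let Λ : (Fin 3 × Fin 3 → ℂ) →ₗ[ℂ] (Fin 2 × Fin 2 → ℂ) :=
    { toFun := fun η k => ξ ⬝ᵥ (![s₁, s₂] k.2) *ᵥ (fun i => η (k.1.castSucc, i)) +
        ξ' ⬝ᵥ (![s₁, s₂] k.2) *ᵥ (fun i => η (k.1.succ, i))
      map_add' := fun η η' => by
        ext k
        simp only [Pi.add_apply, Matrix.dotProduct_mulVec]
        rw [show (fun i => η (k.1.castSucc, i) + η' (k.1.castSucc, i)) =
          (fun i => η (k.1.castSucc, i)) + fun i => η' (k.1.castSucc, i) from rfl,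
          show (fun i => η (k.1.succ, i) + η' (k.1.succ, i)) =
          (fun i => η (k.1.succ, i)) + fun i => η' (k.1.succ, i) from rfl,
          dotProduct_add, dotProduct_add]
        ring
      map_smul' := fun t η => by
        ext k
        simp only [Pi.smul_apply, Matrix.dotProduct_mulVec, RingHom.id_apply]
        rw [show (fun i => t • η (k.1.castSucc, i)) = t • fun i => η (k.1.castSucc, i) from rfl,
          show (fun i => t • η (k.1.succ, i)) = t • fun i => η (k.1.succ, i) from rfl,
          dotProduct_smul, dotProduct_smul, smul_add] }
  let Θ : (Fin 3 × Fin 3 → ℂ) →ₗ[ℂ] (Fin 3 × Fin 6 → ℂ) :=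
    { toFun := fun η l => ∑ i, η (l.1, i) * y i l.2
      map_add' := fun η η' => by ext l; simp [add_mul, Finset.sum_add_distrib]
      map_smul' := fun t η => by ext l; simp [mul_assoc, Finset.mul_sum] }
  have hΘ : ∀ η l, (fun j => Θ η (l, j)) = ∑ i, η (l, i) • y i := by
    intro η l
    ext j
    simp [Θ]
  have hΘinj : Function.Injective Θ := by
    rw [← LinearMap.ker_eq_bot, LinearMap.ker_eq_bot']
    intro η hη
    ext ⟨l, i⟩
    have h1 : ∑ i, η (l, i) • y i = 0 := by
      rw [← hΘ, hη]
      rfl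
    exact Fintype.linearIndependent_iff.mp h.indep_y _ h1 i
  have hsurj : Function.Surjective Λ := by
    intro w
    obtain ⟨c, hc'⟩ := h.crem_x
    have hn : (ξ ᵥ* s₁) ⨯₃ (ξ ᵥ* s₂) ≠ 0 := by
      intro h0
      apply hc
      rw [← hξ, hc', h0]
      simp
    obtain ⟨η₁, e₁, e₂⟩ := exists_dotProduct_eq hn (w (1, 0)) (w (1, 1))
    obtain ⟨η₀, e₃, e₄⟩ := exists_dotProduct_eq hn (w (0, 0) - (ξ' ᵥ* s₁) ⬝ᵥ η₁)
      (w (0, 1) - (ξ' ᵥ* s₂) ⬝ᵥ η₁)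
    refine ⟨fun k => (![η₀, η₁, 0] : Fin 3 → Fin 3 → ℂ) k.1 k.2, ?_⟩
    have h0 : (fun _ : Fin 3 => (0 : ℂ)) = 0 := rfl
    ext ⟨k, a⟩
    fin_cases k <;> fin_cases a <;>
      simp [Λ, Matrix.dotProduct_mulVec, e₁, e₂, e₃, e₄, h0]
  have hsol : solutions (tripleSystem b u v) p = (LinearMap.ker Λ).map Θ := by
    have hΘ' : ∀ η, (fun l j => Θ η (l, j)) = fun l => ∑ i, η (l, i) • y i :=
      fun η => _root_.funext (hΘ η)
    have hform : ∀ η, PencilTriple b (u p) (v p) (fun l j => Θ η (l, j)) ↔ Λ η = 0 := by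
      intro η
      rw [hΘ']
      constructor
      · rintro ⟨h0, h1⟩
        rw [← hξ, ← hξ', pencilPair_iff] at h0 h1
        have a0 := h0 _ (traceForm_mem_pencilForms b hM₁)
        have a1 := h0 _ (traceForm_mem_pencilForms b hM₂)
        have a2 := h1 _ (traceForm_mem_pencilForms b hM₁)
        have a3 := h1 _ (traceForm_mem_pencilForms b hM₂)
        rw [form_sum_sum (fun i j => (hM i j).1), form_sum_sum (fun i j => (hM i j).1)] at a0 a2
        rw [form_sum_sum (fun i j => (hM i j).2), form_sum_sum (fun i j => (hM i j).2)] at a1 a3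
        ext ⟨k, a⟩
        fin_cases k <;> fin_cases a
        exacts [a0, a1, a2, a3]
      · intro h0
        have e := fun k => congrFun h0 k
        constructor
        · rw [← hξ, ← hξ']
          exact h.pencilPair hbξ hbξ' (e (0, 0)) (e (0, 1))
        · rw [← hξ, ← hξ']
          exact h.pencilPair hbξ hbξ' (e (1, 0)) (e (1, 1))
    ext Y
    rw [mem_solutions_tripleSystem, Submodule.mem_map]
    constructor
    · intro hY
      choose η hη using fun l => exists_coords (h.triple_mem huv hY l)
      have : Θ (fun k => η k.1 k.2) = Y := by
        ext ⟨l, j⟩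
        exact (congrFun (hΘ _ l) j).trans (congrFun (hη l) j)
      refine ⟨_, ?_, this⟩
      rw [LinearMap.mem_ker, ← hform, this]
      exact hY
    · rintro ⟨η, hη, rfl⟩
      exact (hform η).mpr hη
  have h1 := LinearMap.finrank_range_add_finrank_ker Λ
  rw [LinearMap.range_eq_top.mpr hsurj, finrank_top, Module.finrank_fintype_fun_eq_card,
    Module.finrank_fintype_fun_eq_card] at h1
  simp only [Fintype.card_prod, Fintype.card_fin] at h1
  rw [hsol, ← (Submodule.equivMapOfInjective Θ hΘinj _).finrank_eq]
  omega

/-- Polynomial families of points in the planes of the total transforms. -/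
theorem AdaptedFrame.exists_polyFun_point {σ : Type*} (h : AdaptedFrame b x y s₁ s₂)
    {u v : (σ → ℂ) → Fin 6 → ℂ} (hu : ∀ j, (fun p => u p j) ∈ polyFun σ)
    (hv : ∀ j, (fun p => v p j) ∈ polyFun σ) {p₀ : σ → ℂ}
    (huv : Submodule.span ℂ {u p₀, v p₀} = Submodule.span ℂ {x 0, x 1}) (hc : crem (u p₀) ≠ 0)
    {z : Fin 6 → ℂ} (hz : z ∈ Submodule.span ℂ (Set.range y)) :
    ∃ (Y : (σ → ℂ) → Fin 6 → ℂ) (δ : (σ → ℂ) → ℂ), (∀ j, (fun p => Y p j) ∈ polyFun σ) ∧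
      δ ∈ polyFun σ ∧ δ p₀ ≠ 0 ∧ Y p₀ = δ p₀ • z ∧
      ∀ p, δ p ≠ 0 → crem (u p) ≠ 0 → ∀ {x y : Fin 3 → Fin 6 → ℂ}
        {s₁ s₂ : Matrix (Fin 3) (Fin 3) ℂ}, AdaptedFrame b x y s₁ s₂ →
        Submodule.span ℂ {u p, v p} = Submodule.span ℂ {x 0, x 1} →
        Y p ∈ Submodule.span ℂ (Set.range y) := by
  obtain ⟨k₁, k₂, hmem⟩ := h.exists_coords_bil
  obtain ⟨ξ, hξ, hbξ⟩ := hmem (u p₀) (huv ▸ Submodule.subset_span (by simp))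
  obtain ⟨ξ', hξ', hbξ'⟩ := hmem (v p₀) (huv ▸ Submodule.subset_span (by simp))
  obtain ⟨ζ, rfl⟩ := exists_coords hz
  obtain ⟨Z, hZ, hZt⟩ := h.exists_triple (by rwa [hξ]) hbξ hbξ' ζ
  rw [hξ, hξ'] at hZt
  obtain ⟨Y, δ, hY, hδ, hδ₀, hY₀, key⟩ := exists_polyFun_solution (tripleSystem_mem (b := b) hu hv)
    (p₀ := p₀) (Y₀ := fun l => Z l.1 l.2) (mem_solutions_tripleSystem.mpr hZt)
  refine ⟨fun p j => Y (2, j) p, δ, fun j => hY _, hδ, hδ₀, ?_, ?_⟩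
  · ext j
    change Y (2, j) p₀ = _
    rw [hY₀, Pi.smul_apply, ← hZ]
    rfl
  · intro p hp hcp x y s₁ s₂ h' hL
    -- Both solution spaces have dimension five, so the dimension does not drop and the family
    -- consists of triples at p.
    have h1 := key p hp (by rw [h.finrank_solutions huv hc, h'.finrank_solutions hL hcp])
    exact h'.triple_mem hL (mem_solutions_tripleSystem.mp h1) 2

end

end VeroneseFano
end

/-! ### The residual line depends algebraically on the line. -/

open MvPolynomial
noncomputable section
namespace VeroneseFano

open Matrix

theorem linearIndependent_of_det_ne_zero {n : ℕ} {V : Type*} [AddCommGroup V] [Module ℂ V]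
    {ℓ : Fin n → Module.Dual ℂ V} {Y : Fin n → V}
    (h : (Matrix.of fun i j => ℓ i (Y j)).det ≠ 0) : LinearIndependent ℂ Y := by
  rw [Fintype.linearIndependent_iff]
  intro c hc
  have h1 : (Matrix.of fun i j => ℓ i (Y j)) *ᵥ c = 0 := by
    ext i
    have := congrArg (ℓ i) hc
    simp only [map_sum, map_smul, smul_eq_mul, map_zero] at this
    rw [Pi.zero_apply, ← this]
    simp only [Matrix.mulVec, dotProduct, Matrix.of_apply, mul_comm]
  exact congrFun (Matrix.eq_zero_of_mulVec_eq_zero h h1)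

/-- For a function with vanishing third differences, w can be moved along each coordinate direction
without meeting G = 0. It supplies a basis of the plane off the conic. -/
theorem exists_linearIndependent_forall_ne_zero {G : (Fin 3 → ℂ) → ℂ}
    (hG : ∀ a c : Fin 3 → ℂ, G a - 3 * G (a + (1 : ℂ) • c) + 3 * G (a + (2 : ℂ) • c) -
      G (a + (3 : ℂ) • c) = 0) {w : Fin 3 → ℂ} (hw0 : w ≠ 0) (hw : G w ≠ 0) :
    ∃ z : Fin 3 → Fin 3 → ℂ, LinearIndependent ℂ z ∧ ∀ i, G (z i) ≠ 0 := by
  have key : ∀ c, ∃ t : ℂ, t ≠ 0 ∧ G (w + t • c) ≠ 0 := by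
    intro c
    by_contra! H
    have := hG w c
    rw [H 1 (by norm_num), H 2 (by norm_num), H 3 (by norm_num)] at this
    exact hw (by simpa using this)
  obtain ⟨k, hk⟩ := Function.ne_iff.mp hw0
  rw [Pi.zero_apply] at hk
  choose t ht hGt using fun i : Fin 3 => key (Pi.single i 1)
  refine ⟨fun i => if i = k then w else w + t i • Pi.single i 1, ?_, fun i => ?_⟩
  · rw [Fintype.linearIndependent_iff]
    intro c hc
    have e : ∀ j, (∑ i, c i) * w j + (if j = k then 0 else c j * t j) = 0 := by
      intro j
      have h1 := congrFun hc j
      rw [Finset.sum_apply, Pi.zero_apply] at h1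
      refine Eq.trans ?_ h1
      rw [Finset.sum_mul]
      have h2 : ∀ i, (c i • if i = k then w else w + t i • Pi.single i (1 : ℂ)) j =
          c i * w j + if i = j then (if j = k then 0 else c j * t j) else 0 := by
        intro i
        by_cases h : i = k <;> by_cases h' : i = j
        · simp [← h, ← h']
        · simp [h, show ¬k = j from h ▸ h']
        · simp [h, ← h']
          ring
        · simp [h, h']
      simp only [h2, Finset.sum_add_distrib, Finset.sum_ite_eq', Finset.mem_univ, if_true]
    have hs : ∑ i, c i = 0 := by
      have := e k
      rw [if_pos rfl, add_zero] at this
      exact (mul_eq_zero.mp this).resolve_right hk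
    have hne : ∀ j, j ≠ k → c j = 0 := by
      intro j hj
      have := e j
      rw [hs, zero_mul, zero_add, if_neg hj] at this
      exact (mul_eq_zero.mp this).resolve_right (ht j)
    intro j
    by_cases hj : j = k
    · subst hj
      rwa [Finset.sum_eq_single j (fun i _ hi => hne i hi) (by simp)] at hs
    · exact hne j hj
  · dsimp only
    split_ifs
    · exact hw
    · exact hGt i

theorem conicForm_difference (s₁ s₂ : Matrix (Fin 3) (Fin 3) ℂ) (a c : Fin 3 → ℂ) :
    conicForm s₁ s₂ a - 3 * conicForm s₁ s₂ (a + (1 : ℂ) • c) +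
      3 * conicForm s₁ s₂ (a + (2 : ℂ) • c) - conicForm s₁ s₂ (a + (3 : ℂ) • c) = 0 := by
  simp only [conicForm, Matrix.mulVec_add, Matrix.mulVec_smul, map_add, map_smul,
    LinearMap.add_apply, LinearMap.smul_apply, Pi.add_apply, Pi.smul_apply, smul_eq_mul]
  ring

section

theorem isPluckerVector_lineIn_aux {P : Submodule ℂ (Fin 6 → ℂ)} (hP : Module.finrank ℂ P = 3)
    {A B C : Fin 6 → ℂ} (hi : LinearIndependent ℂ ![A, B, C]) (hA : A ∈ P) (hB : B ∈ P)
    (hC : C ∈ P) {μ : Module.Dual ℂ (Fin 6 → ℂ)} (hμ : μ A ≠ 0) :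
    IsPluckerVector (lineIn P μ) (μ A • wedge B C + μ B • wedge C A + μ C • wedge A B) := by
  refine ⟨B - (μ B / μ A) • A, μ A • C - μ C • A, ?_, ?_⟩
  · have hspan : Submodule.span ℂ (Set.range ![A, B, C]) = P := by
      refine Submodule.eq_of_le_of_finrank_eq ?_ ?_
      · rw [Submodule.span_le]
        rintro _ ⟨i, rfl⟩
        fin_cases i
        exacts [hA, hB, hC]
      · rw [finrank_span_eq_card hi, hP, Fintype.card_fin]
    have h2 := finrank_lineIn (μ := μ) hi ⟨A, hspan.symm ▸ hA, hμ⟩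
    rw [hspan] at h2
    symm
    refine Submodule.eq_of_le_of_finrank_eq ?_ ?_
    · rw [Submodule.span_le]
      rintro _ (rfl | rfl)
      · refine ⟨P.sub_mem hB (P.smul_mem _ hA), ?_⟩
        rw [SetLike.mem_coe, LinearMap.mem_ker, map_sub, map_smul, smul_eq_mul,
          div_mul_cancel₀ _ hμ, sub_self]
      · refine ⟨P.sub_mem (P.smul_mem _ hC) (P.smul_mem _ hA), ?_⟩
        rw [SetLike.mem_coe, LinearMap.mem_ker, map_sub, map_smul, map_smul, smul_eq_mul,
          smul_eq_mul, mul_comm, sub_self]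
    · rw [h2]
      have hi2 : LinearIndependent ℂ ![B - (μ B / μ A) • A, μ A • C - μ C • A] := by
        rw [Fintype.linearIndependent_iff]
        intro c hc
        have := Fintype.linearIndependent_iff.mp hi
          ![-(c 0 * (μ B / μ A)) - c 1 * μ C, c 0, c 1 * μ A] (by
            rw [← hc, Fin.sum_univ_three, Fin.sum_univ_two]
            simp only [Matrix.cons_val]
            module)
        have h0 := this 1
        have h1 := this 2
        simp only [Matrix.cons_val] at h0 h1
        intro i
        fin_cases i
        · exact h0
        · exact (mul_eq_zero.mp h1).resolve_right hμ
      have := finrank_span_eq_card hi2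
      rwa [Matrix.range_cons, Matrix.range_cons, Matrix.range_empty, Set.union_empty] at this
  · ext k
    simp only [wedge, Pi.add_apply, Pi.sub_apply, Pi.smul_apply, smul_eq_mul]
    field_simp
    ring

/-- The line on which a functional vanishes in the plane spanned by three vectors. -/
theorem isPluckerVector_lineIn {P : Submodule ℂ (Fin 6 → ℂ)} (hP : Module.finrank ℂ P = 3)
    {Y : Fin 3 → Fin 6 → ℂ} (hi : LinearIndependent ℂ Y) (hY : ∀ i, Y i ∈ P)
    {μ : Module.Dual ℂ (Fin 6 → ℂ)} (hμ : ∃ a ∈ P, μ a ≠ 0) :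
    IsPluckerVector (lineIn P μ) (μ (Y 0) • wedge (Y 1) (Y 2) + μ (Y 1) • wedge (Y 2) (Y 0) +
      μ (Y 2) • wedge (Y 0) (Y 1)) := by
  have hspan : Submodule.span ℂ (Set.range Y) = P := by
    refine Submodule.eq_of_le_of_finrank_eq ?_ ?_
    · rw [Submodule.span_le]
      rintro _ ⟨i, rfl⟩
      exact hY i
    · rw [finrank_span_eq_card hi, hP, Fintype.card_fin]
  obtain ⟨k, hk⟩ : ∃ k, μ (Y k) ≠ 0 := by
    by_contra! H
    obtain ⟨a, ha, hne⟩ := hμ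
    rw [← hspan] at ha
    obtain ⟨η, rfl⟩ := exists_coords ha
    apply hne
    simp [H]
  have hcyc : ∀ τ : Fin 3 → Fin 3, Function.Injective τ →
      LinearIndependent ℂ ![Y (τ 0), Y (τ 1), Y (τ 2)] := by
    intro τ hτ
    have : ![Y (τ 0), Y (τ 1), Y (τ 2)] = Y ∘ τ := by
      ext i j; fin_cases i <;> rfl
    rw [this]
    exact hi.comp τ hτ
  fin_cases k
  · exact isPluckerVector_lineIn_aux hP (hcyc ![0, 1, 2] (by decide)) (hY _) (hY _) (hY _) hk
  · have := isPluckerVector_lineIn_aux hP (hcyc ![1, 2, 0] (by decide)) (hY _) (hY _) (hY _) hk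
    convert this using 1
    simp only [Matrix.cons_val]
    abel
  · have := isPluckerVector_lineIn_aux hP (hcyc ![2, 0, 1] (by decide)) (hY _) (hY _) (hY _) hk
    convert this using 1
    simp only [Matrix.cons_val]
    abel

end

section

variable {b : Bil} {x y : Fin 3 → Fin 6 → ℂ} {s₁ s₂ : Matrix (Fin 3) (Fin 3) ℂ}

theorem conicForm_eq_mulVec (η : Fin 3 → ℂ) : conicForm s₁ s₂ η =
    (s₁ *ᵥ η) 0 * (s₂ *ᵥ η) 1 - (s₁ *ᵥ η) 1 * (s₂ *ᵥ η) 0 := rfl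

/-- The equation of the total transform computed with arbitrary bilinear equations. -/
theorem ConicFrame.exists_eval_conicEq (h : ConicFrame x y s₁ s₂) {M₁ M₂ : Matrix (Fin 3) (Fin 3) ℂ}
    (hM₁ : M₁.trace = 0) (hM₂ : M₂.trace = 0) {u v : Fin 6 → ℂ}
    (huv : Submodule.span ℂ {u, v} = Submodule.span ℂ {x 0, x 1}) : ∃ κ : ℂ, ∀ η : Fin 3 → ℂ,
    eval (∑ j, η j • y j) (conicEq (traceForm M₁) (traceForm M₂) u v) =
      κ * conicForm s₁ s₂ η := by
  obtain ⟨p, q, r, s, rfl, rfl, -⟩ := exists_change_of_span_eq h.indep_x huv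
  obtain ⟨A, B, τ, hm⟩ := h.mul_sum
  have htr : ∀ {M : Matrix (Fin 3) (Fin 3) ℂ} (_ : M.trace = 0) (i : Fin 3) (η : Fin 3 → ℂ),
      traceForm M (x i) (∑ j, η j • y j) =
        (s₁ *ᵥ η) i * (M * A).trace + (s₂ *ᵥ η) i * (M * B).trace := by
    intro M hM i η
    rw [traceForm_apply, hm, mul_add, mul_add, Matrix.trace_add, Matrix.trace_add, mul_smul_comm,
      mul_smul_comm, mul_smul_comm, Matrix.trace_smul, Matrix.trace_smul, Matrix.trace_smul,
      mul_one, hM, smul_zero, add_zero, smul_eq_mul, smul_eq_mul]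
  refine ⟨(p * s - q * r) * ((M₁ * A).trace * (M₂ * B).trace -
    (M₁ * B).trace * (M₂ * A).trace), fun η => ?_⟩
  rw [conicEq, map_sub, map_mul, map_mul, eval_linForm, eval_linForm, eval_linForm, eval_linForm,
    conicForm_eq_mulVec]
  simp only [map_add, map_smul, LinearMap.add_apply, LinearMap.smul_apply, smul_eq_mul, htr hM₁,
    htr hM₂]
  ring

theorem eval_conicEq_of_frame (hx : LinearIndependent ℂ x) {T₁ T₂ : Bil}
    (hT : ∀ i j, T₁ (x i) (y j) = s₁ i j ∧ T₂ (x i) (y j) = s₂ i j) {u v : Fin 6 → ℂ}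
    (huv : Submodule.span ℂ {u, v} = Submodule.span ℂ {x 0, x 1}) : ∃ κ : ℂ, κ ≠ 0 ∧
    ∀ η : Fin 3 → ℂ, eval (∑ j, η j • y j) (conicEq T₁ T₂ u v) = κ * conicForm s₁ s₂ η := by
  obtain ⟨p, q, r, s, rfl, rfl, hd⟩ := exists_change_of_span_eq hx huv
  refine ⟨_, hd, fun η => ?_⟩
  rw [conicEq, map_sub, map_mul, map_mul, eval_linForm, eval_linForm, eval_linForm, eval_linForm,
    conicForm_eq_mulVec]
  simp only [map_add, map_smul, LinearMap.add_apply, LinearMap.smul_apply, smul_eq_mul,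
    form_sum (fun i j => (hT i j).1), form_sum (fun i j => (hT i j).2)]
  ring

/-- The cyclic combination of three points of a plane cubic `q μ` that spans the line `μ = 0`. -/
def residualPlucker (F' : Poly) (Y : Fin 3 → Fin 6 → ℂ) (Q : (Fin 6 → ℂ) → ℂ) :
    Fin 6 × Fin 6 → ℂ :=
  (eval (Y 0) F' * Q (Y 1) * Q (Y 2)) • wedge (Y 1) (Y 2) +
  (eval (Y 1) F' * Q (Y 2) * Q (Y 0)) • wedge (Y 2) (Y 0) +
  (eval (Y 2) F' * Q (Y 0) * Q (Y 1)) • wedge (Y 0) (Y 1)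

theorem DualCubics.isPluckerVector_residual {F F' : Poly} (hD : DualCubics b F F')
    {L : FanoLines F} {L' : FanoLines F'} (hres : IsResidualLine F F' L.1 L'.1)
    (h : AdaptedFrame b x y s₁ s₂) (hL : L.1 = Submodule.span ℂ {x 0, x 1})
    {Y : Fin 3 → Fin 6 → ℂ} (hi : LinearIndependent ℂ Y)
    (hY : ∀ i, Y i ∈ Submodule.span ℂ (Set.range y)) {Q : (Fin 6 → ℂ) → ℂ} {κ : ℂ}
    (hQ : ∀ η : Fin 3 → ℂ, Q (∑ j, η j • y j) = κ * conicForm s₁ s₂ η)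
    (hne : ∀ i, Q (Y i) ≠ 0) : IsPluckerVector L'.1 (residualPlucker F' Y Q) := by
  obtain ⟨T₁, hT₁, T₂, hT₂, hT⟩ := h.exists_forms b
  obtain ⟨k₁, k₂, hb⟩ := h.bil
  obtain ⟨⟨c, hc, hF⟩, hμ, hr⟩ := h.isResidualLine hD (hL ▸ L.2.2) hT₁ hT₂ hT hb
  rw [hres.unique (hL ▸ hr)]
  set μ := residualForm b T₁ T₂ k₁ k₂ (x 2)
  have hfin : Module.finrank ℂ (Submodule.span ℂ (Set.range y)) = 3 := by
    rw [finrank_span_eq_card h.indep_y, Fintype.card_fin]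
  have h1 := isPluckerVector_lineIn hfin hi hY hμ
  choose η hη using fun i => exists_coords (hY i)
  have eF : ∀ i, eval (Y i) F' = c * conicForm s₁ s₂ (η i) * μ (Y i) := by
    intro i
    rw [← hη, hF]
  have eQ : ∀ i, Q (Y i) = κ * conicForm s₁ s₂ (η i) := by
    intro i
    rw [← hη, hQ]
  have hκ : κ ≠ 0 := fun h0 => hne 0 (by rw [eQ, h0, zero_mul])
  have hq : ∀ i, conicForm s₁ s₂ (η i) ≠ 0 := fun i h0 => hne i (by rw [eQ, h0, mul_zero])
  -- On the plane F' is c times conic times μ, and Q is κ times the conic. Hence F'(Y i) Q(Y j) Q(Y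
  -- k) equals μ(Y i) times a factor common to all three cyclic terms.
  convert h1.smul (c := c * κ ^ 2 * conicForm s₁ s₂ (η 0) * conicForm s₁ s₂ (η 1) *
    conicForm s₁ s₂ (η 2)) (by simp [hc, hκ, hq]) using 1
  simp only [residualPlucker, eF, eQ]
  module

/-- Contraction of a Plücker vector with a functional. -/
def contract (φ : Module.Dual ℂ (Fin 6 → ℂ)) (p : Fin 6 × Fin 6 → ℂ) : Fin 6 → ℂ :=
  fun i => ∑ k, φ (Pi.single k 1) * p (k, i)

theorem contract_wedge (φ : Module.Dual ℂ (Fin 6 → ℂ)) (u v : Fin 6 → ℂ) :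
    contract φ (wedge u v) = φ u • v - φ v • u := by
  ext i
  have h : ∀ a : Fin 6 → ℂ, φ a = ∑ k, φ (Pi.single k 1) * a k := fun a => by
    conv_lhs => rw [pi_sum_single a]
    simp [mul_comm]
  simp only [contract, wedge, Pi.sub_apply, Pi.smul_apply, smul_eq_mul, h u, h v, Finset.sum_mul,
    ← Finset.sum_sub_distrib]
  exact Finset.sum_congr rfl fun k _ => by ring

theorem polyFun_contract (φ : Module.Dual ℂ (Fin 6 → ℂ)) (i : Fin 6) :
    (fun p => contract φ p i) ∈ polyFun (Fin 6 × Fin 6) :=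
  polyFun_sum _ fun _ => polyFun_mul (const_mem_polyFun _) (apply_mem_polyFun _)

/-- Contracting with two functionals recovers generators of the line linearly from its Plücker
vector, up to the determinant of the functionals on the line. -/
theorem span_contract_eq {φ ψ : Module.Dual ℂ (Fin 6 → ℂ)} {u v : Fin 6 → ℂ}
    (h : ψ (contract φ (wedge u v)) ≠ 0) :
    Submodule.span ℂ {contract ψ (wedge u v), contract φ (wedge u v)} =
      Submodule.span ℂ {u, v} := by
  rw [contract_wedge, map_sub, map_smul, map_smul, smul_eq_mul, smul_eq_mul] at h
  set d := φ u * ψ v - φ v * ψ u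
  have hu : u ∈ Submodule.span ℂ {u, v} := Submodule.subset_span (by simp)
  have hv : v ∈ Submodule.span ℂ {u, v} := Submodule.subset_span (by simp)
  rw [contract_wedge, contract_wedge]
  apply le_antisymm
  · rw [Submodule.span_le]
    rintro _ (rfl | rfl)
    · exact Submodule.sub_mem _ (Submodule.smul_mem _ _ hv) (Submodule.smul_mem _ _ hu)
    · exact Submodule.sub_mem _ (Submodule.smul_mem _ _ hv) (Submodule.smul_mem _ _ hu)
  · rw [Submodule.span_le, Set.pair_subset_iff]
    constructor
    · refine Submodule.mem_span_pair.mpr ⟨-φ u / d, ψ u / d, ?_⟩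
      have : (-φ u / d) • (ψ u • v - ψ v • u) + (ψ u / d) • (φ u • v - φ v • u) =
          (d / d) • u := by simp only [d]; module
      rw [this, div_self h, one_smul]
    · refine Submodule.mem_span_pair.mpr ⟨-φ v / d, ψ v / d, ?_⟩
      have : (-φ v / d) • (ψ u • v - ψ v • u) + (ψ v / d) • (φ u • v - φ v • u) =
          (d / d) • v := by simp only [d]; module
      rw [this, div_self h, one_smul]

/-- The residual line depends algebraically on the line. -/
theorem DualCubics.isMorphism {F F' : Poly} (hD : DualCubics b F F')
    {π : FanoLines F → FanoLines F'} (hπ : ∀ L, IsResidualLine F F' L.1 (π L).1) :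
    IsMorphism π := by
  intro L₀
  obtain ⟨x, y, s₁, s₂, h₀, hL₀⟩ := hD.exists_frame L₀
  obtain ⟨M₁, M₂, hM₁, hM₂, hM⟩ := h₀.exists_traceForms
  obtain ⟨u₀, hu₀, hc⟩ := exists_crem_ne_zero L₀.2.1
  have hu₀0 : u₀ ≠ 0 := by
    rintro rfl
    apply hc
    ext i; fin_cases i <;> simp [crem]
  obtain ⟨v₀, hv₀, huv⟩ := exists_span_pair_eq L₀.2.1 hu₀ hu₀0
  have hind : LinearIndependent ℂ ![u₀, v₀] :=
    linearIndependent_pair_of_finrank (by rw [huv]; exact L₀.2.1)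
  obtain ⟨ℓ, hℓ⟩ := exists_dual_family hind
  have l00 : ℓ 0 u₀ = 1 := by simpa using hℓ 0 0
  have l01 : ℓ 0 v₀ = 0 := by simpa using hℓ 0 1
  have l10 : ℓ 1 u₀ = 0 := by simpa using hℓ 1 0
  have l11 : ℓ 1 v₀ = 1 := by simpa using hℓ 1 1
  set p₀ := wedge u₀ v₀
  -- Generators of the varying line, normalised to equal u₀ and v₀ at p₀.
  let U : (Fin 6 × Fin 6 → ℂ) → Fin 6 → ℂ := contract (-ℓ 1)
  let V : (Fin 6 × Fin 6 → ℂ) → Fin 6 → ℂ := contract (ℓ 0)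
  have hU : ∀ j, (fun p => U p j) ∈ polyFun _ := polyFun_contract _
  have hV : ∀ j, (fun p => V p j) ∈ polyFun _ := polyFun_contract _
  have hU₀ : U p₀ = u₀ := by
    simp only [U, p₀, contract_wedge, LinearMap.neg_apply, l10, l11]
    module
  have hV₀ : V p₀ = v₀ := by
    simp only [V, p₀, contract_wedge, l00, l01]
    module
  have huv₀ : Submodule.span ℂ {U p₀, V p₀} = Submodule.span ℂ {x 0, x 1} := by
    rw [hU₀, hV₀, huv, hL₀]
  obtain ⟨κ₀, hκ₀, hQ₀⟩ := eval_conicEq_of_frame h₀.indep_x hM huv₀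
  -- The trace forms of the frame at L₀ are kept for all lines. They always give a multiple of the
  -- equation of the conic, and `good` records where this multiple is nonzero.
  let Q : (Fin 6 × Fin 6 → ℂ) → (Fin 6 → ℂ) → ℂ := fun p a =>
    eval a (conicEq (traceForm M₁) (traceForm M₂) (U p) (V p))
  obtain ⟨w, hw⟩ : ∃ w, conicForm s₁ s₂ w ≠ 0 := by
    rcases h₀.conic with ⟨η, η', h⟩ | ⟨⟨k, hk, h⟩, -⟩
    · by_contra! H
      simp [H] at h
    · exact ⟨![0, 0, 1], by simpa [h] using hk⟩
  have hw0 : w ≠ 0 := by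
    rintro rfl
    simp [conicForm] at hw
  obtain ⟨ζ, hζ, hζq⟩ := exists_linearIndependent_forall_ne_zero (conicForm_difference s₁ s₂) hw0 hw
  let z : Fin 3 → Fin 6 → ℂ := fun i => ∑ j, ζ i j • y j
  have hz : LinearIndependent ℂ z :=
    hζ.map' (Fintype.linearCombination ℂ y) (LinearMap.ker_eq_bot'.mpr fun c hc => _root_.funext
      (Fintype.linearIndependent_iff.mp h₀.indep_y c
        (by simpa [Fintype.linearCombination_apply] using hc)))
  obtain ⟨m, hm⟩ := exists_dual_family hz
  have hpts := fun i => h₀.exists_polyFun_point hU hV huv₀ (by rwa [hU₀])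
    ((Submodule.mem_span_range_iff_exists_fun ℂ).mpr ⟨ζ i, rfl⟩)
  choose Y δ hY hδ hδ₀ hY₀ key using hpts
  obtain ⟨i₀, hi₀⟩ := Function.ne_iff.mp hc
  let ω : (Fin 6 × Fin 6 → ℂ) → ℂ := fun p => (Matrix.of fun i j => m i (Y j p)).det
  have hω : ω ∈ polyFun _ := polyFun_det fun i j => polyFun_dual _ (hY j)
  have hQmem : ∀ i, (fun p => Q p (Y i p)) ∈ polyFun _ := by
    intro i
    simp only [Q, conicEq, map_sub, map_mul, eval_linForm]
    exact polyFun_sub (polyFun_mul (polyFun_bil _ hU (hY i)) (polyFun_bil _ hV (hY i)))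
      (polyFun_mul (polyFun_bil _ hV (hY i)) (polyFun_bil _ hU (hY i)))
  -- The product of all quantities that must not vanish. It also multiplies the coordinate functions
  -- g, so that g ≠ 0 implies every condition at once.
  let good : (Fin 6 × Fin 6 → ℂ) → ℂ := fun p => (-ℓ 1) (V p) * crem (U p) i₀ *
    ((δ 0 p * δ 1 p * δ 2 p) * (Q p (Y 0 p) * Q p (Y 1 p) * Q p (Y 2 p)) * ω p)
  have hcrem : (fun p => crem (U p) i₀) ∈ polyFun (Fin 6 × Fin 6) := by
    have := polyFun_eval hU (crem (X : Fin 6 → Poly) i₀)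
    convert this using 2 with p
    have h1 := congrFun (map_crem (eval fun i => U p i) (X : Fin 6 → Poly)) i₀
    simpa using h1.symm
  have hgood : good ∈ polyFun _ :=
    polyFun_mul (polyFun_mul (polyFun_dual _ hV) hcrem) (polyFun_mul (polyFun_mul
      (polyFun_mul (polyFun_mul (hδ 0) (hδ 1)) (hδ 2))
      (polyFun_mul (polyFun_mul (hQmem 0) (hQmem 1)) (hQmem 2))) hω)
  let g : Fin 6 × Fin 6 → (Fin 6 × Fin 6 → ℂ) → ℂ := fun k p =>
    good p * residualPlucker F' (fun i => Y i p) (Q p) k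
  have hF'mem : ∀ i, (fun p => eval (Y i p) F') ∈ polyFun (Fin 6 × Fin 6) :=
    fun i => polyFun_eval (hY i) F'
  have hwmem : ∀ i j k, (fun p => wedge (Y i p) (Y j p) k) ∈ polyFun (Fin 6 × Fin 6) := by
    intro i j k
    exact polyFun_sub (polyFun_mul (hY _ _) (hY _ _)) (polyFun_mul (hY _ _) (hY _ _))
  have hg : ∀ k, g k ∈ polyFun _ := by
    intro k
    refine polyFun_mul hgood (polyFun_add (polyFun_add ?_ ?_) ?_)
    · exact polyFun_mul (polyFun_mul (polyFun_mul (hF'mem _) (hQmem _)) (hQmem _)) (hwmem _ _ _)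
    · exact polyFun_mul (polyFun_mul (polyFun_mul (hF'mem _) (hQmem _)) (hQmem _)) (hwmem _ _ _)
    · exact polyFun_mul (polyFun_mul (polyFun_mul (hF'mem _) (hQmem _)) (hQmem _)) (hwmem _ _ _)
  have main : ∀ (L : FanoLines F) (p : Fin 6 × Fin 6 → ℂ), IsPluckerVector L.1 p → good p ≠ 0 →
      IsPluckerVector (π L).1 fun k => g k p := by
    intro L p hp hne
    have hne' := hne
    simp only [good, mul_ne_zero_iff] at hne'
    obtain ⟨⟨h1, h2⟩, ⟨⟨⟨d0, d1⟩, d2⟩, ⟨q0, q1⟩, q2⟩, h3⟩ := hne'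
    obtain ⟨x', y', t₁, t₂, h', hL'⟩ := hD.exists_frame L
    have hspan : Submodule.span ℂ {U p, V p} = Submodule.span ℂ {x' 0, x' 1} := by
      obtain ⟨u, v, huv, rfl⟩ := hp
      rw [← hL', huv]
      exact span_contract_eq h1
    obtain ⟨κ, hκ⟩ := h'.exists_eval_conicEq hM₁ hM₂ hspan
    have hcp : crem (U p) ≠ 0 := fun h0 => h2 (congrFun h0 i₀)
    have hd : ∀ i, δ i p ≠ 0 := by
      intro i
      fin_cases i
      exacts [d0, d1, d2]
    have hr := hD.isPluckerVector_residual (hπ L) h' hL' (Y := fun i => Y i p) (Q := Q p)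
      (linearIndependent_of_det_ne_zero h3) (fun i => key i p (hd i) hcp h' hspan) hκ (by
        intro i
        fin_cases i
        exacts [q0, q1, q2])
    exact hr.smul hne
  have hgood₀ : good p₀ ≠ 0 := by
    have hQz : ∀ i, Q p₀ (Y i p₀) ≠ 0 := by
      intro i
      have h1 : Y i p₀ = ∑ j, (δ i p₀ • ζ i) j • y j := by
        rw [hY₀, Finset.smul_sum]
        exact Finset.sum_congr rfl fun j _ => by rw [Pi.smul_apply, smul_assoc]
      change eval (Y i p₀) _ ≠ 0
      rw [h1, hQ₀]
      refine mul_ne_zero hκ₀ ?_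
      have h2 : conicForm s₁ s₂ (δ i p₀ • ζ i) = δ i p₀ ^ 2 * conicForm s₁ s₂ (ζ i) := by
        simp only [conicForm_eq_mulVec, Matrix.mulVec_smul, Pi.smul_apply, smul_eq_mul]
        ring
      rw [h2]
      exact mul_ne_zero (pow_ne_zero _ (hδ₀ i)) (hζq i)
    have hωz : ω p₀ ≠ 0 := by
      have h1 : (Matrix.of fun i j => m i (Y j p₀)) = Matrix.diagonal fun i => δ i p₀ := by
        ext i j
        rw [Matrix.of_apply, hY₀, map_smul, show ∑ k, ζ j k • y k = z j from rfl, hm,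
          Matrix.diagonal_apply]
        by_cases hij : i = j
        · simp [hij]
        · simp [hij]
      change (Matrix.of fun i j => m i (Y j p₀)).det ≠ 0
      rw [h1, Matrix.det_diagonal]
      exact Finset.prod_ne_zero_iff.mpr fun i _ => hδ₀ i
    have h1 : (-ℓ 1) (V p₀) ≠ 0 := by
      rw [hV₀, LinearMap.neg_apply, l11]
      norm_num
    have h2 : crem (U p₀) i₀ ≠ 0 := by
      rw [hU₀]
      exact hi₀
    exact mul_ne_zero (mul_ne_zero h1 h2) (mul_ne_zero (mul_ne_zero
      (mul_ne_zero (mul_ne_zero (hδ₀ 0) (hδ₀ 1)) (hδ₀ 2))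
      (mul_ne_zero (mul_ne_zero (hQz 0) (hQz 1)) (hQz 2))) hωz)
  choose G hG using fun k => mem_polyFun.mp (hg k)
  have hp₀ : IsPluckerVector L₀.1 p₀ := huv ▸ isPluckerVector_wedge u₀ v₀
  apply exists_homogeneous_of_plucker hp₀ (g := G)
  · have h1 := (main L₀ p₀ hp₀ hgood₀).ne_zero (π L₀).2.1
    obtain ⟨k, hk⟩ := Function.ne_iff.mp h1
    exact ⟨k, by rw [hG]; exact hk⟩
  · rintro L p hp ⟨k, hk⟩
    simp only [hG] at hk ⊢
    exact main L p hp (left_ne_zero_of_mul hk)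

/-- Residual lines define mutually inverse isomorphisms of the Fano varieties. -/
theorem IsCubicPair.exists_isomorphism {F F' : Poly} (h : IsCubicPair F F') :
    ∃ (π : FanoLines F → FanoLines F') (π' : FanoLines F' → FanoLines F),
      (∀ (L : FanoLines F) (L' : FanoLines F'), IsResidualLine F F' L.1 L'.1 ↔ π L = L') ∧
      (∀ (L' : FanoLines F') (L : FanoLines F), IsResidualLine F' F L'.1 L.1 ↔ π' L' = L) ∧
      IsMorphism π ∧ IsMorphism π' ∧
      Function.LeftInverse π' π ∧ Function.RightInverse π' π := by
  obtain ⟨b, hD⟩ := h.exists_dualCubics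
  obtain ⟨c, hD'⟩ := hD.symm
  choose π hπ using hD.exists_isResidualLine
  choose π' hπ' using hD'.exists_isResidualLine
  refine ⟨π, π', fun L L' => ⟨fun h => Subtype.ext ((hπ L).unique h), fun h => h ▸ hπ L⟩,
    fun L' L => ⟨fun h => Subtype.ext ((hπ' L').unique h), fun h => h ▸ hπ' L'⟩,
    hD.isMorphism hπ, hD'.isMorphism hπ', fun L => ?_, fun L' => ?_⟩
  · exact Subtype.ext ((hπ' (π L)).unique (hD.isResidualLine_symm (hπ L)))
  · exact Subtype.ext ((hπ (π' L')).unique (hD'.isResidualLine_symm (hπ' L')))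

end

end VeroneseFano
end

/-! ### Derivations of ℂ and generic cubics. -/

open MvPolynomial
noncomputable section
namespace VeroneseFano

open Matrix

/-- L is algebraic, hence separable in characteristic zero, over a purely transcendental extension
of K. -/
theorem formallySmooth_of_charZero (K L : Type*) [Field K] [CharZero K] [Field L] [Algebra K L] :
    Algebra.FormallySmooth K L := by
  obtain ⟨s, hs⟩ := exists_isTranscendenceBasis K L
  have h1 : Algebra.IsAlgebraic (IntermediateField.adjoin K (Set.range ((↑) : s → L))) L :=
    hs.isAlgebraic_field
  exact .of_algebraicIndependent_of_isSeparable hs.1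

theorem exists_ringHom_lift {K L B : Type*} [Field K] [CharZero K] [Field L] [CommRing B]
    (ι : K →+* L) (ψ : K →+* B) (g : B →+* L) (hg : Function.Surjective g)
    (hn : IsNilpotent (RingHom.ker g)) (h : g.comp ψ = ι) :
    ∃ φ : L →+* B, (∀ z, g (φ z) = z) ∧ ∀ z, φ (ι z) = ψ z := by
  let _ := ι.toAlgebra
  let _ := ψ.toAlgebra
  have := formallySmooth_of_charZero K L
  let g' : B →ₐ[K] L := { g with commutes' := fun z => DFunLike.congr_fun h z }
  refine ⟨(Algebra.FormallySmooth.liftOfSurjective (AlgHom.id K L) g' hg hn).toRingHom,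
    fun z => ?_, fun z => ?_⟩
  · exact Algebra.FormallySmooth.liftOfSurjective_apply (AlgHom.id K L) g' hg hn z
  · exact (Algebra.FormallySmooth.liftOfSurjective (AlgHom.id K L) g' hg hn).commutes z

theorem dualNumber_ker_fst_isNilpotent :
    IsNilpotent (RingHom.ker (TrivSqZeroExt.fstHom ℂ ℂ ℂ).toRingHom) := by
  suffices h : RingHom.ker (TrivSqZeroExt.fstHom ℂ ℂ ℂ).toRingHom *
      RingHom.ker (TrivSqZeroExt.fstHom ℂ ℂ ℂ).toRingHom = ⊥ from
    ⟨2, ((pow_two (RingHom.ker (TrivSqZeroExt.fstHom ℂ ℂ ℂ).toRingHom)).trans h :)⟩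
  refine le_bot_iff.mp (Ideal.mul_le.mpr fun r hr s hs => ?_)
  have hr' : r.fst = 0 := hr
  have hs' : s.fst = 0 := hs
  rw [Ideal.mem_bot]
  ext <;> simp [hr', hs']

/-- A tangent vector to the `ℚ`-Zariski closure of a complex point extends to a derivation. -/
theorem exists_derivation {σ : Type*} (x y : σ → ℂ)
    (h : ∀ P : MvPolynomial σ ℚ, aeval x P = 0 →
      aeval (fun s => (TrivSqZeroExt.inl (x s) + TrivSqZeroExt.inr (y s) : DualNumber ℂ)) P = 0) :
    ∃ D : Derivation ℚ ℂ ℂ, ∀ s, D (x s) = y s := by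
  let ex : MvPolynomial σ ℚ →ₐ[ℚ] ℂ := aeval x
  let exy : MvPolynomial σ ℚ →ₐ[ℚ] DualNumber ℂ :=
    aeval (fun s => (TrivSqZeroExt.inl (x s) + TrivSqZeroExt.inr (y s) : DualNumber ℂ))
  let fs : DualNumber ℂ →+* ℂ := (TrivSqZeroExt.fstHom ℂ ℂ ℂ).toRingHom
  have hfs : ∀ P, fs (exy P) = ex P := fun P => by
    have : ((TrivSqZeroExt.fstHom ℂ ℂ ℂ).restrictScalars ℚ).comp exy = ex := by
      apply MvPolynomial.algHom_ext
      intro s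
      simp [exy, ex]
    exact DFunLike.congr_fun this P
  let A := ex.range
  -- The hypothesis says that x + εy satisfies all rational relations of x, so it defines a
  -- homomorphism on ℚ[x]. Elements with nonzero constant part are units, so it extends to the
  -- fraction field.
  let α : A →ₐ[ℚ] DualNumber ℂ :=
    AlgHom.liftOfSurjective ex.rangeRestrict ex.rangeRestrict_surjective exy (fun P hP => by
      apply h
      have := (RingHom.mem_ker).mp hP
      exact congrArg Subtype.val this)
  have hα : ∀ P, α (ex.rangeRestrict P) = exy P := fun P => AlgHom.liftOfSurjective_apply ..
  have hfα : ∀ a : A, fs (α a) = a := fun a => by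
    obtain ⟨P, rfl⟩ := ex.rangeRestrict_surjective a
    rw [hα, hfs]; rfl
  let K := FractionRing A
  let _ := FractionRing.liftAlgebra A ℂ
  have hu : ∀ a : nonZeroDivisors A, IsUnit ((α : A →+* DualNumber ℂ) a) := fun a => by
    rw [TrivSqZeroExt.isUnit_iff_isUnit_fst]
    have h1 : ((α : A →+* DualNumber ℂ) a).fst = ((a : A) : ℂ) := hfα a
    rw [h1, isUnit_iff_ne_zero]
    intro h0
    exact nonZeroDivisors.ne_zero a.2 (Subtype.ext h0)
  let ψ : K →+* DualNumber ℂ := IsLocalization.lift (M := nonZeroDivisors A) hu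
  have hψ : ∀ a : A, ψ (algebraMap A K a) = α a := fun a => IsLocalization.lift_eq hu a
  have hι : ∀ a : A, algebraMap K ℂ (algebraMap A K a) = a := fun a =>
    (IsScalarTower.algebraMap_apply A K ℂ a).symm
  have hcomp : fs.comp ψ = algebraMap K ℂ := by
    apply IsLocalization.ringHom_ext (nonZeroDivisors A)
    ext a
    simp only [RingHom.comp_apply, hψ, hfα, hι]
  -- Formal smoothness of ℂ over that field extends the homomorphism to ℂ, lifting the identity; its
  -- ε-part is the derivation.
  obtain ⟨φ, h1, h2⟩ := exists_ringHom_lift (algebraMap K ℂ) ψ fs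
    (fun z => ⟨TrivSqZeroExt.inl z, rfl⟩) dualNumber_ker_fst_isNilpotent hcomp
  have h1' : ∀ z, (φ z).fst = z := h1
  refine ⟨Derivation.mk' ((AddMonoidHom.toRatLinearMap
    { toFun := fun z => (φ z).snd, map_zero' := by simp, map_add' := by simp })) ?_, fun s => ?_⟩
  · intro a b
    change (φ (a * b)).snd = a • (φ b).snd + b • (φ a).snd
    rw [map_mul]
    simp [h1', mul_comm]
  · change (φ (x s)).snd = y s
    have h3 := h2 (algebraMap A K (ex.rangeRestrict (X s)))
    rw [hι, hψ, hα] at h3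
    have h4 : ((ex.rangeRestrict (X s) : A) : ℂ) = x s := by
      change ex (X s) = x s
      simp [ex]
    rw [h4] at h3
    rw [h3]
    simp [exy]

/-- The symmetric trilinear form of the cubic `b(a, f(a))`. -/
def tril (b : Bil) (a c d : Fin 6 → ℂ) : ℂ := b a (pol c d) + b c (pol a d) + b d (pol a c)

/-- The bilinear form whose matrix is obtained by applying `D`. -/
def Bil.map (D : ℂ → ℂ) (b : Bil) : Bil :=
  LinearMap.mk₂ ℂ (fun x y => ∑ i, ∑ j, D (b (Pi.single i 1) (Pi.single j 1)) * (x i * y j))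
    (fun x x' y => by
      simp only [Pi.add_apply, ← Finset.sum_add_distrib]
      refine Finset.sum_congr rfl fun i _ => Finset.sum_congr rfl fun j _ => by ring)
    (fun t x y => by
      simp only [Pi.smul_apply, smul_eq_mul, Finset.mul_sum]
      refine Finset.sum_congr rfl fun i _ => Finset.sum_congr rfl fun j _ => by ring)
    (fun x y y' => by
      simp only [Pi.add_apply, ← Finset.sum_add_distrib]
      refine Finset.sum_congr rfl fun i _ => Finset.sum_congr rfl fun j _ => by ring)
    (fun t x y => by
      simp only [Pi.smul_apply, smul_eq_mul, Finset.mul_sum]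
      refine Finset.sum_congr rfl fun i _ => Finset.sum_congr rfl fun j _ => by ring)

theorem Bil.map_apply (D : ℂ → ℂ) (b : Bil) (x y : Fin 6 → ℂ) : b.map D x y =
    ∑ i, ∑ j, D (b (Pi.single i 1) (Pi.single j 1)) * (x i * y j) := rfl

theorem Bil.map_flip (D : ℂ → ℂ) (b : Bil) : Bil.map D b.flip = (b.map D).flip := by
  refine LinearMap.ext fun x => LinearMap.ext fun y => ?_
  rw [LinearMap.flip_apply, Bil.map_apply, Bil.map_apply, Finset.sum_comm]
  refine Finset.sum_congr rfl fun i _ => Finset.sum_congr rfl fun j _ => ?_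
  rw [LinearMap.flip_apply]; ring

theorem Bil.map_single (D : ℂ → ℂ) (b : Bil) (i j : Fin 6) :
    b.map D (Pi.single i 1) (Pi.single j 1) = D (b (Pi.single i 1) (Pi.single j 1)) := by
  simp [Bil.map_apply, Pi.single_apply]

theorem derivation_bil (D : Derivation ℚ ℂ ℂ) (b : Bil) (x y : Fin 6 → ℂ) :
    D (b x y) = b.map D x y + b (D ∘ x) y + b x (D ∘ y) := by
  rw [← Bil.ext_apply b x y, ← Bil.ext_apply b _ y, ← Bil.ext_apply b x, Bil.map_apply]
  simp only [Bil.ext, map_sum, Derivation.leibniz, smul_eq_mul, Algebra.algebraMap_self,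
    RingHom.id_apply, ← Finset.sum_add_distrib, Function.comp_apply]
  refine Finset.sum_congr rfl fun i _ => Finset.sum_congr rfl fun j _ => ?_
  ring

theorem derivation_pol (D : Derivation ℚ ℂ ℂ) (x y : Fin 6 → ℂ) :
    D ∘ pol x y = pol (D ∘ x) y + pol x (D ∘ y) := by
  have h2 : D (2 : ℂ) = 0 := by exact_mod_cast D.map_natCast 2
  ext i
  fin_cases i <;> simp [pol, h2] <;> ring

theorem derivation_tril (D : Derivation ℚ ℂ ℂ) (b : Bil) (a c d : Fin 6 → ℂ) :
    D (tril b a c d) = tril (b.map D) a c d + tril b (D ∘ a) c d + tril b a (D ∘ c) d +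
      tril b a c (D ∘ d) := by
  simp only [tril, map_add, derivation_bil, derivation_pol]
  ring

theorem tril_eq (b : Bil) (a c d : Fin 6 → ℂ) : tril b a c d =
    eval (a + c + d) (cubicOf b) - eval (a + c) (cubicOf b) - eval (a + d) (cubicOf b) -
      eval (c + d) (cubicOf b) + eval a (cubicOf b) + eval c (cubicOf b) + eval d (cubicOf b) := by
  have h : pol (a + c) d = pol a d + pol c d := by
    ext i; fin_cases i <;> simp [pol] <;> ring
  simp only [eval_cubicOf, crem_add, h, map_add, LinearMap.add_apply, tril]
  ring

/-- The coordinates of f have integer coefficients, killed by D, so D acts only through the entries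
of b. -/
theorem derivation_coeff_cubicOf (D : Derivation ℚ ℂ ℂ) (b : Bil) (s : Fin 6 →₀ ℕ) :
    D (coeff s (cubicOf b)) = coeff s (cubicOf (b.map D)) := by
  have h : ∀ i j, D (coeff s (X i * crem (X : Fin 6 → Poly) j)) = 0 := fun i j => by
    have : X i * crem (X : Fin 6 → Poly) j = MvPolynomial.map (Int.castRingHom ℂ)
        (X i * crem (X : Fin 6 → MvPolynomial (Fin 6) ℤ) j) := by
      have h1 := congrFun (map_crem (MvPolynomial.map (Int.castRingHom ℂ)) (X : Fin 6 → _)) j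
      simp only [map_X] at h1
      rw [map_mul, map_X, h1]
    rw [this, coeff_map]
    simp
  simp only [cubicOf, Bil.ext, coeff_sum, map_sum, Bil.map_single, algebraMap_eq, coeff_C_mul,
    Derivation.leibniz, h, smul_eq_mul]
  refine Finset.sum_congr rfl fun i _ => Finset.sum_congr rfl fun j _ => ?_
  ring

/-- Every first-order deformation of the cubic of `b` comes from a derivation of `ℂ`. -/
def IsGeneric (b : Bil) : Prop :=
  ∀ b' : Bil, ∃ D : Derivation ℚ ℂ ℂ, cubicOf (b.map D) = cubicOf b'

theorem IsGeneric.exists_derivation {b : Bil} (h : IsGeneric b) (b' : Bil) :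
    ∃ D : Derivation ℚ ℂ ℂ, ∀ a c d, D (tril b a c d) = tril b' a c d + tril b (D ∘ a) c d +
      tril b a (D ∘ c) d + tril b a c (D ∘ d) := by
  obtain ⟨D, hD⟩ := h b'
  refine ⟨D, fun a c d => ?_⟩
  rw [derivation_tril, tril_eq (b.map D), hD, ← tril_eq]

/-- By f(f(a)) = det(a) a, a bilinear form and its transpose define the zero cubic simultaneously,
so deformations of the two cubics correspond. -/
theorem IsGeneric.flip {b : Bil} (h : IsGeneric b) : IsGeneric b.flip := by
  intro b'
  obtain ⟨D, hD⟩ := h (LinearMap.flip b')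
  refine ⟨D, ?_⟩
  by_contra hne
  rw [Bil.map_flip] at hne
  have h1 : cubicOfL ((b.map D).flip - b') ≠ 0 := by
    rw [map_sub]; exact sub_ne_zero.mpr hne
  apply cubicOf_flip_ne_zero h1
  have h2 : LinearMap.flip ((b.map D).flip - b') = b.map D - LinearMap.flip b' := rfl
  rw [h2]
  change cubicOfL _ = 0
  rw [map_sub]; exact sub_eq_zero.mpr hD

/-- The equations with rational coefficients of proper closed subsets of the space of cubics. -/
def rationalEquations : Set (MvPolynomial (Fin 6 →₀ ℕ) ℂ) :=
  {E | E ∈ Set.range (MvPolynomial.map (σ := Fin 6 →₀ ℕ) (algebraMap ℚ ℂ)) ∧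
    ∃ F ∈ cubicsThroughVeronese, eval (fun s => coeff s F) E ≠ 0}

theorem rationalEquations_countable : rationalEquations.Countable := by
  have : Countable (MvPolynomial (Fin 6 →₀ ℕ) ℚ) :=
    (AddMonoidAlgebra.coeffEquiv (R := ℚ) (M := (Fin 6 →₀ ℕ) →₀ ℕ)).injective.countable
  exact (Set.countable_range _).mono fun E hE => hE.1

theorem isGeneric_of_forall_ne_zero {b : Bil}
    (h : ∀ E ∈ rationalEquations, eval (fun s => coeff s (cubicOf b)) E ≠ 0) : IsGeneric b := by
  intro b'
  obtain ⟨D, hD⟩ := VeroneseFano.exists_derivation (fun s => coeff s (cubicOf b))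
    (fun s => coeff s (cubicOf b')) (by
    intro P hP
    -- A rational relation satisfied by the coefficients of this cubic must hold on the whole space
    -- of cubics through V, as otherwise it would be one of the excluded equations.
    have key : ∀ F ∈ cubicsThroughVeronese, aeval (fun s => coeff s F) P = (0 : ℂ) := by
      by_contra! hF
      obtain ⟨F, hF, hne⟩ := hF
      refine h (MvPolynomial.map (algebraMap ℚ ℂ) P) ⟨⟨P, rfl⟩, F, hF, ?_⟩ ?_
      · rwa [eval_map, ← aeval_def]
      · rwa [eval_map, ← aeval_def]
    let z : (Fin 6 →₀ ℕ) → Polynomial ℂ := fun s =>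
      Polynomial.C (coeff s (cubicOf b)) + Polynomial.X * Polynomial.C (coeff s (cubicOf b'))
    have hz : aeval z P = 0 := by
      apply Polynomial.funext
      intro t
      have h1 := key _ (cubicsThroughVeronese.add_mem (cubicOf_mem b)
        (cubicsThroughVeronese.smul_mem t (cubicOf_mem b')))
      have h2 : (((Polynomial.aeval t).restrictScalars ℚ : Polynomial ℂ →ₐ[ℚ] ℂ)) (aeval z P) =
          aeval (fun s => coeff s (cubicOf b + t • cubicOf b')) P := by
        rw [← AlgHom.comp_apply, comp_aeval]
        congr 2
        ext s
        simp only [z, AlgHom.restrictScalars_apply, map_add, map_mul, Polynomial.aeval_C,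
          Polynomial.aeval_X, coeff_add, coeff_smul, smul_eq_mul, Algebra.algebraMap_self,
          RingHom.id_apply]
      rw [Polynomial.eval_zero, ← h1, ← h2]
      simp [Polynomial.coe_aeval_eq_eval]
    -- The relation holds along the line b + t b' as a polynomial identity in t, hence also at t =
    -- ε.
    have h3 : (((Polynomial.aeval (DualNumber.eps : DualNumber ℂ)).restrictScalars ℚ :
        Polynomial ℂ →ₐ[ℚ] DualNumber ℂ)) (aeval z P) = aeval (fun s =>
          (TrivSqZeroExt.inl (coeff s (cubicOf b)) + TrivSqZeroExt.inr (coeff s (cubicOf b')) :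
            DualNumber ℂ)) P := by
      rw [← AlgHom.comp_apply, comp_aeval]
      congr 2
      ext s <;> simp [z, TrivSqZeroExt.algebraMap_eq_inl]
    rw [← h3, hz, map_zero])
  refine ⟨D, ?_⟩
  ext s
  rw [← derivation_coeff_cubicOf, hD]

end VeroneseFano
end

/-! ### Smoothness of generic cubics. -/

open MvPolynomial
noncomputable section
namespace VeroneseFano

open Matrix

theorem pol_comm {R : Type*} [CommRing R] (a c : Fin 6 → R) : pol a c = pol c a := by
  ext i; fin_cases i <;> simp [pol] <;> ring

theorem pol_self {R : Type*} [CommRing R] (a : Fin 6 → R) : pol a a = 2 • crem a := by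
  ext i; fin_cases i <;> simp [pol, crem] <;> ring

theorem tril_swap (b : Bil) (a c d : Fin 6 → ℂ) : tril b a c d = tril b c a d := by
  rw [tril, tril, pol_comm a c]; ring

theorem tril_right_comm (b : Bil) (a c d : Fin 6 → ℂ) : tril b a c d = tril b a d c := by
  rw [tril, tril, pol_comm c d]; ring

theorem pol_add_left {R : Type*} [CommRing R] (x y a : Fin 6 → R) :
    pol (x + y) a = pol x a + pol y a := by
  rw [pol_comm, pol_add_right, pol_comm x, pol_comm y]

theorem pol_smul_left {R : Type*} [CommRing R] (t : R) (x a : Fin 6 → R) :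
    pol (t • x) a = t • pol x a := by
  rw [pol_comm, pol_smul_right, pol_comm x]

/-- The trilinear form as a linear form in its first argument. -/
def trilL (b : Bil) (c d : Fin 6 → ℂ) : Module.Dual ℂ (Fin 6 → ℂ) where
  toFun a := tril b a c d
  map_add' x y := by
    simp only [tril, pol_add_left, map_add, LinearMap.add_apply]
    ring
  map_smul' t x := by
    simp only [tril, pol_smul_left, map_smul, LinearMap.smul_apply,
      RingHom.id_apply, smul_eq_mul]
    ring

theorem trilL_apply (b : Bil) (a c d : Fin 6 → ℂ) : trilL b c d a = tril b a c d := rfl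

/-- The product of two linear forms, as a bilinear form. -/
def Bil.tensor (κ ν : Module.Dual ℂ (Fin 6 → ℂ)) : Bil := κ.smulRight ν

theorem Bil.tensor_apply (κ ν : Module.Dual ℂ (Fin 6 → ℂ)) (x y : Fin 6 → ℂ) :
    Bil.tensor κ ν x y = κ x * ν y := rfl

theorem exists_dual_eq_one {a : Fin 6 → ℂ} (h : a ≠ 0) :
    ∃ κ : Module.Dual ℂ (Fin 6 → ℂ), κ a = 1 := by
  obtain ⟨i, hi⟩ := Function.ne_iff.mp h
  exact ⟨(a i)⁻¹ • LinearMap.proj i, inv_mul_cancel₀ hi⟩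

theorem exists_orthogonal (t s : Fin 3 → ℂ) :
    ∃ θ : Fin 3 → ℂ, θ ≠ 0 ∧ ∑ i, θ i * t i = 0 ∧ ∑ i, θ i * s i = 0 := by
  obtain ⟨θ, h0, h⟩ := (Matrix.exists_mulVec_eq_zero_iff (M := Matrix.of ![t, s, 0])).mpr (by
    simp [Matrix.det_fin_three])
  refine ⟨θ, h0, ?_, ?_⟩
  · simpa [Matrix.mulVec, dotProduct, mul_comm] using congrFun h 0
  · simpa [Matrix.mulVec, dotProduct, mul_comm] using congrFun h 1

/-- The value at `x` of the quadratic form of a symmetric matrix. -/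
def quadAt (x : Fin 3 → ℂ) : Module.Dual ℂ (Fin 6 → ℂ) where
  toFun a := x 0 ^ 2 * a 0 + 2 * x 0 * x 1 * a 1 + 2 * x 0 * x 2 * a 2 + x 1 ^ 2 * a 3 +
    2 * x 1 * x 2 * a 4 + x 2 ^ 2 * a 5
  map_add' a c := by simp only [Pi.add_apply]; ring
  map_smul' t a := by simp only [Pi.smul_apply, smul_eq_mul, RingHom.id_apply]; ring

theorem quadAt_apply (x : Fin 3 → ℂ) (a : Fin 6 → ℂ) : quadAt x a = x 0 ^ 2 * a 0 +
    2 * x 0 * x 1 * a 1 + 2 * x 0 * x 2 * a 2 + x 1 ^ 2 * a 3 + 2 * x 1 * x 2 * a 4 +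
    x 2 ^ 2 * a 5 := rfl

theorem quadAt_ver (x e : Fin 3 → ℂ) : quadAt x (ver e) = (x ⬝ᵥ e) ^ 2 := by
  simp [quadAt_apply, ver, dotProduct, Fin.sum_univ_three]; ring

theorem quadAt_symProd (x e f : Fin 3 → ℂ) : quadAt x (symProd e f) = 2 * (x ⬝ᵥ e) * (x ⬝ᵥ f) := by
  simp [quadAt_apply, symProd, dotProduct, Fin.sum_univ_three]; ring

/-- The quadratic forms are evaluated at vectors orthogonal to q, to p, and at their sum, which
isolates the three coefficients. -/
theorem coeff_eq_zero_of_ver_comb {p q : Fin 3 → ℂ} (h : p ⨯₃ q ≠ 0) {θ : Fin 3 → ℂ}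
    (h0 : θ 0 • ver p + θ 1 • symProd p q + θ 2 • ver q = 0) : θ = 0 := by
  obtain ⟨e, he⟩ := exists_tri_ne_zero h
  have hq : ∀ x : Fin 3 → ℂ, θ 0 * (x ⬝ᵥ p) ^ 2 + θ 1 * (2 * (x ⬝ᵥ p) * (x ⬝ᵥ q)) +
      θ 2 * (x ⬝ᵥ q) ^ 2 = 0 := fun x => by
    have := congrArg (quadAt x) h0
    simpa only [map_add, map_smul, quadAt_ver, quadAt_symProd, smul_eq_mul, map_zero] using this
  have e1 : (q ⨯₃ e) ⬝ᵥ p = tri e p q ∧ (q ⨯₃ e) ⬝ᵥ q = 0 ∧ (p ⨯₃ e) ⬝ᵥ p = 0 ∧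
      (p ⨯₃ e) ⬝ᵥ q = - tri e p q := by
    simp only [cross_apply, dotProduct, Fin.sum_univ_three, tri, Matrix.cons_val]
    refine ⟨?_, ?_, ?_, ?_⟩ <;> ring
  obtain ⟨e1, e2, e3, e4⟩ := e1
  have h1 := hq (q ⨯₃ e)
  have h2 := hq (p ⨯₃ e)
  have h3 := hq (q ⨯₃ e + p ⨯₃ e)
  simp only [add_dotProduct, e1, e2, e3, e4] at h1 h2 h3
  have t2 : tri e p q ^ 2 ≠ 0 := pow_ne_zero 2 he
  have k0 : θ 0 = 0 := (mul_eq_zero.mp (by linear_combination h1 : θ 0 * tri e p q ^ 2 = 0)).resolve_right t2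
  have k2 : θ 2 = 0 := (mul_eq_zero.mp (by linear_combination h2 : θ 2 * tri e p q ^ 2 = 0)).resolve_right t2
  have k1 : θ 1 = 0 := by
    rw [k0, k2] at h3
    exact (mul_eq_zero.mp (by linear_combination (-1 / 2) * h3 :
      θ 1 * tri e p q ^ 2 = 0)).resolve_right t2
  ext i; fin_cases i <;> assumption

theorem exists_comb_of_tri_ne_zero {e f g : Fin 3 → ℂ} (h : tri e f g ≠ 0) (u : Fin 3 → ℂ) :
    ∃ α β γ : ℂ, u = α • e + β • f + γ • g := by
  refine ⟨tri u f g / tri e f g, tri e u g / tri e f g, tri e f u / tri e f g, ?_⟩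
  ext i
  fin_cases i <;> simp only [Pi.add_apply, Pi.smul_apply, smul_eq_mul] <;> field_simp <;>
    simp [tri] <;> ring

theorem pol_ver_symProd {R : Type*} [CommRing R] (e f g : Fin 3 → R) :
    pol (ver e) (symProd f g) = symProd (e ⨯₃ f) (e ⨯₃ g) := by
  ext i; fin_cases i <;> simp [pol, ver, symProd, cross_apply] <;> ring

theorem symProd_add_smul (e u v w : Fin 3 → ℂ) (α β γ : ℂ) :
    symProd e (α • u + β • v + γ • w) = α • symProd e u + β • symProd e v + γ • symProd e w := by
  ext i; fin_cases i <;> simp [symProd] <;> ring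

theorem symProd_self (e : Fin 3 → ℂ) : symProd e e = (2 : ℂ) • ver e := by
  ext i; fin_cases i <;> simp [symProd, ver] <;> ring

theorem derivation_ver (D : Derivation ℚ ℂ ℂ) (e : Fin 3 → ℂ) :
    D ∘ ver e = symProd e (D ∘ e) := by
  ext i; fin_cases i <;> simp [ver, symProd] <;> ring

theorem derivation_symProd (D : Derivation ℚ ℂ ℂ) (e f : Fin 3 → ℂ) :
    D ∘ symProd e f = symProd e (D ∘ f) + symProd f (D ∘ e) := by
  have h2 : D (2 : ℂ) = 0 := by exact_mod_cast D.map_natCast 2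
  ext i; fin_cases i <;> simp [symProd, h2] <;> ring

theorem tril_eq_zero_of_singular {b : Bil} {a : Fin 6 → ℂ}
    (h : ∀ i, eval a (pderiv i (cubicOf b)) = 0) (v : Fin 6 → ℂ) : tril b v a a = 0 := by
  have : trilL b a a = 0 := by
    refine LinearMap.pi_ext' fun i => LinearMap.ext_ring ?_
    change tril b (Pi.single i 1) a a = 0
    have := h i
    rw [eval_pderiv_cubicOf] at this
    rw [tril, pol_comm (Pi.single i 1), pol_self, map_nsmul]
    simp only [nsmul_eq_mul, Nat.cast_ofNat]
    linear_combination 2 * this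
  exact LinearMap.congr_fun this v

/-- A generic cubic through the Veronese surface is smooth. -/
theorem IsGeneric.isSmoothHypersurface {b : Bil} (hb : IsGeneric b) :
    IsSmoothHypersurface (cubicOf b) := by
  intro a ha _
  by_contra! hs
  have hv := tril_eq_zero_of_singular hs
  -- Differentiating the vanishing gradient at a: any change b' of the cubic is compensated by
  -- moving a in the direction D a.
  have key : ∀ b' : Bil, ∃ D : Derivation ℚ ℂ ℂ, ∀ v,
      tril b' v a a = -2 * tril b v (D ∘ a) a := fun b' => by
    obtain ⟨D, hD⟩ := hb.exists_derivation b'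
    refine ⟨D, fun v => ?_⟩
    have h1 := hD v a a
    rw [hv, hv, map_zero, tril_right_comm b v a] at h1
    linear_combination -h1
  obtain ⟨κ, hκ⟩ := exists_dual_eq_one ha
  -- Pairing with v = a eliminates D a, so every cubic through V would vanish at a; this fails off
  -- V.
  have hc : crem a = 0 := by
    by_contra hne
    obtain ⟨ν, hν⟩ := exists_dual_eq_one hne
    obtain ⟨D, hD⟩ := key (Bil.tensor κ ν)
    have h1 := hD a
    rw [tril_swap b a (D ∘ a), hv, tril, pol_self, map_nsmul, Bil.tensor_apply, hκ, hν] at h1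
    norm_num at h1
  obtain ⟨e, rfl⟩ := exists_ver_of_crem_eq_zero hc
  have he : e ≠ 0 := by rintro rfl; apply ha; ext i; fin_cases i <;> simp [ver]
  obtain ⟨f, g, htri⟩ := exists_basis_extending he
  let w : Fin 3 → Fin 6 → ℂ := ![ver f, symProd f g, ver g]
  -- On V the point moves within the two-dimensional tangent plane, but there are three normal
  -- directions. The combination θ of normal directions is insensitive to both tangent motions, yet
  -- some cubic through V has nonzero derivative along it.
  obtain ⟨θ, hθ, h1, h2⟩ := exists_orthogonal (fun i => tril b (w i) (symProd e f) (ver e))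
    (fun i => tril b (w i) (symProd e g) (ver e))
  have hcross : (e ⨯₃ f) ⨯₃ (e ⨯₃ g) ≠ 0 := by
    have : (e ⨯₃ f) ⨯₃ (e ⨯₃ g) = tri e f g • e := by
      ext i; fin_cases i <;> simp [cross_apply, tri] <;> ring
    rw [this]; exact smul_ne_zero htri he
  have hN : ∑ i, θ i • pol (ver e) (w i) ≠ 0 := fun h0 => hθ (by
    apply coeff_eq_zero_of_ver_comb hcross
    simpa [Fin.sum_univ_three, w, pol_ver_ver, pol_ver_symProd] using h0)
  obtain ⟨ν, hν⟩ := exists_dual_eq_one hN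
  obtain ⟨D, hD⟩ := key (Bil.tensor κ ν)
  obtain ⟨α, β, γ, hDe⟩ := exists_comb_of_tri_ne_zero htri (D ∘ e)
  have h3 : ∀ v, ν (pol (ver e) v) = -(β * tril b v (symProd e f) (ver e) +
      γ * tril b v (symProd e g) (ver e)) := fun v => by
    have h4 := hD v
    rw [derivation_ver, hDe, symProd_add_smul, symProd_self, tril_swap b v] at h4
    have h5 : tril b (ver e) v (ver e) = 0 := by rw [tril_swap]; exact hv v
    simp only [← trilL_apply, map_add, map_smul, smul_eq_mul] at h4
    simp only [trilL_apply] at h4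
    rw [h5, tril, pol_self, hc, pol_comm v, Bil.tensor_apply, Bil.tensor_apply, hκ] at h4
    simp only [smul_zero, map_zero] at h4
    rw [tril_swap b v, tril_swap b v]
    linear_combination h4 / 2
  rw [map_sum] at hν
  simp only [map_smul, smul_eq_mul, h3] at hν
  rw [Fin.sum_univ_three] at h1 h2 hν
  have : (0 : ℂ) = 1 := by rw [← hν]; linear_combination β * h1 + γ * h2
  exact zero_ne_one this

end VeroneseFano
end

/-! ### Apolarity for nets of conics without base points. -/

open MvPolynomial
noncomputable section
namespace VeroneseFano

open Matrix

theorem exists_binary_zero (A B C : ℂ) :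
    ∃ s t : ℂ, (s ≠ 0 ∨ t ≠ 0) ∧ A * s ^ 2 + B * (s * t) + C * t ^ 2 = 0 := by
  obtain ⟨α, β, α', β', h1, h2, h3⟩ := exists_binary_factor (2 * A) B (2 * C)
  by_cases h : β ≠ 0 ∨ -α ≠ 0
  · exact ⟨β, -α, h, by rw [h2]; linear_combination β ^ 2 / 2 * h1 + α ^ 2 / 2 * h3⟩
  · push Not at h
    have : A = 0 := by linear_combination h1 / 2 - α' * h.2
    exact ⟨1, 0, Or.inl one_ne_zero, by rw [this]; ring⟩

/-- All (α, β, γ) are orthogonal to the rows of the Hankel matrix of l. In rank two they are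
multiples of one binary form, which has a root; in rank one, l is concentrated at a point, which is
a common root. -/
theorem exists_common_zero {ι : Type*} {α β γ : ι → ℂ} {l₀ l₁ l₂ l₃ : ℂ}
    (hl : ¬(l₀ = 0 ∧ l₁ = 0 ∧ l₂ = 0 ∧ l₃ = 0))
    (h₀ : ∀ m, α m * l₀ + β m * l₁ + γ m * l₂ = 0)
    (h₁ : ∀ m, α m * l₁ + β m * l₂ + γ m * l₃ = 0) :
    ∃ s t : ℂ, (s ≠ 0 ∨ t ≠ 0) ∧ ∀ m, α m * s ^ 2 + β m * (s * t) + γ m * t ^ 2 = 0 := by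
  by_cases hv : ![l₀, l₁, l₂] ⨯₃ ![l₁, l₂, l₃] = 0
  · have e0 := congrFun hv 0
    have e1 := congrFun hv 1
    have e2 := congrFun hv 2
    simp only [cross_apply, Matrix.cons_val, Pi.zero_apply] at e0 e1 e2
    by_cases h : l₀ ≠ 0 ∨ l₁ ≠ 0
    · exact ⟨l₀, l₁, h, fun m => by linear_combination l₀ * h₀ m - γ m * e2⟩
    · push Not at h
      obtain ⟨rfl, rfl⟩ := h
      have h2 : l₂ = 0 := by
        have : l₂ * l₂ = 0 := by linear_combination -e0
        exact mul_self_eq_zero.mp this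
      refine ⟨0, 1, Or.inr one_ne_zero, fun m => ?_⟩
      have h3 : l₃ ≠ 0 := fun h3 => hl ⟨rfl, rfl, h2, h3⟩
      have := h₁ m
      have : γ m * l₃ = 0 := by rw [← this, h2]; ring
      rw [(mul_eq_zero.mp this).resolve_right h3]; ring
  · set v := ![l₀, l₁, l₂] ⨯₃ ![l₁, l₂, l₃] with hvdef
    obtain ⟨s, t, hst, h0⟩ := exists_binary_zero (v 0) (v 1) (v 2)
    refine ⟨s, t, hst, fun m => ?_⟩
    obtain ⟨r, hr⟩ := exists_smul_of_cross_eq_zero (m := ![α m, β m, γ m]) (by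
      ext i
      fin_cases i <;> simp only [hvdef, cross_apply, Matrix.cons_val, Pi.zero_apply,
        Fin.zero_eta, Fin.mk_one, Fin.reduceFinMk]
      · linear_combination l₁ * h₀ m - l₀ * h₁ m
      · linear_combination l₂ * h₀ m - l₁ * h₁ m
      · linear_combination l₃ * h₀ m - l₂ * h₁ m) hv
    have r0 := congrFun hr 0
    have r1 := congrFun hr 1
    have r2 := congrFun hr 2
    simp only [Matrix.cons_val, Pi.smul_apply, smul_eq_mul] at r0 r1 r2
    rw [r0, r1, r2]
    linear_combination r * h0

/-- The index of a cubic monomial in three variables. -/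
def cubicIndex : Fin 3 → Fin 3 → Fin 3 → Fin 10 :=
  ![![![0, 1, 2], ![1, 3, 4], ![2, 4, 5]], ![![1, 3, 4], ![3, 6, 7], ![4, 7, 8]],
    ![![2, 4, 5], ![4, 7, 8], ![5, 8, 9]]]

/-- The contraction of a symmetric tensor of order three with a quadratic form. -/
def contraction : (Fin 10 → ℂ) →ₗ[ℂ] (Fin 6 → ℂ) →ₗ[ℂ] (Fin 3 → ℂ) :=
  LinearMap.mk₂ ℂ (fun c a i => ∑ j, ∑ k, c (cubicIndex i j k) * symMat a j k)
    (fun c c' a => by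
      ext i; simp only [Pi.add_apply, add_mul, Finset.sum_add_distrib])
    (fun t c a => by
      ext i; simp only [Pi.smul_apply, smul_eq_mul, mul_assoc, Finset.mul_sum])
    (fun c a a' => by
      ext i; simp only [symMat_add, Matrix.add_apply, Pi.add_apply, mul_add,
        Finset.sum_add_distrib])
    (fun t c a => by
      ext i; simp only [symMat_smul, Matrix.smul_apply, Pi.smul_apply, smul_eq_mul, Finset.mul_sum]
      refine Finset.sum_congr rfl fun j _ => Finset.sum_congr rfl fun k _ => by ring)

theorem contraction_apply (c : Fin 10 → ℂ) (a : Fin 6 → ℂ) (i : Fin 3) :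
    contraction c a i = ∑ j, ∑ k, c (cubicIndex i j k) * symMat a j k := rfl

/-- A symmetric tensor killed by u is a binary tensor on the line u = 0. Apolarity to the net then
means apolarity to its restriction to this line, so a nonzero tensor would produce a base point
there. -/
theorem tensor_eq_zero_aux {ι : Type*} {Λ : Fin 3 → Fin 3 → Fin 3 → ℂ}
    (h12 : ∀ i j k, Λ i j k = Λ j i k) (h23 : ∀ i j k, Λ i j k = Λ i k j)
    {M : ι → Matrix (Fin 3) (Fin 3) ℂ} (hM : ∀ m j k, M m j k = M m k j)
    (h : ∀ i m, ∑ j, ∑ k, Λ i j k * M m j k = 0)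
    (hz : ∀ x : Fin 3 → ℂ, x ≠ 0 → ∃ m, ∑ j, ∑ k, x j * x k * M m j k ≠ 0)
    {u : Fin 3 → ℂ} (hu : u 2 ≠ 0) (hΛ : ∀ j k, ∑ i, u i * Λ i j k = 0) (i j k : Fin 3) :
    Λ i j k = 0 := by
  obtain ⟨p, hp⟩ : ∃ p, p = -u 0 / u 2 := ⟨_, rfl⟩
  obtain ⟨q, hq⟩ : ∃ q, q = -u 1 / u 2 := ⟨_, rfl⟩
  have h2 : ∀ j k, Λ 2 j k = p * Λ 0 j k + q * Λ 1 j k := fun j k => by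
    have := hΛ j k
    rw [Fin.sum_univ_three] at this
    rw [hp, hq]; field_simp; linear_combination this
  obtain ⟨l₀, h000⟩ : ∃ l, Λ 0 0 0 = l := ⟨_, rfl⟩
  obtain ⟨l₁, h001⟩ : ∃ l, Λ 0 0 1 = l := ⟨_, rfl⟩
  obtain ⟨l₂, h011⟩ : ∃ l, Λ 0 1 1 = l := ⟨_, rfl⟩
  obtain ⟨l₃, h111⟩ : ∃ l, Λ 1 1 1 = l := ⟨_, rfl⟩
  have h010 : Λ 0 1 0 = l₁ := by rw [h23, h001]
  have h100 : Λ 1 0 0 = l₁ := by rw [h12, h010]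
  have h101 : Λ 1 0 1 = l₂ := by rw [h12, h011]
  have h110 : Λ 1 1 0 = l₂ := by rw [h23, h101]
  have h200 := h2 0 0
  have h201 := h2 0 1
  have h210 := h2 1 0
  have h211 := h2 1 1
  rw [h000, h100] at h200
  rw [h001, h101] at h201
  rw [h010, h110] at h210
  rw [h011, h111] at h211
  have h020 := (h12 0 2 0).trans h200
  have h002 := (h23 0 0 2).trans h020
  have h021 := (h12 0 2 1).trans h201
  have h012 := (h23 0 1 2).trans h021
  have h120 := (h12 1 2 0).trans h210
  have h102 := (h23 1 0 2).trans h120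
  have h121 := (h12 1 2 1).trans h211
  have h112 := (h23 1 1 2).trans h121
  have h202 := h2 0 2
  have h212 := h2 1 2
  rw [h002, h102] at h202
  rw [h012, h112] at h212
  have h022 := (h12 0 2 2).trans h202
  have h122 := (h12 1 2 2).trans h212
  have h220 := (h23 2 2 0).trans h202
  have h221 := (h23 2 2 1).trans h212
  have h222 := h2 2 2
  rw [h022, h122] at h222
  by_cases hl : l₀ = 0 ∧ l₁ = 0 ∧ l₂ = 0 ∧ l₃ = 0
  · obtain ⟨rfl, rfl, rfl, rfl⟩ := hl
    fin_cases i <;> fin_cases j <;> fin_cases k <;>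
      simp only [Fin.zero_eta, Fin.mk_one, Fin.reduceFinMk, mul_zero, add_zero, *]
  · exfalso
    obtain ⟨s, t, hst, h0⟩ := exists_common_zero
      (α := fun m => M m 0 0 + 2 * p * M m 0 2 + p ^ 2 * M m 2 2)
      (β := fun m => 2 * (M m 0 1 + q * M m 0 2 + p * M m 1 2 + p * q * M m 2 2))
      (γ := fun m => M m 1 1 + 2 * q * M m 1 2 + q ^ 2 * M m 2 2) hl (fun m => by
        have := h 0 m
        simp only [Fin.sum_univ_three, h000, h001, h002, h010, h011, h012, h020, h021, h022,
          hM m 1 0, hM m 2 0, hM m 2 1] at this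
        linear_combination this) (fun m => by
        have := h 1 m
        simp only [Fin.sum_univ_three, h100, h101, h102, h110, h111, h112, h120, h121, h122,
          hM m 1 0, hM m 2 0, hM m 2 1] at this
        linear_combination this)
    obtain ⟨m, hm⟩ := hz ![s, t, p * s + q * t] (by
      intro h3
      rcases hst with h4 | h4
      · exact h4 (congrFun h3 0)
      · exact h4 (congrFun h3 1))
    apply hm
    simp only [Fin.sum_univ_three, Matrix.cons_val, hM m 1 0, hM m 2 0, hM m 2 1]
    linear_combination h0 m

theorem cubicIndex_symm : (∀ i j k, cubicIndex i j k = cubicIndex j i k) ∧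
    (∀ i j k, cubicIndex i j k = cubicIndex i k j) ∧ ∀ n, ∃ i j k, cubicIndex i j k = n := by
  decide

theorem quadAt_eq_sum (x : Fin 3 → ℂ) (a : Fin 6 → ℂ) :
    quadAt x a = ∑ j, ∑ k, x j * x k * symMat a j k := by
  simp [Fin.sum_univ_three, symMat, quadAt_apply]; ring

theorem symMat_symm (a : Fin 6 → ℂ) (j k : Fin 3) : symMat a j k = symMat a k j :=
  congrFun (congrFun (symMat_transpose a) k) j

/-- Any two conics meet: their pencil contains a pair of lines, and one of these lines meets another
member. So a net spanned by two conics has base points. -/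
theorem linearIndependent_of_no_common_zero {S : Fin 3 → Fin 6 → ℂ}
    (hS : ∀ x : Fin 3 → ℂ, x ≠ 0 → ∃ m, quadAt x (S m) ≠ 0) : LinearIndependent ℂ S := by
  have key : ∀ a d : Fin 6 → ℂ, ∃ x : Fin 3 → ℂ, x ≠ 0 ∧ quadAt x a = 0 ∧ quadAt x d = 0 := by
    intro a d
    obtain ⟨s, t, hst, hdet⟩ : ∃ s t : ℂ, (s ≠ 0 ∨ t ≠ 0) ∧ (symMat (s • a + t • d)).det = 0 := by
      by_cases h : LinearIndependent ℂ ![a, d]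
      · obtain ⟨z, hz, h0, hdet⟩ := exists_det_eq_zero (finrank_span_eq_card h)
        rw [Matrix.range_cons_cons_empty, Submodule.mem_span_pair] at hz
        obtain ⟨s, t, rfl⟩ := hz
        refine ⟨s, t, ?_, hdet⟩
        by_contra! h3
        rw [h3.1, h3.2] at h0
        simp at h0
      · rw [LinearIndependent.pair_iff] at h
        push Not at h
        obtain ⟨s, t, h1, h2⟩ := h
        refine ⟨s, t, ?_, ?_⟩
        · by_cases hs : s = 0
          · exact Or.inr (h2 hs)
          · exact Or.inl hs
        · rw [h1]
          simp [symMat, Matrix.det_fin_three]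
    obtain ⟨l, m, hlm⟩ := exists_symProd_of_det_eq_zero hdet
    obtain ⟨x₁, x₂, hx, h1, h2⟩ : ∃ x₁ x₂ : Fin 3 → ℂ, x₁ ⨯₃ x₂ ≠ 0 ∧ x₁ ⬝ᵥ l = 0 ∧
        x₂ ⬝ᵥ l = 0 := by
      by_cases hl : l = 0
      · refine ⟨![1, 0, 0], ![0, 1, 0], fun h => ?_, by simp [hl], by simp [hl]⟩
        simpa [cross_apply] using congrFun h 2
      · obtain ⟨f, g, hfg⟩ := exists_basis_extending hl
        refine ⟨l ⨯₃ f, l ⨯₃ g, ?_, ?_, ?_⟩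
        · have : (l ⨯₃ f) ⨯₃ (l ⨯₃ g) = tri l f g • l := by
            ext i; fin_cases i <;> simp [cross_apply, tri] <;> ring
          rw [this]; exact smul_ne_zero hfg hl
        all_goals simp [cross_apply, dotProduct, Fin.sum_univ_three]; ring
    have hpt : ∀ z : Fin 6 → ℂ, ∃ x : Fin 3 → ℂ, x ≠ 0 ∧ quadAt x z = 0 ∧
        quadAt x (s • a + t • d) = 0 := by
      intro z
      obtain ⟨σ, τ, hστ, h3⟩ := exists_binary_zero (quadAt x₁ z)
        (quadAt (x₁ + x₂) z - quadAt x₁ z - quadAt x₂ z) (quadAt x₂ z)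
      refine ⟨σ • x₁ + τ • x₂, fun h0 => ?_, ?_, ?_⟩
      · have e1 := congrArg (x₁ ⨯₃ ·) h0
        have e2 := congrArg (· ⨯₃ x₂) h0
        simp only [map_add, map_smul, cross_self, smul_zero, zero_add, map_zero,
          LinearMap.add_apply, LinearMap.smul_apply, add_zero, LinearMap.zero_apply,
          smul_eq_zero, hx, or_false] at e1 e2
        exact hστ.elim (· e2) (· e1)
      · rw [← h3]
        simp only [quadAt_apply, Pi.add_apply, Pi.smul_apply, smul_eq_mul]
        ring
      · rw [hlm, quadAt_symProd, add_dotProduct, smul_dotProduct, smul_dotProduct, h1, h2]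
        simp
    by_cases hs : s = 0
    · obtain ⟨x, hx0, e1, e2⟩ := hpt a
      refine ⟨x, hx0, e1, ?_⟩
      rw [map_add, map_smul, map_smul, e1, smul_zero, zero_add, smul_eq_mul] at e2
      exact (mul_eq_zero.mp e2).resolve_left (hst.resolve_left (not_not.mpr hs))
    · obtain ⟨x, hx0, e1, e2⟩ := hpt d
      refine ⟨x, hx0, ?_, e1⟩
      rw [map_add, map_smul, map_smul, e1, smul_zero, add_zero, smul_eq_mul] at e2
      exact (mul_eq_zero.mp e2).resolve_left hs
  rw [Fintype.linearIndependent_iff]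
  intro κ hκ k
  by_contra hk
  obtain ⟨x, hx0, e1, e2⟩ := key (S (k + 1)) (S (k + 2))
  obtain ⟨m, hm⟩ := hS x hx0
  have h3 := congrArg (quadAt x) hκ
  rw [Fin.sum_univ_three, map_add, map_add, map_smul, map_smul, map_smul, map_zero] at h3
  simp only [smul_eq_mul] at h3
  apply hm
  fin_cases k <;> simp at e1 e2 h3 hk <;> fin_cases m <;> simp_all

/-- A permutation of the coordinates makes the last coefficient of u nonzero, the case treated by
`tensor_eq_zero_aux`. -/
theorem eq_zero_of_contraction {S : Fin 3 → Fin 6 → ℂ}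
    (hS : ∀ x : Fin 3 → ℂ, x ≠ 0 → ∃ m, quadAt x (S m) ≠ 0)
    {c : Fin 10 → ℂ} (hc : ∀ m, contraction c (S m) = 0) {u : Module.Dual ℂ (Fin 3 → ℂ)} (hu : u ≠ 0)
    (h : ∀ a, u (contraction c a) = 0) : c = 0 := by
  have hsum : ∀ z : Fin 3 → ℂ, u z = ∑ i, u (Pi.single i 1) * z i := fun z => by
    conv_lhs => rw [← Finset.univ_sum_single z, map_sum]
    refine Finset.sum_congr rfl fun i _ => ?_
    rw [show (Pi.single i (z i) : Fin 3 → ℂ) = z i • Pi.single i 1 by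
      rw [← Pi.single_smul]; simp, map_smul, smul_eq_mul, mul_comm]
  obtain ⟨k, hk⟩ : ∃ k, u (Pi.single k 1) ≠ 0 := by
    by_contra! h0
    exact hu (LinearMap.ext fun z => by simp [hsum z, h0])
  have hΛ : ∀ j k, ∑ i, u (Pi.single i 1) * c (cubicIndex i j k) = 0 := by
    have h0' := fun n => (hsum _).symm.trans (h (Pi.single n 1))
    simp only [contraction_apply, Fin.sum_univ_three, symMat, Matrix.of_apply, Matrix.cons_val] at h0'
    have q0 := h0' 0
    have q1 := h0' 1
    have q2 := h0' 2
    have q3 := h0' 3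
    have q4 := h0' 4
    have q5 := h0' 5
    simp [cubicIndex] at q0 q1 q2 q3 q4 q5
    intro j k
    fin_cases j <;> fin_cases k <;> simp [Fin.sum_univ_three, cubicIndex]
    · exact q0
    · linear_combination q1 / 2
    · linear_combination q2 / 2
    · linear_combination q1 / 2
    · exact q3
    · linear_combination q4 / 2
    · linear_combination q2 / 2
    · linear_combination q4 / 2
    · exact q5
  obtain ⟨s12, s23, ssurj⟩ := cubicIndex_symm
  let π : Equiv.Perm (Fin 3) := Equiv.swap k 2
  have hπ : ∀ i, π (π i) = i := Equiv.swap_apply_self k 2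
  have key := tensor_eq_zero_aux (Λ := fun i j l => c (cubicIndex (π i) (π j) (π l)))
    (fun i j l => by rw [s12]) (fun i j l => by rw [s23])
    (M := fun m => (symMat (S m)).submatrix π π) (fun m j l => symMat_symm _ _ _)
    (fun i m => by
      have := congrFun (hc m) (π i)
      rw [contraction_apply] at this
      rw [← Equiv.sum_comp π] at this
      simp only [← Equiv.sum_comp π (fun l => c (cubicIndex (π i) _ l) * _)] at this
      exact this)
    (fun x hx => by
      obtain ⟨m, hm⟩ := hS (fun i => x (π i)) (fun h0 => hx (by
        ext i
        have := congrFun h0 (π i)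
        simpa [hπ] using this))
      refine ⟨m, ?_⟩
      rw [quadAt_eq_sum, ← Equiv.sum_comp π] at hm
      simp only [← Equiv.sum_comp π (fun l => _ * x (π l) * _), hπ] at hm
      exact hm)
    (u := fun i => u (Pi.single (π i) 1)) (by simpa [π] using hk)
    (fun j l => by
      have := hΛ (π j) (π l)
      rwa [← Equiv.sum_comp π] at this)
  ext n
  obtain ⟨i, j, l, rfl⟩ := ssurj n
  have := key (π i) (π j) (π l)
  simp only [hπ] at this
  exact this

end VeroneseFano
end

/-! ### Uniqueness of the apolar cubic and absence of linear syzygies. -/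

open MvPolynomial
noncomputable section
namespace VeroneseFano

open Matrix

theorem contraction_surjective {S : Fin 3 → Fin 6 → ℂ}
    (hS : ∀ x : Fin 3 → ℂ, x ≠ 0 → ∃ m, quadAt x (S m) ≠ 0)
    {c : Fin 10 → ℂ} (hc : ∀ m, contraction c (S m) = 0) (h0 : c ≠ 0) :
    Function.Surjective (contraction c) := by
  rw [← LinearMap.range_eq_top]
  by_contra h
  obtain ⟨u, hu, hle⟩ := Submodule.exists_le_ker_of_lt_top _ (lt_top_iff_ne_top.mpr h)
  exact h0 (eq_zero_of_contraction hS hc hu fun a => hle (LinearMap.mem_range_self _ a))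

/-- The net lies in the kernel, and surjectivity from dimension 6 onto dimension 3 leaves dimension
3 for it. -/
theorem ker_contraction {S : Fin 3 → Fin 6 → ℂ}
    (hS : ∀ x : Fin 3 → ℂ, x ≠ 0 → ∃ m, quadAt x (S m) ≠ 0)
    {c : Fin 10 → ℂ} (hc : ∀ m, contraction c (S m) = 0) (h0 : c ≠ 0) :
    LinearMap.ker (contraction c) = Submodule.span ℂ (Set.range S) := by
  symm
  apply Submodule.eq_of_le_of_finrank_eq
  · rw [Submodule.span_le]
    rintro _ ⟨m, rfl⟩
    exact hc m
  · rw [finrank_span_eq_card (linearIndependent_of_no_common_zero hS)]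
    have h1 := (contraction c).finrank_range_add_finrank_ker
    rw [LinearMap.range_eq_top.mpr (contraction_surjective hS hc h0), finrank_top] at h1
    simp only [Module.finrank_fintype_fun_eq_card, Fintype.card_fin] at h1 ⊢
    omega

/-- Contraction with c' kills the kernel of contraction with c, so it factors as an endomorphism of
ℂ³. An eigenvector u of its transpose, with eigenvalue μ, kills all contractions of c' - μc, which
therefore vanishes. -/
theorem exists_smul_of_contraction {S : Fin 3 → Fin 6 → ℂ}
    (hS : ∀ x : Fin 3 → ℂ, x ≠ 0 → ∃ m, quadAt x (S m) ≠ 0)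
    {c c' : Fin 10 → ℂ} (hc : ∀ m, contraction c (S m) = 0) (h0 : c ≠ 0)
    (hc' : ∀ m, contraction c' (S m) = 0) : ∃ μ : ℂ, μ • c = c' := by
  obtain ⟨R, hR⟩ := (contraction c).exists_rightInverse_of_surjective
    (LinearMap.range_eq_top.mpr (contraction_surjective hS hc h0))
  let A : Module.End ℂ (Module.Dual ℂ (Fin 3 → ℂ)) := (contraction c' ∘ₗ R).dualMap
  obtain ⟨μ, hμ⟩ := Module.End.exists_eigenvalue A
  obtain ⟨u, hu⟩ := hμ.exists_hasEigenvector
  have h1 : ∀ z, u (contraction c' (R z)) = μ * u z := fun z =>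
    LinearMap.congr_fun hu.apply_eq_smul z
  have h2 : ∀ a, contraction c' a = contraction c' (R (contraction c a)) := fun a => by
    have h3 : a - R (contraction c a) ∈ LinearMap.ker (contraction c) := by
      rw [LinearMap.mem_ker, map_sub]
      have := LinearMap.congr_fun hR (contraction c a)
      rw [LinearMap.comp_apply, LinearMap.id_apply] at this
      rw [this, sub_self]
    rw [ker_contraction hS hc h0] at h3
    have h4 : Submodule.span ℂ (Set.range S) ≤ LinearMap.ker (contraction c') := by
      rw [Submodule.span_le]
      rintro _ ⟨m, rfl⟩
      exact hc' m
    have h5 := h4 h3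
    rw [LinearMap.mem_ker, map_sub] at h5
    exact sub_eq_zero.mp h5
  refine ⟨μ, (sub_eq_zero.mp ?_).symm⟩
  refine eq_zero_of_contraction hS (c := c' - μ • c) (fun m => ?_) hu.2 fun a => ?_
  · rw [map_sub, map_smul, LinearMap.sub_apply, LinearMap.smul_apply, hc, hc', smul_zero, sub_zero]
  · rw [map_sub, map_smul, LinearMap.sub_apply, LinearMap.smul_apply, h2, map_sub, h1, map_smul,
      smul_eq_mul, sub_self]

/-- The contractions of a symmetric tensor with the members of a net of conics. -/
def netContraction (S : Fin 3 → Fin 6 → ℂ) : (Fin 10 → ℂ) →ₗ[ℂ] (Fin 3 → Fin 3 → ℂ) :=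
  LinearMap.pi fun m => contraction.flip (S m)

theorem netContraction_apply (S : Fin 3 → Fin 6 → ℂ) (c : Fin 10 → ℂ) (m : Fin 3) :
    netContraction S c m = contraction c (S m) := rfl

/-- Ten coefficients against nine equations. -/
theorem exists_contraction_eq_zero (S : Fin 3 → Fin 6 → ℂ) :
    ∃ c : Fin 10 → ℂ, c ≠ 0 ∧ ∀ m, contraction c (S m) = 0 := by
  have h : LinearMap.ker (netContraction S) ≠ ⊥ :=
    LinearMap.ker_ne_bot_of_finrank_lt (by
      rw [Module.finrank_pi_fintype]; simp)
  obtain ⟨c, hc, h0⟩ := Submodule.exists_mem_ne_zero_of_ne_bot h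
  exact ⟨c, h0, fun m => congrFun (LinearMap.mem_ker.mp hc) m⟩

/-- A net of conics without base points has no linear syzygies. -/
theorem syzygy_eq_zero {S : Fin 3 → Fin 6 → ℂ}
    (hS : ∀ x : Fin 3 → ℂ, x ≠ 0 → ∃ m, quadAt x (S m) ≠ 0) {σ : Fin 3 → Fin 3 → ℂ}
    (hσ : ∀ i j k, ∑ m, (σ i m * symMat (S m) j k + σ j m * symMat (S m) k i +
      σ k m * symMat (S m) i j) = 0) : σ = 0 := by
  by_contra hne
  let f : Module.Dual ℂ (Fin 3 → Fin 3 → ℂ) :=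
    ∑ m, ∑ i, σ i m • ((LinearMap.proj i : (Fin 3 → ℂ) →ₗ[ℂ] ℂ) ∘ₗ
      (LinearMap.proj m : (Fin 3 → Fin 3 → ℂ) →ₗ[ℂ] (Fin 3 → ℂ)))
  have hf : ∀ z, f z = ∑ m, ∑ i, σ i m * z m i := fun z => by
    simp [f, LinearMap.sum_apply]
  have hf0 : f ≠ 0 := fun h0 => hne (by
    ext i m
    have := LinearMap.congr_fun h0 (Pi.single m (Pi.single i 1))
    rw [hf, Finset.sum_eq_single m, Finset.sum_eq_single i] at this
    · simpa using this
    · intro j _ hj; simp [hj]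
    · simp
    · intro n _ hn; simp [hn]
    · simp)
  -- A linear syzygy is a functional on ℂ⁹ annihilating all contractions of cubics with the net. The
  -- apolar cubic is unique, so these contractions fill dimension 10 - 1 = 9 and the functional is
  -- zero.
  have hle : LinearMap.range (netContraction S) ≤ LinearMap.ker f := by
    rintro _ ⟨c, rfl⟩
    rw [LinearMap.mem_ker, hf]
    have h3 := hσ
    simp only [netContraction_apply, contraction_apply, Fin.sum_univ_three] at h3 ⊢
    have a0 := h3 0 0 0
    have a1 := h3 0 0 1
    have a2 := h3 0 0 2
    have a3 := h3 0 1 1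
    have a4 := h3 0 1 2
    have a4' := h3 0 2 1
    have a5 := h3 0 2 2
    have a6 := h3 1 1 1
    have a7 := h3 1 1 2
    have a8 := h3 1 2 2
    have a9 := h3 2 2 2
    clear h3 hσ
    simp only [symMat_symm _ 1 0, symMat_symm _ 2 0, symMat_symm _ 2 1] at *
    simp only [cubicIndex, Matrix.cons_val]
    linear_combination c 0 / 3 * a0 + c 1 * a1 + c 2 * a2 + c 3 * a3 + c 4 * (a4 + a4') +
      c 5 * a5 + c 6 / 3 * a6 + c 7 * a7 + c 8 * a8 + c 9 / 3 * a9
  have h1 := Module.Dual.finrank_ker_add_one_of_ne_zero hf0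
  have h2 := (netContraction S).finrank_range_add_finrank_ker
  have h3 := Submodule.finrank_mono hle
  obtain ⟨c, h0, hc⟩ := exists_contraction_eq_zero S
  have h4 : LinearMap.ker (netContraction S) ≤ Submodule.span ℂ {c} := fun c' hc' => by
    rw [Submodule.mem_span_singleton]
    exact exists_smul_of_contraction hS hc h0 fun m => congrFun (LinearMap.mem_ker.mp hc') m
  have h5 := Submodule.finrank_mono h4
  rw [finrank_span_singleton h0] at h5
  rw [Module.finrank_pi_fintype] at h1
  simp only [Module.finrank_fintype_fun_eq_card, Fintype.card_fin, Finset.sum_const,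
    Finset.card_univ, smul_eq_mul] at h1 h2
  omega

end VeroneseFano
end

/-! ### Planes in a cubic: polarisation and planes with a common kernel vector. -/

open MvPolynomial
noncomputable section
namespace VeroneseFano

open Matrix

theorem tril_eq_zero_of_liesOn {b : Bil} {P : Submodule ℂ (Fin 6 → ℂ)} (h : LiesOn P (cubicOf b))
    {x y z : Fin 6 → ℂ} (hx : x ∈ P) (hy : y ∈ P) (hz : z ∈ P) : tril b x y z = 0 := by
  rw [tril_eq, h _ (P.add_mem (P.add_mem hx hy) hz), h _ (P.add_mem hx hy),
    h _ (P.add_mem hx hz), h _ (P.add_mem hy hz), h _ hx, h _ hy, h _ hz]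
  ring

theorem tril_single (b : Bil) (a : Fin 6 → ℂ) (i : Fin 6) :
    tril b (Pi.single i 1) a a = 2 * eval a (pderiv i (cubicOf b)) := by
  rw [eval_pderiv_cubicOf, tril, pol_comm (Pi.single i 1), pol_self, map_nsmul]
  simp only [nsmul_eq_mul, Nat.cast_ofNat]
  ring

theorem tril_sum_sum (b : Bil) (v : Fin 6 → ℂ) (y : Fin 3 → Fin 6 → ℂ) (x : Fin 3 → ℂ) :
    tril b v (∑ j, x j • y j) (∑ k, x k • y k) = ∑ j, ∑ k, x j * x k * tril b v (y j) (y k) := by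
  have h1 : ∀ c d, tril b v c d = trilL b v d c := fun c d => tril_swap b v c d
  have h2 : ∀ c d, tril b v c d = trilL b c v d := fun c d => (tril_right_comm b v c d).trans ((tril_swap b v d c).trans (tril_right_comm b d v c))
  rw [h1, map_sum]
  refine Finset.sum_congr rfl fun j _ => ?_
  rw [map_smul, ← h1, h2, map_sum, smul_eq_mul, Finset.mul_sum]
  refine Finset.sum_congr rfl fun k _ => ?_
  rw [map_smul, ← h2, smul_eq_mul, mul_assoc]

theorem sum_cubicIndex_symm (c : Fin 10 → ℂ) (G : Fin 3 → Fin 3 → Fin 3 → ℂ) :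
    ∑ i, ∑ j, ∑ k, c (cubicIndex i j k) * (G i j k + G j i k + G k i j) =
      3 * ∑ i, ∑ j, ∑ k, c (cubicIndex i j k) * G i j k := by
  simp only [Fin.sum_univ_three, cubicIndex, Matrix.cons_val]
  ring

theorem symMat_ver_mulVec (e n : Fin 3 → ℂ) : symMat (ver e) *ᵥ n = (e ⬝ᵥ n) • e := by
  ext i; fin_cases i <;> simp [symMat, ver, dotProduct, Fin.sum_univ_three, Matrix.mulVec] <;> ring

theorem symMat_symProd_mulVec (e f n : Fin 3 → ℂ) :
    symMat (symProd e f) *ᵥ n = (f ⬝ᵥ n) • e + (e ⬝ᵥ n) • f := by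
  ext i
  fin_cases i <;> simp [symMat, symProd, dotProduct, Fin.sum_univ_three, Matrix.mulVec] <;> ring

/-- A plane of matrices annihilating a common vector consists of all such matrices. -/
theorem exists_ver_mem_of_mulVec_eq_zero {P : Submodule ℂ (Fin 6 → ℂ)}
    (hP : Module.finrank ℂ P = 3) {n : Fin 3 → ℂ} (hn : n ≠ 0)
    (h : ∀ a ∈ P, symMat a *ᵥ n = 0) :
    ∃ e f : Fin 3 → ℂ, e ⨯₃ f ≠ 0 ∧ ver e ∈ P ∧ symProd e f ∈ P ∧ ver f ∈ P := by
  obtain ⟨e₂, e₃, htri⟩ := exists_basis_extending hn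
  have hef : (n ⨯₃ e₂) ⨯₃ (n ⨯₃ e₃) = tri n e₂ e₃ • n := by
    ext i; fin_cases i <;> simp [cross_apply, tri] <;> ring
  have he : (n ⨯₃ e₂) ⬝ᵥ n = 0 := by
    simp [cross_apply, dotProduct, Fin.sum_univ_three]; ring
  have hf : (n ⨯₃ e₃) ⬝ᵥ n = 0 := by
    simp [cross_apply, dotProduct, Fin.sum_univ_three]; ring
  have hg : (e₂ ⨯₃ e₃) ⬝ᵥ n = tri n e₂ e₃ := by
    simp [cross_apply, dotProduct, Fin.sum_univ_three, tri]; ring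
  have ht : tri (n ⨯₃ e₂) (n ⨯₃ e₃) (e₂ ⨯₃ e₃) = tri n e₂ e₃ ^ 2 := by
    simp [cross_apply, tri]; ring
  generalize n ⨯₃ e₂ = e at *
  generalize n ⨯₃ e₃ = f at *
  generalize e₂ ⨯₃ e₃ = g at *
  have ht0 : tri e f g ≠ 0 := by rw [ht]; exact pow_ne_zero 2 htri
  have hle : P ≤ Submodule.span ℂ (Set.range ![ver e, symProd e f, ver f]) := fun a ha => by
    obtain ⟨c, rfl⟩ := symComb_surjective ht0 a
    have h0 := h _ ha
    have h1 : c 2 • e + c 4 • f + c 5 • g = 0 := by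
      have : symMat (symComb e f g c) *ᵥ n = tri n e₂ e₃ • (c 2 • e + c 4 • f + c 5 • g) := by
        simp only [symComb, symMat_add, symMat_smul, Matrix.add_mulVec, Matrix.smul_mulVec,
          symMat_ver_mulVec, symMat_symProd_mulVec, he, hf, hg]
        module
      rw [this] at h0
      exact (smul_eq_zero.mp h0).resolve_left htri
    have q0 := congrFun h1 0
    have q1 := congrFun h1 1
    have q2 := congrFun h1 2
    simp only [Pi.add_apply, Pi.smul_apply, smul_eq_mul, Pi.zero_apply] at q0 q1 q2
    have c2 : c 2 = 0 := (mul_eq_zero.mp (by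
      rw [tri]
      linear_combination (f 1 * g 2 - f 2 * g 1) * q0 - (f 0 * g 2 - f 2 * g 0) * q1 +
        (f 0 * g 1 - f 1 * g 0) * q2 : c 2 * tri e f g = 0)).resolve_right ht0
    have c4 : c 4 = 0 := (mul_eq_zero.mp (by
      rw [tri]
      linear_combination -(e 1 * g 2 - e 2 * g 1) * q0 + (e 0 * g 2 - e 2 * g 0) * q1 -
        (e 0 * g 1 - e 1 * g 0) * q2 : c 4 * tri e f g = 0)).resolve_right ht0
    have c5 : c 5 = 0 := (mul_eq_zero.mp (by
      rw [tri]
      linear_combination (e 1 * f 2 - e 2 * f 1) * q0 - (e 0 * f 2 - e 2 * f 0) * q1 +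
        (e 0 * f 1 - e 1 * f 0) * q2 : c 5 * tri e f g = 0)).resolve_right ht0
    rw [symComb, c2, c4, c5]
    simp only [zero_smul, add_zero]
    refine Submodule.add_mem _ (Submodule.add_mem _ ?_ ?_) ?_ <;>
      refine Submodule.smul_mem _ _ (Submodule.subset_span ?_)
    exacts [⟨0, rfl⟩, ⟨1, rfl⟩, ⟨2, rfl⟩]
  have heq := Submodule.eq_of_le_of_finrank_le hle (by
    rw [hP]
    exact (finrank_range_le_card _).trans (by simp))
  refine ⟨e, f, by rw [hef]; exact smul_ne_zero htri hn, ?_, ?_, ?_⟩ <;> rw [heq] <;>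
    apply Submodule.subset_span
  exacts [⟨0, rfl⟩, ⟨1, rfl⟩, ⟨2, rfl⟩]

/-- If some y_i B_m were a nonzero scalar, B_m would be invertible and all y_j multiples of its
inverse, contradicting independence. So all products vanish, and a nonzero column of some B_m is a
common kernel vector. If all B_m vanish, f vanishes on the plane, which V cannot contain. -/
theorem exists_mulVec_eq_zero {y B : Fin 3 → Fin 6 → ℂ} (hy : LinearIndependent ℂ y)
    (hB : ∀ i m, ∃ s : ℂ, symMat (y i) * symMat (B m) = s • 1)
    (h0 : (∀ m, B m = 0) → ∀ j k, pol (y j) (y k) = 0) :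
    ∃ n : Fin 3 → ℂ, n ≠ 0 ∧ ∀ i, symMat (y i) *ᵥ n = 0 := by
  choose s hs using hB
  have hs0 : ∀ i m, s i m = 0 := by
    intro i m
    by_contra hne
    have h1 : symMat (B m) * ((s i m)⁻¹ • symMat (y i)) = 1 := mul_eq_one_comm.mp (by
      rw [smul_mul_assoc, hs, smul_smul, inv_mul_cancel₀ hne, one_smul])
    have h2 : s i m • y (i + 1) - s (i + 1) m • y i = 0 := by
      apply symMat_injective
      have h3 : symMat (s i m • y (i + 1) - s (i + 1) m • y i) * symMat (B m) = 0 := by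
        rw [sub_eq_add_neg, ← neg_smul, symMat_add, symMat_smul, symMat_smul, add_mul,
          smul_mul_assoc, smul_mul_assoc, hs, hs]
        module
      have h4 := congrArg (· * ((s i m)⁻¹ • symMat (y i))) h3
      simp only [Matrix.mul_assoc, h1, Matrix.mul_one, Matrix.zero_mul] at h4
      rw [h4]
      ext p q; fin_cases p <;> fin_cases q <;> simp [symMat]
    have h5 := Fintype.linearIndependent_iff.mp hy
      (Pi.single (i + 1) (s i m) - Pi.single i (s (i + 1) m)) (by
        simpa [sub_smul, Finset.sum_sub_distrib, Pi.single_apply] using h2) (i + 1)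
    apply hne
    fin_cases i <;> simpa [Pi.single_apply] using h5
  by_cases hB : ∀ m, B m = 0
  · exfalso
    have h1 := h0 hB
    have hc : ∀ j, crem (y j) = 0 := fun j => by
      have := h1 j j
      rw [pol_self] at this
      exact (smul_eq_zero.mp this).resolve_left two_ne_zero
    obtain ⟨e, he⟩ := exists_ver_of_crem_eq_zero (hc 0)
    obtain ⟨f, hf⟩ := exists_ver_of_crem_eq_zero (hc 1)
    have h2 := h1 0 1
    rw [he, hf, pol_ver_ver] at h2
    have h3 : e ⨯₃ f = 0 := by
      by_contra h3; exact ver_ne_zero h3 h2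
    have he0 : e ≠ 0 := by
      rintro rfl
      apply hy.ne_zero 0
      rw [he]; ext i; fin_cases i <;> simp [ver]
    obtain ⟨t, rfl⟩ := exists_smul_of_cross_eq_zero h3 he0
    have h4 : (t * t) • y 0 - y 1 = 0 := by
      rw [he, hf]; ext i; fin_cases i <;> simp [ver] <;> ring
    have h5 := Fintype.linearIndependent_iff.mp hy ![t * t, -1, 0] (by
      rw [← h4]; simp [Fin.sum_univ_three, sub_eq_add_neg]) 1
    simp at h5
  · push Not at hB
    obtain ⟨m, hm⟩ := hB
    obtain ⟨q, hq⟩ : ∃ q, (fun p => symMat (B m) p q) ≠ 0 := by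
      by_contra! h1
      apply hm
      apply symMat_injective
      have : symMat 0 = 0 := symMatL.map_zero
      rw [this]
      ext p q
      exact congrFun (h1 q) p
    refine ⟨_, hq, fun i => ?_⟩
    have h1 := hs i m
    rw [hs0, zero_smul] at h1
    ext p
    exact congrFun (congrFun h1 p) q

end VeroneseFano
end

/-! ### Generic cubics contain no plane. -/

open MvPolynomial
noncomputable section
namespace VeroneseFano

open Matrix

/-- Differentiating the vanishing of the trilinear form on P: every cubic through V restricts to P
as a combination coming from first-order motions of P. -/
theorem IsGeneric.exists_derivation_of_liesOn {b : Bil} (hb : IsGeneric b)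
    {P : Submodule ℂ (Fin 6 → ℂ)} (hP : LiesOn P (cubicOf b)) (b' : Bil) :
    ∃ D : Derivation ℚ ℂ ℂ, ∀ {x y z : Fin 6 → ℂ}, x ∈ P → y ∈ P → z ∈ P →
      tril b' x y z = -(tril b (D ∘ x) y z + tril b (D ∘ y) x z + tril b (D ∘ z) x y) := by
  obtain ⟨D, hD⟩ := hb.exists_derivation b'
  refine ⟨D, fun {x y z} hx hy hz => ?_⟩
  have := hD x y z
  rw [tril_eq_zero_of_liesOn hP hx hy hz, map_zero, tril_swap b x (D ∘ y),
    tril_right_comm b x y, tril_swap b x (D ∘ z)] at this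
  linear_combination -this

/-- A generic cubic through the Veronese surface contains no plane of matrices that annihilate a
common vector. -/
theorem IsGeneric.not_conic_plane {b : Bil} (hb : IsGeneric b) {P : Submodule ℂ (Fin 6 → ℂ)}
    (hP : LiesOn P (cubicOf b)) {e f : Fin 3 → ℂ} (hef : e ⨯₃ f ≠ 0) (h0 : ver e ∈ P)
    (h1 : symProd e f ∈ P) (h2 : ver f ∈ P) : False := by
  have hT : ∀ {x y z : Fin 6 → ℂ}, x ∈ P → y ∈ P → z ∈ P → tril b x y z = 0 :=
    fun hx hy hz => tril_eq_zero_of_liesOn hP hx hy hz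
  obtain ⟨g, htri'⟩ := exists_tri_ne_zero hef
  have htri : tri e f g ≠ 0 := by
    have : tri e f g = tri g e f := by simp only [tri]; ring
    rwa [this]
  -- Such planes move with two parameters, the components of D e and D f along g. The two vectors
  -- hold their effects on three chosen values of a cubic, so some combination θ of these values is
  -- unaffected.
  obtain ⟨θ, hθ, o1, o2⟩ := exists_orthogonal
    ![2 * tril b (symProd e g) (ver e) (ver f), tril b (symProd e g) (ver f) (ver f),
      3 * tril b (symProd f g) (symProd e f) (symProd e f)]
    ![tril b (symProd f g) (ver e) (ver e), 2 * tril b (symProd f g) (ver e) (ver f),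
      3 * tril b (symProd e g) (symProd e f) (symProd e f)]
  simp only [Fin.sum_univ_three, Matrix.cons_val] at o1 o2
  obtain ⟨ν, hν⟩ := exists_dual_eq_one (ver_ne_zero hef)
  -- The test cubic is κ times a quadric through V. Its values at the three chosen triples are
  -- 2κ(e²), 2κ(f²) and -6κ(ef), the last factor coming from f(ef) = -(e × f)². As κ is arbitrary, θ
  -- must vanish.
  have key : ∀ κ : Module.Dual ℂ (Fin 6 → ℂ),
      θ 0 * κ (ver e) + -3 * θ 2 * κ (symProd e f) + θ 1 * κ (ver f) = 0 := fun κ => by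
    obtain ⟨D, hD⟩ := hb.exists_derivation_of_liesOn hP (Bil.tensor κ ν)
    obtain ⟨α, β, γ, hDe⟩ := exists_comb_of_tri_ne_zero htri (D ∘ e)
    obtain ⟨α', β', γ', hDf⟩ := exists_comb_of_tri_ne_zero htri (D ∘ f)
    have ke : ∀ c ∈ P, ∀ d ∈ P, tril b (D ∘ ver e) c d = γ * tril b (symProd e g) c d := by
      intro c hc d hd
      rw [derivation_ver, hDe, symProd_add_smul, symProd_self, ← trilL_apply]
      simp only [map_add, map_smul, trilL_apply, hT h0 hc hd, hT h1 hc hd, smul_eq_mul]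
      ring
    have kf : ∀ c ∈ P, ∀ d ∈ P, tril b (D ∘ ver f) c d = γ' * tril b (symProd f g) c d := by
      intro c hc d hd
      rw [derivation_ver, hDf, symProd_add_smul, symProd_self, symProd_comm f e, ← trilL_apply]
      simp only [map_add, map_smul, trilL_apply, hT h2 hc hd, hT h1 hc hd, smul_eq_mul]
      ring
    have kef : ∀ c ∈ P, ∀ d ∈ P, tril b (D ∘ symProd e f) c d =
        γ * tril b (symProd f g) c d + γ' * tril b (symProd e g) c d := by
      intro c hc d hd
      rw [derivation_symProd, hDe, hDf, symProd_add_smul, symProd_add_smul, symProd_self,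
        symProd_self, symProd_comm f e, ← trilL_apply]
      simp only [map_add, map_smul, trilL_apply, hT h0 hc hd, hT h2 hc hd, hT h1 hc hd, smul_eq_mul]
      ring
    have p00 : pol (ver e) (ver e) = 0 := by rw [pol_self, crem_ver, smul_zero]
    have p22 : pol (ver f) (ver f) = 0 := by rw [pol_self, crem_ver, smul_zero]
    have p11 : pol (symProd e f) (symProd e f) = (-2 : ℂ) • ver (e ⨯₃ f) := by
      rw [pol_self, crem_symProd]; module
    have q0 := hD h0 h0 h2
    have q1 := hD h0 h2 h2
    have q2 := hD h1 h1 h1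
    rw [ke _ h0 _ h2, kf _ h0 _ h0, tril, p00] at q0
    rw [ke _ h2 _ h2, kf _ h0 _ h2, tril, p22] at q1
    rw [kef _ h1 _ h1, tril, p11] at q2
    simp only [Bil.tensor_apply, pol_ver_ver, hν, map_zero, map_smul, smul_eq_mul] at q0 q1 q2
    linear_combination θ 0 / 2 * q0 + θ 1 / 2 * q1 + θ 2 / 2 * q2 - γ / 2 * o1 - γ' / 2 * o2
  refine hθ ?_
  have hvec : ![θ 0, -3 * θ 2, θ 1] = 0 := by
    apply coeff_eq_zero_of_ver_comb hef
    by_contra hne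
    obtain ⟨κ, hκ⟩ := exists_dual_eq_one hne
    simp only [map_add, map_smul, smul_eq_mul, Matrix.cons_val] at hκ
    rw [key κ] at hκ
    exact zero_ne_one hκ
  have e0 := congrFun hvec 0
  have e1 := congrFun hvec 1
  have e2 := congrFun hvec 2
  simp at e0 e1 e2
  ext i; fin_cases i <;> assumption

/-- A generic cubic through the Veronese surface contains no plane. -/
theorem IsGeneric.containsNoPlane {b : Bil} (hb : IsGeneric b) : ContainsNoPlane (cubicOf b) := by
  intro P hP hF
  obtain ⟨y, hy, rfl⟩ := exists_span_eq_of_finrank three_ne_zero hP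
  have hyP : ∀ i, y i ∈ Submodule.span ℂ (Set.range y) := fun i => Submodule.subset_span ⟨i, rfl⟩
  obtain ⟨Q, hQ⟩ := Submodule.exists_isCompl (Submodule.span ℂ (Set.range y))
  have hQ3 : Module.finrank ℂ Q = 3 := by
    have := Submodule.finrank_add_eq_of_isCompl hQ
    rw [hP] at this
    simp at this
    omega
  obtain ⟨n, hn, rfl⟩ := exists_span_eq_of_finrank three_ne_zero hQ3
  have hw : ∀ w : Fin 6 → ℂ, ∃ ω : Fin 3 → ℂ, ∀ j k, tril b w (y j) (y k) =
      ∑ m, ω m * tril b (n m) (y j) (y k) := fun w => by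
    obtain ⟨p, hp, q, hq, rfl⟩ := Submodule.mem_sup.mp
      (show w ∈ Submodule.span ℂ (Set.range y) ⊔ Submodule.span ℂ (Set.range n) by
        rw [hQ.sup_eq_top]; trivial)
    obtain ⟨ω, rfl⟩ := exists_coords hq
    refine ⟨ω, fun j k => ?_⟩
    rw [← trilL_apply, map_add, trilL_apply, tril_eq_zero_of_liesOn hF hp (hyP j) (hyP k), zero_add,
      map_sum]
    simp only [map_smul, smul_eq_mul, trilL_apply]
  -- The net of conics on P formed by the derivatives of F in three directions transverse to P. A
  -- base point of this net would be a singular point of X.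
  let S : Fin 3 → Fin 6 → ℂ := fun m => ofSym fun j k => tril b (n m) (y j) (y k)
  have hSapp : ∀ m j k, symMat (S m) j k = tril b (n m) (y j) (y k) := fun m j k => by
    have := symMat_ofSym (M := fun j k => tril b (n m) (y j) (y k)) (by
      ext j k; exact tril_right_comm _ _ _ _)
    exact congrFun (congrFun this j) k
  have hS : ∀ x : Fin 3 → ℂ, x ≠ 0 → ∃ m, quadAt x (S m) ≠ 0 := fun x hx => by
    by_contra! h0
    have ha : ∑ j, x j • y j ≠ 0 := fun h => hx (_root_.funext (Fintype.linearIndependent_iff.mp hy x h))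
    have haP : ∑ j, x j • y j ∈ Submodule.span ℂ (Set.range y) :=
      Submodule.sum_mem _ fun j _ => Submodule.smul_mem _ _ (hyP j)
    obtain ⟨i, hi⟩ := hb.isSmoothHypersurface _ ha (hF _ haP)
    apply hi
    have h1 := tril_single b (∑ j, x j • y j) i
    obtain ⟨ω, hω⟩ := hw (Pi.single i 1)
    have h2 : ∀ m, ∑ j, ∑ k, x j * x k * tril b (n m) (y j) (y k) = 0 := fun m => by
      rw [← h0 m, quadAt_eq_sum]
      simp only [hSapp]
    rw [tril_sum_sum] at h1
    have h3 : ∑ j, ∑ k, x j * x k * tril b (Pi.single i 1) (y j) (y k) =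
        ∑ m, ω m * ∑ j, ∑ k, x j * x k * tril b (n m) (y j) (y k) := by
      simp only [hω, Fin.sum_univ_three]; ring
    rw [h3] at h1
    simp only [h2, mul_zero, Finset.sum_const_zero] at h1
    exact (mul_eq_zero.mp h1.symm).resolve_left two_ne_zero
  obtain ⟨c, hc0, hc⟩ := exists_contraction_eq_zero S
  obtain ⟨ℓ, hℓ⟩ := exists_dual_family hy
  -- The cubic c apolar to the net annihilates everything produced by motions of P, hence the
  -- restriction of every cubic through V. For a cubic ℓ_i times a quadric ν(f), this says that
  -- contraction of c with the quadric has zero i-th coordinate.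
  have hpol : ∀ i (ν : Module.Dual ℂ (Fin 6 → ℂ)),
      ∑ j, ∑ k, c (cubicIndex i j k) * ν (pol (y j) (y k)) = 0 := fun i₀ ν => by
    obtain ⟨D, hD⟩ := hb.exists_derivation_of_liesOn hF (Bil.tensor (ℓ i₀) ν)
    choose ω hω using fun i => hw (D ∘ y i)
    have h1 : ∀ i j k, tril (Bil.tensor (ℓ i₀) ν) (y i) (y j) (y k) =
        -(tril b (D ∘ y i) (y j) (y k) + tril b (D ∘ y j) (y i) (y k) +
          tril b (D ∘ y k) (y i) (y j)) := fun i j k => hD (hyP i) (hyP j) (hyP k)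
    have h2 := sum_cubicIndex_symm c fun i j k => tril b (D ∘ y i) (y j) (y k)
    have h3 := sum_cubicIndex_symm c fun i j k => ℓ i₀ (y i) * ν (pol (y j) (y k))
    have h4 : ∑ i, ∑ j, ∑ k, c (cubicIndex i j k) * tril b (D ∘ y i) (y j) (y k) = 0 := by
      refine Finset.sum_eq_zero fun i _ => ?_
      have h5 : ∀ m, ∑ j, ∑ k, c (cubicIndex i j k) * tril b (n m) (y j) (y k) = 0 := fun m => by
        have := congrFun (hc m) i
        simp only [contraction_apply, hSapp] at this
        exact this
      have h6 : ∑ j, ∑ k, c (cubicIndex i j k) * tril b (D ∘ y i) (y j) (y k) =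
          ∑ m, ω i m * ∑ j, ∑ k, c (cubicIndex i j k) * tril b (n m) (y j) (y k) := by
        simp only [hω, Fin.sum_univ_three]; ring
      rw [h6]
      simp only [h5, mul_zero, Finset.sum_const_zero]
    have h7 : ∑ i, ∑ j, ∑ k, c (cubicIndex i j k) * (ℓ i₀ (y i) * ν (pol (y j) (y k)) +
        ℓ i₀ (y j) * ν (pol (y i) (y k)) + ℓ i₀ (y k) * ν (pol (y i) (y j))) = 0 := by
      rw [← neg_eq_zero, ← mul_zero (3 : ℂ), ← h4, ← h2]
      simp only [← Finset.sum_neg_distrib]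
      refine Finset.sum_congr rfl fun i _ => Finset.sum_congr rfl fun j _ =>
        Finset.sum_congr rfl fun k _ => ?_
      have := h1 i j k
      simp only [tril, Bil.tensor_apply] at this
      rw [this, tril, tril, tril]
      ring
    rw [h3] at h7
    have h8 := (mul_eq_zero.mp h7).resolve_left three_ne_zero
    rw [Finset.sum_eq_single i₀] at h8
    · simpa [hℓ] using h8
    · intro i _ hi
      simp [hℓ, hi.symm]
    · simp
  -- The quadrics through V restricted to P lie in the kernel of contraction with c, which is the
  -- net itself.
  have hB : ∀ r, ∃ β : Fin 3 → ℂ, ∀ j k, pol (y j) (y k) r = ∑ m, β m * symMat (S m) j k := by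
    intro r
    have hsym : symMat (ofSym fun j k => pol (y j) (y k) r) = fun j k => pol (y j) (y k) r :=
      symMat_ofSym (by ext j k; exact congrFun (pol_comm _ _) r)
    have h1 : (ofSym fun j k => pol (y j) (y k) r) ∈ LinearMap.ker (contraction c) := by
      rw [LinearMap.mem_ker]
      ext i
      rw [contraction_apply, hsym]
      exact hpol i (LinearMap.proj r)
    rw [ker_contraction hS hc hc0] at h1
    obtain ⟨β, hβ⟩ := exists_coords h1
    refine ⟨β, fun j k => ?_⟩
    have h2 := congrFun (congrFun hsym j) k
    rw [← h2, ← hβ]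
    change symMatL _ j k = _
    simp only [map_sum, map_smul, Matrix.sum_apply, Matrix.smul_apply, smul_eq_mul, symMatL_apply]
  choose B' hB' using hB
  let B : Fin 3 → Fin 6 → ℂ := fun m r => B' r m
  have hB : ∀ j k, pol (y j) (y k) = ∑ m, symMat (S m) j k • B m := fun j k => by
    ext r
    rw [hB', Finset.sum_apply]
    exact Finset.sum_congr rfl fun m _ => mul_comm _ _
  have hprod : ∀ i m, ∃ s : ℂ, symMat (y i) * symMat (B m) = s • 1 := by
    intro i m
    apply exists_smul_one_of_trace
    intro M hM
    have hz : ∀ x z w, tril (traceForm M) x z w = 0 := fun x z w => by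
      have : ∀ a, eval a (cubicOf (traceForm M)) = 0 := fun a => by
        rw [eval_cubicOf]
        exact traceForm_mem 0 hM a rfl
      rw [tril_eq]
      simp only [this]
      ring
    -- For traceless M the cubic tr(M a f(a)) is identically zero. Expressing f through the net
    -- turns this identity into a linear syzygy with coefficients tr(M y_i B_m), which must all
    -- vanish.
    have h1 := syzygy_eq_zero hS (σ := fun i m => traceForm M (y i) (B m)) (fun i j k => by
      rw [← hz (y i) (y j) (y k), tril, hB, hB, hB]
      simp only [map_sum, map_smul, smul_eq_mul, ← Finset.sum_add_distrib]
      refine Finset.sum_congr rfl fun m _ => ?_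
      rw [symMat_symm _ k i]
      ring)
    exact congrFun (congrFun h1 i) m
  obtain ⟨v, hv, hvy⟩ := exists_mulVec_eq_zero hy hprod fun h j k => by
    rw [hB]; simp [h]
  obtain ⟨e, f, hef, h0, h1, h2⟩ := exists_ver_mem_of_mulVec_eq_zero hP hv fun a ha => by
    obtain ⟨η, rfl⟩ := exists_coords ha
    change symMatL _ *ᵥ v = 0
    simp only [map_sum, map_smul, Matrix.sum_mulVec, Matrix.smul_mulVec, symMatL_apply, hvy,
      smul_zero, Finset.sum_const_zero]
  exact hb.not_conic_plane hF hef h0 h1 h2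

end VeroneseFano
end

/-! ### The Cremona image, and very general cubics. -/

open MvPolynomial
noncomputable section
namespace VeroneseFano

open Matrix

theorem notMem_vars_of_mem_supported {p : Poly} {i : Fin 6} (h : p ∈ supported ℂ {i}ᶜ) :
    i ∉ p.vars := fun hi => (mem_supported.mp h hi) rfl

theorem X_mem_supported_compl {i j : Fin 6} (h : j ≠ i) : (X j : Poly) ∈ supported ℂ {i}ᶜ :=
  X_mem_supported.mpr h

theorem irreducible_minor : Irreducible (X 3 * X 5 - X 4 * X 4 : Poly) := by
  rw [sub_eq_add_neg]
  have h4 : (-(X 4 * X 4) : Poly) ∈ supported ℂ {5}ᶜ :=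
    neg_mem (mul_mem (X_mem_supported_compl (by decide)) (X_mem_supported_compl (by decide)))
  refine irreducible_mul_X_add _ _ 5 (X_ne_zero _)
    (notMem_vars_of_mem_supported (X_mem_supported_compl (by decide)))
    (notMem_vars_of_mem_supported h4) ?_
  rw [(X_prime (R := ℂ) (i := (3 : Fin 6))).irreducible.isRelPrime_iff_not_dvd]
  rintro ⟨q, hq⟩
  have := congrArg (eval ![0, 0, 0, 0, 1, 0]) hq
  simp at this

/-- The determinant is linear in the first coordinate, and its leading coefficient is irreducible
and does not divide the remaining term. -/
theorem irreducible_detPoly : Irreducible detPoly := by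
  have h : detPoly = (X 3 * X 5 - X 4 * X 4) * X 0 +
      (X 1 * (X 2 * X 4 - X 1 * X 5) + X 2 * (X 1 * X 4 - X 2 * X 3)) := by
    rw [detPoly]; ring
  have hX : ∀ {i : Fin 6}, i ≠ 0 → (X i : Poly) ∈ supported ℂ {0}ᶜ := X_mem_supported_compl
  have h1 : (X 1 : Poly) ∈ supported ℂ {0}ᶜ := hX (by decide)
  have h2 : (X 2 : Poly) ∈ supported ℂ {0}ᶜ := hX (by decide)
  have h3 : (X 3 : Poly) ∈ supported ℂ {0}ᶜ := hX (by decide)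
  have h4 : (X 4 : Poly) ∈ supported ℂ {0}ᶜ := hX (by decide)
  have h5 : (X 5 : Poly) ∈ supported ℂ {0}ᶜ := hX (by decide)
  rw [h]
  refine irreducible_mul_X_add _ _ 0 irreducible_minor.ne_zero
    (notMem_vars_of_mem_supported (sub_mem (mul_mem h3 h5) (mul_mem h4 h4)))
    (notMem_vars_of_mem_supported (add_mem
      (mul_mem h1 (sub_mem (mul_mem h2 h4) (mul_mem h1 h5)))
      (mul_mem h2 (sub_mem (mul_mem h1 h4) (mul_mem h2 h3))))) ?_
  rw [irreducible_minor.isRelPrime_iff_not_dvd]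
  rintro ⟨q, hq⟩
  have := congrArg (eval ![0, 0, 1, 1, 0, 0]) hq
  simp at this

/-- The determinant vanishes on the plane of matrices supported in the first row and column, whose
rank is at most two. -/
theorem not_detPoly_dvd {F : Poly} (hF : ContainsNoPlane F) : ¬ detPoly ∣ F := by
  rintro ⟨G, rfl⟩
  let y : Fin 3 → Fin 6 → ℂ := ![Pi.single 0 1, Pi.single 1 1, Pi.single 2 1]
  have hy : LinearIndependent ℂ y := by
    rw [Fintype.linearIndependent_iff]
    intro g hg i
    have := congrFun hg (Fin.castLE (by decide) i)
    fin_cases i <;> simpa [y, Fin.sum_univ_three, Pi.single_apply] using this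
  refine hF _ ((finrank_span_eq_card hy).trans (by simp)) fun a ha => ?_
  obtain ⟨η, rfl⟩ := exists_coords ha
  rw [map_mul, eval_detPoly]
  simp [y, Fin.sum_univ_three, symMat, Matrix.det_fin_three]

/-- The Cremona image of the cubic `b(a, f(a)) = 0` is the cubic `b(f(y), y) = 0`. -/
theorem isCremonaImage_cubicOf {b : Bil} (hs : IsSmoothHypersurface (cubicOf b.flip))
    (hp : ContainsNoPlane (cubicOf b.flip)) : IsCremonaImage (cubicOf b) (cubicOf b.flip) := by
  apply le_antisymm
  · intro G hG
    rw [Ideal.mem_span_singleton]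
    have h1 : cubicOf b.flip ∣ detPoly * G := by
      apply dvd_of_forall_eval_eq_zero hs.squarefree
      intro y hy
      rw [map_mul, eval_detPoly, mul_eq_zero, or_iff_not_imp_left]
      intro hd
      -- As f(f(t y)) = t⁴ det(y) y, this scaling makes y itself the image of the point f(t y),
      -- which lies on X.
      obtain ⟨t, ht⟩ := IsAlgClosed.exists_pow_nat_eq (symMat y).det⁻¹ (n := 4) (by norm_num)
      have h2 := hG (cremona (crem (t • y))) ⟨_, by
        change eval (crem (t • y)) (cubicOf (LinearMap.flip b.flip)) = 0
        rw [eval_cubicOf_flip_crem, eval_smul_of_isHomogeneous (cubicOf_isHomogeneous _), hy]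
        simp, rfl⟩
      rw [cremona_eq, crem_smul, crem_smul, crem_crem, smul_smul, ← pow_mul, ht,
        inv_mul_cancel₀ hd, one_smul, aeval_eq_eval] at h2
      exact h2
    -- The argument only reaches points with nonzero determinant, so it yields divisibility after
    -- multiplying by the determinant; this factor is irreducible and does not divide F', hence can
    -- be removed.
    refine IsRelPrime.dvd_of_dvd_mul_left ?_ h1
    exact (irreducible_detPoly.isRelPrime_iff_not_dvd.mpr (not_detPoly_dvd hp)).symm
  · rw [Ideal.span_singleton_le_iff_mem]
    rintro _ ⟨a, ha, rfl⟩
    rw [aeval_eq_eval, cremona_eq, eval_cubicOf_flip_crem, show eval a (cubicOf b) = 0 from ha,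
      mul_zero]

theorem IsGeneric.isCubicPair {b : Bil} (h : IsGeneric b) :
    IsCubicPair (cubicOf b) (cubicOf b.flip) where
  mem := cubicOf_mem b
  smooth := h.isSmoothHypersurface
  noPlane := h.containsNoPlane
  homogeneous' := cubicOf_isHomogeneous _
  image := isCremonaImage_cubicOf h.flip.isSmoothHypersurface h.flip.containsNoPlane
  smooth' := h.flip.isSmoothHypersurface
  noPlane' := h.flip.containsNoPlane

/-- A very general cubic through the Veronese surface satisfies the standing assumptions. -/
theorem veryGeneralCubic_isCubicPair :
    VeryGeneralCubic fun F => ∃ F' : Poly, IsCubicPair F F' := by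
  refine ⟨rationalEquations, rationalEquations_countable, fun E hE => hE.2, fun F hF h => ?_⟩
  obtain ⟨b, rfl⟩ := exists_cubicOf hF
  exact ⟨_, (isGeneric_of_forall_ne_zero h).isCubicPair⟩

end VeroneseFano
end

theorem mainTheorem7 :
    (∀ F F' : VeroneseFano.Poly, VeroneseFano.IsCubicPair F F' →
      ∃ (π : VeroneseFano.FanoLines F → VeroneseFano.FanoLines F')
        (π' : VeroneseFano.FanoLines F' → VeroneseFano.FanoLines F),
        (∀ (L : VeroneseFano.FanoLines F) (L' : VeroneseFano.FanoLines F'),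
          VeroneseFano.IsResidualLine F F' L.1 L'.1 ↔ π L = L') ∧
        (∀ (L' : VeroneseFano.FanoLines F') (L : VeroneseFano.FanoLines F),
          VeroneseFano.IsResidualLine F' F L'.1 L.1 ↔ π' L' = L) ∧
        VeroneseFano.IsMorphism π ∧ VeroneseFano.IsMorphism π' ∧
        Function.LeftInverse π' π ∧ Function.RightInverse π' π) ∧
    VeroneseFano.VeryGeneralCubic
      (fun F => ∃ F' : VeroneseFano.Poly, VeroneseFano.IsCubicPair F F') := by
  exact ⟨fun F F' h => h.exists_isomorphism, VeroneseFano.veryGeneralCubic_isCubicPair⟩
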